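/- **Setting.** Let $k\ge 2$, $\ell=ck$ with an integer $c\ge1$, $k\le n$, $z\in\{\pm1\}^n$, $0\le\rho\le1$ and $\tilde m>0$ real. A $k$XOR instance $\mathcal I$ is a list of constraints $(S,b)$ with $S\subseteq[n]$, $|S|=k$, $b=\pm1$. Let $\widetilde{\mathcal P}^z_{n,k}(\tilde m,\rho)$ be the law of the instance whose number of constraints is Poisson with mean $\tilde m$ and whose constraints are, independently, $(S,\eta\prod_{i\in S}z_i)$ with $S$ a uniformly random $k$-subset of $[n]$ and $\eta=\pm1$ an independent sign of mean $\rho$. Write $B_{\mathcal I}(S)=\sum_{(S,b)\in\mathcal I}b$. If the following vector is nonzero, let $|\Psi\rangle$ be the unit vector in the direction of $$\sum_{T\in\binom{[n]}{\ell}}\ \sum_{\{S_1,\dots,S_c\}}\Bigl(\prod_{j=1}^cB_{\mathcal I}(S_j)\Bigr)|T\rangle ,$$ where the inner sum is over the partitions of $T$ into $k$-element sets, and where $|T\rangle=|s_1,\dots,s_\ell\rangle$ for the elements $s_1<\dots<s_\ell$ of $T$, each written in binary on $\lceil\log_2n\rceil$ qubits. Quantum circuits consist of arbitrary 1- and 2-qubit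 gates and start in the all-zero state; in addition to the registers written below they may use work qubits that start and end in $|0\rangle$. **Theorem.** There is a deterministic classical algorithm which on every input $(n,k,\ell,\mathcal I)$, with the numbers written in unary, halts in time polynomial in the size of the input, and for which the following holds. For all $k\ge2$ and $C>0$ there are constants $\varepsilon,K_1,K_2,\kappa>0$, depending only on $k$ and $C$, such that whenever $\ell^2\log n\le\varepsilon n$ and $n\le\tilde m\le Cn^{k/2}$, then for all $z$ and $\rho$, except with probability at most $K_1\tilde m^{-1/2}$ over $\mathcal I\sim\widetilde{\mathcal P}^z_{n,k}(\tilde m,\rho)$, the vector above is nonzero and the algorithm outputs a description (with all matrix entries given exactly, with real and imaginary parts of the form $\pm\sqrt{a/b}$ for natural numbers $a,b$) of a quantum circuit with at most $K_2\,\ell\tilde m\log n$ gates that prepares $$\beta\,|\Psi\rangle\,|0^{\ell\lceil\log_2\ell\rceil+3}\rangle+|\perp\rangle|1\rangle$$ for some real $\beta\ge\kappa\,\ell^{-\ell/2}$ and some unnormalized vector $|\perp\rangle$. -/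

import Mathlib

open scoped NNReal ENNReal

noncomputable section

namespace Guiding

/-! ### Planted noisy `k`XOR instances -/

/-- A scope: a `k`-element subset of `[n]`. -/
abbrev Scope (n k : ℕ) : Type := {S : Finset (Fin n) // S.card = k}

/-- A constraint `x^S = b` with `b = ±1`. -/
abbrev Constraint (n k : ℕ) : Type := Scope n k × ℤˣ

/-- A `k`XOR instance, as the list of its constraints (repetitions allowed). -/
abbrev KXor (n k : ℕ) : Type := List (Constraint n k)

/-- The law of `m` independent samples of `p`. -/
def iidList {α : Type} (p : PMF α) : ℕ → PMF (List α)
  | 0 => PMF.pure []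
  | m + 1 => p.bind fun a => (iidList p m).map fun l => a :: l

/-- The law of a sign with mean `ρ`. -/
def signLaw (ρ : ℝ≥0) (hρ : ρ ≤ 1) : PMF ℤˣ :=
  PMF.ofFintype (fun η => if η = 1 then (((1 + ρ) / 2 : ℝ≥0) : ℝ≥0∞) else (((1 - ρ) / 2 : ℝ≥0) : ℝ≥0∞)) (by
    have h : (Finset.univ : Finset ℤˣ) = {1, -1} := rfl
    have hne : (-1 : ℤˣ) ≠ 1 := by decide
    rw [h, Finset.sum_pair (Ne.symm hne), if_pos rfl, if_neg hne, ← ENNReal.coe_add,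
      ← add_div]
    have h2 : 1 + ρ + (1 - ρ) = 2 := by
      rw [add_assoc, add_tsub_cancel_of_le hρ]; norm_num
    rw [h2, div_self two_ne_zero, ENNReal.coe_one])

/-- The law of one planted constraint: a uniformly random scope `S` and the right-hand side
`η z^S`, where `η` is an independent sign with mean `ρ`. -/
def constraintLaw {n k : ℕ} (hk : k ≤ n) (z : Fin n → ℤˣ) (ρ : ℝ≥0) (hρ : ρ ≤ 1) :
    PMF (Constraint n k) :=
  haveI : Nonempty (Scope n k) := by
    obtain ⟨S, -, hS⟩ := Finset.exists_subset_card_eq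
      (s := (Finset.univ : Finset (Fin n))) (n := k) (by simpa using hk)
    exact ⟨⟨S, hS⟩⟩
  (PMF.uniformOfFintype (Scope n k)).bind fun S =>
    (signLaw ρ hρ).map fun η => (S, η * ∏ i ∈ S.1, z i)

/-- The Poissonized planted noisy distribution: the number of constraints is Poisson of mean `m`,
and the constraints are then drawn independently. -/
def plantedLaw {n k : ℕ} (hk : k ≤ n) (z : Fin n → ℤˣ) (m : ℝ≥0) (ρ : ℝ≥0) (hρ : ρ ≤ 1) :
    PMF (KXor n k) :=
  (ProbabilityTheory.poissonMeasure m).toPMF.bind fun N => iidList (constraintLaw hk z ρ hρ) N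

/-! ### The symmetrized guiding state -/

/-- `B_I(S)`: the sum of the right-hand sides of the constraints with scope `S`. -/
def coeff {n k : ℕ} (I : KXor n k) (S : Finset (Fin n)) : ℤ :=
  (I.map fun c => if c.1.1 = S then (c.2 : ℤ) else 0).sum

/-- The partitions of `T` into `k`-element sets. -/
def partitions {n : ℕ} (k : ℕ) (T : Finset (Fin n)) : Finset (Finset (Finset (Fin n))) := by
  classical
  exact (T.powersetCard k).powerset.filter fun P =>
    (P : Set (Finset (Fin n))).PairwiseDisjoint id ∧ P.sup id = T

/-- The `T`-coordinate of the unnormalized guiding vector. -/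
def guideCoeff {n k : ℕ} (I : KXor n k) (T : Finset (Fin n)) : ℝ :=
  ∑ P ∈ partitions k T, ∏ S ∈ P, (coeff I S : ℝ)

/-- The Euclidean norm of the guiding vector with coordinates indexed by the `l`-subsets. -/
def guideNorm {n k : ℕ} (l : ℕ) (I : KXor n k) : ℝ :=
  √(∑ T ∈ (Finset.univ : Finset (Fin n)).powersetCard l, guideCoeff I T ^ 2)

/-! ### Quantum states and circuits on qubits -/

/-- A (not necessarily normalized) state vector on `N` qubits. -/
abbrev State (N : ℕ) : Type := (Fin N → Bool) → ℂ

/-- The computational basis state of a bit string. -/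
def ket {N : ℕ} (v : Fin N → Bool) : State N := fun x => if x = v then 1 else 0

/-- The state `|0^N⟩`. -/
def zeros (N : ℕ) : State N := ket fun _ => false

/-- The tensor product of two state vectors, on consecutive registers. -/
def tensor {M N : ℕ} (φ : State M) (χ : State N) : State (M + N) :=
  fun x => φ (fun i => x (Fin.castAdd N i)) * χ (fun j => x (Fin.natAdd M j))

/-- An arbitrary one- or two-qubit gate, placed on one wire or on two distinct wires. -/
inductive Gate (N : ℕ) : Type
  | one (i : Fin N) (U : Matrix.unitaryGroup Bool ℂ) : Gate N
  | two (i j : Fin N) (hij : i ≠ j) (U : Matrix.unitaryGroup (Bool × Bool) ℂ) : Gate N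

/-- The action of a gate on state vectors. -/
def Gate.apply {N : ℕ} : Gate N → State N → State N
  | .one i U, ψ => fun x => ∑ b : Bool, U.1 (x i) b * ψ (Function.update x i b)
  | .two i j _ U, ψ => fun x => ∑ b : Bool × Bool,
      U.1 (x i, x j) b * ψ (Function.update (Function.update x i b.1) j b.2)

/-- The state produced from `|0^N⟩` by applying the gates of a circuit from left to right. -/
def circuitOutput {N : ℕ} (G : List (Gate N)) : State N :=
  G.foldl (fun ψ g => g.apply ψ) (zeros N)

/-- Number of qubits that represent a qudit of dimension `d`: `⌈log₂ d⌉`. -/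
abbrev bitLen (d : ℕ) : ℕ := Nat.clog 2 d

/-- The bit string of the basis state `|s₁,…,s_l⟩`, where `s₁ < ⋯ < s_l` are the elements of `T`;
each is written in binary on `bitLen n` qubits. -/
def setBits {n : ℕ} (l : ℕ) (T : Finset (Fin n)) : Fin (l * bitLen n) → Bool :=
  fun i => (((T.sort (· ≤ ·)).map Fin.val).getD (i.val / bitLen n) 0).testBit (i.val % bitLen n)

/-- The guiding state `|Ψ⟩` on `l` qudits: the guiding vector scaled to unit length (meaningful
when `guideNorm l I ≠ 0`). -/
def guideState {n k : ℕ} (l : ℕ) (I : KXor n k) : State (l * bitLen n) :=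
  ∑ T ∈ (Finset.univ : Finset (Fin n)).powersetCard l,
    ((guideCoeff I T / guideNorm l I : ℝ) : ℂ) • ket (setBits l T)

/-- The number of qubits on which a preparation circuit with `w` work qubits acts: `l` qudits,
`l ⌈log₂ l⌉ + 3` ancilla qubits and the work qubits. -/
abbrev width (n l w : ℕ) : ℕ := l * bitLen n + (l * bitLen l + 2 + 1) + w

/-- `G` prepares `β |Ψ⟩|0^(l ⌈log₂ l⌉ + 3)⟩ + |⊥⟩|1⟩` for some vector `|⊥⟩`; the work qubits start
and end in `|0^w⟩`. -/
def Prepares {n k : ℕ} (l : ℕ) (I : KXor n k) (w : ℕ) (G : List (Gate (width n l w))) (β : ℝ) :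
    Prop :=
  guideNorm l I ≠ 0 ∧
  ∃ perp : State (l * bitLen n + (l * bitLen l + 2)),
    circuitOutput G =
      tensor ((β : ℂ) • tensor (guideState l I) (zeros (l * bitLen l + 2 + 1))
        + tensor perp (ket fun _ : Fin 1 => true)) (zeros w)

/-! ### Classical algorithms: programs on binary trees, with a step count -/

/-- The data of programs: binary trees. -/
inductive Tree : Type
  | leaf : Tree
  | node : Tree → Tree → Tree

namespace Tree

/-- The number of vertices of a tree. -/
def size : Tree → ℕ
  | leaf => 1
  | node a b => a.size + b.size + 1

/-- The left subtree. -/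
def fst : Tree → Tree
  | leaf => leaf
  | node a _ => a

/-- The right subtree. -/
def snd : Tree → Tree
  | leaf => leaf
  | node _ b => b

/-- Unary encoding of natural numbers. -/
def ofNat : ℕ → Tree
  | 0 => leaf
  | i + 1 => node leaf (ofNat i)

/-- Encoding of truth values. -/
def ofBool : Bool → Tree
  | false => leaf
  | true => node leaf leaf

/-- Encoding of lists. -/
def ofList {α : Type} (f : α → Tree) : List α → Tree
  | [] => leaf
  | a :: l => node (f a) (ofList f l)

end Tree

/-- A structured programming language for functions on trees. -/
inductive Prog : Type
  | skip : Prog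
  | nil : Prog
  | fst : Prog
  | snd : Prog
  | pair : Prog → Prog → Prog
  | seq : Prog → Prog → Prog
  | ifLeaf : Prog → Prog → Prog → Prog
  | loop : Prog → Prog → Prog

/-- `Eval p x y t`: the program `p` halts on input `x` with output `y` after `t` steps. A basic
instruction is charged the size of the data it is applied to. `seq p q` runs `p` and then `q`;
`ifLeaf c p q` runs `p` if `c` returns the leaf and `q` otherwise; `loop c p` repeats `p` as long
as `c` does not return the leaf. -/
inductive Eval : Prog → Tree → Tree → ℕ → Prop
  | skip (x : Tree) : Eval .skip x x (x.size + 1)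
  | nil (x : Tree) : Eval .nil x .leaf (x.size + 1)
  | fst (x : Tree) : Eval .fst x x.fst (x.size + 1)
  | snd (x : Tree) : Eval .snd x x.snd (x.size + 1)
  | pair {p q : Prog} {x y z : Tree} {s t : ℕ} :
      Eval p x y s → Eval q x z t → Eval (.pair p q) x (.node y z) (s + t + 1)
  | seq {p q : Prog} {x y z : Tree} {s t : ℕ} :
      Eval p x y s → Eval q y z t → Eval (.seq p q) x z (s + t + 1)
  | ifLeaf_leaf {c p q : Prog} {x y : Tree} {s t : ℕ} :
      Eval c x .leaf s → Eval p x y t → Eval (.ifLeaf c p q) x y (s + t + 1)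
  | ifLeaf_node {c p q : Prog} {x y a b : Tree} {s t : ℕ} :
      Eval c x (.node a b) s → Eval q x y t → Eval (.ifLeaf c p q) x y (s + t + 1)
  | loop_stop {c p : Prog} {x : Tree} {s : ℕ} :
      Eval c x .leaf s → Eval (.loop c p) x x (s + 1)
  | loop_step {c p : Prog} {x y z a b : Tree} {s t u : ℕ} :
      Eval c x (.node a b) s → Eval p x y t → Eval (.loop c p) y z u →
      Eval (.loop c p) x z (s + t + u + 1)

/-- The encoding of the input `(n, k, l, I)`; a scope is listed in increasing order. -/
def encodeInput (n k l : ℕ) (I : KXor n k) : Tree :=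
  .node (.ofNat n) (.node (.ofNat k) (.node (.ofNat l)
    (.ofList (fun c : Constraint n k =>
      .node (.ofList (fun i : Fin n => .ofNat i.val) (c.1.1.sort (· ≤ ·)))
        (.ofBool (decide (c.2 = -1)))) I)))

/-! ### Descriptions of circuits, as output by a program -/

/-- A description of the real number `± √(num / den)`. -/
structure RealCode : Type where
  neg : Bool
  num : ℕ
  den : ℕ

/-- The number described. -/
def RealCode.val (a : RealCode) : ℝ :=
  (if a.neg then -1 else 1) * √((a.num : ℝ) / (a.den : ℝ))

/-- A description of a complex number by its real and imaginary parts. -/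
structure EntryCode : Type where
  re : RealCode
  im : RealCode

/-- The number described. -/
def EntryCode.val (a : EntryCode) : ℂ := ⟨a.re.val, a.im.val⟩

/-- A description of a gate: its wires and all entries of its matrix. -/
inductive GateCode : Type
  | one (i : ℕ) (M : Bool → Bool → EntryCode) : GateCode
  | two (i j : ℕ) (M : Bool × Bool → Bool × Bool → EntryCode) : GateCode

/-- A gate description denotes a gate on `N` wires. -/
inductive GateCode.Denotes {N : ℕ} : GateCode → Gate N → Prop
  | one (i : Fin N) (M : Bool → Bool → EntryCode) (U : Matrix.unitaryGroup Bool ℂ)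
      (h : ∀ a b, U.1 a b = (M a b).val) : Denotes (.one i.val M) (.one i U)
  | two (i j : Fin N) (hij : i ≠ j) (M : Bool × Bool → Bool × Bool → EntryCode)
      (U : Matrix.unitaryGroup (Bool × Bool) ℂ)
      (h : ∀ a b, U.1 a b = (M a b).val) : Denotes (.two i.val j.val M) (.two i j hij U)

/-- The tree encoding of a real number description. -/
def RealCode.tree (a : RealCode) : Tree := .node (.ofBool a.neg) (.node (.ofNat a.num) (.ofNat a.den))

/-- The tree encoding of a complex number description. -/
def EntryCode.tree (a : EntryCode) : Tree := .node a.re.tree a.im.tree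

/-- The tree encoding of a gate description; matrices are listed row by row. -/
def GateCode.tree : GateCode → Tree
  | .one i M => .node .leaf (.node (.ofNat i)
      (.ofList (fun a => .ofList (fun b => (M a b).tree) [false, true]) [false, true]))
  | .two i j M => .node (.node .leaf .leaf) (.node (.ofNat i) (.node (.ofNat j)
      (.ofList (fun a => .ofList (fun b => (M a b).tree)
          [(false, false), (false, true), (true, false), (true, true)])
        [(false, false), (false, true), (true, false), (true, true)])))

/-- The tree encoding of a circuit: its number of work qubits and its gates in order. -/
def circuitTree (w : ℕ) (G : List GateCode) : Tree :=
  .node (.ofNat w) (.ofList GateCode.tree G)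

/-- On input `(n, k, l, I)` the program `alg` outputs a circuit of at most `g` gates that prepares
`β |Ψ⟩|0…0⟩ + |⊥⟩|1⟩` for some real `β ≥ b`. -/
def OutputsPreparation (alg : Prog) {n k : ℕ} (l : ℕ) (I : KXor n k) (g b : ℝ) : Prop :=
  ∃ (w : ℕ) (D : List GateCode) (G : List (Gate (width n l w))) (t : ℕ) (β : ℝ),
    Eval alg (encodeInput n k l I) (circuitTree w D) t ∧
    List.Forall₂ GateCode.Denotes D G ∧
    (G.length : ℝ) ≤ g ∧ b ≤ β ∧ Prepares l I w G β

/-- `alg` halts on all inputs, in time polynomial in the size of the input. -/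
def PolyTime (alg : Prog) : Prop :=
  ∃ P : Polynomial ℕ, ∀ (n k l : ℕ) (I : KXor n k), ∃ (y : Tree) (t : ℕ),
    Eval alg (encodeInput n k l I) y t ∧ t ≤ P.eval (encodeInput n k l I).size

end Guiding

end

noncomputable section

namespace Guiding

/-! ### Running times and sizes -/

/-! Write `B(S)` for the coefficients of the instance, `V` for the number of scopes, `M = ⌈log₂ l⌉`,
and `N` for the number of constraints. The guiding vector arises from the product state `(∑ B(S)
|S⟩)^{⊗c}` by dropping the tuples of scopes that intersect and by forgetting in which order the
elements of a disjoint tuple are listed. The circuit realizes this operation with postselection on a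
flag. The probabilistic part shows that the surviving amplitude is not too small.

Circuit. A block is loaded item by item; each rotation splits off one item with the correct
amplitude and leaves the rest for the later ones (`impl_itemsCode`). A reversible circuit then
replaces the `l` elements by the sorted list and the list of their ranks, or raises a collision flag
(`crun_sortCirc`). All ordered partitions of one set `T` now agree except in the rank register.
Hadamard gates send every content of that register to `|0…0⟩` with the same amplitude `2^(-lM/2)`,
so the contributions add up there, and a last flag marks all other strings. This gives `β = c!
‖guide‖ 2^(-lM/2) / (∑ B²)^(c/2)` (`prepares_mainCode`).

Norm. Call a `c`-tuple of constraints clean if their scopes are pairwise disjoint, occur nowhere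
else in the instance, and form the only partition of their union into `k`-sets with nonzero
coefficients. The coordinate of the guiding vector at this union is then `±1`, whatever the signs
are, and at most `c!` clean tuples share a union. So the number of clean tuples is at most `c!
‖guide‖²` (`card_clean_le`). A tuple that is not clean contains intersecting scopes, or a repeated
scope, or it admits an exchange: some `a ≥ 2` of its scopes have the same union as `a` disjoint
scopes of other constraints (`exists_exchange`). The three conditions of `GoodScopes` limit these
tuples to the fractions 1/4, 1/8 and 1/8, so that `‖guide‖² ≥ N^c / (2 c!)` (`pow_le_guideNorm_sq`).
Together with `∑ B² ≤ 2N` and `2^M ≤ 2l` this yields `β² ≥ c! 2^(-(k+1)c-1) l^(-l)`, and the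
factorial beats the exponential up to a constant (`amplitude_le`).

Probability. Only the scopes matter, and they are independent and uniform for every `z` and `ρ`.
Repeated scopes are rare by Markov's inequality. For intersecting pairs the mean alone would only
give failure probability of order `c²/n`, so the variance is used (`sum_sq_pairs_le`,
`card_meet_le`). For exchanges, a set of `ak` points splits into `a` labelled scopes in at most
`a^(ak)` ways; the first moment is at most a sum over `a ≥ 2` of terms `(const · (cN/n^k)
a^(k-2))^a`. The assumptions on `l` and `m` make it geometric, with value `O((cN/n^k)²)`, which is
small enough (`card_bad_exchanges_le`, `exists_card_bad_le`). Chebyshev's inequality keeps the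
Poisson number `N` between `m/2` and `2m`.

Algorithm. The predicate `PT` of polynomial-time computability is closed under composition, case
distinction, and loops over lists with polynomially bounded accumulators. The circuit is a list
expression in the input, so its program is assembled from these closure properties. -/

theorem Tree.one_le_size (x : Tree) : 1 ≤ x.size := by
  cases x <;> simp [Tree.size]

/-- Every basic instruction is charged at least the size of its data. A time bound is therefore also
a bound on the size of the output, which is what keeps compositions polynomial. -/
theorem Eval.size_le {p : Prog} {x y : Tree} {t : ℕ} (h : Eval p x y t) :
    x.size ≤ t ∧ y.size ≤ t := by
  induction h with
  | skip x => omega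
  | nil x => have := x.one_le_size; simp only [Tree.size]; omega
  | fst x => cases x <;> simp only [Tree.size, Tree.fst] <;> omega
  | snd x => cases x <;> simp only [Tree.size, Tree.snd] <;> omega
  | pair _ _ h1 h2 => simp only [Tree.size]; omega
  | seq _ _ h1 h2 => omega
  | ifLeaf_leaf _ _ h1 h2 => omega
  | ifLeaf_node _ _ h1 h2 => omega
  | loop_stop _ h1 => omega
  | loop_step _ _ _ h1 h2 h3 => omega

theorem eval_mono (P : Polynomial ℕ) {a b : ℕ} (h : a ≤ b) : P.eval a ≤ P.eval b := by
  simp only [Polynomial.eval_eq_sum, Polynomial.sum]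
  gcongr

/-- Types whose elements are represented by trees. -/
class Enc (α : Type) where
  /-- The tree that represents an element. -/
  enc : α → Tree

instance : Enc ℕ := ⟨Tree.ofNat⟩
instance : Enc Bool := ⟨Tree.ofBool⟩
instance : Enc Unit := ⟨fun _ => .leaf⟩
instance {α β : Type} [Enc α] [Enc β] : Enc (α × β) := ⟨fun p => .node (Enc.enc p.1) (Enc.enc p.2)⟩
instance {α : Type} [Enc α] : Enc (List α) := ⟨Tree.ofList Enc.enc⟩
instance : Enc RealCode := ⟨RealCode.tree⟩
instance : Enc EntryCode := ⟨EntryCode.tree⟩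
instance : Enc GateCode := ⟨GateCode.tree⟩

/-- The size of the representation. -/
def sz {α : Type} [Enc α] (a : α) : ℕ := (Enc.enc a).size

/-! ### Polynomial-time functions and their closure properties -/

section
variable {α β γ δ : Type} [Enc α] [Enc β] [Enc γ] [Enc δ]

theorem one_le_sz (a : α) : 1 ≤ sz a := Tree.one_le_size _

theorem sz_pair (a : α) (b : β) : sz (a, b) = sz a + sz b + 1 := rfl

theorem sz_nil : sz ([] : List α) = 1 := rfl

theorem sz_cons (a : α) (l : List α) : sz (a :: l) = sz a + sz l + 1 := rfl

theorem sz_append (l l' : List α) : sz (l ++ l') + 1 = sz l + sz l' := by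
  induction l with
  | nil => simp [sz_nil, add_comm]
  | cons a l ih => simp only [List.cons_append, sz_cons]; omega

theorem sz_reverse (l : List α) : sz l.reverse = sz l := by
  induction l with
  | nil => rfl
  | cons a l ih =>
    have := sz_append l.reverse [a]
    simp only [List.reverse_cons, sz_cons, sz_nil] at *; omega

theorem sz_mem {a : α} {l : List α} (h : a ∈ l) : sz a ≤ sz l := by
  induction l with
  | nil => simp at h
  | cons b l ih =>
    rw [sz_cons]
    rcases List.mem_cons.1 h with rfl | h
    · omega
    · have := ih h; omega

theorem length_lt_sz (l : List α) : l.length < sz l := by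
  induction l with
  | nil => simp [sz_nil]
  | cons a l ih => simp only [List.length_cons, sz_cons]; omega

theorem sz_nat (n : ℕ) : sz n = 2 * n + 1 := by
  induction n with
  | zero => rfl
  | succ n ih =>
    change (Tree.leaf.size + sz n + 1) = _
    simp only [Tree.size]; omega

/-- Functions that a program computes in polynomial time. -/
@[fun_prop]
def PT (f : α → β) : Prop :=
  ∃ (p : Prog) (P : Polynomial ℕ), ∀ a, ∃ t, Eval p (Enc.enc a) (Enc.enc (f a)) t ∧ t ≤ P.eval (sz a)

theorem PT.bound {f : α → β} (h : PT f) : ∃ P : Polynomial ℕ, ∀ a, sz (f a) ≤ P.eval (sz a) := by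
  obtain ⟨p, P, h⟩ := h
  refine ⟨P, fun a => ?_⟩
  obtain ⟨t, h1, h2⟩ := h a
  exact h1.size_le.2.trans h2

@[fun_prop]
theorem PT.id : PT (fun a : α => a) :=
  ⟨.skip, .X + 1, fun a => ⟨_, .skip _, by simp [sz]⟩⟩

@[fun_prop]
theorem PT.comp {f : β → γ} {g : α → β} (hf : PT f) (hg : PT g) : PT (fun a => f (g a)) := by
  obtain ⟨p, P, hp⟩ := hf
  obtain ⟨q, Q, hq⟩ := hg
  refine ⟨.seq q p, Q + P.comp Q + 1, fun a => ?_⟩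
  obtain ⟨s, h1, h2⟩ := hq a
  obtain ⟨t, h3, h4⟩ := hp (g a)
  refine ⟨_, .seq h1 h3, ?_⟩
  have := eval_mono P (h1.size_le.2.trans h2)
  simp only [Polynomial.eval_add, Polynomial.eval_comp, Polynomial.eval_one]
  change P.eval (sz (g a)) ≤ _ at this
  omega

/-- Programs see only trees, so functions with equal output trees are interchangeable. This lets
unary numbers pass as lists of units and structures as tuples. -/
theorem PT.of_enc {f : α → β} {g : α → γ} (hg : PT g) (h : ∀ a, Enc.enc (f a) = Enc.enc (g a)) :
    PT f := by
  obtain ⟨p, P, hp⟩ := hg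
  exact ⟨p, P, fun a => by rw [h]; exact hp a⟩

theorem PT.of_eq {f g : α → β} (hg : PT g) (h : ∀ a, f a = g a) : PT f :=
  hg.of_enc fun a => by rw [h]

@[fun_prop]
theorem PT.prodMk {f : α → β} {g : α → γ} (hf : PT f) (hg : PT g) : PT (fun a => (f a, g a)) := by
  obtain ⟨p, P, hp⟩ := hf
  obtain ⟨q, Q, hq⟩ := hg
  refine ⟨.pair p q, P + Q + 1, fun a => ?_⟩
  obtain ⟨s, h1, h2⟩ := hp a
  obtain ⟨t, h3, h4⟩ := hq a
  refine ⟨_, .pair h1 h3, ?_⟩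
  simp only [Polynomial.eval_add, Polynomial.eval_one]
  omega

theorem PT.fst' : PT (fun p : α × β => p.1) :=
  ⟨.fst, .X + 1, fun a => ⟨_, .fst _, by simp [sz]⟩⟩

theorem PT.snd' : PT (fun p : α × β => p.2) :=
  ⟨.snd, .X + 1, fun a => ⟨_, .snd _, by simp [sz]⟩⟩

@[fun_prop]
theorem PT.fst {f : α → β × γ} (hf : PT f) : PT (fun a => (f a).1) := PT.fst'.comp hf

@[fun_prop]
theorem PT.snd {f : α → β × γ} (hf : PT f) : PT (fun a => (f a).2) := PT.snd'.comp hf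

theorem exists_prog_const (y : Tree) :
    ∃ (p : Prog) (P : Polynomial ℕ), ∀ x, ∃ t, Eval p x y t ∧ t ≤ P.eval x.size := by
  induction y with
  | leaf => exact ⟨.nil, .X + 1, fun x => ⟨_, .nil x, by simp⟩⟩
  | node y z ih ih' =>
    obtain ⟨p, P, hp⟩ := ih
    obtain ⟨q, Q, hq⟩ := ih'
    refine ⟨.pair p q, P + Q + 1, fun a => ?_⟩
    obtain ⟨s, h1, h2⟩ := hp a
    obtain ⟨t, h3, h4⟩ := hq a
    refine ⟨_, .pair h1 h3, ?_⟩
    simp only [Polynomial.eval_add, Polynomial.eval_one]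
    omega

@[fun_prop]
theorem PT.const (b : β) : PT (fun _ : α => b) := by
  obtain ⟨p, P, h⟩ := exists_prog_const (Enc.enc b)
  exact ⟨p, P, fun a => h _⟩

@[fun_prop]
theorem PT.cond {c : α → Bool} {f g : α → β} (hc : PT c) (hf : PT f) (hg : PT g) :
    PT (fun a => bif c a then f a else g a) := by
  obtain ⟨r, R, hr⟩ := hc
  obtain ⟨p, P, hp⟩ := hf
  obtain ⟨q, Q, hq⟩ := hg
  refine ⟨.ifLeaf r q p, R + P + Q + 1, fun a => ?_⟩
  obtain ⟨u, h5, h6⟩ := hr a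
  obtain ⟨s, h1, h2⟩ := hp a
  obtain ⟨t, h3, h4⟩ := hq a
  simp only [Polynomial.eval_add, Polynomial.eval_one]
  cases h : c a
  · rw [h] at h5
    exact ⟨_, .ifLeaf_leaf h5 h3, by omega⟩
  · rw [h] at h5
    exact ⟨_, .ifLeaf_node h5 h1, by omega⟩

@[fun_prop]
theorem PT.ite {c : α → Bool} {f g : α → β} (hc : PT c) (hf : PT f) (hg : PT g) :
    PT (fun a => if c a = true then f a else g a) :=
  (PT.cond hc hf hg).of_eq fun a => by cases c a <;> rfl

@[fun_prop]
theorem PT.not {c : α → Bool} (hc : PT c) : PT (fun a => !c a) :=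
  (PT.cond hc (PT.const false) (PT.const true)).of_eq fun a => by cases c a <;> rfl

@[fun_prop]
theorem PT.and {c d : α → Bool} (hc : PT c) (hd : PT d) : PT (fun a => c a && d a) :=
  (PT.cond hc hd (PT.const false)).of_eq fun a => by cases c a <;> rfl

@[fun_prop]
theorem PT.cons {f : α → β} {g : α → List β} (hf : PT f) (hg : PT g) :
    PT (fun a => f a :: g a) :=
  (hf.prodMk hg).of_enc fun _ => rfl

@[fun_prop]
theorem PT.succ {f : α → ℕ} (hf : PT f) : PT (fun a => f a + 1) :=
  ((PT.const ()).prodMk hf).of_enc fun _ => rfl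

/-- Distinction of the empty and the nonempty list. -/
theorem PT.listCases {l : α → List β} {f : α → γ} {g : α × β × List β → γ} (hl : PT l) (hf : PT f)
    (hg : PT g) : PT (fun a => match l a with | [] => f a | b :: r => g (a, b, r)) := by
  obtain ⟨p, P, hp⟩ := hl
  obtain ⟨q, Q, hq⟩ := hf
  obtain ⟨r, R, hr⟩ := hg
  -- The list is computed twice, once for the test and once to be paired with the input. The tree of
  -- a nonempty list is already the pair of head and tail that `r` expects.
  refine ⟨.ifLeaf p q (.seq (.pair .skip p) r),
    P + Q + .X + P + R.comp (.X + P + 1) + 5, fun a => ?_⟩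
  obtain ⟨u, h5, h6⟩ := hp a
  obtain ⟨s, h1, h2⟩ := hq a
  simp only [Polynomial.eval_add, Polynomial.eval_X, Polynomial.eval_comp, Polynomial.eval_one,
    Polynomial.eval_ofNat]
  rcases h : l a with _ | ⟨b, m⟩
  · rw [h] at h5
    exact ⟨_, .ifLeaf_leaf h5 h1, by omega⟩
  · rw [h] at h5
    obtain ⟨t, h3, h4⟩ := hr (a, b, m)
    refine ⟨_, .ifLeaf_node h5 (.seq (.pair (.skip _) h5) h3), ?_⟩
    have : sz (a, b, m) ≤ sz a + P.eval (sz a) + 1 := by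
      have := h5.size_le.2
      simp only [Enc.enc, Tree.ofList, Tree.size] at this
      rw [sz_pair, sz_pair]
      simp only [sz] at *
      change _ ≤ u at this
      have h7 : (Tree.ofList Enc.enc m).size = (Enc.enc m).size := rfl
      omega
    have := (eval_mono R this)
    have h8 : (Enc.enc a).size = sz a := rfl
    omega

/-- Loops over lists with accumulators of polynomial size. -/
theorem PT.foldl {l : α → List β} {b : α → γ} {F : α × γ × β → γ} (hl : PT l) (hb : PT b)
    (hF : PT F) (Q : Polynomial ℕ)
    (hQ : ∀ a l₁ l₂, l a = l₁ ++ l₂ →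
      sz (l₁.foldl (fun c x => F (a, c, x)) (b a)) ≤ Q.eval (sz a)) :
    PT (fun a => (l a).foldl (fun c x => F (a, c, x)) (b a)) := by
  -- The loop state is the remaining list, the accumulator and the input. Its first component is a
  -- leaf exactly when the list is exhausted, so `.fst` serves as the loop condition.
  have hinit : PT fun a => (l a, b a, a) := by fun_prop
  obtain ⟨p, P, hp⟩ := hinit
  obtain ⟨S, hS⟩ := hl.bound
  have hbody : PT fun s : (β × List β) × γ × α => (s.1.2, F (s.2.2, s.2.1, s.1.1), s.2.2) := by
    have : PT fun s : (β × List β) × γ × α => F (s.2.2, s.2.1, s.1.1) :=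
      hF.comp (by fun_prop)
    fun_prop
  obtain ⟨q, R, hq⟩ := hbody
  -- `M` bounds the size of every loop state, hence the cost of one pass is bounded by `M + R.comp
  -- M` up to a constant, and there are fewer passes than the size of the list.
  let M : Polynomial ℕ := S + Q + .X + 5
  have key : ∀ a l₁ l₂, l a = l₁ ++ l₂ → ∃ t,
      Eval (.loop .fst q) (Enc.enc (l₂, l₁.foldl (fun c x => F (a, c, x)) (b a), a))
        (Enc.enc (([] : List β), (l a).foldl (fun c x => F (a, c, x)) (b a), a)) t ∧
      t ≤ (l₂.length + 1) * (M.eval (sz a) + R.eval (M.eval (sz a)) + 5) := by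
    intro a l₁ l₂
    have hsz : ∀ l₁ l₂, l a = l₁ ++ l₂ →
        sz (l₂, l₁.foldl (fun c x => F (a, c, x)) (b a), a) ≤ M.eval (sz a) := by
      intro l₁ l₂ h
      have h1 := hQ a l₁ l₂ h
      have h2 := hS a
      have h3 := sz_append l₁ l₂
      have h4 := one_le_sz l₁
      rw [h] at h2
      simp only [sz_pair, M, Polynomial.eval_add, Polynomial.eval_X, Polynomial.eval_ofNat]
      omega
    induction l₂ generalizing l₁ with
    | nil =>
      intro h
      have h1 := hsz _ _ h
      rw [List.append_nil] at h
      rw [h]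
      refine ⟨_, Eval.loop_stop (.fst _), ?_⟩
      change sz _ + 1 + 1 ≤ _
      simp only [List.length_nil]
      omega
    | cons x l₂ ih =>
      intro h
      have h1 := hsz _ _ h
      have h' : l a = (l₁ ++ [x]) ++ l₂ := by simp [h]
      obtain ⟨t, h2, h3⟩ := ih _ h'
      rw [List.foldl_append, List.foldl_cons, List.foldl_nil] at h2
      obtain ⟨s, h4, h5⟩ := hq ((x, l₂), l₁.foldl (fun c x => F (a, c, x)) (b a), a)
      refine ⟨_, .loop_step (.fst (Enc.enc (x :: l₂, l₁.foldl (fun c x => F (a, c, x)) (b a), a))) h4 h2, ?_⟩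
      change sz _ + 1 + s + t + 1 ≤ _
      have h6 := (eval_mono R h1)
      change s ≤ R.eval (sz (x :: l₂, l₁.foldl (fun c x => F (a, c, x)) (b a), a)) at h5
      rw [List.length_cons, add_mul _ 1]
      omega
  refine ⟨.seq p (.seq (.loop .fst q) (.seq .snd .fst)),
    P + (S + 1) * (M + R.comp M + 5) + (2 * Q + 2 * .X + 20), fun a => ?_⟩
  obtain ⟨s, h1, h2⟩ := hp a
  obtain ⟨t, h3, h4⟩ := key a [] (l a) rfl
  refine ⟨_, .seq h1 (.seq h3 (.seq (.snd _) (.fst _))), ?_⟩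
  have h5 := hQ a (l a) [] (by simp)
  have h6 := length_lt_sz (l a)
  have h7 := hS a
  have h8 : t ≤ (S.eval (sz a) + 1) * (M.eval (sz a) + R.eval (M.eval (sz a)) + 5) :=
    h4.trans (Nat.mul_le_mul_right _ (by omega))
  simp only [Polynomial.eval_add, Polynomial.eval_mul, Polynomial.eval_comp, Polynomial.eval_X,
    Polynomial.eval_one, Polynomial.eval_ofNat] at h8 ⊢
  set Y := (l a).foldl (fun c x => F (a, c, x)) (b a)
  have e1 : (Enc.enc (([] : List β), Y, a)).size = sz Y + sz a + 3 := by
    change sz (([] : List β), Y, a) = _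
    rw [sz_pair, sz_pair, sz_nil]; omega
  have e2 : (Tree.snd (Enc.enc (([] : List β), Y, a))).size = sz Y + sz a + 1 := rfl
  omega

/-! ### Polynomial-time list operations -/

@[fun_prop]
theorem PT.reverseAux {f g : α → List β} (hf : PT f) (hg : PT g) :
    PT (fun a => (f a).reverseAux (g a)) := by
  obtain ⟨P, hP⟩ := hf.bound
  obtain ⟨Q, hQ⟩ := hg.bound
  have hfold : ∀ l m : List β, l.foldl (fun c x => x :: c) m = l.reverseAux m := by
    intro l
    induction l with
    | nil => simp
    | cons x l ih => intro m; simp [ih]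
  have hF : PT fun p : α × List β × β => p.2.2 :: p.2.1 := by fun_prop
  refine (PT.foldl hf hg hF (P + Q) fun a l₁ l₂ h => ?_).of_eq fun a => (hfold _ _).symm
  have h1 := hP a
  have h2 := hQ a
  have h3 := sz_append l₁ l₂
  have h4 := sz_append l₁.reverse (g a)
  rw [h] at h1
  simp only [hfold, List.reverseAux_eq, Polynomial.eval_add, sz_reverse] at *
  have := one_le_sz l₂
  omega

@[fun_prop]
theorem PT.reverse {f : α → List β} (hf : PT f) : PT (fun a => (f a).reverse) :=
  (hf.reverseAux (PT.const [])).of_eq fun a => by simp [List.reverseAux_eq]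

@[fun_prop]
theorem PT.append {f g : α → List β} (hf : PT f) (hg : PT g) : PT (fun a => f a ++ g a) :=
  (hf.reverse.reverseAux hg).of_eq fun a => by simp [List.reverseAux_eq]

theorem sz_flatMap_le {β γ : Type} [Enc γ] {l : List β} {F : β → List γ} {B : ℕ} (h : ∀ x ∈ l, sz (F x) ≤ B) :
    sz (l.flatMap F) ≤ l.length * B + 1 := by
  induction l with
  | nil => simp [sz_nil]
  | cons x l ih =>
    have h1 := sz_append (F x) (l.flatMap F)
    have h2 := ih fun y hy => h y (by simp [hy])
    have h3 := h x (by simp)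
    rw [List.flatMap_cons, List.length_cons, add_mul]
    omega

@[fun_prop]
theorem PT.flatMap {l : α → List β} {F : α → β → List γ} (hl : PT l)
    (hF : PT fun p : α × β => F p.1 p.2) : PT (fun a => (l a).flatMap (F a)) := by
  obtain ⟨P, hP⟩ := hl.bound
  obtain ⟨Q, hQ⟩ := hF.bound
  -- The result is accumulated in reverse order and reversed once at the end, since `reverseAux` is
  -- the append operation already available as a loop.
  have hfold : ∀ (a : α) (l : List β) (m : List γ),
      l.foldl (fun c x => (F a x).reverseAux c) m = (l.flatMap (F a)).reverse ++ m := by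
    intro a l
    induction l with
    | nil => simp
    | cons x l ih =>
      intro m
      rw [List.foldl_cons, ih, List.reverseAux_eq, List.flatMap_cons, List.reverse_append,
        List.append_assoc]
  have hG : PT fun p : α × List γ × β => (F p.1 p.2.2).reverseAux p.2.1 := by
    have : PT fun p : α × List γ × β => F p.1 p.2.2 :=
      hF.comp (g := fun p : α × List γ × β => (p.1, p.2.2)) (by fun_prop)
    fun_prop
  refine (PT.foldl hl (PT.const []) hG (P * Q.comp (.X + P + 1) + 1) fun a l₁ l₂ h => ?_).reverse.of_eq
    fun a => by rw [hfold, List.append_nil, List.reverse_reverse]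
  have h1 := hP a
  have h3 := sz_append l₁ l₂
  have h4 := one_le_sz l₂
  rw [← h] at h3
  simp only [hfold, List.append_nil, sz_reverse]
  refine (sz_flatMap_le (B := Q.eval (sz a + P.eval (sz a) + 1)) fun x hx => ?_).trans ?_
  · refine (hQ (a, x)).trans (eval_mono Q ?_)
    have : sz x ≤ sz (l a) := sz_mem (by rw [h]; simp [hx])
    rw [sz_pair]; omega
  · simp only [Polynomial.eval_add, Polynomial.eval_mul, Polynomial.eval_comp, Polynomial.eval_X,
      Polynomial.eval_one]
    gcongr
    have := length_lt_sz l₁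
    omega

@[fun_prop]
theorem PT.map {l : α → List β} {F : α → β → γ} (hl : PT l)
    (hF : PT fun p : α × β => F p.1 p.2) : PT (fun a => (l a).map (F a)) :=
  (PT.flatMap (F := fun a x => [F a x]) hl (hF.cons (PT.const []))).of_eq fun a => by
    rw [List.map_eq_flatMap]

@[fun_prop]
theorem PT.filter {l : α → List β} {F : α → β → Bool} (hl : PT l)
    (hF : PT fun p : α × β => F p.1 p.2) : PT (fun a => (l a).filter (F a)) :=
  (PT.flatMap (F := fun a x => bif F a x then [x] else []) hl
    (hF.cond (PT.cons (by fun_prop) (PT.const [])) (PT.const []))).of_eq fun a => by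
    induction l a with
    | nil => rfl
    | cons x l ih => cases h : F a x <;> simp [h, ih]

/-- In unary a number is literally the tree of a list of that many units, so taking a length only
means replacing the entries by units. -/
theorem enc_length {β : Type} (l : List β) : Enc.enc l.length = Enc.enc (l.map fun _ => ()) := by
  induction l with
  | nil => rfl
  | cons x l ih =>
    change Tree.node Tree.leaf (Enc.enc l.length) = Tree.node Tree.leaf (Enc.enc (l.map fun _ => ()))
    rw [ih]

@[fun_prop]
theorem PT.length {l : α → List β} (hl : PT l) : PT (fun a => (l a).length) :=
  (PT.map (F := fun _ _ => ()) hl (PT.const ())).of_enc fun _ => enc_length _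

@[fun_prop]
theorem PT.replicate {n : α → ℕ} (hn : PT n) : PT (fun a => List.replicate (n a) ()) :=
  hn.of_enc fun a => by
    have := enc_length (List.replicate (n a) ())
    rw [List.length_replicate, List.map_replicate] at this
    exact this.symm

@[fun_prop]
theorem PT.all {l : α → List β} {F : α → β → Bool} (hl : PT l)
    (hF : PT fun p : α × β => F p.1 p.2) : PT (fun a => (l a).all (F a)) :=
  (PT.listCases (g := fun _ => false) (PT.filter (F := fun a x => !F a x) hl hF.not)
    (PT.const true) (PT.const false)).of_eq fun a => by
    induction l a with
    | nil => rfl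
    | cons x l ih => cases h : F a x <;> simp [h, ih]

@[fun_prop]
theorem PT.any {l : α → List β} {F : α → β → Bool} (hl : PT l)
    (hF : PT fun p : α × β => F p.1 p.2) : PT (fun a => (l a).any (F a)) :=
  (PT.all (F := fun a x => !F a x) hl hF.not).not.of_eq fun a => by
    simp [List.any_eq_not_all_not]

/-- Iteration of a function that does not increase the size. -/
theorem PT.iterate {f : β → β} {n : α → ℕ} {b : α → β} (hf : PT f) (hsz : ∀ x, sz (f x) ≤ sz x)
    (hn : PT n) (hb : PT b) : PT (fun a => f^[n a] (b a)) := by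
  obtain ⟨P, hP⟩ := hb.bound
  have hF : PT fun p : α × β × Unit => f p.2.1 := hf.comp (by fun_prop)
  have hfold : ∀ (l : List Unit) (x : β), l.foldl (fun c _ => f c) x = f^[l.length] x := by
    intro l
    induction l with
    | nil => simp
    | cons x l ih => intro m; simp [ih]
  refine (PT.foldl hn.replicate hb hF P fun a l₁ l₂ _ => ?_).of_eq fun a => ?_
  · rw [hfold]
    refine le_trans ?_ (hP a)
    induction l₁.length with
    | zero => simp
    | succ i ih => rw [Function.iterate_succ_apply']; exact (hsz _).trans ih
  · rw [hfold, List.length_replicate]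

theorem PT.tail {l : α → List β} (hl : PT l) : PT (fun a => (l a).tail) :=
  (PT.listCases (g := fun p => p.2.2) hl (PT.const []) (by fun_prop)).of_eq fun a => by
    cases l a <;> rfl

theorem PT.drop {l : α → List β} {n : α → ℕ} (hl : PT l) (hn : PT n) :
    PT (fun a => (l a).drop (n a)) := by
  refine (PT.iterate (f := List.tail) (PT.tail PT.id) (fun x => ?_) hn hl).of_eq fun a => ?_
  · cases x
    · exact le_rfl
    · rw [sz_cons, List.tail_cons]; omega
  · generalize l a = m
    induction n a generalizing m with
    | zero => simp
    | succ i ih => rw [Function.iterate_succ_apply, ← ih]; cases m <;> simp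

@[fun_prop]
theorem PT.getD {l : α → List β} {n : α → ℕ} {d : α → β} (hl : PT l) (hn : PT n) (hd : PT d) :
    PT (fun a => (l a).getD (n a) (d a)) :=
  (PT.listCases (g := fun p => p.2.1) (hl.drop hn) hd (by fun_prop)).of_eq fun a => by
    generalize l a = m
    induction n a generalizing m with
    | zero => cases m <;> rfl
    | succ i ih => cases m with
      | nil => simp
      | cons x m => simpa using ih m

/-! ### Arithmetic -/

theorem enc_nat_append (m n : ℕ) :
    Enc.enc (m + n) = Enc.enc (List.replicate m () ++ List.replicate n ()) := by
  have := enc_length (List.replicate (m + n) ())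
  rw [List.length_replicate, List.map_replicate, List.replicate_add] at this
  exact this

@[fun_prop]
theorem PT.add {m n : α → ℕ} (hm : PT m) (hn : PT n) : PT (fun a => m a + n a) :=
  (hm.replicate.append hn.replicate).of_enc fun _ => enc_nat_append _ _

@[fun_prop]
theorem PT.mul {m n : α → ℕ} (hm : PT m) (hn : PT n) : PT (fun a => m a * n a) :=
  (PT.length (PT.flatMap (F := fun a _ => List.replicate (n a) ()) hm.replicate
    (PT.replicate (hn.comp (PT.fst PT.id))))).of_eq fun a => by simp [List.length_flatMap]

@[fun_prop]
theorem PT.sub {m n : α → ℕ} (hm : PT m) (hn : PT n) : PT (fun a => m a - n a) :=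
  (PT.length (hm.replicate.drop hn)).of_eq fun a => by simp

@[fun_prop]
theorem PT.range {n : α → ℕ} (hn : PT n) : PT (fun a => List.range (n a)) := by
  obtain ⟨P, hP⟩ := hn.bound
  have hfold : ∀ (l : List Unit), l.foldl (fun c _ => c.length :: c) ([] : List ℕ) =
      (List.range l.length).reverse := by
    intro l
    induction l using List.reverseRecOn with
    | nil => simp
    | append_singleton l x ih => simp [ih, List.range_succ]
  have hF : PT fun p : α × List ℕ × Unit => p.2.1.length :: p.2.1 := by fun_prop
  refine (PT.foldl hn.replicate (PT.const []) hF (P * (2 * P + 5) + 1)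
    fun a l₁ l₂ h => ?_).reverse.of_eq fun a => ?_
  · rw [hfold, sz_reverse]
    have h0 : l₁.length ≤ n a := by
      have := congrArg List.length h
      simp at this; omega
    have h1 : n a ≤ P.eval (sz a) := by
      have := hP a; rw [sz_nat] at this; omega
    have h2 : sz (List.range l₁.length) ≤ n a * (2 * n a + 5) + 1 := by
      have := sz_flatMap_le (l := List.range l₁.length) (F := fun i => [i]) (B := 2 * n a + 5)
        (fun i hi => by
          rw [sz_cons, sz_nil, sz_nat]; rw [List.mem_range] at hi; omega)
      rw [List.flatMap_singleton', List.length_range] at this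
      exact this.trans (by gcongr)
    simp only [Polynomial.eval_add, Polynomial.eval_mul, Polynomial.eval_one,
      Polynomial.eval_ofNat]
    exact h2.trans (by gcongr)
  · rw [hfold, List.reverse_reverse, List.length_replicate]

@[fun_prop]
theorem PT.beqZero {n : α → ℕ} (hn : PT n) : PT (fun a => n a == 0) :=
  (PT.listCases (g := fun _ => false) hn.replicate (PT.const true) (PT.const false)).of_eq
    fun a => by cases n a <;> rfl

@[fun_prop]
theorem PT.decideLE {m n : α → ℕ} (hm : PT m) (hn : PT n) : PT (fun a => decide (m a ≤ n a)) :=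
  (PT.beqZero (hm.sub hn)).of_eq fun a => by
    rw [Bool.eq_iff_iff]; simp; omega

@[fun_prop]
theorem PT.decideLT {m n : α → ℕ} (hm : PT m) (hn : PT n) : PT (fun a => decide (m a < n a)) :=
  (PT.decideLE hm.succ hn).of_eq fun _ => rfl

@[fun_prop]
theorem PT.beqNat {m n : α → ℕ} (hm : PT m) (hn : PT n) : PT (fun a => m a == n a) :=
  (PT.and (PT.decideLE hm hn) (PT.decideLE hn hm)).of_eq fun a => by
    rw [Bool.eq_iff_iff]; simp; omega

theorem length_filter_range (p : ℕ → Bool) {n m : ℕ} (hm : m ≤ n) (h : ∀ i < n, p i = decide (i < m)) :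
    ((List.range n).filter p).length = m := by
  have : (List.range n).filter p = List.range m := by
    obtain ⟨d, rfl⟩ := Nat.exists_eq_add_of_le hm
    rw [List.range_add, List.filter_append, List.filter_eq_self.2, List.filter_eq_nil_iff.2,
      List.append_nil]
    · intro i hi
      obtain ⟨j, hj, rfl⟩ := List.mem_map.1 hi
      rw [List.mem_range] at hj
      rw [h _ (by omega)]; simp
    · intro i hi
      rw [List.mem_range] at hi
      rw [h _ (by omega)]; simp [hi]
  rw [this, List.length_range]

-- Halving is done by counting: exactly `n / 2` indices `i` satisfy `2 * i + 1 < n`.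
@[fun_prop]
theorem PT.half {n : α → ℕ} (hn : PT n) : PT (fun a => n a / 2) :=
  (PT.length (PT.filter (F := fun a i => decide (2 * i + 1 < n a)) hn.range
    (PT.decideLT (by fun_prop) (hn.comp (PT.fst PT.id))))).of_eq fun a => by
    rw [length_filter_range _ (m := n a / 2) (by omega)]
    intro i _; rw [Bool.eq_iff_iff]; simp; omega

theorem iterate_half (x b : ℕ) : (fun y => y / 2)^[b] x = x / 2 ^ b := by
  induction b with
  | zero => simp
  | succ b ih => rw [Function.iterate_succ_apply', ih, Nat.div_div_eq_div_mul, pow_succ]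

-- The halving is iterated. The number `2 ^ b` is never formed, because in unary it could be
-- exponentially large.
@[fun_prop]
theorem PT.shiftRight {x b : α → ℕ} (hx : PT x) (hb : PT b) : PT (fun a => x a / 2 ^ b a) :=
  (PT.iterate (f := fun y => y / 2) (PT.half PT.id)
    (fun x => by rw [sz_nat, sz_nat]; omega) hb hx).of_eq fun a => (iterate_half _ _).symm

@[fun_prop]
theorem PT.testBit {x b : α → ℕ} (hx : PT x) (hb : PT b) : PT (fun a => (x a).testBit (b a)) := by
  have h : PT fun a => x a / 2 ^ b a - 2 * (x a / 2 ^ b a / 2) == 1 := by fun_prop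
  refine h.of_eq fun a => ?_
  rw [Nat.testBit_eq_decide_div_mod_eq, Bool.eq_iff_iff]
  simp only [decide_eq_true_eq, beq_iff_eq]
  omega

-- The value is the number of exponents `b` with `2 ^ b < n`. The test is written as `0 < (n - 1) /
-- 2 ^ b`, again to avoid forming the power.
@[fun_prop]
theorem PT.clog {n : α → ℕ} (hn : PT n) : PT (fun a => Nat.clog 2 (n a)) := by
  have h : PT fun a => ((List.range (n a)).filter fun b => decide (0 < (n a - 1) / 2 ^ b)).length :=
    PT.length (PT.filter hn.range (PT.decideLT (PT.const 0)
      (PT.shiftRight ((hn.comp (PT.fst PT.id)).sub (PT.const 1)) (PT.snd PT.id))))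
  refine h.of_eq fun a => (length_filter_range _ ?_ ?_).symm
  · exact Nat.clog_le_of_le_pow Nat.lt_two_pow_self.le
  · intro i hi
    rw [Bool.eq_iff_iff, decide_eq_true_iff, decide_eq_true_iff, Nat.lt_clog_iff_pow_lt one_lt_two]
    rw [Nat.div_pos_iff]
    have := Nat.two_pow_pos i
    omega

@[fun_prop]
theorem PT.natPair {m n : α → ℕ} (hm : PT m) (hn : PT n) : PT (fun a => Nat.pair (m a) (n a)) := by
  have h : PT fun a => if decide (m a < n a) = true then n a * n a + m a else m a * m a + m a + n a := by
    fun_prop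
  exact h.of_eq fun a => by simp [Nat.pair]

@[fun_prop]
theorem PT.xor {c d : α → Bool} (hc : PT c) (hd : PT d) : PT (fun a => c a ^^ d a) :=
  (PT.cond hc (PT.not hd) hd).of_eq fun a => by cases c a <;> simp

@[fun_prop]
theorem PT.sum {l : α → List ℕ} (hl : PT l) : PT (fun a => (l a).sum) :=
  (PT.length (PT.flatMap (F := fun _ n => List.replicate n ()) hl
    (PT.replicate (by fun_prop)))).of_eq fun a => by
    simp [List.length_flatMap]

@[fun_prop]
theorem PT.tails {l : α → List β} (hl : PT l) : PT (fun a => (l a).tails) := by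
  have h : PT fun a => (List.range ((l a).length + 1)).map fun i => (l a).drop i :=
    PT.map (F := fun a i => (l a).drop i) (by fun_prop) ((hl.comp (PT.fst PT.id)).drop (PT.snd PT.id))
  refine h.of_eq fun a => ?_
  generalize l a = m
  induction m with
  | nil => rfl
  | cons x m ih =>
    rw [List.tails_cons, ih, List.length_cons, List.range_succ_eq_map (n := m.length + 1),
      List.map_cons, List.map_map]
    rfl

/-! ### Descriptions of circuits -/

@[fun_prop]
theorem PT.realCode {s : α → Bool} {p q : α → ℕ} (hs : PT s) (hp : PT p) (hq : PT q) :
    PT (fun a => RealCode.mk (s a) (p a) (q a)) :=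
  (hs.prodMk (hp.prodMk hq)).of_enc fun _ => rfl

@[fun_prop]
theorem PT.entryCode {x y : α → RealCode} (hx : PT x) (hy : PT y) :
    PT (fun a => EntryCode.mk (x a) (y a)) :=
  (hx.prodMk hy).of_enc fun _ => rfl

@[fun_prop]
theorem PT.gateOne {i : α → ℕ} {M : α → Bool → Bool → EntryCode} (hi : PT i)
    (hM : ∀ r s, PT fun a => M a r s) : PT (fun a => GateCode.one (i a) (M a)) := by
  have h : PT fun a => ((), i a, [false, true].map fun r => [false, true].map fun s => M a r s) := by
    simp only [List.map_cons, List.map_nil]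
    fun_prop
  exact h.of_enc fun _ => rfl

@[fun_prop]
theorem PT.gateTwo {i j : α → ℕ} {M : α → Bool × Bool → Bool × Bool → EntryCode} (hi : PT i)
    (hj : PT j) (hM : ∀ r s, PT fun a => M a r s) : PT (fun a => GateCode.two (i a) (j a) (M a)) := by
  have h : PT fun a => (true, i a, j a,
      [(false, false), (false, true), (true, false), (true, true)].map fun r =>
        [(false, false), (false, true), (true, false), (true, true)].map fun s => M a r s) := by
    simp only [List.map_cons, List.map_nil]
    fun_prop
  exact h.of_enc fun _ => rfl

end

/-! ### Linear action of circuits -/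

/-- The action of a gate as a linear map. -/
def Gate.lin {N : ℕ} (g : Gate N) : State N →ₗ[ℂ] State N where
  toFun := g.apply
  map_add' φ χ := by
    cases g <;> ext x <;> simp [Gate.apply, mul_add, Finset.sum_add_distrib]
  map_smul' c φ := by
    cases g <;> ext x <;> simp only [Gate.apply, Pi.smul_apply, smul_eq_mul, RingHom.id_apply,
      Finset.mul_sum] <;> exact Finset.sum_congr rfl fun b _ => by ring

/-- The gate descriptions `D` denote a circuit on `N` wires with action `T`. -/
def Impl (N : ℕ) (D : List GateCode) (T : State N →ₗ[ℂ] State N) : Prop :=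
  ∃ G : List (Gate N), List.Forall₂ GateCode.Denotes D G ∧
    ∀ ψ, G.foldl (fun ψ g => g.apply ψ) ψ = T ψ

theorem Impl.nil (N : ℕ) : Impl N [] LinearMap.id := ⟨[], .nil, fun _ => rfl⟩

theorem Impl.append {N : ℕ} {D E : List GateCode} {S T : State N →ₗ[ℂ] State N}
    (hD : Impl N D S) (hE : Impl N E T) : Impl N (D ++ E) (T ∘ₗ S) := by
  obtain ⟨G, h1, h2⟩ := hD
  obtain ⟨H, h3, h4⟩ := hE
  exact ⟨G ++ H, List.rel_append h1 h3, fun ψ => by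
    rw [List.foldl_append, h2, h4, LinearMap.comp_apply]⟩

theorem Impl.congr {N : ℕ} {D : List GateCode} {S T : State N →ₗ[ℂ] State N}
    (hD : Impl N D S) (h : ∀ ψ, S ψ = T ψ) : Impl N D T := by
  rwa [← LinearMap.ext h]

/-- The description of `0`. -/
def EntryCode.zero : EntryCode := ⟨⟨false, 0, 1⟩, ⟨false, 0, 1⟩⟩

/-- The description of `± √(p / q)`. -/
def EntryCode.real (s : Bool) (p q : ℕ) : EntryCode := ⟨⟨s, p, q⟩, ⟨false, 0, 1⟩⟩

/-- The description of `(1 ± i) / 2`. -/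
def EntryCode.half (s : Bool) : EntryCode := ⟨⟨false, 1, 4⟩, ⟨s, 1, 4⟩⟩

theorem EntryCode.val_zero : EntryCode.zero.val = 0 := by
  apply Complex.ext <;> simp [EntryCode.zero, EntryCode.val, RealCode.val]

theorem EntryCode.val_real (s : Bool) (p q : ℕ) :
    (EntryCode.real s p q).val = (((if s then -1 else 1) * √((p : ℝ) / q) : ℝ) : ℂ) := by
  apply Complex.ext <;> cases s <;> simp [EntryCode.real, EntryCode.val, RealCode.val]

theorem EntryCode.val_half (s : Bool) :
    (EntryCode.half s).val = (1 + (if s then -1 else 1) * Complex.I) / 2 := by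
  have h : √((4 : ℝ)) = 2 := by rw [show (4 : ℝ) = 2 ^ 2 by norm_num]; simp
  apply Complex.ext <;> cases s <;> simp [EntryCode.half, EntryCode.val, RealCode.val, h]
  all_goals norm_num

/-- The controlled version of a one-qubit gate; it acts when the control differs from `p`. -/
def ctrlCode (p : Bool) (M : Bool → Bool → EntryCode) (r s : Bool × Bool) : EntryCode :=
  if r.1 = s.1 then
    if (r.1 ^^ p) = true then M r.2 s.2 else if r.2 = s.2 then EntryCode.real false 1 1 else .zero
  else .zero

/-- The matrix described by one-qubit codes. -/
def codeMat (M : Bool → Bool → EntryCode) : Matrix Bool Bool ℂ := Matrix.of fun a b => (M a b).val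

theorem impl_one {N i : ℕ} (hi : i < N) {M : Bool → Bool → EntryCode}
    (hM : codeMat M ∈ Matrix.unitaryGroup Bool ℂ) :
    ∃ T, Impl N [.one i M] T ∧
      ∀ ψ x, T ψ x = ∑ b : Bool, (M (x ⟨i, hi⟩) b).val * ψ (Function.update x ⟨i, hi⟩ b) :=
  ⟨(Gate.one ⟨i, hi⟩ ⟨codeMat M, hM⟩).lin,
    ⟨[_], .cons (.one ⟨i, hi⟩ M ⟨codeMat M, hM⟩ fun _ _ => rfl) .nil, fun _ => rfl⟩, fun _ _ => rfl⟩

theorem impl_ctrl {N i j : ℕ} (hi : i < N) (hj : j < N) (hij : i ≠ j) (p : Bool)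
    {M : Bool → Bool → EntryCode} (hM : codeMat M ∈ Matrix.unitaryGroup Bool ℂ) :
    ∃ T, Impl N [.two i j (ctrlCode p M)] T ∧
      ∀ ψ x, T ψ x = if (x ⟨i, hi⟩ ^^ p) = true then
        ∑ b : Bool, (M (x ⟨j, hj⟩) b).val * ψ (Function.update x ⟨j, hj⟩ b) else ψ x := by
  have hU : Matrix.of (fun r s => (ctrlCode p M r s).val) ∈ Matrix.unitaryGroup (Bool × Bool) ℂ := by
    rw [Matrix.mem_unitaryGroup_iff] at hM ⊢
    have h1 : ∀ a b, (M a false).val * star (M b false).val + (M a true).val * star (M b true).val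
        = if a = b then 1 else 0 := by
      intro a b
      have := congrFun (congrFun hM a) b
      simp only [Matrix.mul_apply, Fintype.sum_bool, Matrix.one_apply, Matrix.star_apply, codeMat,
        Matrix.of_apply] at this
      rw [add_comm]; exact this
    ext ⟨a, b⟩ ⟨c, d⟩
    rw [Matrix.mul_apply, Fintype.sum_prod_type]
    simp only [Fintype.sum_bool, Matrix.star_apply, Matrix.of_apply, ctrlCode, Matrix.one_apply]
    have h2 := h1 b d
    cases p <;> cases a <;> cases c <;> simp [EntryCode.val_zero] at h2 ⊢ <;>
      first
      | (rw [add_comm]; exact h2)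
      | (cases b <;> cases d <;> simp [EntryCode.val_zero, EntryCode.val_real])
  refine ⟨(Gate.two ⟨i, hi⟩ ⟨j, hj⟩ (by simpa using hij) ⟨_, hU⟩).lin,
    ⟨[_], .cons (.two ⟨i, hi⟩ ⟨j, hj⟩ (by simpa using hij) _ ⟨_, hU⟩ fun _ _ => rfl) .nil,
      fun _ => rfl⟩, fun ψ x => ?_⟩
  change ∑ b : Bool × Bool, (ctrlCode p M (x ⟨i, hi⟩, x ⟨j, hj⟩) b).val *
    ψ (Function.update (Function.update x ⟨i, hi⟩ b.1) ⟨j, hj⟩ b.2) = _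
  rw [Fintype.sum_prod_type]
  have hu : Function.update x ⟨i, hi⟩ (x ⟨i, hi⟩) = x := Function.update_eq_self _ _
  have hu' : Function.update x ⟨j, hj⟩ (x ⟨j, hj⟩) = x := Function.update_eq_self _ _
  generalize hb : x ⟨j, hj⟩ = b at *
  generalize ha : x ⟨i, hi⟩ = a at *
  simp only [Fintype.sum_bool, ctrlCode]
  cases p <;> cases a <;> simp [EntryCode.val_zero, hu] <;>
    cases b <;> simp [EntryCode.val_zero, EntryCode.val_real, hu']

/-! ### Classical reversible instructions -/

/-- A Toffoli gate whose controls act when they differ from `pa` and `pb`. -/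
structure Instr : Type where
  t : ℕ
  a : ℕ
  pa : Bool
  b : ℕ
  pb : Bool

/-- The effect on bit strings. -/
def Instr.step (g : Instr) (v : ℕ → Bool) : ℕ → Bool :=
  Function.update v g.t (v g.t ^^ ((v g.a ^^ g.pa) && (v g.b ^^ g.pb)))

/-- The instruction acts on three distinct wires below `N`. -/
structure Instr.WF (N : ℕ) (g : Instr) : Prop where
  ht : g.t < N
  ha : g.a < N
  hb : g.b < N
  hta : g.t ≠ g.a
  htb : g.t ≠ g.b
  hab : g.a ≠ g.b

/-- The effect of a list of instructions. -/
def crun (L : List Instr) (v : ℕ → Bool) : ℕ → Bool := L.foldl (fun v g => g.step v) v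

theorem crun_nil (v : ℕ → Bool) : crun [] v = v := rfl

theorem crun_cons (g : Instr) (L : List Instr) (v : ℕ → Bool) :
    crun (g :: L) v = crun L (g.step v) := rfl

theorem crun_append (L M : List Instr) (v : ℕ → Bool) : crun (L ++ M) v = crun M (crun L v) :=
  List.foldl_append ..

theorem Instr.WF.step_step {N : ℕ} {g : Instr} (hg : g.WF N) (v : ℕ → Bool) :
    g.step (g.step v) = v := by
  funext i
  have h1 := hg.hta
  have h2 := hg.htb
  by_cases hi : i = g.t
  · subst hi; simp [Instr.step, h1.symm, h2.symm]
  · simp [Instr.step, hi]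

theorem crun_reverse {N : ℕ} {L : List Instr} (hL : ∀ g ∈ L, g.WF N) (v : ℕ → Bool) :
    crun L.reverse (crun L v) = v := by
  induction L generalizing v with
  | nil => rfl
  | cons g L ih =>
    rw [List.reverse_cons, crun_append, crun_cons g L, ih fun g hg => hL g (by simp [hg])]
    exact (hL g (by simp)).step_step v

theorem crun_reverse' {N : ℕ} {L : List Instr} (hL : ∀ g ∈ L, g.WF N) (v : ℕ → Bool) :
    crun L (crun L.reverse v) = v := by
  have := crun_reverse (L := L.reverse) (fun g hg => hL g (by simpa using hg)) v
  rwa [List.reverse_reverse] at this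

/-- The restriction to the first `N` wires. -/
def restr (N : ℕ) (v : ℕ → Bool) : Fin N → Bool := fun i => v i

/-- The extension by zeros. -/
def ext {N : ℕ} (x : Fin N → Bool) : ℕ → Bool := fun i => if h : i < N then x ⟨i, h⟩ else false

theorem restr_ext {N : ℕ} (x : Fin N → Bool) : restr N (ext x) = x := by
  funext i; simp [restr, ext]

/-- The basis state given by the first `N` bits of `v`. -/
def kt (N : ℕ) (v : ℕ → Bool) : State N := ket (restr N v)

theorem restr_step {N : ℕ} {g : Instr} (hg : g.WF N) {v w : ℕ → Bool} (h : restr N v = restr N w) :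
    restr N (g.step v) = restr N (g.step w) := by
  have h' : ∀ i < N, v i = w i := fun i hi => congrFun h ⟨i, hi⟩
  funext i
  have h1 := h' _ hg.ha
  have h2 := h' _ hg.hb
  have h3 := h' _ hg.ht
  by_cases hi : (i : ℕ) = g.t
  · simp [restr, Instr.step, hi, h1, h2, h3]
  · simp [restr, Instr.step, hi, h' i i.2]

theorem restr_crun {N : ℕ} {L : List Instr} (hL : ∀ g ∈ L, g.WF N) {v w : ℕ → Bool}
    (h : restr N v = restr N w) : restr N (crun L v) = restr N (crun L w) := by
  induction L generalizing v w with
  | nil => exact h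
  | cons g L ih => exact ih (fun g hg => hL g (by simp [hg])) (restr_step (hL g (by simp)) h)

/-- The description of the square root of the bit flip, or of its inverse. -/
def vCode (s : Bool) (a b : Bool) : EntryCode := EntryCode.half (a != b ^^ s)

/-- The description of the bit flip. -/
def xCode (a b : Bool) : EntryCode := if a = b then .zero else .real false 1 1

/-- The circuit of an instruction. -/
def Instr.code (g : Instr) : List GateCode :=
  [.two g.b g.t (ctrlCode g.pb (vCode false)), .two g.a g.b (ctrlCode g.pa xCode),
    .two g.b g.t (ctrlCode g.pb (vCode true)), .two g.a g.b (ctrlCode g.pa xCode),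
    .two g.a g.t (ctrlCode g.pa (vCode false))]

theorem vCode_unitary (s : Bool) : codeMat (vCode s) ∈ Matrix.unitaryGroup Bool ℂ := by
  rw [Matrix.mem_unitaryGroup_iff]
  ext a b
  have h2 : Complex.I * Complex.I = -1 := Complex.I_mul_I
  simp only [Matrix.mul_apply, Fintype.sum_bool, codeMat, Matrix.star_apply, Matrix.of_apply, vCode,
    EntryCode.val_half, Matrix.one_apply]
  cases s <;> cases a <;> cases b <;> simp <;> ring_nf <;> simp <;> norm_num

theorem xCode_unitary : codeMat xCode ∈ Matrix.unitaryGroup Bool ℂ := by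
  rw [Matrix.mem_unitaryGroup_iff]
  ext a b
  simp only [Matrix.mul_apply, Fintype.sum_bool, codeMat, Matrix.star_apply, Matrix.of_apply, xCode,
    Matrix.one_apply]
  cases a <;> cases b <;> simp [EntryCode.val_zero, EntryCode.val_real]

/-- Let `V` be the square root of the bit flip `X`, and `α`, `β` the two control literals. The five
gates apply `V^β V^(-(α ⊕ β)) V^α` to the target, and `α + β - (α ⊕ β) = 2αβ`, so the total effect
is `X^(αβ)`. The two controlled flips of the wire `b` cancel. -/
theorem Instr.WF.impl {N : ℕ} {g : Instr} (hg : g.WF N) :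
    Impl N g.code (LinearMap.funLeft ℂ ℂ fun x => restr N (g.step (ext x))) := by
  obtain ⟨T1, h1, e1⟩ := impl_ctrl hg.hb hg.ht hg.htb.symm g.pb (vCode_unitary false)
  obtain ⟨T2, h2, e2⟩ := impl_ctrl hg.ha hg.hb hg.hab g.pa xCode_unitary
  obtain ⟨T3, h3, e3⟩ := impl_ctrl hg.hb hg.ht hg.htb.symm g.pb (vCode_unitary true)
  obtain ⟨T5, h5, e5⟩ := impl_ctrl hg.ha hg.ht hg.hta.symm g.pa (vCode_unitary false)
  refine ((((h1.append h2).append h3).append h2).append h5).congr fun ψ => ?_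
  funext x
  obtain ⟨ht, ha, hb, hta, htb, hab⟩ := hg
  have hx : restr N (g.step (ext x)) = Function.update x ⟨g.t, ht⟩
      (x ⟨g.t, ht⟩ ^^ ((x ⟨g.a, ha⟩ ^^ g.pa) && (x ⟨g.b, hb⟩ ^^ g.pb))) := by
    funext i
    by_cases hi : i = ⟨g.t, ht⟩
    · subst hi; simp [restr, Instr.step, ext, ht, ha, hb]
    · have : (i : ℕ) ≠ g.t := fun h => hi (Fin.ext h)
      simp [restr, Instr.step, ext, hi, this]
  rw [LinearMap.funLeft_apply, hx]
  simp only [LinearMap.comp_apply]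
  generalize hA : (⟨g.a, ha⟩ : Fin N) = A at *
  generalize hB : (⟨g.b, hb⟩ : Fin N) = B at *
  generalize hT : (⟨g.t, ht⟩ : Fin N) = t at *
  have dta : t ≠ A := by rw [← hT, ← hA]; simpa using hta
  have dtb : t ≠ B := by rw [← hT, ← hB]; simpa using htb
  have dab : A ≠ B := by rw [← hA, ← hB]; simpa using hab
  have u1 : ∀ x : Fin N → Bool, ∀ p q, Function.update (Function.update x t q) B p =
    Function.update (Function.update x B p) t q := fun x p q => Function.update_comm dtb _ _ _
  have u2 : ∀ x : Fin N → Bool, Function.update x B (x B) = x := fun x => Function.update_eq_self _ _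
  have u3 : ∀ x : Fin N → Bool, Function.update x t (x t) = x := fun x => Function.update_eq_self _ _
  have u2' := u2 x
  have u3' := u3 x
  have hI : Complex.I ^ 2 = -1 := Complex.I_sq
  simp only [e1, e2, e3, e5, Fintype.sum_bool, Function.update_apply, dtb, dab, dta.symm,
    dtb.symm, if_true, if_false, vCode, xCode, EntryCode.val_half, u1,
    Function.update_idem]
  generalize x A = α at *
  generalize x B = β at *
  generalize x t = τ at *
  generalize g.pa = pa at *
  generalize g.pb = pb at *
  cases pa <;> cases α <;> cases pb <;> cases β <;> cases τ <;>
    simp [EntryCode.val_zero, EntryCode.val_real, u2', u3'] <;> ring_nf <;>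
    simp only [hI] <;> ring_nf

/-- A permutation of basis strings acts on amplitudes by composition with its inverse. Each
instruction is an involution, so the inverse of the list is the reversed list. -/
theorem impl_crun {N : ℕ} {L : List Instr} (hL : ∀ g ∈ L, g.WF N) :
    Impl N (L.flatMap Instr.code)
      (LinearMap.funLeft ℂ ℂ fun x => restr N (crun L.reverse (ext x))) := by
  induction L with
  | nil =>
    refine (Impl.nil N).congr fun ψ => ?_
    funext x
    simp only [LinearMap.funLeft_apply, List.reverse_nil, crun_nil, restr_ext, LinearMap.id_apply]
  | cons g L ih =>
    have hL' : ∀ g ∈ L, g.WF N := fun g hg => hL g (by simp [hg])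
    have hg := hL g (by simp)
    rw [List.flatMap_cons]
    refine (hg.impl.append (ih hL')).congr fun ψ => ?_
    funext x
    simp only [LinearMap.comp_apply, LinearMap.funLeft_apply, List.reverse_cons, crun_append]
    exact congrArg ψ (restr_step hg (restr_ext _))

theorem funLeft_crun_kt {N : ℕ} {L : List Instr} (hL : ∀ g ∈ L, g.WF N) (v : ℕ → Bool) :
    LinearMap.funLeft ℂ ℂ (fun x => restr N (crun L.reverse (ext x))) (kt N v) =
      kt N (crun L v) := by
  funext x
  have hL' : ∀ g ∈ L.reverse, g.WF N := fun g hg => hL g (by simpa using hg)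
  rw [LinearMap.funLeft_apply, kt, kt, ket, ket]
  congr 1
  apply propext
  constructor
  · intro h
    have := restr_crun hL h
    rwa [crun_reverse' hL, restr_ext] at this
  · rintro rfl
    have := restr_crun hL' (restr_ext (restr N (crun L v)))
    rwa [crun_reverse hL] at this

/-! ### Layers of instructions -/

/-- The bit that an instruction adds to its target. -/
def Instr.term (g : Instr) (w : ℕ → Bool) : Bool := (w g.a ^^ g.pa) && (w g.b ^^ g.pb)

/-- The sum of the bits that the instructions of `C` add to the wire `z`. -/
def xs (C : List Instr) (w : ℕ → Bool) (z : ℕ) : Bool :=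
  C.foldr (fun g s => (decide (g.t = z) && g.term w) ^^ s) false

theorem xs_nil (w : ℕ → Bool) (z : ℕ) : xs [] w z = false := rfl

theorem xs_cons (g : Instr) (C : List Instr) (w : ℕ → Bool) (z : ℕ) :
    xs (g :: C) w z = ((decide (g.t = z) && g.term w) ^^ xs C w z) := rfl

theorem xs_append (C D : List Instr) (w : ℕ → Bool) (z : ℕ) :
    xs (C ++ D) w z = (xs C w z ^^ xs D w z) := by
  induction C with
  | nil => simp [xs_nil]
  | cons g C ih => rw [List.cons_append, xs_cons, xs_cons, ih, Bool.xor_assoc]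

theorem xs_eq_false {C : List Instr} {w : ℕ → Bool} {z : ℕ} (h : ∀ g ∈ C, g.t ≠ z) :
    xs C w z = false := by
  induction C with
  | nil => rfl
  | cons g C ih =>
    rw [xs_cons, ih fun g hg => h g (by simp [hg])]
    simp [h g (by simp)]

theorem xs_flatMap_false {α : Type} {l : List α} {F : α → List Instr} {w : ℕ → Bool} {z : ℕ}
    (h : ∀ i ∈ l, xs (F i) w z = false) : xs (l.flatMap F) w z = false := by
  induction l with
  | nil => rfl
  | cons i l ih =>
    rw [List.flatMap_cons, xs_append, ih fun j hj => h j (by simp [hj]), h i (by simp)]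
    rfl

theorem xs_flatMap_single {α : Type} {l : List α} (hl : l.Nodup) {F : α → List Instr}
    {w : ℕ → Bool} {z : ℕ} {i : α} (hi : i ∈ l) (h : ∀ j ∈ l, j ≠ i → xs (F j) w z = false) :
    xs (l.flatMap F) w z = xs (F i) w z := by
  induction l with
  | nil => simp at hi
  | cons j l ih =>
    rw [List.flatMap_cons, xs_append]
    rw [List.nodup_cons] at hl
    by_cases hj : j = i
    · subst hj
      rw [xs_flatMap_false, Bool.xor_false]
      exact fun m hm => h m (by simp [hm]) fun e => hl.1 (e ▸ hm)
    · rw [h j (by simp) hj, Bool.false_xor]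
      exact ih hl.2 (by simpa [Ne.symm hj] using hi) fun m hm => h m (by simp [hm])

theorem crun_of_not_target {L : List Instr} {v : ℕ → Bool} {z : ℕ} (h : ∀ g ∈ L, g.t ≠ z) :
    crun L v z = v z := by
  induction L generalizing v with
  | nil => rfl
  | cons g L ih =>
    rw [crun_cons, ih fun g hg => h g (by simp [hg])]
    simp [Instr.step, (h g (by simp)).symm]

/-- Instructions whose targets satisfy `P` and whose controls do not. -/
def Layer (P : ℕ → Prop) (C : List Instr) : Prop := ∀ g ∈ C, P g.t ∧ ¬ P g.a ∧ ¬ P g.b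

theorem xs_congr {C : List Instr} {P : ℕ → Prop} (hC : Layer P C) {v w : ℕ → Bool}
    (h : ∀ z, ¬ P z → v z = w z) (z : ℕ) : xs C v z = xs C w z := by
  induction C with
  | nil => rfl
  | cons g C ih =>
    have hg := hC g (by simp)
    rw [xs_cons, xs_cons, ih fun g hg => hC g (by simp [hg]), Instr.term, Instr.term, h _ hg.2.1,
      h _ hg.2.2]

/-- No control of the layer is ever a target in it. Hence every instruction may be evaluated on the
initial string, and the order is immaterial: each wire receives the sum of its terms. -/
theorem crun_layer {C : List Instr} {P : ℕ → Prop} (hC : Layer P C) (w : ℕ → Bool) (z : ℕ) :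
    crun C w z = (w z ^^ xs C w z) := by
  induction C generalizing w with
  | nil => simp [crun_nil, xs_nil]
  | cons g C ih =>
    have hg := hC g (by simp)
    have hC' : Layer P C := fun g hg => hC g (by simp [hg])
    rw [crun_cons, ih hC', xs_cons, ← xs_congr hC' (v := g.step w) (w := w)]
    · by_cases hz : z = g.t
      · subst hz; simp [Instr.step, Instr.term]
      · simp [Instr.step, hz, Ne.symm hz]
    · intro z hz
      have : z ≠ g.t := fun e => hz (e ▸ hg.1)
      simp [Instr.step, this]

/-- Instructions none of whose wires satisfies `P`. -/
def Avoids (P : ℕ → Prop) (A : List Instr) : Prop := ∀ g ∈ A, ¬ P g.t ∧ ¬ P g.a ∧ ¬ P g.b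

theorem Avoids.reverse {P : ℕ → Prop} {A : List Instr} (hA : Avoids P A) : Avoids P A.reverse :=
  fun g hg => hA g (by simpa using hg)

theorem Avoids.crun_eq {P : ℕ → Prop} {A : List Instr} (hA : Avoids P A) (v : ℕ → Bool) {z : ℕ}
    (hz : P z) : crun A v z = v z :=
  crun_of_not_target fun g hg e => (hA g hg).1 (e ▸ hz)

theorem Avoids.crun_congr {P : ℕ → Prop} {A : List Instr} (hA : Avoids P A) {v w : ℕ → Bool}
    (h : ∀ z, ¬ P z → v z = w z) : ∀ z, ¬ P z → crun A v z = crun A w z := by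
  induction A generalizing v w with
  | nil => exact h
  | cons g A ih =>
    refine ih (fun g hg => hA g (by simp [hg])) fun z hz => ?_
    have hg := hA g (by simp)
    by_cases e : z = g.t
    · subst e; simp [Instr.step, h _ hg.1, h _ hg.2.1, h _ hg.2.2]
    · simp [Instr.step, e, h _ hz]

/-- Compute with `A`, use the result in `C`, uncompute. -/
theorem crun_conj {N : ℕ} {P : ℕ → Prop} {A C : List Instr} (hN : ∀ g ∈ A, g.WF N)
    (hA : Avoids P A) (hC : Layer P C) (v : ℕ → Bool) (z : ℕ) :
    crun (A ++ C ++ A.reverse) v z = (v z ^^ xs C (crun A v) z) := by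
  rw [crun_append, crun_append]
  -- On wires in `P` only `C` acts. Off `P` the layer `C` changes nothing, so `A.reverse` undoes
  -- `A`.
  by_cases hz : P z
  · rw [hA.reverse.crun_eq _ hz, crun_layer hC, hA.crun_eq _ hz]
  · rw [hA.reverse.crun_congr (w := crun A v) _ _ hz, crun_reverse hN, xs_eq_false, Bool.xor_false]
    · exact fun g hg e => hz (e ▸ (hC g hg).1)
    · intro y hy
      rw [crun_layer hC, xs_eq_false, Bool.xor_false]
      exact fun g hg e => hy (e ▸ (hC g hg).1)

/-! ### Work wires -/

/-- Work wires, with a tag and three indices. -/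
def wk (W tag i j b : ℕ) : ℕ := W + Nat.pair (Nat.pair tag i) (Nat.pair j b)

-- Injectivity of the pairing keeps the families of work wires apart. The tags are: 0 constant zero
-- wires, 1 comparisons, 2 one-hot partial ranks, 3 column parities, 4 distinctness, 5 selected
-- ranks, 6 copy of the sorted list, 7 decoded ranks, 8 control wires of the block preparation, 9
-- string comparison, 10 final conjunction.
@[simp]
theorem wk_inj {W t i j b t' i' j' b' : ℕ} :
    wk W t i j b = wk W t' i' j' b' ↔ t = t' ∧ i = i' ∧ j = j' ∧ b = b' := by
  simp only [wk, Nat.add_left_cancel_iff, Nat.pair_eq_pair, and_assoc]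

theorem le_wk (W t i j b : ℕ) : W ≤ wk W t i j b := Nat.le_add_right _ _

theorem wk_ne {W t i j b z : ℕ} (h : z < W) : wk W t i j b ≠ z :=
  fun e => absurd (le_wk W t i j b) (by omega)

/-- Pairing two numbers below `R` gives a number below `R ^ 2`. Two levels of pairing cost a fourth
power, so the number of work qubits stays polynomial. -/
theorem wk_lt {W Q t i j b : ℕ} (ht : t < Q) (hi : i < Q) (hj : j < Q) (hb : b < Q) :
    wk W t i j b < W + Q ^ 4 := by
  have key : ∀ {a b R : ℕ}, a < R → b < R → Nat.pair a b < R ^ 2 := fun {a b R} ha hb =>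
    (Nat.pair_lt_max_add_one_sq a b).trans_le (Nat.pow_le_pow_left (by omega) 2)
  have := key (key ht hi) (key hj hb)
  rw [← pow_mul] at this
  exact Nat.add_lt_add_left this W

/-- Negation of a wire; the controls are wires that always hold `0`. -/
def notI (W t : ℕ) : Instr := ⟨t, wk W 0 0 0 0, true, wk W 0 0 0 1, true⟩

/-- Addition of the bit `a` or of its negation to a wire. -/
def addI (W t a : ℕ) (pa : Bool) : Instr := ⟨t, a, pa, wk W 0 0 0 0, true⟩

/-- Iterated conjunction: `base (s + 1)` receives the conjunction of the first `s + 1` literals. -/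
def chain (W : ℕ) (base : ℕ → ℕ) (f : ℕ → ℕ × Bool) (m : ℕ) : List Instr :=
  notI W (base 0) :: (List.range m).map fun s => ⟨base (s + 1), base s, false, (f s).1, (f s).2⟩

/-- The wire `base 0` is set to 1, the empty conjunction, and each further wire adds one literal to
the previous one. All intermediate values remain on their wires, so the chain is only ever used
inside a compute-uncompute pair. -/
theorem crun_chain {W : ℕ} {base : ℕ → ℕ} {f : ℕ → ℕ × Bool} {m : ℕ} {v : ℕ → Bool}
    (hb : Function.Injective base) (hv : ∀ s, v (base s) = false)
    (hf : ∀ s < m, ∀ s', (f s).1 ≠ base s') (hz : v (wk W 0 0 0 0) = false)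
    (hz' : v (wk W 0 0 0 1) = false) (z : ℕ) :
    ((∀ s ≤ m, z ≠ base s) → crun (chain W base f m) v z = v z) ∧
    (∀ s ≤ m, z = base s → crun (chain W base f m) v z =
      (List.range s).all fun s' => v (f s').1 ^^ (f s').2) := by
  induction m generalizing z with
  | zero =>
    simp only [chain, List.range_zero, List.map_nil, crun_cons, crun_nil]
    refine ⟨fun h => ?_, fun s hs e => ?_⟩
    · simp [Instr.step, notI, h 0 le_rfl]
    · obtain rfl : s = 0 := by omega
      subst e
      simp [Instr.step, notI, hv, hz, hz']
  | succ m ih =>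
    have ih := ih fun s hs => hf s (by omega)
    have hstep : crun (chain W base f (m + 1)) v = Instr.step
        ⟨base (m + 1), base m, false, (f m).1, (f m).2⟩ (crun (chain W base f m) v) := by
      simp only [chain, List.range_succ, List.map_append, crun_cons, crun_append, List.map_cons,
        List.map_nil, crun_nil]
    have h1 := (ih (f m).1).1 fun s _ => hf m (by omega) s
    have h2 := (ih (base m)).2 m le_rfl rfl
    have h3 := (ih (base (m + 1))).1 fun s hs e => by have := hb e; omega
    rw [hstep]
    refine ⟨fun h => ?_, fun s hs e => ?_⟩
    · rw [← (ih z).1 fun s hs => h s (by omega)]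
      simp [Instr.step, h (m + 1) le_rfl]
    · rcases Nat.lt_or_ge m s with hs' | hs'
      · obtain rfl : s = m + 1 := by omega
        subst e
        simp only [Instr.step, Function.update_self]
        rw [h1, h2, h3, hv, List.range_succ, List.all_append]
        simp
      · rw [← (ih z).2 s hs' e]
        have : z ≠ base (m + 1) := fun e' => by have := hb (e.symm.trans e'); omega
        simp [Instr.step, this]

/-! ### The sorting circuit -/

theorem idx_lt {i l b L : ℕ} (hi : i < l) (hb : b < L) : i * L + b < l * L := by
  calc i * L + b < i * L + L := by omega
    _ = (i + 1) * L := by ring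
    _ ≤ l * L := Nat.mul_le_mul_right _ hi

/-- One digit of the comparison of all pairs. -/
def cmpLayer (W l L b : ℕ) : List Instr :=
  (List.range l).flatMap fun i => (List.range l).flatMap fun j => bif i == j then [] else
    [⟨wk W 1 i j (b + 1), j * L + b, true, i * L + b, false⟩,
      ⟨wk W 1 i j (b + 1), j * L + b, true, wk W 1 i j b, false⟩,
      ⟨wk W 1 i j (b + 1), i * L + b, false, wk W 1 i j b, false⟩]

/-- The wire `wk W 1 i j L` receives the truth value of `x_j < x_i`. -/
def cmps (W l L B : ℕ) : List Instr := (List.range B).flatMap (cmpLayer W l L)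

theorem Layer.cmpLayer {W l L b : ℕ} (hW : l * L ≤ W) (hb : b < L) :
    Layer (fun z => ∃ i j, z = wk W 1 i j (b + 1)) (cmpLayer W l L b) := by
  intro g hg
  simp only [Guiding.cmpLayer, List.mem_flatMap, List.mem_range] at hg
  obtain ⟨i, hi, j, hj, hg⟩ := hg
  have h1 := (idx_lt hi hb).trans_le hW
  have h2 := (idx_lt hj hb).trans_le hW
  cases h : (i == j)
  · simp only [h, cond_false, List.mem_cons, List.not_mem_nil, or_false] at hg
    rcases hg with rfl | rfl | rfl <;>
      refine ⟨⟨i, j, rfl⟩, ?_, ?_⟩ <;> rintro ⟨i', j', e⟩ <;>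
        first | exact wk_ne h1 e.symm | exact wk_ne h2 e.symm | simp at e
  · simp [h] at hg

/-- The comparison of `b + 1` digits is the majority of three bits: the negated top digit of `x`,
the top digit of `y`, and the comparison of the lower digits. The majority of three bits is the sum
modulo 2 of their pairwise products, hence three Toffoli gates onto a fresh wire. -/
theorem maj_testBit (x y b : ℕ) :
    decide (x % 2 ^ (b + 1) < y % 2 ^ (b + 1)) =
      (((!x.testBit b) && y.testBit b) ^^ ((!x.testBit b) && decide (x % 2 ^ b < y % 2 ^ b)) ^^
        (y.testBit b && decide (x % 2 ^ b < y % 2 ^ b))) := by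
  rw [Nat.mod_pow_succ, Nat.mod_pow_succ, Nat.testBit_eq_decide_div_mod_eq,
    Nat.testBit_eq_decide_div_mod_eq]
  have h1 := Nat.mod_lt x (Nat.two_pow_pos b)
  have h2 := Nat.mod_lt y (Nat.two_pow_pos b)
  generalize x % 2 ^ b = p at *
  generalize y % 2 ^ b = q at *
  rcases Nat.mod_two_eq_zero_or_one (x / 2 ^ b) with hx | hx <;>
    rcases Nat.mod_two_eq_zero_or_one (y / 2 ^ b) with hy | hy <;>
    rw [hx, hy, Bool.eq_iff_iff] <;> simp <;> omega

/-- Induction on the number of processed digits. A layer only adds bits to its targets, so the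
induction has to carry the last clause, that the wires of later digits are still zero. -/
theorem cmps_spec {W l L : ℕ} (hW : l * L ≤ W) {v : ℕ → Bool} {s : ℕ → ℕ}
    (hv : ∀ z, W ≤ z → v z = false)
    (hx : ∀ i < l, ∀ b < L, v (i * L + b) = (s i).testBit b) {B : ℕ} (hB : B ≤ L) :
    (∀ z, (∀ i j b, z ≠ wk W 1 i j (b + 1)) → crun (cmps W l L B) v z = v z) ∧
    (∀ i < l, ∀ j < l, ∀ b ≤ B, crun (cmps W l L B) v (wk W 1 i j b) =
      decide (s j % 2 ^ b < s i % 2 ^ b)) ∧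
    (∀ i j b, B < b → crun (cmps W l L B) v (wk W 1 i j b) = false) := by
  induction B with
  | zero =>
    have h0 : crun (cmps W l L 0) v = v := rfl
    refine ⟨fun _ _ => rfl, fun i _ j _ b hb => ?_, fun i j b _ => ?_⟩
    · obtain rfl : b = 0 := by omega
      rw [h0, hv _ (le_wk ..)]
      simp [Nat.mod_one]
    · rw [h0, hv _ (le_wk ..)]
  | succ B ih =>
    obtain ⟨ih1, ih2, ih3⟩ := ih (by omega)
    have hs : crun (cmps W l L (B + 1)) v = crun (cmpLayer W l L B) (crun (cmps W l L B) v) := by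
      rw [cmps, List.range_succ, List.flatMap_append, crun_append, List.flatMap_singleton]; rfl
    have hL := Layer.cmpLayer hW (show B < L by omega)
    have hout : ∀ z w, (∀ i j, z ≠ wk W 1 i j (B + 1)) → crun (cmpLayer W l L B) w z = w z := by
      intro z w h
      refine crun_of_not_target fun g hg e => ?_
      obtain ⟨i, j, h'⟩ := (hL g hg).1
      exact h i j (e.symm.trans h')
    rw [hs]
    refine ⟨fun z hz => ?_, fun i hi j hj b hb => ?_, fun i j b hb => ?_⟩
    · rw [hout _ _ fun i j => hz i j B, ih1 z hz]
    · rcases Nat.lt_or_ge B b with hb' | hb'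
      · obtain rfl : b = B + 1 := by omega
        rw [crun_layer hL, ih3 _ _ _ (by omega), Bool.false_xor, cmpLayer,
          xs_flatMap_single List.nodup_range (List.mem_range.2 hi),
          xs_flatMap_single List.nodup_range (List.mem_range.2 hj)]
        -- For `i = j` no instruction is issued, since both controls could be the same wire. The
        -- target stays zero, which is the correct value of `x_i < x_i`.
        · by_cases hij : i = j
          · subst hij; simp [xs_nil]
          · have hij' : (i == j) = false := by simpa using hij
            have h1 := ih1 (i * L + B) fun i' j' b' => (wk_ne ((idx_lt hi hB).trans_le hW)).symm
            have h2 := ih1 (j * L + B) fun i' j' b' => (wk_ne ((idx_lt hj hB).trans_le hW)).symm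
            rw [hx i hi B hB] at h1
            rw [hx j hj B hB] at h2
            simp only [hij', cond_false, xs_cons, xs_nil, Instr.term, h1, h2,
              ih2 i hi j hj B le_rfl, decide_true, Bool.true_and, Bool.xor_false, Bool.xor_true,
              maj_testBit (s j) (s i) B, Bool.xor_assoc]
        · intro j' _ hj'
          cases h : (i == j')
          · simp [xs_cons, xs_nil, hj']
          · simp [xs_nil]
        · intro i' _ hi'
          refine xs_flatMap_false fun j' _ => ?_
          cases h : (i' == j')
          · simp [xs_cons, xs_nil, hi']
          · simp [xs_nil]
      · rw [hout _ _ fun i' j' e => ?_, ih2 i hi j hj b hb']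
        simp only [wk_inj] at e
        omega
    · rw [hout _ _ fun i' j' e => ?_, ih3 i j b (by omega)]
      simp only [wk_inj] at e
      omega

/-- One step of the computation of the ranks in one-hot encoding. -/
def rankLayer (W l L j : ℕ) : List Instr :=
  (List.range l).flatMap fun i => (List.range l).flatMap fun r =>
    [⟨wk W 2 i (j + 1) (r + 1), wk W 2 i j (r + 1), false, wk W 1 i j L, true⟩,
      ⟨wk W 2 i (j + 1) (r + 1), wk W 2 i j r, false, wk W 1 i j L, false⟩]

/-- The wire `wk W 2 i J (r + 1)` receives the truth value of `#{j < J : x_j < x_i} = r`. -/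
def ranks (W l L J : ℕ) : List Instr :=
  ((List.range l).map fun i => notI W (wk W 2 i 0 1)) ++ (List.range J).flatMap (rankLayer W l L)

theorem Layer.rankLayer (W l L j : ℕ) :
    Layer (fun z => ∃ i r, z = wk W 2 i (j + 1) r) (rankLayer W l L j) := by
  intro g hg
  simp only [Guiding.rankLayer, List.mem_flatMap, List.mem_range, List.mem_cons, List.not_mem_nil,
    or_false] at hg
  obtain ⟨i, hi, r, hr, rfl | rfl⟩ := hg <;>
    exact ⟨⟨i, r + 1, rfl⟩, by simp, by simp⟩

/-- The number of indices below `J` with a smaller value than index `i`. -/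
def rankOf (s : ℕ → ℕ) (J i : ℕ) : ℕ := ((Finset.range J).filter fun j => s j < s i).card

theorem rankOf_succ (s : ℕ → ℕ) (J i : ℕ) :
    rankOf s (J + 1) i = rankOf s J i + if s J < s i then 1 else 0 := by
  rw [rankOf, Finset.range_add_one, Finset.filter_insert]
  split_ifs
  · rw [Finset.card_insert_of_notMem (by simp)]; rfl
  · rfl

/-- The rank `r` is stored at index `r + 1`. The wire with index 0 is never written and plays the
role of the rank `-1`, so that the shift by one needs no exception at `r = 0`. -/
theorem ranks_spec {W l L : ℕ} {v : ℕ → Bool} {s : ℕ → ℕ}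
    (hz : v (wk W 0 0 0 0) = false) (hz' : v (wk W 0 0 0 1) = false)
    (hv : ∀ i j r, v (wk W 2 i j r) = false)
    (hc : ∀ i < l, ∀ j < l, v (wk W 1 i j L) = decide (s j < s i)) {J : ℕ} (hJ : J ≤ l) :
    (∀ z, (∀ i j b, z ≠ wk W 2 i j b) → crun (ranks W l L J) v z = v z) ∧
    (∀ i j, crun (ranks W l L J) v (wk W 2 i j 0) = false) ∧
    (∀ i < l, ∀ r < l, ∀ j ≤ J, crun (ranks W l L J) v (wk W 2 i j (r + 1)) =
      decide (rankOf s j i = r)) ∧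
    (∀ i j b, J < j → crun (ranks W l L J) v (wk W 2 i j b) = false) := by
  induction J with
  | zero =>
    have h0 : ranks W l L 0 = (List.range l).flatMap fun i => [notI W (wk W 2 i 0 1)] := by
      rw [ranks, List.range_zero, List.flatMap_nil, List.append_nil, List.map_eq_flatMap]
    have hLay : Layer (fun z => ∃ i, z = wk W 2 i 0 1) (ranks W l L 0) := by
      intro g hg
      rw [h0] at hg
      simp only [List.mem_flatMap, List.mem_range, List.mem_cons, List.not_mem_nil, or_false] at hg
      obtain ⟨i, hi, rfl⟩ := hg
      exact ⟨⟨i, rfl⟩, by simp [notI], by simp [notI]⟩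
    have hout : ∀ z, (∀ i, z ≠ wk W 2 i 0 1) → crun (ranks W l L 0) v z = v z := by
      intro z h
      refine crun_of_not_target fun g hg e => ?_
      obtain ⟨i, h'⟩ := (hLay g hg).1
      exact h i (e.symm.trans h')
    refine ⟨fun z h => hout z fun i => h _ _ _, fun i j => ?_, fun i hi r hr j hj => ?_,
      fun i j b hj => ?_⟩
    · rw [hout _ (by simp), hv]
    · obtain rfl : j = 0 := by omega
      by_cases h : r = 0
      · subst h
        rw [crun_layer hLay, hv, h0, xs_flatMap_single List.nodup_range (List.mem_range.2 hi)]
        · simp [xs_cons, xs_nil, Instr.term, notI, hz, hz', rankOf]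
        · intro i' _ hi'
          simp [xs_cons, xs_nil, notI, hi']
      · rw [hout _ (by simp [h]), hv]
        simp [rankOf, Ne.symm h]
    · rw [hout _ (by simp; omega), hv]
  | succ J ih =>
    obtain ⟨ih1, ih2, ih3, ih4⟩ := ih (by omega)
    have hs : crun (ranks W l L (J + 1)) v = crun (rankLayer W l L J) (crun (ranks W l L J) v) := by
      rw [ranks, List.range_succ, List.flatMap_append, ← List.append_assoc, crun_append,
        List.flatMap_singleton]; rfl
    have hL := Layer.rankLayer W l L J
    have hout : ∀ z w, (∀ i r, z ≠ wk W 2 i (J + 1) (r + 1)) →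
        crun (rankLayer W l L J) w z = w z := by
      intro z w h
      refine crun_of_not_target fun g hg e => ?_
      simp only [Guiding.rankLayer, List.mem_flatMap, List.mem_range, List.mem_cons,
        List.not_mem_nil, or_false] at hg
      obtain ⟨i, hi, r, hr, rfl | rfl⟩ := hg <;> exact h i r e.symm
    rw [hs]
    refine ⟨fun z h => ?_, fun i j => ?_, fun i hi r hr j hj => ?_, fun i j b hj => ?_⟩
    · rw [hout _ _ fun i r => h _ _ _, ih1 z h]
    · rw [hout _ _ (by simp), ih2]
    · rcases Nat.lt_or_ge J j with hj' | hj'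
      · obtain rfl : j = J + 1 := by omega
        rw [crun_layer hL, ih4 _ _ _ (by omega), Bool.false_xor, rankLayer,
          xs_flatMap_single List.nodup_range (List.mem_range.2 hi),
          xs_flatMap_single List.nodup_range (List.mem_range.2 hr)]
        · have h1 := ih1 (wk W 1 i J L) (by simp)
          rw [hc i hi J (by omega)] at h1
          have h2 := ih3 i hi r hr J le_rfl
          have h3 : crun (ranks W l L J) v (wk W 2 i J r) = decide (rankOf s J i + 1 = r) := by
            cases r with
            | zero => rw [ih2]; simp
            | succ r => rw [ih3 i hi r (by omega) J le_rfl]; simp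
          simp only [xs_cons, xs_nil, Instr.term, h1, h2, h3, rankOf_succ]
          by_cases h : s J < s i <;> simp [h]
        · intro r' _ hr'
          simp [xs_cons, xs_nil, hr']
        · intro i' _ hi'
          exact xs_flatMap_false fun r' _ => by simp [xs_cons, xs_nil, hi']
      · rw [hout _ _ fun i' j' e => ?_, ih3 i hi r hr j hj']
        simp only [wk_inj] at e
        omega
    · rw [hout _ _ fun i' j' e => ?_, ih4 i j b (by omega)]
      simp only [wk_inj] at e
      omega

/-- The parities of the columns of the one-hot matrix. -/
def parity (W l : ℕ) : List Instr :=
  (List.range l).flatMap fun r => (List.range l).flatMap fun i =>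
    [addI W (wk W 3 r 0 0) (wk W 2 i l (r + 1)) false]

/-- The one-hot ranks, erased if two inputs agree. -/
def sel (W l : ℕ) : List Instr :=
  (List.range l).flatMap fun i => (List.range l).flatMap fun r =>
    [⟨wk W 5 i r 0, wk W 2 i l (r + 1), false, wk W 4 0 0 l, false⟩]

/-- The computation of the ranks. -/
def sortA (W l L : ℕ) : List Instr :=
  cmps W l L L ++ ranks W l L l ++ parity W l ++
    chain W (wk W 4 0 0) (fun r => (wk W 3 r 0 0, false)) l ++ sel W l

/-- If all values below `l` occurred as ranks, the rank map would be a bijection, but equal inputs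
have equal ranks. So a list with a repetition has an empty column in its one-hot matrix, while a
list of distinct numbers has exactly one entry in each column. The conjunction of the column
parities thus tests distinctness. -/
theorem exists_rankOf_ne {s : ℕ → ℕ} {l : ℕ} (h : ¬ Set.InjOn s (Finset.range l)) :
    ∃ r < l, ∀ i < l, rankOf s l i ≠ r := by
  by_contra! hcon
  refine h ?_
  have hmaps : ∀ i ∈ Finset.range l, rankOf s l i ∈ Finset.range l := by
    intro i hi
    rw [Finset.mem_range]
    refine (Finset.card_lt_card (t := Finset.range l) ?_).trans_eq (Finset.card_range l)
    refine ⟨Finset.filter_subset _ _, fun hsub => ?_⟩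
    have := hsub hi
    simp at this
  have hinj := Finset.injOn_of_surjOn_of_card_le (rankOf s l) hmaps
    (fun r hr => by
      obtain ⟨i, hi, h'⟩ := hcon r (by simpa using hr)
      exact ⟨i, by simpa using hi, h'⟩) le_rfl
  intro i hi j hj e
  refine hinj hi hj ?_
  simp only [rankOf, e]

theorem rankOf_lt {s : ℕ → ℕ} {l i j : ℕ} (hi : i < l) (h : s i < s j) :
    rankOf s l i < rankOf s l j := by
  refine Finset.card_lt_card ⟨fun a ha => ?_, fun hsub => ?_⟩
  · simp only [Finset.mem_filter, Finset.mem_range] at *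
    exact ⟨ha.1, ha.2.trans h⟩
  · have := hsub (Finset.mem_filter.2 ⟨Finset.mem_range.2 hi, h⟩)
    simp at this

theorem rankOf_lt_self {s : ℕ → ℕ} {l i : ℕ} (hi : i < l) : rankOf s l i < l := by
  refine (Finset.card_lt_card (t := Finset.range l) ?_).trans_eq (Finset.card_range l)
  refine ⟨Finset.filter_subset _ _, fun hsub => ?_⟩
  have := hsub (Finset.mem_range.2 hi)
  simp at this

theorem rankOf_injOn {s : ℕ → ℕ} {l : ℕ} (h : Set.InjOn s (Finset.range l)) {i j : ℕ} (hi : i < l)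
    (hj : j < l) (e : rankOf s l i = rankOf s l j) : i = j := by
  rcases lt_trichotomy (s i) (s j) with h' | h' | h'
  · exact absurd e (rankOf_lt hi h').ne
  · exact h (by simpa using hi) (by simpa using hj) h'
  · exact absurd e (rankOf_lt hj h').ne'

theorem exists_rankOf_eq {s : ℕ → ℕ} {l : ℕ} (h : Set.InjOn s (Finset.range l)) {r : ℕ}
    (hr : r < l) : ∃ i < l, rankOf s l i = r := by
  have := Finset.surj_on_of_inj_on_of_card_le (s := Finset.range l) (t := Finset.range l)
    (fun i _ => rankOf s l i) (fun i hi => by simpa using rankOf_lt_self (by simpa using hi))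
    (fun i j hi hj e => rankOf_injOn h (by simpa using hi) (by simpa using hj) e) le_rfl r
    (by simpa using hr)
  obtain ⟨i, hi, e⟩ := this
  exact ⟨i, by simpa using hi, e.symm⟩

open Classical in
-- The one-hot matrix with tag 5 is masked by the distinctness bit. For a colliding list everything
-- that is copied from it later is zero, which lets one circuit treat both cases.
theorem sortA_spec {W l L : ℕ} (hW : l * L ≤ W) {v : ℕ → Bool} {s : ℕ → ℕ}
    (hv : ∀ z, W ≤ z → v z = false) (hs : ∀ i < l, s i < 2 ^ L)
    (hx : ∀ i < l, ∀ b < L, v (i * L + b) = (s i).testBit b) :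
    (∀ z < W, crun (sortA W l L) v z = v z) ∧
    (∀ tag i j b, tag = 0 ∨ 6 ≤ tag → crun (sortA W l L) v (wk W tag i j b) = false) ∧
    crun (sortA W l L) v (wk W 4 0 0 l) = decide (Set.InjOn s (Finset.range l)) ∧
    (∀ i < l, ∀ r < l, crun (sortA W l L) v (wk W 5 i r 0) =
      (decide (rankOf s l i = r) && decide (Set.InjOn s (Finset.range l)))) := by
  obtain ⟨c1, c2, c3⟩ := cmps_spec hW hv hx (B := L) le_rfl
  set v1 := crun (cmps W l L L) v with hv1
  have f1 : ∀ t i j b, t ≠ 1 → v1 (wk W t i j b) = false := fun t i j b ht => by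
    rw [c1 _ fun _ _ _ e => ht (wk_inj.1 e).1, hv _ (le_wk ..)]
  obtain ⟨r1, r2, r3, r4⟩ := ranks_spec (W := W) (l := l) (L := L) (v := v1) (s := s)
    (f1 _ _ _ _ (by simp)) (f1 _ _ _ _ (by simp)) (fun i j r => f1 _ _ _ _ (by simp))
    (fun i hi j hj => by
      rw [c2 i hi j hj L le_rfl, Nat.mod_eq_of_lt (hs i hi), Nat.mod_eq_of_lt (hs j hj)]) le_rfl
  set v2 := crun (ranks W l L l) v1 with hv2
  have f2 : ∀ t i j b, t ≠ 1 → t ≠ 2 → v2 (wk W t i j b) = false := fun t i j b h1 h2 => by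
    rw [r1 _ fun _ _ _ e => h2 (wk_inj.1 e).1, f1 _ _ _ _ h1]
  have hpL : Layer (fun z => ∃ r, z = wk W 3 r 0 0) (parity W l) := by
    intro g hg
    simp only [parity, List.mem_flatMap, List.mem_range, List.mem_cons, List.not_mem_nil,
      or_false] at hg
    obtain ⟨r, hr, i, hi, rfl⟩ := hg
    exact ⟨⟨r, rfl⟩, by simp [addI], by simp [addI]⟩
  set v3 := crun (parity W l) v2 with hv3
  have p1 : ∀ z, (∀ r, z ≠ wk W 3 r 0 0) → v3 z = v2 z := by
    intro z h
    refine crun_of_not_target fun g hg e => ?_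
    obtain ⟨i, h'⟩ := (hpL g hg).1
    exact h i (e.symm.trans h')
  have p2 : ∀ r < l, v3 (wk W 3 r 0 0) = xs ((List.range l).flatMap fun i =>
      [addI W (wk W 3 r 0 0) (wk W 2 i l (r + 1)) false]) v2 (wk W 3 r 0 0) := by
    intro r hr
    rw [hv3, crun_layer hpL, f2 _ _ _ _ (by simp) (by simp), Bool.false_xor, parity,
      xs_flatMap_single List.nodup_range (List.mem_range.2 hr)]
    intro r' _ hr'
    exact xs_flatMap_false fun i _ => by simp [xs_cons, xs_nil, addI, hr']
  have hone : v2 (wk W 0 0 0 0) = false := f2 _ _ _ _ (by simp) (by simp)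
  have p3 : ∀ r < l, ∀ i < l, xs [addI W (wk W 3 r 0 0) (wk W 2 i l (r + 1)) false] v2
      (wk W 3 r 0 0) = decide (rankOf s l i = r) := by
    intro r hr i hi
    simp [xs_cons, xs_nil, addI, Instr.term, hone, r3 i hi r hr l le_rfl]
  have p4 : ((List.range l).all fun r => v3 (wk W 3 r 0 0) ^^ false) =
      decide (Set.InjOn s (Finset.range l)) := by
    rw [Bool.eq_iff_iff, List.all_eq_true, decide_eq_true_iff]
    constructor
    · intro h
      by_contra hcon
      obtain ⟨r, hr, hne⟩ := exists_rankOf_ne hcon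
      have := h r (List.mem_range.2 hr)
      rw [p2 r hr, xs_flatMap_false] at this
      · simp at this
      · intro i hi
        rw [p3 r hr i (List.mem_range.1 hi)]
        simp [hne i (List.mem_range.1 hi)]
    · intro h r hr
      rw [List.mem_range] at hr
      obtain ⟨i, hi, e⟩ := exists_rankOf_eq h hr
      rw [p2 r hr, xs_flatMap_single List.nodup_range (List.mem_range.2 hi), p3 r hr i hi]
      · simp [e]
      · intro j hj hji
        rw [List.mem_range] at hj
        rw [p3 r hr j hj]
        simp only [decide_eq_false_iff_not]
        exact fun e' => hji (rankOf_injOn h hj hi (e'.trans e.symm))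
  have f3 : ∀ t i j b, t ≠ 1 → t ≠ 2 → t ≠ 3 → v3 (wk W t i j b) = false :=
    fun t i j b h1 h2 h3 => by
      rw [p1 _ fun _ e => h3 (wk_inj.1 e).1, f2 _ _ _ _ h1 h2]
  have hch := crun_chain (W := W) (base := wk W 4 0 0) (f := fun r => (wk W 3 r 0 0, false))
    (m := l) (v := v3) (fun a b e => (wk_inj.1 e).2.2.2) (fun b => f3 _ _ _ _ (by simp) (by simp)
      (by simp)) (by simp) (f3 _ _ _ _ (by simp) (by simp) (by simp))
      (f3 _ _ _ _ (by simp) (by simp) (by simp))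
  set v4 := crun (chain W (wk W 4 0 0) (fun r => (wk W 3 r 0 0, false)) l) v3 with hv4
  have q1 : v4 (wk W 4 0 0 l) = decide (Set.InjOn s (Finset.range l)) := by
    rw [(hch _).2 l le_rfl rfl]; exact p4
  have q2 : ∀ z, (∀ b, z ≠ wk W 4 0 0 b) → v4 z = v3 z := fun z h => (hch z).1 fun b _ => h b
  have hsL : Layer (fun z => ∃ i r, z = wk W 5 i r 0) (sel W l) := by
    intro g hg
    simp only [sel, List.mem_flatMap, List.mem_range, List.mem_cons, List.not_mem_nil,
      or_false] at hg
    obtain ⟨r, hr, i, hi, rfl⟩ := hg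
    exact ⟨⟨r, i, rfl⟩, by simp, by simp⟩
  have hA : crun (sortA W l L) v = crun (sel W l) v4 := by
    rw [sortA, crun_append, crun_append, crun_append, crun_append]
  have s1 : ∀ z, (∀ i r, z ≠ wk W 5 i r 0) → crun (sortA W l L) v z = v4 z := by
    intro z h
    rw [hA]
    refine crun_of_not_target fun g hg e => ?_
    obtain ⟨i, r, h'⟩ := (hsL g hg).1
    exact h i r (e.symm.trans h')
  refine ⟨fun z hz => ?_, fun tag i j b ht => ?_, ?_, fun i hi r hr => ?_⟩
  · rw [s1 _ fun _ _ => (wk_ne hz).symm, q2 _ fun _ => (wk_ne hz).symm, p1 _ fun _ => (wk_ne hz).symm,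
      r1 _ fun _ _ _ => (wk_ne hz).symm, c1 _ fun _ _ _ => (wk_ne hz).symm]
  · rw [s1 _ fun _ _ e => by have := (wk_inj.1 e).1; omega,
      q2 _ fun _ e => by have := (wk_inj.1 e).1; omega]
    exact f3 _ _ _ _ (by omega) (by omega) (by omega)
  · rw [s1 _ (by simp), q1]
  · rw [hA, crun_layer hsL, sel, xs_flatMap_single List.nodup_range (List.mem_range.2 hi),
      xs_flatMap_single List.nodup_range (List.mem_range.2 hr), q2 _ (by simp),
      f3 _ _ _ _ (by simp) (by simp) (by simp), Bool.false_xor]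
    · have h1 : v4 (wk W 2 i l (r + 1)) = decide (rankOf s l i = r) := by
        rw [q2 _ (by simp), p1 _ (by simp), r3 i hi r hr l le_rfl]
      simp [xs_cons, xs_nil, Instr.term, h1, q1]
    · intro r' _ hr'
      simp [xs_cons, xs_nil, hr']
    · intro i' _ hi'
      exact xs_flatMap_false fun r' _ => by simp [xs_cons, xs_nil, hi']

theorem idx_div {i b L : ℕ} (hb : b < L) : (i * L + b) / L = i := by
  rw [add_comm, Nat.add_mul_div_right _ _ (by omega), Nat.div_eq_of_lt hb, zero_add]

theorem idx_mod {i b L : ℕ} (hb : b < L) : (i * L + b) % L = b := by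
  rw [add_comm, Nat.add_mul_mod_self_right, Nat.mod_eq_of_lt hb]

theorem idx_inj {i b i' b' L : ℕ} (hb : b < L) (hb' : b' < L) (h : i * L + b = i' * L + b') :
    i = i' ∧ b = b' :=
  ⟨by rw [← idx_div (i := i) hb, h, idx_div hb'], by rw [← idx_mod (i := i) hb, h, idx_mod hb']⟩

theorem exists_idx {z l L : ℕ} (h : z < l * L) : ∃ i < l, ∃ b < L, z = i * L + b := by
  have hL : 0 < L := Nat.pos_of_ne_zero fun e => by simp [e] at h
  exact ⟨z / L, Nat.div_lt_of_lt_mul (by rwa [mul_comm]), z % L, Nat.mod_lt _ hL, by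
    rw [mul_comm, Nat.div_add_mod]⟩

/-- The sorted list is written to work wires. -/
def outC (W l L : ℕ) : List Instr :=
  (List.range l).flatMap fun r => (List.range L).flatMap fun b => (List.range l).flatMap fun i =>
    [⟨wk W 6 (r * L + b) 0 0, wk W 5 i r 0, false, i * L + b, false⟩]

/-- The ranks are written to the ancilla register. -/
def rankC (W l L M : ℕ) : List Instr :=
  (List.range l).flatMap fun i => (List.range M).flatMap fun b => (List.range l).flatMap fun r =>
    bif r.testBit b then [addI W (l * L + (i * M + b)) (wk W 5 i r 0) false] else []

/-- The results of the computation of the ranks are copied. -/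
def sortC (W l L M : ℕ) : List Instr :=
  outC W l L ++ (rankC W l L M ++ [addI W (l * L + l * M) (wk W 4 0 0 l) true])

/-- The ranks in the ancilla register are decoded. -/
def dec (W l L M : ℕ) : List Instr :=
  (List.range l).flatMap fun i => (List.range l).flatMap fun r =>
    chain W (wk W 7 i r) (fun b => (l * L + (i * M + b), !r.testBit b)) M

/-- The input is erased. -/
def decC (W l L M : ℕ) : List Instr :=
  (List.range l).flatMap fun i => (List.range L).flatMap fun b => (List.range l).flatMap fun r =>
    [⟨i * L + b, wk W 7 i r M, false, wk W 6 (r * L + b) 0 0, false⟩]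

/-- The sorted list is added to the main register. -/
def mvA (W l L : ℕ) : List Instr :=
  (List.range (l * L)).flatMap fun s => [addI W s (wk W 6 s 0 0) false]

/-- The copy of the sorted list is erased. -/
def mvB (W l L M : ℕ) : List Instr :=
  (List.range (l * L)).flatMap fun s => [⟨wk W 6 s 0 0, s, false, l * L + l * M, true⟩]

/-- The sorting circuit. -/
def sortCirc (W l L M : ℕ) : List Instr :=
  (sortA W l L ++ sortC W l L M ++ (sortA W l L).reverse) ++
    ((dec W l L M ++ decC W l L M ++ (dec W l L M).reverse) ++ (mvA W l L ++ mvB W l L M))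

theorem notI_wf {W Q N t : ℕ} (hN : W + Q ^ 4 ≤ N) (hQ : 1 < Q) (ht : t < N)
    (h : ∀ b, t ≠ wk W 0 0 0 b) : (notI W t).WF N := by
  constructor
  · exact ht
  · exact (wk_lt (by omega) (by omega) (by omega) (by omega)).trans_le hN
  · exact (wk_lt (by omega) (by omega) (by omega) hQ).trans_le hN
  · exact h 0
  · exact h 1
  · simp [notI]

theorem addI_wf {W Q N t a : ℕ} {pa : Bool} (hN : W + Q ^ 4 ≤ N) (hQ : 1 < Q) (ht : t < N)
    (ha : a < N) (hta : t ≠ a) (h : t ≠ wk W 0 0 0 0) (h' : a ≠ wk W 0 0 0 0) :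
    (addI W t a pa).WF N :=
  ⟨ht, ha, (wk_lt (by omega) (by omega) (by omega) (by omega)).trans_le hN, hta, h, h'⟩

theorem chain_wf {W Q N m : ℕ} {base : ℕ → ℕ} {f : ℕ → ℕ × Bool} (hN : W + Q ^ 4 ≤ N)
    (hQ : 1 < Q) (hb : Function.Injective base) (hbN : ∀ s ≤ m, base s < N)
    (hb0 : ∀ s b, base s ≠ wk W 0 0 0 b) (hf : ∀ s < m, (f s).1 < N)
    (hfb : ∀ s < m, ∀ s', (f s).1 ≠ base s') : ∀ g ∈ chain W base f m, g.WF N := by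
  intro g hg
  simp only [chain, List.mem_cons, List.mem_map, List.mem_range] at hg
  rcases hg with rfl | ⟨s, hs, rfl⟩
  · exact notI_wf hN hQ (hbN _ (by omega)) (hb0 0)
  · exact ⟨hbN _ (by omega), hbN s (by omega), hf s hs, fun e => by have := hb e; omega,
      (hfb s hs _).symm, (hfb s hs _).symm⟩

theorem sortA_wf {W Q N l L : ℕ} (hN : W + Q ^ 4 ≤ N) (hW : l * L ≤ W) (hQ : 8 < Q)
    (hl : l + 2 < Q) (hL : L + 2 < Q) : ∀ g ∈ sortA W l L, g.WF N := by
  have hw : ∀ {t i j b : ℕ}, t < Q → i < Q → j < Q → b < Q → wk W t i j b < N :=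
    fun h1 h2 h3 h4 => (wk_lt h1 h2 h3 h4).trans_le hN
  intro g hg
  simp only [sortA, List.mem_append, or_assoc] at hg
  rcases hg with hg | hg | hg | hg | hg
  · simp only [cmps, cmpLayer, List.mem_flatMap, List.mem_range] at hg
    obtain ⟨b, hb, i, hi, j, hj, hg⟩ := hg
    have h1 := (idx_lt hi hb).trans_le hW
    have h2 := (idx_lt hj hb).trans_le hW
    have h1' : i * L + b < N := by omega
    have h2' : j * L + b < N := by omega
    cases h : (i == j)
    · have hij : i ≠ j := by simpa using h
      have h3 : j * L + b ≠ i * L + b := fun e => hij (idx_inj hb hb e).1.symm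
      simp only [h, cond_false, List.mem_cons, List.not_mem_nil, or_false] at hg
      rcases hg with rfl | rfl | rfl
      · exact ⟨hw (by omega) (by omega) (by omega) (by omega), h2', h1', wk_ne h2,
          wk_ne h1, h3⟩
      · exact ⟨hw (by omega) (by omega) (by omega) (by omega), h2',
          hw (by omega) (by omega) (by omega) (by omega), wk_ne h2, by simp, (wk_ne h2).symm⟩
      · exact ⟨hw (by omega) (by omega) (by omega) (by omega), h1',
          hw (by omega) (by omega) (by omega) (by omega), wk_ne h1, by simp, (wk_ne h1).symm⟩
    · simp [h] at hg
  · simp only [ranks, rankLayer, List.mem_append, List.mem_map, List.mem_flatMap, List.mem_range,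
      List.mem_cons, List.not_mem_nil, or_false] at hg
    rcases hg with ⟨i, hi, rfl⟩ | ⟨j, hj, i, hi, r, hr, rfl | rfl⟩
    · exact notI_wf hN (by omega) (hw (by omega) (by omega) (by omega) (by omega)) (by simp)
    · exact ⟨hw (by omega) (by omega) (by omega) (by omega),
        hw (by omega) (by omega) (by omega) (by omega),
        hw (by omega) (by omega) (by omega) (by omega), by simp, by simp, by simp⟩
    · exact ⟨hw (by omega) (by omega) (by omega) (by omega),
        hw (by omega) (by omega) (by omega) (by omega),
        hw (by omega) (by omega) (by omega) (by omega), by simp, by simp, by simp⟩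
  · simp only [parity, List.mem_flatMap, List.mem_range, List.mem_cons, List.not_mem_nil,
      or_false] at hg
    obtain ⟨r, hr, i, hi, rfl⟩ := hg
    exact addI_wf hN (by omega) (hw (by omega) (by omega) (by omega) (by omega))
      (hw (by omega) (by omega) (by omega) (by omega)) (by simp) (by simp) (by simp)
  · exact chain_wf hN (by omega) (fun a b e => (wk_inj.1 e).2.2.2)
      (fun s hs => hw (by omega) (by omega) (by omega) (by omega)) (by simp)
      (fun s hs => hw (by omega) (by omega) (by omega) (by omega)) (by simp) g hg
  · simp only [sel, List.mem_flatMap, List.mem_range, List.mem_cons, List.not_mem_nil,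
      or_false] at hg
    obtain ⟨i, hi, r, hr, rfl⟩ := hg
    exact ⟨hw (by omega) (by omega) (by omega) (by omega),
      hw (by omega) (by omega) (by omega) (by omega),
      hw (by omega) (by omega) (by omega) (by omega), by simp, by simp, by simp⟩

theorem sortC_layer {W l L M : ℕ} (hW : l * L + (l * M + 3) ≤ W) :
    Layer (fun z => (∃ s, z = wk W 6 s 0 0) ∨ (l * L ≤ z ∧ z < W)) (sortC W l L M) := by
  have hno : ∀ {t i j b}, t ≠ 6 → ¬ ((∃ s, wk W t i j b = wk W 6 s 0 0) ∨
      (l * L ≤ wk W t i j b ∧ wk W t i j b < W)) := by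
    rintro t i j b ht (⟨s, e⟩ | ⟨_, h⟩)
    · exact ht (wk_inj.1 e).1
    · exact absurd h (le_wk ..).not_gt
  intro g hg
  simp only [sortC, outC, rankC, List.mem_append, List.mem_flatMap, List.mem_range, List.mem_cons,
    List.not_mem_nil, or_false] at hg
  rcases hg with ⟨r, hr, b, hb, i, hi, rfl⟩ | ⟨i, hi, b, hb, r, hr, hg⟩ | rfl
  · refine ⟨.inl ⟨_, rfl⟩, hno (by simp), ?_⟩
    have h1 := idx_lt hi hb
    rintro (⟨s, e⟩ | ⟨h, _⟩)
    · exact wk_ne (show i * L + b < W by omega) e.symm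
    · exact absurd h (by simpa using h1)
  · cases h : r.testBit b
    · simp [h] at hg
    · simp only [h, cond_true, List.mem_cons, List.not_mem_nil, or_false] at hg
      subst hg
      have h1 := idx_lt hi hb
      exact ⟨.inr ⟨by simp only [addI]; omega, by simp only [addI]; omega⟩, hno (by simp),
        hno (by simp)⟩
  · exact ⟨.inr ⟨by simp only [addI]; omega, by simp only [addI]; omega⟩, hno (by simp),
      hno (by simp)⟩

theorem sortA_avoids {W l L M : ℕ} (hW : l * L + (l * M + 3) ≤ W) :
    Avoids (fun z => (∃ s, z = wk W 6 s 0 0) ∨ (l * L ≤ z ∧ z < W)) (sortA W l L) := by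
  have hno : ∀ {t i j b}, t ≠ 6 → ¬ ((∃ s, wk W t i j b = wk W 6 s 0 0) ∨
      (l * L ≤ wk W t i j b ∧ wk W t i j b < W)) := by
    rintro t i j b ht (⟨s, e⟩ | ⟨_, h⟩)
    · exact ht (wk_inj.1 e).1
    · exact absurd h (le_wk ..).not_gt
  have hno' : ∀ {z}, z < l * L → ¬ ((∃ s, z = wk W 6 s 0 0) ∨ (l * L ≤ z ∧ z < W)) := by
    rintro z hz (⟨s, e⟩ | ⟨h, _⟩)
    · exact wk_ne (show z < W by omega) e.symm
    · omega
  intro g hg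
  simp only [sortA, List.mem_append, or_assoc] at hg
  rcases hg with hg | hg | hg | hg | hg
  · simp only [cmps, cmpLayer, List.mem_flatMap, List.mem_range] at hg
    obtain ⟨b, hb, i, hi, j, hj, hg⟩ := hg
    have h1 := idx_lt hi hb
    have h2 := idx_lt hj hb
    cases h : (i == j)
    · simp only [h, cond_false, List.mem_cons, List.not_mem_nil, or_false] at hg
      rcases hg with rfl | rfl | rfl
      · exact ⟨hno (by simp), hno' h2, hno' h1⟩
      · exact ⟨hno (by simp), hno' h2, hno (by simp)⟩
      · exact ⟨hno (by simp), hno' h1, hno (by simp)⟩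
    · simp [h] at hg
  · simp only [ranks, rankLayer, List.mem_append, List.mem_map, List.mem_flatMap, List.mem_range,
      List.mem_cons, List.not_mem_nil, or_false] at hg
    rcases hg with ⟨i, hi, rfl⟩ | ⟨j, hj, i, hi, r, hr, rfl | rfl⟩ <;>
      exact ⟨hno (by simp), hno (by simp), hno (by simp)⟩
  · simp only [parity, List.mem_flatMap, List.mem_range, List.mem_cons, List.not_mem_nil,
      or_false] at hg
    obtain ⟨r, hr, i, hi, rfl⟩ := hg
    exact ⟨hno (by simp), hno (by simp), hno (by simp)⟩
  · simp only [chain, List.mem_cons, List.mem_map, List.mem_range] at hg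
    rcases hg with rfl | ⟨s, hs, rfl⟩ <;> exact ⟨hno (by simp), hno (by simp), hno (by simp)⟩
  · simp only [sel, List.mem_flatMap, List.mem_range, List.mem_cons, List.not_mem_nil,
      or_false] at hg
    obtain ⟨i, hi, r, hr, rfl⟩ := hg
    exact ⟨hno (by simp), hno (by simp), hno (by simp)⟩

open Classical in
/-- The effect of computing, copying and uncomputing the ranks. -/
theorem crun_sort_one {W Q l L M : ℕ} (hW : l * L + (l * M + 3) ≤ W) (hQ : 8 < Q)
    (hl : l + 2 < Q) (hL : L + 2 < Q) {v : ℕ → Bool} {s y : ℕ → ℕ}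
    (hv : ∀ z, l * L ≤ z → v z = false) (hs : ∀ i < l, s i < 2 ^ L)
    (hx : ∀ i < l, ∀ b < L, v (i * L + b) = (s i).testBit b)
    (hy : Set.InjOn s (Finset.range l) → ∀ i < l, y (rankOf s l i) = s i)
    {v' : ℕ → Bool} (hv' : v' = crun (sortA W l L ++ sortC W l L M ++ (sortA W l L).reverse) v) :
    (∀ z < l * L, v' z = v z) ∧
    (∀ i < l, ∀ b < M, v' (l * L + (i * M + b)) =
      (decide (Set.InjOn s (Finset.range l)) && (rankOf s l i).testBit b)) ∧
    v' (l * L + l * M) = !decide (Set.InjOn s (Finset.range l)) ∧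
    (∀ r < l, ∀ b < L, v' (wk W 6 (r * L + b) 0 0) =
      (decide (Set.InjOn s (Finset.range l)) && (y r).testBit b)) ∧
    (∀ z, l * L + l * M < z → (∀ c < l * L, z ≠ wk W 6 c 0 0) → v' z = false) := by
  obtain ⟨a1, a2, a3, a4⟩ := sortA_spec (W := W) (by omega) (fun z hz => hv z (by omega)) hs hx
  have key : ∀ z, v' z = (v z ^^ xs (sortC W l L M) (crun (sortA W l L) v) z) := by
    intro z
    rw [hv']
    exact crun_conj (N := W + Q ^ 4) (sortA_wf le_rfl (by omega) hQ hl hL) (sortA_avoids hW)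
      (sortC_layer hW) v z
  set w := crun (sortA W l L) v with hw
  have hone : w (wk W 0 0 0 0) = false := a2 _ _ _ _ (by simp)
  have xout : ∀ z, (∀ c < l * L, z ≠ wk W 6 c 0 0) → xs (outC W l L) w z = false := by
    intro z h
    refine xs_eq_false fun g hg e => ?_
    simp only [outC, List.mem_flatMap, List.mem_range, List.mem_cons, List.not_mem_nil,
      or_false] at hg
    obtain ⟨r, hr, b, hb, i, hi, rfl⟩ := hg
    exact h _ (idx_lt hr hb) e.symm
  have xrank : ∀ z, (∀ i < l, ∀ b < M, z ≠ l * L + (i * M + b)) → xs (rankC W l L M) w z = false := by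
    intro z h
    refine xs_eq_false fun g hg e => ?_
    simp only [rankC, List.mem_flatMap, List.mem_range] at hg
    obtain ⟨i, hi, b, hb, r, hr, hg⟩ := hg
    cases h' : r.testBit b
    · simp [h'] at hg
    · simp only [h', cond_true, List.mem_cons, List.not_mem_nil, or_false] at hg
      subst hg
      exact h _ hi _ hb e.symm
  have hlow : ∀ {z}, z < W → ∀ c < l * L, z ≠ wk W 6 c 0 0 := fun hz c _ => (wk_ne hz).symm
  simp only [sortC, xs_append] at key
  refine ⟨fun z hz => ?_, fun i hi b hb => ?_, ?_, fun r hr b hb => ?_, fun z hz h => ?_⟩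
  · rw [key, xout _ (hlow (by omega)), xrank _ (fun _ _ _ _ => by omega),
      xs_eq_false (by simp [addI]; omega)]
    simp
  · have h1 := idx_lt hi hb
    rw [key, hv _ (by omega), xout _ (hlow (by omega)), xs_eq_false (C := [_]) (by simp [addI]; omega),
      rankC, xs_flatMap_single List.nodup_range (List.mem_range.2 hi),
      xs_flatMap_single List.nodup_range (List.mem_range.2 hb),
      xs_flatMap_single List.nodup_range (List.mem_range.2 (rankOf_lt_self hi))]
    · cases h : (rankOf s l i).testBit b
      · simp [xs_nil]
      · simp [xs_cons, xs_nil, addI, Instr.term, hone, a4 i hi _ (rankOf_lt_self hi)]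
    · intro r hr hne
      rw [List.mem_range] at hr
      cases h : r.testBit b
      · simp [xs_nil]
      · simp [xs_cons, xs_nil, addI, Instr.term, hone, a4 i hi r hr, Ne.symm hne]
    · intro b' hb' hne
      refine xs_flatMap_false fun r _ => ?_
      cases h : r.testBit b'
      · simp [xs_nil]
      · simp [xs_cons, xs_nil, addI, hne]
    · intro i' hi' hne
      refine xs_flatMap_false fun b' hb' => xs_flatMap_false fun r _ => ?_
      rw [List.mem_range] at hb'
      cases h : r.testBit b'
      · simp [xs_nil]
      · have : i' * M + b' ≠ i * M + b := fun e => hne (idx_inj hb' hb e).1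
        simp [xs_cons, xs_nil, addI, this]
  · rw [key, hv _ (by omega), xout _ (hlow (by omega)), xrank _ fun i hi b hb => by
      have := idx_lt hi hb; omega]
    simp [xs_cons, xs_nil, addI, Instr.term, hone, a3]
  · rw [key, hv _ (by have := le_wk W 6 (r * L + b) 0 0; omega),
      xrank _ (fun i hi b hb => wk_ne (by have := idx_lt hi hb; omega)),
      xs_eq_false (C := [_]) (by simp only [addI, List.mem_singleton, forall_eq]; exact (wk_ne (by omega)).symm), outC,
      xs_flatMap_single List.nodup_range (List.mem_range.2 hr),
      xs_flatMap_single List.nodup_range (List.mem_range.2 hb)]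
    · by_cases hinj : Set.InjOn s (Finset.range l)
      · obtain ⟨i, hi, hir⟩ := exists_rankOf_eq hinj hr
        rw [xs_flatMap_single List.nodup_range (List.mem_range.2 hi)]
        · have h1 : w (i * L + b) = (s i).testBit b := by
            rw [a1 _ (by have := idx_lt hi hb; omega), hx i hi b hb]
          have h2 := hy hinj i hi
          rw [hir] at h2
          simp [xs_cons, xs_nil, Instr.term, h1, a4 i hi r hr, hir, h2]
        · intro j hj hne
          rw [List.mem_range] at hj
          have : rankOf s l j ≠ r := fun e => hne (rankOf_injOn hinj hj hi (e.trans hir.symm))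
          simp [xs_cons, xs_nil, Instr.term, a4 j hj r hr, this]
      · rw [xs_flatMap_false]
        · rw [decide_eq_false hinj, Bool.false_and]; rfl
        · intro i hi
          simp only [xs_cons, xs_nil, Instr.term, a4 i (List.mem_range.1 hi) r hr,
            decide_eq_false hinj]
          simp
    · intro b' hb' hne
      exact xs_flatMap_false fun i _ => by simp [xs_cons, xs_nil, hne]
    · intro r' hr' hne
      refine xs_flatMap_false fun b' hb' => xs_flatMap_false fun i _ => ?_
      rw [List.mem_range] at hb'
      have : r' * L + b' ≠ r * L + b := fun e => hne (idx_inj hb' hb e).1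
      simp [xs_cons, xs_nil, this]
  · rw [key, hv _ (by omega), xout _ h, xrank _ (fun i hi b hb => by have := idx_lt hi hb; omega),
      xs_eq_false (by simp [addI]; omega)]
    rfl

/-- The other members write only to wires in `P`, which `F i` neither reads nor writes, so off `P`
only `F i` is visible. This is needed for chains, which use their own targets as controls and so are
not layers. -/
theorem crun_flatMap_local {α : Type} {l : List α} (hl : l.Nodup) {F : α → List Instr} {i : α}
    (hi : i ∈ l) (P : ℕ → Prop) (h : Avoids P (F i))
    (h' : ∀ j ∈ l, j ≠ i → ∀ g ∈ F j, P g.t) (v : ℕ → Bool) {z : ℕ} (hz : ¬ P z) :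
    crun (l.flatMap F) v z = crun (F i) v z := by
  induction l generalizing v with
  | nil => simp at hi
  | cons j l ih =>
    rw [List.nodup_cons] at hl
    rw [List.flatMap_cons, crun_append]
    by_cases hj : j = i
    · subst hj
      refine crun_of_not_target fun g hg e => ?_
      obtain ⟨m, hm, hg⟩ := List.mem_flatMap.1 hg
      exact hz (e ▸ h' m (by simp [hm]) (fun e => hl.1 (e ▸ hm)) g hg)
    · rw [ih hl.2 (by simpa [Ne.symm hj] using hi) fun m hm => h' m (by simp [hm])]
      refine h.crun_congr (fun y hy => ?_) z hz
      exact crun_of_not_target fun g hg e => hy (e ▸ h' j (by simp) hj g hg)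

theorem dec_wf {W Q N l L M : ℕ} (hN : W + Q ^ 4 ≤ N) (hW : l * L + (l * M + 3) ≤ W) (hQ : 8 < Q)
    (hl : l + 2 < Q) (hM : M + 2 < Q) : ∀ g ∈ dec W l L M, g.WF N := by
  intro g hg
  simp only [dec, List.mem_flatMap, List.mem_range] at hg
  obtain ⟨i, hi, r, hr, hg⟩ := hg
  refine chain_wf hN (by omega) (fun a b e => (wk_inj.1 e).2.2.2)
    (fun s hs => (wk_lt (by omega) (by omega) (by omega) (by omega)).trans_le hN) (by simp)
    (fun b hb => ?_) (fun b hb s' => ?_) g hg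
  · have := idx_lt hi hb
    change l * L + (i * M + b) < N
    omega
  · exact (wk_ne (by have := idx_lt hi hb; change l * L + (i * M + b) < W; omega)).symm

/-- For each `i` and `r` a chain of literals compares the `i`-th entry of the rank register with the
constant `r`. Since ranks are below `l ≤ 2 ^ M`, agreement in `M` bits is equality. -/
theorem dec_spec {W l L M : ℕ} (hW : l * L + (l * M + 3) ≤ W) {v : ℕ → Bool} {ρ : ℕ → ℕ}
    (hz : ∀ t i j b, t ≠ 6 → v (wk W t i j b) = false) (hl : l ≤ 2 ^ M) (hρ : ∀ i < l, ρ i < l)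
    (hv : ∀ i < l, ∀ b < M, v (l * L + (i * M + b)) = (ρ i).testBit b) :
    (∀ z, (∀ i r b, z ≠ wk W 7 i r b) → crun (dec W l L M) v z = v z) ∧
    (∀ i < l, ∀ r < l, crun (dec W l L M) v (wk W 7 i r M) = decide (ρ i = r)) := by
  have htgt : ∀ i r, ∀ g ∈ chain W (wk W 7 i r) (fun b => (l * L + (i * M + b), !r.testBit b)) M,
      ∃ b, g.t = wk W 7 i r b := by
    intro i r g hg
    simp only [chain, List.mem_cons, List.mem_map, List.mem_range] at hg
    rcases hg with rfl | ⟨s, hs, rfl⟩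
    · exact ⟨0, rfl⟩
    · exact ⟨s + 1, rfl⟩
  refine ⟨fun z h => ?_, fun i hi r hr => ?_⟩
  · refine crun_of_not_target fun g hg e => ?_
    simp only [dec, List.mem_flatMap, List.mem_range] at hg
    obtain ⟨i, hi, r, hr, hg⟩ := hg
    obtain ⟨b, hb⟩ := htgt i r g hg
    exact h i r b (e.symm.trans hb)
  · have hav : ∀ r' < l, Avoids (fun z => ∃ i' r' b', z = wk W 7 i' r' b' ∧ ¬ (i' = i ∧ r' = r))
        (chain W (wk W 7 i r) (fun b => (l * L + (i * M + b), !r.testBit b)) M) := by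
      intro r' hr' g hg
      simp only [chain, List.mem_cons, List.mem_map, List.mem_range] at hg
      rcases hg with rfl | ⟨b, hb, rfl⟩
      · refine ⟨?_, ?_, ?_⟩ <;> rintro ⟨i', r', b', e, h⟩ <;> simp [notI] at e
        exact h ⟨e.1.symm, e.2.1.symm⟩
      · refine ⟨?_, ?_, ?_⟩ <;> rintro ⟨i', r', b', e, h⟩
        · simp only [wk_inj] at e; exact h ⟨e.2.1.symm, e.2.2.1.symm⟩
        · simp only [wk_inj] at e; exact h ⟨e.2.1.symm, e.2.2.1.symm⟩
        · have := idx_lt hi hb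
          exact wk_ne (show l * L + (i * M + b) < W by omega) e.symm
    have hch := crun_chain (W := W) (base := wk W 7 i r)
      (f := fun b => (l * L + (i * M + b), !r.testBit b)) (m := M) (v := v)
      (fun a b e => (wk_inj.1 e).2.2.2) (fun b => hz _ _ _ _ (by simp))
      (fun b hb s' => (wk_ne (by have := idx_lt hi hb; change l * L + (i * M + b) < W; omega)).symm)
      (hz _ _ _ _ (by simp)) (hz _ _ _ _ (by simp)) (wk W 7 i r M)
    have hloc : crun (dec W l L M) v (wk W 7 i r M) =
        crun (chain W (wk W 7 i r) (fun b => (l * L + (i * M + b), !r.testBit b)) M) v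
          (wk W 7 i r M) := by
      have hav' : Avoids (fun z => ∃ i' r' b', z = wk W 7 i' r' b' ∧ ¬ (i' = i ∧ r' = r))
        (chain W (wk W 7 i r) (fun b => (l * L + (i * M + b), !r.testBit b)) M) := hav r hr
      let D : ℕ × ℕ → List Instr := fun p =>
        chain W (wk W 7 p.1 p.2) (fun b => (l * L + (p.1 * M + b), !p.2.testBit b)) M
      have hD : dec W l L M = ((List.range l).product (List.range l)).flatMap D := by
        rw [dec, List.product, List.flatMap_assoc]
        simp only [List.flatMap_map, D]
      rw [hD]
      refine crun_flatMap_local (List.nodup_range.product List.nodup_range) (i := (i, r))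
        (by simp [hi, hr]) _ hav' ?_ v ?_
      · rintro ⟨i', r'⟩ _ hne g hg
        obtain ⟨b, hb⟩ := htgt i' r' g hg
        exact ⟨i', r', b, hb, fun e => hne (by rw [e.1, e.2])⟩
      · rintro ⟨i', r', b', e, h⟩
        simp only [wk_inj] at e
        exact h ⟨e.2.1.symm, e.2.2.1.symm⟩
    rw [hloc, hch.2 M le_rfl rfl, Bool.eq_iff_iff, List.all_eq_true, decide_eq_true_iff]
    constructor
    · intro h
      refine Nat.eq_of_testBit_eq fun b => ?_
      by_cases hb : b < M
      · have := h b (List.mem_range.2 hb)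
        rw [hv i hi b hb] at this
        simpa using this
      · have hp : 2 ^ M ≤ 2 ^ b := Nat.pow_le_pow_right (by simp) (by omega)
        have := hρ i hi
        rw [Nat.testBit_lt_two_pow (by omega), Nat.testBit_lt_two_pow (by omega)]
    · intro h b hb
      rw [List.mem_range] at hb
      rw [hv i hi b hb, h]
      simp

theorem decC_layer {W l L M : ℕ} (hW : l * L + (l * M + 3) ≤ W) :
    Layer (fun z => z < l * L) (decC W l L M) := by
  intro g hg
  simp only [decC, List.mem_flatMap, List.mem_range, List.mem_cons, List.not_mem_nil,
    or_false] at hg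
  obtain ⟨i, hi, b, hb, r, hr, rfl⟩ := hg
  have h1 := le_wk W 7 i r M
  have h2 := le_wk W 6 (r * L + b) 0 0
  exact ⟨idx_lt hi hb, by dsimp only; omega, by dsimp only; omega⟩

theorem dec_avoids {W l L M : ℕ} (hW : l * L + (l * M + 3) ≤ W) :
    Avoids (fun z => z < l * L) (dec W l L M) := by
  have hno : ∀ {t i j b}, ¬ (wk W t i j b < l * L) := fun {t i j b} h => by
    have := le_wk W t i j b; omega
  intro g hg
  simp only [dec, chain, List.mem_flatMap, List.mem_cons, List.mem_map, List.mem_range] at hg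
  obtain ⟨i, hi, r, hr, rfl | ⟨b, hb, rfl⟩⟩ := hg
  · exact ⟨hno, hno, hno⟩
  · exact ⟨hno, hno, by dsimp only; omega⟩

open Classical in
/-- The sorting circuit replaces a list of distinct numbers by the sorted list and the ranks, and
flags other lists. -/
theorem crun_sortCirc {W Q l L M : ℕ} (hW : l * L + (l * M + 3) ≤ W) (hQ : 8 < Q)
    (hl : l + 2 < Q) (hL : L + 2 < Q) (hM : M + 2 < Q) (hlM : l ≤ 2 ^ M) {v : ℕ → Bool}
    {s y : ℕ → ℕ} (hv : ∀ z, l * L ≤ z → v z = false) (hs : ∀ i < l, s i < 2 ^ L)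
    (hx : ∀ i < l, ∀ b < L, v (i * L + b) = (s i).testBit b)
    (hy : Set.InjOn s (Finset.range l) → ∀ i < l, y (rankOf s l i) = s i) :
    crun (sortCirc W l L M) v = if Set.InjOn s (Finset.range l) then
      fun z => if z < l * L then (y (z / L)).testBit (z % L) else
        if z < l * L + l * M then (rankOf s l ((z - l * L) / M)).testBit ((z - l * L) % M) else false
      else Function.update v (l * L + l * M) true := by
  obtain ⟨e1, e2, e3, e4, e5⟩ := crun_sort_one hW hQ hl hL hv hs hx hy rfl
  rw [sortCirc, crun_append, crun_append]
  set v1 := crun (sortA W l L ++ sortC W l L M ++ (sortA W l L).reverse) v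
  have hd : ∀ z, crun (dec W l L M ++ decC W l L M ++ (dec W l L M).reverse) v1 z =
      (v1 z ^^ xs (decC W l L M) (crun (dec W l L M) v1) z) :=
    crun_conj (N := W + Q ^ 4) (dec_wf le_rfl hW hQ hl hM) (dec_avoids hW) (decC_layer hW) v1
  set v2 := crun (dec W l L M ++ decC W l L M ++ (dec W l L M).reverse) v1
  have hA : Layer (fun z => z < l * L) (mvA W l L) := by
    intro g hg
    simp only [mvA, List.mem_flatMap, List.mem_range, List.mem_cons, List.not_mem_nil,
      or_false] at hg
    obtain ⟨c, hc, rfl⟩ := hg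
    have h1 := le_wk W 6 c 0 0
    have h2 := le_wk W 0 0 0 0
    exact ⟨hc, by simp only [addI]; omega, by simp only [addI]; omega⟩
  have hB : Layer (fun z => W ≤ z) (mvB W l L M) := by
    intro g hg
    simp only [mvB, List.mem_flatMap, List.mem_range, List.mem_cons, List.not_mem_nil,
      or_false] at hg
    obtain ⟨c, hc, rfl⟩ := hg
    exact ⟨le_wk W 6 c 0 0, by dsimp only; omega, by dsimp only; omega⟩
  have hAB : ∀ z, crun (mvA W l L ++ mvB W l L M) v2 z =
      ((v2 z ^^ xs (mvA W l L) v2 z) ^^ xs (mvB W l L M) (crun (mvA W l L) v2) z) := fun z => by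
    rw [crun_append, crun_layer hB, crun_layer hA]
  have hz7 : ∀ t i j b, t ≠ 6 → v1 (wk W t i j b) = false := fun t i j b ht =>
    e5 _ (by have := le_wk W t i j b; omega) fun c _ e => ht (wk_inj.1 e).1
  have xA : ∀ z, ¬ z < l * L → xs (mvA W l L) v2 z = false := fun z hz =>
    xs_eq_false fun g hg e => hz (e ▸ (hA g hg).1)
  have xB : ∀ z, (∀ c < l * L, z ≠ wk W 6 c 0 0) →
      ∀ w, xs (mvB W l L M) w z = false := by
    intro z hz w
    refine xs_eq_false fun g hg e => ?_
    simp only [mvB, List.mem_flatMap, List.mem_range, List.mem_cons, List.not_mem_nil,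
      or_false] at hg
    obtain ⟨c, hc, rfl⟩ := hg
    exact hz c hc e.symm
  have hlow : ∀ {z}, z < W → ∀ c < l * L, z ≠ wk W 6 c 0 0 := fun hz c _ => (wk_ne hz).symm
  have d2 : ∀ z, ¬ z < l * L → v2 z = v1 z := fun z hz => by
    have h0 : xs (decC W l L M) (crun (dec W l L M) v1) z = false :=
      xs_eq_false fun g hg e => hz (e ▸ (decC_layer hW g hg).1)
    rw [hd, h0, Bool.xor_false]
  have hone : v2 (wk W 0 0 0 0) = false := by
    rw [d2 _ (by have := le_wk W 0 0 0 0; omega), hz7 _ _ _ _ (by simp)]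
  have xA' : ∀ z < l * L, xs (mvA W l L) v2 z = v1 (wk W 6 z 0 0) := by
    intro z hz
    rw [mvA, xs_flatMap_single List.nodup_range (List.mem_range.2 hz)]
    · simp [xs_cons, xs_nil, addI, Instr.term, hone, d2 (wk W 6 z 0 0) (by have := le_wk W 6 z 0 0; omega)]
    · intro c _ hne
      simp [xs_cons, xs_nil, addI, hne]
  have xB' : ∀ c < l * L, xs (mvB W l L M) (crun (mvA W l L) v2) (wk W 6 c 0 0) =
      ((v2 c ^^ v1 (wk W 6 c 0 0)) && !v1 (l * L + l * M)) := by
    intro c hc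
    have h1 : crun (mvA W l L) v2 (l * L + l * M) = v1 (l * L + l * M) := by
      rw [crun_layer hA, xA _ (by omega), Bool.xor_false, d2 _ (by omega)]
    have h2 : crun (mvA W l L) v2 c = (v2 c ^^ v1 (wk W 6 c 0 0)) := by
      rw [crun_layer hA, xA' c hc]
    rw [mvB, xs_flatMap_single List.nodup_range (List.mem_range.2 hc)]
    · simp [xs_cons, xs_nil, Instr.term, h1, h2]
    · intro c' _ hne
      simp [xs_cons, xs_nil, hne]
  by_cases hinj : Set.InjOn s (Finset.range l)
  -- Distinct inputs: the `i`-th input is the sorted entry whose position is the rank of `i`. The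
  -- decoded rank selects exactly this entry, so `decC` clears the main register. The sorted list is
  -- then moved in, and its copy is cancelled against the main register.
  · rw [if_pos hinj]
    simp only [decide_eq_true hinj, Bool.true_and, Bool.not_true] at e2 e3 e4
    obtain ⟨f1, f2⟩ := dec_spec hW hz7 hlM (fun i hi => rankOf_lt_self hi) e2
    have v2z : ∀ z < l * L, v2 z = false := by
      intro z hz
      obtain ⟨i, hi, b, hb, rfl⟩ := exists_idx hz
      have hr := rankOf_lt_self (s := s) hi
      rw [hd, e1 _ hz, hx i hi b hb, decC, xs_flatMap_single List.nodup_range (List.mem_range.2 hi),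
        xs_flatMap_single List.nodup_range (List.mem_range.2 hb),
        xs_flatMap_single List.nodup_range (List.mem_range.2 hr)]
      · have h1 := f1 (wk W 6 (rankOf s l i * L + b) 0 0) (by simp)
        rw [e4 _ hr b hb, hy hinj i hi] at h1
        simp [xs_cons, xs_nil, Instr.term, f2 i hi _ hr, h1]
      · intro r hr' hne
        simp [xs_cons, xs_nil, Instr.term, f2 i hi _ (List.mem_range.1 hr'), Ne.symm hne]
      · intro b' hb' hne
        exact xs_flatMap_false fun r _ => by simp [xs_cons, xs_nil, hne]
      · intro i' hi' hne
        refine xs_flatMap_false fun b' hb' => xs_flatMap_false fun r _ => ?_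
        have : i' * L + b' ≠ i * L + b := fun e => hne (idx_inj (List.mem_range.1 hb') hb e).1
        simp [xs_cons, xs_nil, this]
    funext z
    rw [hAB]
    split_ifs with h1 h2
    · rw [v2z z h1, xA' z h1, xB _ (hlow (by omega))]
      obtain ⟨i, hi, b, hb, rfl⟩ := exists_idx h1
      rw [e4 i hi b hb, idx_div hb, idx_mod hb]
      simp
    · rw [xA _ h1, xB _ (hlow (by omega)), d2 _ h1]
      obtain ⟨i, hi, b, hb, e⟩ := exists_idx (show z - l * L < l * M by omega)
      rw [e, idx_div hb, idx_mod hb, ← e2 i hi b hb, show z = l * L + (i * M + b) by omega]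
      simp
    · rw [xA _ h1, d2 _ h1]
      by_cases h3 : ∀ c < l * L, z ≠ wk W 6 c 0 0
      · rw [xB _ h3]
        rcases (show l * L + l * M ≤ z by omega).eq_or_lt with h4 | h4
        · rw [← h4, e3]; rfl
        · rw [e5 _ h4 h3]; rfl
      · push Not at h3
        obtain ⟨c, hc, rfl⟩ := h3
        rw [xB' c hc, v2z c hc, e3]
        simp
  -- Colliding inputs: the copy of the sorted list and the rank register are zero. Whatever the
  -- decoded ranks select is zero, the move adds nothing, and the flag blocks `mvB`, so the input
  -- stays in place.
  · rw [if_neg hinj]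
    simp only [decide_eq_false hinj, Bool.false_and, Bool.not_false] at e2 e3 e4
    have out0 : ∀ c < l * L, v1 (wk W 6 c 0 0) = false := by
      intro c hc
      obtain ⟨i, hi, b, hb, rfl⟩ := exists_idx hc
      exact e4 i hi b hb
    have hl0 : ∀ i < l, (fun _ : ℕ => 0) i < l := fun i hi => by simp only; omega
    obtain ⟨f1, -⟩ := dec_spec hW hz7 hlM hl0 fun i hi b hb => by rw [e2 i hi b hb]; simp
    have v2z : ∀ z < l * L, v2 z = v z := by
      intro z hz
      rw [hd, e1 _ hz, decC, xs_flatMap_false, Bool.xor_false]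
      intro i hi
      refine xs_flatMap_false fun b hb => xs_flatMap_false fun r hr => ?_
      rw [List.mem_range] at hb hr
      have h1 := f1 (wk W 6 (r * L + b) 0 0) (by simp)
      rw [e4 r hr b hb] at h1
      simp [xs_cons, xs_nil, Instr.term, h1]
    funext z
    rw [hAB]
    by_cases h1 : z < l * L
    · rw [v2z z h1, xA' z h1, xB _ (hlow (by omega)), out0 z h1,
        Function.update_of_ne (by omega)]
      simp
    · rw [xA _ h1, d2 _ h1]
      by_cases h3 : ∀ c < l * L, z ≠ wk W 6 c 0 0
      · rw [xB _ h3]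
        by_cases h4 : z = l * L + l * M
        · rw [h4, e3]; simp
        · rw [Function.update_of_ne h4, hv z (by omega)]
          by_cases h5 : z < l * L + l * M
          · obtain ⟨i, hi, b, hb, e⟩ := exists_idx (show z - l * L < l * M by omega)
            rw [show z = l * L + (i * M + b) by omega, e2 i hi b hb]; rfl
          · rw [e5 _ (by omega) h3]; rfl
      · push Not at h3
        obtain ⟨c, hc, rfl⟩ := h3
        have := le_wk W 6 c 0 0
        rw [xB' c hc, e3, out0 c hc, Function.update_of_ne (by omega), hv _ (by omega)]
        simp

theorem sortCirc_wf {W Q N l L M : ℕ} (hN : W + Q ^ 4 ≤ N) (hW : l * L + (l * M + 3) ≤ W)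
    (hQ : 8 < Q) (hl : l + 2 < Q) (hL : L + 2 < Q) (hM : M + 2 < Q) (hlL : l * L < Q) :
    ∀ g ∈ sortCirc W l L M, g.WF N := by
  have hw : ∀ {t i j b : ℕ}, t < Q → i < Q → j < Q → b < Q → wk W t i j b < N :=
    fun h1 h2 h3 h4 => (wk_lt h1 h2 h3 h4).trans_le hN
  have hA := sortA_wf hN (by omega) hQ hl hL
  have hD := dec_wf hN hW hQ hl hM
  intro g hg
  simp only [sortCirc, sortC, List.mem_append, List.mem_reverse, or_assoc] at hg
  rcases hg with hg | hg | hg | hg | hg | hg | hg | hg | hg | hg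
  · exact hA g hg
  · simp only [outC, List.mem_flatMap, List.mem_range, List.mem_cons, List.not_mem_nil,
      or_false] at hg
    obtain ⟨r, hr, b, hb, i, hi, rfl⟩ := hg
    have h1 := idx_lt hr hb
    have h2 := idx_lt hi hb
    exact ⟨hw (by omega) (by omega) (by omega) (by omega),
      hw (by omega) (by omega) (by omega) (by omega), by dsimp only; omega, by simp,
      wk_ne (by dsimp only; omega), wk_ne (by dsimp only; omega)⟩
  · simp only [rankC, List.mem_flatMap, List.mem_range] at hg
    obtain ⟨i, hi, b, hb, r, hr, hg⟩ := hg
    have h1 := idx_lt hi hb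
    cases h : r.testBit b
    · simp [h] at hg
    · simp only [h, cond_true, List.mem_cons, List.not_mem_nil, or_false] at hg
      subst hg
      exact addI_wf hN (by omega) (by omega) (hw (by omega) (by omega) (by omega) (by omega))
        (wk_ne (by omega)).symm (wk_ne (by omega)).symm (by simp)
  · simp only [List.mem_singleton] at hg
    subst hg
    exact addI_wf hN (by omega) (by omega) (hw (by omega) (by omega) (by omega) (by omega))
      (wk_ne (by omega)).symm (wk_ne (by omega)).symm (by simp)
  · exact hA g hg
  · exact hD g hg
  · simp only [decC, List.mem_flatMap, List.mem_range, List.mem_cons, List.not_mem_nil,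
      or_false] at hg
    obtain ⟨i, hi, b, hb, r, hr, rfl⟩ := hg
    have h1 := idx_lt hr hb
    have h2 := idx_lt hi hb
    exact ⟨by dsimp only; omega, hw (by omega) (by omega) (by omega) (by omega),
      hw (by omega) (by omega) (by omega) (by omega), (wk_ne (by dsimp only; omega)).symm,
      (wk_ne (by dsimp only; omega)).symm, by simp⟩
  · exact hD g hg
  · simp only [mvA, List.mem_flatMap, List.mem_range, List.mem_cons, List.not_mem_nil,
      or_false] at hg
    obtain ⟨c, hc, rfl⟩ := hg
    exact addI_wf hN (by omega) (by omega) (hw (by omega) (by omega) (by omega) (by omega))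
      (wk_ne (by omega)).symm (wk_ne (by omega)).symm (by simp)
  · simp only [mvB, List.mem_flatMap, List.mem_range, List.mem_cons, List.not_mem_nil,
      or_false] at hg
    obtain ⟨c, hc, rfl⟩ := hg
    exact ⟨hw (by omega) (by omega) (by omega) (by omega), by dsimp only; omega,
      by dsimp only; omega, wk_ne (by dsimp only; omega),
      wk_ne (by dsimp only; omega), by dsimp only; omega⟩

/-! ### Preparation of one block -/

/-- The rotation with matrix entries `√(p / (p + q))` and `± √(q / (p + q))`. -/
def rotCode (neg : Bool) (p q : ℕ) (a b : Bool) : EntryCode :=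
  if a = b then .real false p (p + q) else .real (neg ^^ b) q (p + q)

theorem rotCode_unitary (neg : Bool) {p q : ℕ} (h : 0 < p + q) :
    codeMat (rotCode neg p q) ∈ Matrix.unitaryGroup Bool ℂ := by
  rw [Matrix.mem_unitaryGroup_iff]
  have h0 : (0 : ℝ) < (p : ℝ) + q := by exact_mod_cast h
  have h1 : √((p : ℝ) / (p + q)) * √((p : ℝ) / (p + q)) +
      √((q : ℝ) / (p + q)) * √((q : ℝ) / (p + q)) = 1 := by
    rw [Real.mul_self_sqrt (by positivity), Real.mul_self_sqrt (by positivity)]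
    field_simp
  have h2 : (√((p : ℝ) / (p + q)) : ℂ) * √((p : ℝ) / (p + q)) +
      √((q : ℝ) / (p + q)) * √((q : ℝ) / (p + q)) = 1 := by exact_mod_cast h1
  ext a b
  simp only [Matrix.mul_apply, Fintype.sum_bool, codeMat, Matrix.star_apply, Matrix.of_apply,
    rotCode, Matrix.one_apply]
  generalize hP : √((p : ℝ) / (p + q)) = P at *
  generalize hQ : √((q : ℝ) / (p + q)) = Q at *
  cases neg <;> cases a <;> cases b <;>
    simp only [EntryCode.val_real, Nat.cast_add, hP, hQ, RCLike.star_def, Complex.conj_ofReal,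
      reduceCtorEq, if_true, if_false, Bool.xor_true, Bool.xor_false, Bool.not_true,
      Bool.not_false, Complex.ofReal_mul, Complex.ofReal_neg, Complex.ofReal_one,
      map_mul, map_neg, map_one] <;>
    first | linear_combination h2 | ring

/-- Replacement of the bits of a block. -/
def setBlock (off m : ℕ) (u : ℕ → Bool) (b : ℕ → Bool) : ℕ → Bool :=
  fun z => if off ≤ z ∧ z < off + m then b (z - off) else u z

/-- A state of the preparation of a block. -/
def prepVal (W off m : ℕ) (u : ℕ → Bool) (b : ℕ → Bool) (f e : Bool) : ℕ → Bool :=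
  Function.update (Function.update (setBlock off m u b) (wk W 8 0 0 0) f) (wk W 8 1 0 0) e

/-- A string is loaded into the block if the wire `wk W 8 1 0 0` is set. -/
def loadCirc (W off m : ℕ) (b : ℕ → Bool) : List Instr :=
  (List.range m).flatMap (fun s => bif b s then [addI W (off + s) (wk W 8 1 0 0) false] else []) ++
    [addI W (wk W 8 0 0 0) (wk W 8 1 0 0) false]

/-- The comparison of the block with a string. -/
def eqChain (W off m : ℕ) (b : ℕ → Bool) : List Instr :=
  chain W (wk W 9 0 0) (fun s => bif decide (s < m) then (off + s, !b s) else (wk W 8 0 0 0, false))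
    (m + 1)

/-- The wire `wk W 8 1 0 0` is flipped if the block holds the given string. -/
def testCirc (W off m : ℕ) (b : ℕ → Bool) : List Instr :=
  eqChain W off m b ++ [addI W (wk W 8 1 0 0) (wk W 9 0 0 (m + 1)) false] ++ (eqChain W off m b).reverse

theorem loadCirc_wf {W Q N off m : ℕ} (hN : W + Q ^ 4 ≤ N) (hW : off + m ≤ W) (hQ : 9 < Q)
    (b : ℕ → Bool) : ∀ g ∈ loadCirc W off m b, g.WF N := by
  have hw : ∀ {t i j b : ℕ}, t < Q → i < Q → j < Q → b < Q → wk W t i j b < N :=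
    fun h1 h2 h3 h4 => (wk_lt h1 h2 h3 h4).trans_le hN
  intro g hg
  simp only [loadCirc, List.mem_append, List.mem_flatMap, List.mem_range, List.mem_singleton] at hg
  rcases hg with ⟨s, hs, hg⟩ | rfl
  · cases h : b s
    · simp [h] at hg
    · simp only [h, cond_true, List.mem_singleton] at hg
      subst hg
      exact addI_wf hN (by omega) (by omega) (hw (by omega) (by omega) (by omega) (by omega))
        (wk_ne (by omega)).symm (wk_ne (by omega)).symm (by simp)
  · exact addI_wf hN (by omega) (hw (by omega) (by omega) (by omega) (by omega))
      (hw (by omega) (by omega) (by omega) (by omega)) (by simp) (by simp) (by simp)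

theorem eqChain_wf {W Q N off m : ℕ} (hN : W + Q ^ 4 ≤ N) (hW : off + m ≤ W) (hQ : 9 < Q)
    (hm : m + 2 < Q) (b : ℕ → Bool) : ∀ g ∈ eqChain W off m b, g.WF N := by
  have hw : ∀ {t i j b : ℕ}, t < Q → i < Q → j < Q → b < Q → wk W t i j b < N :=
    fun h1 h2 h3 h4 => (wk_lt h1 h2 h3 h4).trans_le hN
  refine chain_wf hN (by omega) (fun a b e => (wk_inj.1 e).2.2.2)
    (fun s hs => hw (by omega) (by omega) (by omega) (by omega)) (by simp) (fun s hs => ?_)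
    (fun s hs s' => ?_)
  · by_cases h : s < m
    · simp only [h, decide_true, cond_true]; omega
    · simp only [h, decide_false, cond_false]
      exact hw (by omega) (by omega) (by omega) (by omega)
  · by_cases h : s < m
    · simp only [h, decide_true, cond_true]; exact (wk_ne (by omega)).symm
    · simp [h]

theorem testCirc_wf {W Q N off m : ℕ} (hN : W + Q ^ 4 ≤ N) (hW : off + m ≤ W) (hQ : 9 < Q)
    (hm : m + 2 < Q) (b : ℕ → Bool) : ∀ g ∈ testCirc W off m b, g.WF N := by
  have hw : ∀ {t i j b : ℕ}, t < Q → i < Q → j < Q → b < Q → wk W t i j b < N :=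
    fun h1 h2 h3 h4 => (wk_lt h1 h2 h3 h4).trans_le hN
  intro g hg
  simp only [testCirc, List.mem_append, List.mem_reverse, List.mem_singleton] at hg
  rcases hg with (hg | rfl) | hg
  · exact eqChain_wf hN hW hQ hm b g hg
  · exact addI_wf hN (by omega) (hw (by omega) (by omega) (by omega) (by omega))
      (hw (by omega) (by omega) (by omega) (by omega)) (by simp) (by simp) (by simp)
  · exact eqChain_wf hN hW hQ hm b g hg

section
variable {W off m : ℕ} {u : ℕ → Bool}

theorem prepVal_wk {t i j b : ℕ} (hW : off + m ≤ W) (hu : ∀ z, W ≤ z → u z = false)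
    (ht : t ≠ 8) (c : ℕ → Bool) (f e : Bool) : prepVal W off m u c f e (wk W t i j b) = false := by
  have h := le_wk W t i j b
  rw [prepVal, Function.update_of_ne (by simp [ht]), Function.update_of_ne (by simp [ht]), setBlock,
    if_neg (by omega), hu _ h]

theorem prepVal_flag (c : ℕ → Bool) (f e : Bool) : prepVal W off m u c f e (wk W 8 0 0 0) = f := by
  rw [prepVal, Function.update_of_ne (by simp), Function.update_self]

theorem prepVal_anc (c : ℕ → Bool) (f e : Bool) : prepVal W off m u c f e (wk W 8 1 0 0) = e := by
  rw [prepVal, Function.update_self]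

theorem prepVal_block (hW : off + m ≤ W) (c : ℕ → Bool) (f e : Bool) {s : ℕ} (hs : s < m) :
    prepVal W off m u c f e (off + s) = c s := by
  rw [prepVal, Function.update_of_ne (wk_ne (by omega)).symm,
    Function.update_of_ne (wk_ne (by omega)).symm, setBlock, if_pos (by omega)]
  congr 1; omega

theorem crun_loadCirc (hW : off + m ≤ W) (hu : ∀ z, W ≤ z → u z = false) (b : ℕ → Bool) :
    crun (loadCirc W off m b) (prepVal W off m u (fun _ => false) false true) =
      prepVal W off m u b true true := by
  set v := prepVal W off m u (fun _ => false) false true with hv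
  have hL : Layer (fun z => z < W ∨ z = wk W 8 0 0 0) (loadCirc W off m b) := by
    have h0 := le_wk W 8 1 0 0
    have h1 := le_wk W 0 0 0 0
    intro g hg
    simp only [loadCirc, List.mem_append, List.mem_flatMap, List.mem_range,
      List.mem_singleton] at hg
    rcases hg with ⟨s, hs, hg⟩ | rfl
    · cases h : b s
      · simp [h] at hg
      · simp only [h, cond_true, List.mem_singleton] at hg
        subst hg
        exact ⟨.inl (by simp only [addI]; omega), by simp only [addI, wk_inj]; omega,
          by simp only [addI, wk_inj]; omega⟩
    · exact ⟨.inr rfl, by simp only [addI, wk_inj]; omega, by simp only [addI, wk_inj]; omega⟩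
  have he : v (wk W 8 1 0 0) = true := prepVal_anc _ _ _
  have hone : v (wk W 0 0 0 0) = false := prepVal_wk hW hu (by simp) _ _ _
  funext z
  rw [crun_layer hL, loadCirc, xs_append]
  by_cases hz : off ≤ z ∧ z < off + m
  · obtain ⟨s, rfl⟩ := Nat.exists_eq_add_of_le hz.1
    have hs : s < m := by omega
    rw [prepVal_block hW _ _ _ hs, hv, prepVal_block hW _ _ _ hs, ← hv,
      xs_flatMap_single List.nodup_range (List.mem_range.2 hs), xs_eq_false (C := [_])]
    · cases h : b s <;> simp [xs_cons, xs_nil, addI, Instr.term, he, hone]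
    · simp only [List.mem_singleton, forall_eq, addI]
      exact wk_ne (by omega)
    · intro s' _ hne
      cases h : b s' <;> simp [xs_cons, xs_nil, addI, hne]
  · rw [xs_flatMap_false]
    · by_cases h8 : z = wk W 8 0 0 0
      · subst h8
        simp [hv, prepVal_flag, xs_cons, xs_nil, addI, Instr.term]
        rw [← hv]
        simp [he, hone]
      · rw [xs_eq_false (by simpa [addI] using Ne.symm h8)]
        by_cases h9 : z = wk W 8 1 0 0
        · subst h9; simp [hv, prepVal_anc]
        · simp [hv, prepVal, h8, h9, setBlock, hz]
    · intro s hs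
      rw [List.mem_range] at hs
      have : ¬ off + s = z := fun e => hz (by omega)
      cases h : b s <;> simp [xs_cons, xs_nil, addI, this]

theorem crun_loadCirc' (b c : ℕ → Bool) (f : Bool) :
    crun (loadCirc W off m b) (prepVal W off m u c f false) = prepVal W off m u c f false := by
  have h : ∀ C : List Instr, (∀ g ∈ C, g.a = wk W 8 1 0 0 ∧ g.pa = false) →
      crun C (prepVal W off m u c f false) = prepVal W off m u c f false := by
    intro C hC
    induction C with
    | nil => rfl
    | cons g C ih =>
      obtain ⟨h1, h2⟩ := hC g (by simp)
      rw [crun_cons]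
      have : g.step (prepVal W off m u c f false) = prepVal W off m u c f false := by
        rw [Instr.step, h1, h2, prepVal_anc]; simp
      rw [this]
      exact ih fun g hg => hC g (by simp [hg])
  refine h _ fun g hg => ?_
  simp only [loadCirc, List.mem_append, List.mem_flatMap, List.mem_range, List.mem_singleton] at hg
  rcases hg with ⟨s, hs, hg⟩ | rfl
  · cases h : b s
    · simp [h] at hg
    · simp only [h, cond_true, List.mem_singleton] at hg
      subst hg
      exact ⟨rfl, rfl⟩
  · exact ⟨rfl, rfl⟩

/-- The chain has `m + 1` literals: the `m` bits of the block and, at position `m`, the wire `wk W 8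
0 0 0` that records whether an item has been loaded. A block that is still empty is therefore never
mistaken for a loaded zero string. -/
theorem crun_testCirc {Q : ℕ} (hW : off + m ≤ W) (hQ : 9 < Q) (hm : m + 2 < Q)
    (hu : ∀ z, W ≤ z → u z = false) (b c : ℕ → Bool) (f e : Bool) :
    crun (testCirc W off m b) (prepVal W off m u c f e) =
      prepVal W off m u c f (e ^^ (f && decide (∀ s < m, c s = b s))) := by
  set v := prepVal W off m u c f e with hv
  have hA : Avoids (fun z => z = wk W 8 1 0 0) (eqChain W off m b) := by
    intro g hg
    simp only [eqChain, chain, List.mem_cons, List.mem_map, List.mem_range] at hg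
    rcases hg with rfl | ⟨s, hs, rfl⟩
    · simp [notI]
    · refine ⟨by simp, by simp, ?_⟩
      by_cases h : s < m
      · simp only [h, decide_true, cond_true]; exact (wk_ne (by omega)).symm
      · simp [h]
  have hC : Layer (fun z => z = wk W 8 1 0 0)
      [addI W (wk W 8 1 0 0) (wk W 9 0 0 (m + 1)) false] := by
    simp [Layer, addI]
  have hch := crun_chain (W := W) (base := wk W 9 0 0)
    (f := fun s => bif decide (s < m) then (off + s, !b s) else (wk W 8 0 0 0, false))
    (m := m + 1) (v := v) (fun a b e => (wk_inj.1 e).2.2.2)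
    (fun b => prepVal_wk hW hu (by simp) _ _ _) (fun s hs s' => by
      by_cases h : s < m
      · simp only [h, decide_true, cond_true]; exact (wk_ne (by omega)).symm
      · simp [h]) (prepVal_wk hW hu (by simp) _ _ _) (prepVal_wk hW hu (by simp) _ _ _)
  have h1 : crun (eqChain W off m b) v (wk W 9 0 0 (m + 1)) =
      (f && decide (∀ s < m, c s = b s)) := by
    rw [eqChain, (hch _).2 (m + 1) le_rfl rfl, Bool.eq_iff_iff, List.all_eq_true, Bool.and_eq_true,
      decide_eq_true_iff]
    constructor
    · intro h
      refine ⟨?_, fun s hs => ?_⟩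
      · have := h m (by simp)
        simpa [hv, prepVal_flag] using this
      · have := h s (by simp; omega)
        simpa [hs, hv, prepVal_block hW _ _ _ hs] using this
    · rintro ⟨h1, h2⟩ s hs
      by_cases h : s < m
      · simp [h, hv, prepVal_block hW _ _ _ h, h2 s h]
      · simp [h, hv, prepVal_flag, h1]
  have h2 : crun (eqChain W off m b) v (wk W 0 0 0 0) = false := by
    rw [eqChain, (hch _).1 (by simp)]
    exact prepVal_wk hW hu (by simp) _ _ _
  funext z
  rw [testCirc, crun_conj (N := W + Q ^ 4) (eqChain_wf le_rfl hW hQ hm b) hA hC]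
  by_cases h9 : z = wk W 8 1 0 0
  · subst h9
    rw [prepVal_anc, hv, prepVal_anc, ← hv]
    simp [xs_cons, xs_nil, addI, Instr.term, h1, h2]
  · rw [xs_eq_false (by simpa [addI] using Ne.symm h9), Bool.xor_false, hv, prepVal, prepVal,
      Function.update_of_ne h9, Function.update_of_ne h9]

end

theorem ctrl_kt {N i j : ℕ} (hi : i < N) (hj : j < N) (hij : i ≠ j) (p : Bool)
    {M : Bool → Bool → EntryCode} {T : State N →ₗ[ℂ] State N}
    (hT : ∀ ψ x, T ψ x = if (x ⟨i, hi⟩ ^^ p) = true then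
        ∑ b : Bool, (M (x ⟨j, hj⟩) b).val * ψ (Function.update x ⟨j, hj⟩ b) else ψ x)
    {v : ℕ → Bool} (hv : v j = false) :
    T (kt N v) = if (v i ^^ p) = true then
      (M false false).val • kt N v + (M true false).val • kt N (Function.update v j true)
      else kt N v := by
  have hij' : (⟨i, hi⟩ : Fin N) ≠ ⟨j, hj⟩ := by simpa using hij
  have hr : ∀ a, restr N (Function.update v j a) = Function.update (restr N v) ⟨j, hj⟩ a := by
    intro a
    funext z
    by_cases hz : z = ⟨j, hj⟩
    · subst hz; simp [restr]
    · have : (z : ℕ) ≠ j := fun e => hz (Fin.ext e)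
      simp [restr, hz, this]
  have hself : Function.update (restr N v) ⟨j, hj⟩ false = restr N v := by
    rw [← hr, ← hv, Function.update_eq_self]
  funext x
  rw [hT]
  have e1 : (kt N v) (Function.update x ⟨j, hj⟩ false) =
      if Function.update x ⟨j, hj⟩ false = restr N v then 1 else 0 := rfl
  have e2 : (kt N v) (Function.update x ⟨j, hj⟩ true) = 0 := by
    rw [kt, ket, if_neg]
    intro h
    have := congrFun h ⟨j, hj⟩
    simp [restr, hv] at this
  have e3 : ∀ w, (kt N w) x = if x = restr N w then 1 else 0 := fun w => rfl
  by_cases hx : Function.update x ⟨j, hj⟩ false = restr N v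
  · have hxi : x ⟨i, hi⟩ = v i := by
      have := congrFun hx ⟨i, hi⟩
      rwa [Function.update_of_ne hij'] at this
    have hxx : x = Function.update (restr N v) ⟨j, hj⟩ (x ⟨j, hj⟩) := by
      rw [← hx, Function.update_idem, Function.update_eq_self]
    rw [hxi]
    split_ifs
    · rw [Fintype.sum_bool, e1, e2, if_pos hx]
      simp only [Pi.add_apply, Pi.smul_apply, smul_eq_mul, e3, hr]
      cases hxj : x ⟨j, hj⟩
      · rw [hxj, hself] at hxx
        rw [if_pos hxx, if_neg]
        · simp
        · intro h
          rw [h] at hxj; simp at hxj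
      · rw [hxj] at hxx
        rw [if_pos hxx, if_neg]
        · simp
        · intro h
          rw [h] at hxj; simp [restr, hv] at hxj
    · rfl
  · have h1 : x ≠ restr N v := fun h => hx (by rw [h, hself])
    have h2 : x ≠ restr N (Function.update v j true) := fun h => hx (by
      rw [h, hr, Function.update_idem, hself])
    have h3 : (kt N v) x = 0 := by rw [e3, if_neg h1]
    have h4 : (kt N (Function.update v j true)) x = 0 := by rw [e3, if_neg h2]
    rw [Fintype.sum_bool, e1, e2, if_neg hx, h3]
    split_ifs <;> simp [h3, h4]

/-- One item of the preparation of a block. -/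
def stepCode (W off m : ℕ) (b : ℕ → Bool) (neg : Bool) (p q : ℕ) : List GateCode :=
  .two (wk W 8 0 0 0) (wk W 8 1 0 0) (ctrlCode true (rotCode neg p q)) ::
    (loadCirc W off m b ++ testCirc W off m b).flatMap Instr.code

/-- While nothing is loaded, the rotation puts amplitude `± √(q / (p + q))` on the auxiliary wire.
If that wire is set, the string is loaded and the loaded-flag raised; recognizing the string in the
block then resets the auxiliary wire. Branches with another string loaded earlier pass unchanged,
because the flag disables the rotation and the test fails. -/
theorem impl_stepCode {W Q N off m : ℕ} (hN : W + Q ^ 4 ≤ N) (hW : off + m ≤ W) (hQ : 9 < Q)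
    (hm : m + 2 < Q) (b : ℕ → Bool) (neg : Bool) {p q : ℕ} (hpq : 0 < p + q) :
    ∃ T, Impl N (stepCode W off m b neg p q) T ∧ ∀ u : ℕ → Bool, (∀ z, W ≤ z → u z = false) →
      (T (kt N (prepVal W off m u (fun _ => false) false false)) =
        (√((p : ℝ) / (p + q)) : ℂ) • kt N (prepVal W off m u (fun _ => false) false false) +
        ((if neg then -1 else 1) * √((q : ℝ) / (p + q)) : ℂ) • kt N (prepVal W off m u b true false)) ∧
      (∀ c : ℕ → Bool, (∃ s < m, c s ≠ b s) →
        T (kt N (prepVal W off m u c true false)) = kt N (prepVal W off m u c true false)) := by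
  have hw : ∀ {t i j b : ℕ}, t < Q → i < Q → j < Q → b < Q → wk W t i j b < N :=
    fun h1 h2 h3 h4 => (wk_lt h1 h2 h3 h4).trans_le hN
  have h8 : wk W 8 0 0 0 < N := hw (by omega) (by omega) (by omega) (by omega)
  have h9 : wk W 8 1 0 0 < N := hw (by omega) (by omega) (by omega) (by omega)
  have h89 : wk W 8 0 0 0 ≠ wk W 8 1 0 0 := by simp
  obtain ⟨T1, i1, e1⟩ := impl_ctrl h8 h9 h89 true (rotCode_unitary neg hpq)
  have hwf : ∀ g ∈ loadCirc W off m b ++ testCirc W off m b, g.WF N := by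
    intro g hg
    rcases List.mem_append.1 hg with hg | hg
    · exact loadCirc_wf hN hW hQ b g hg
    · exact testCirc_wf hN hW hQ hm b g hg
  have i2 := impl_crun hwf
  refine ⟨_, i1.append i2, fun u hu => ⟨?_, fun c hc => ?_⟩⟩
  · rw [LinearMap.comp_apply, ctrl_kt h8 h9 h89 true e1 (prepVal_anc _ _ _), prepVal_flag,
      if_pos (by decide), map_add, map_smul, map_smul, funLeft_crun_kt hwf, funLeft_crun_kt hwf]
    have h1 : Function.update (prepVal W off m u (fun _ => false) false false) (wk W 8 1 0 0) true =
        prepVal W off m u (fun _ => false) false true := by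
      rw [prepVal, Function.update_idem]; rfl
    have h2 : (decide (∀ s < m, b s = b s)) = true := by simp
    rw [h1, crun_append, crun_append, crun_loadCirc hW hu, crun_loadCirc',
      crun_testCirc hW hQ hm hu, crun_testCirc hW hQ hm hu, h2]
    congr 2
    · simp [rotCode, EntryCode.val_real]
    · cases neg <;> simp [rotCode, EntryCode.val_real]
  · rw [LinearMap.comp_apply, ctrl_kt h8 h9 h89 true e1 (prepVal_anc _ _ _), prepVal_flag,
      if_neg (by simp), funLeft_crun_kt hwf, crun_append, crun_loadCirc',
      crun_testCirc hW hQ hm hu, decide_eq_false]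
    · rfl
    · push Not
      exact hc

/-- The sum of the squared weights of a list of items. -/
def sumSq {α : Type} (J : List (α × Bool × ℕ)) : ℕ := (J.map fun x => x.2.2 * x.2.2).sum

/-- The signed weight of an item. -/
def wt {α : Type} (x : α × Bool × ℕ) : ℝ := (if x.2.1 then -1 else 1) * x.2.2

theorem sumSq_cons {α : Type} (x : α × Bool × ℕ) (J : List (α × Bool × ℕ)) :
    sumSq (x :: J) = x.2.2 * x.2.2 + sumSq J := by
  simp [sumSq]

/-- Preparation of the superposition of the items, except for the final flip of the flag. -/
def itemsCode {α : Type} (W off m : ℕ) (bt : α → ℕ → Bool) : List (α × Bool × ℕ) → List GateCode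
  | [] => []
  | x :: J => stepCode W off m (bt x.1) x.2.1 (sumSq J) (x.2.2 * x.2.2) ++ itemsCode W off m bt J

/-- With `q` the square of the current weight and `p` the sum of the later squares, the amplitudes
telescope: the part not yet loaded has norm proportional to `√p`, and at the last item `p = 0`, so
nothing is left over. Multiplication by the square root of the total makes the identity valid for
the empty list as well. -/
theorem impl_itemsCode {α : Type} {W Q N off m : ℕ} (hN : W + Q ^ 4 ≤ N) (hW : off + m ≤ W)
    (hQ : 9 < Q) (hm : m + 2 < Q) (bt : α → ℕ → Bool) (J : List (α × Bool × ℕ))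
    (hpos : ∀ x ∈ J, 0 < x.2.2) (hJ : J.Pairwise fun x y => ∃ s < m, bt x.1 s ≠ bt y.1 s) :
    ∃ T, Impl N (itemsCode W off m bt J) T ∧ ∀ u : ℕ → Bool, (∀ z, W ≤ z → u z = false) →
      ((√(sumSq J : ℝ) : ℂ) • T (kt N (prepVal W off m u (fun _ => false) false false)) =
        (J.map fun x => (wt x : ℂ) • kt N (prepVal W off m u (bt x.1) true false)).sum) ∧
      (∀ c : ℕ → Bool, (∀ x ∈ J, ∃ s < m, c s ≠ bt x.1 s) →
        T (kt N (prepVal W off m u c true false)) = kt N (prepVal W off m u c true false)) := by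
  induction J with
  | nil =>
    refine ⟨_, Impl.nil N, fun u _ => ⟨?_, fun c _ => rfl⟩⟩
    simp [sumSq]
  | cons x J ih =>
    rw [List.pairwise_cons] at hJ
    obtain ⟨T2, i2, e2⟩ := ih (fun y hy => hpos y (by simp [hy])) hJ.2
    have hx : 0 < x.2.2 := hpos x (by simp)
    obtain ⟨T1, i1, e1⟩ := impl_stepCode hN hW hQ hm (bt x.1) x.2.1
      (p := sumSq J) (q := x.2.2 * x.2.2) (by positivity)
    refine ⟨_, i1.append i2, fun u hu => ?_⟩
    obtain ⟨a1, a2⟩ := e1 u hu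
    obtain ⟨b1, b2⟩ := e2 u hu
    refine ⟨?_, fun c hc => ?_⟩
    · rw [LinearMap.comp_apply, a1, map_add, map_smul, map_smul, List.map_cons, List.sum_cons, ← b1,
        b2 (bt x.1) fun y hy => hJ.1 y hy, smul_add, smul_smul, smul_smul, add_comm, sumSq_cons]
      have hR : (0 : ℝ) < (sumSq J : ℝ) + (x.2.2 * x.2.2 : ℕ) := by
        have : (0 : ℝ) < (x.2.2 * x.2.2 : ℕ) := by exact_mod_cast Nat.mul_pos hx hx
        positivity
      have k1 : √((x.2.2 * x.2.2 + sumSq J : ℕ) : ℝ) *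
          √((x.2.2 * x.2.2 : ℕ) / ((sumSq J : ℝ) + (x.2.2 * x.2.2 : ℕ))) = x.2.2 := by
        rw [← Real.sqrt_mul (by positivity), Nat.cast_add, add_comm, mul_div_cancel₀ _ hR.ne',
          Nat.cast_mul, Real.sqrt_mul_self (by positivity)]
      have k2 : √((x.2.2 * x.2.2 + sumSq J : ℕ) : ℝ) *
          √((sumSq J : ℝ) / ((sumSq J : ℝ) + (x.2.2 * x.2.2 : ℕ))) = √(sumSq J : ℝ) := by
        rw [← Real.sqrt_mul (by positivity), Nat.cast_add, add_comm, mul_div_cancel₀ _ hR.ne']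
      congr 2
      · rw [wt, ← k1]
        push_cast
        cases x.2.1 <;> simp
      · rw [← k2]; push_cast; rfl
    · rw [LinearMap.comp_apply, a2 c (hc x (by simp)), b2 c fun y hy => hc y (by simp [hy])]

/-- Preparation of the superposition of the items in one block. -/
def blockCode {α : Type} (W off m : ℕ) (bt : α → ℕ → Bool) (J : List (α × Bool × ℕ)) :
    List GateCode :=
  itemsCode W off m bt J ++ (notI W (wk W 8 0 0 0)).code

theorem impl_blockCode {α : Type} {W Q N off m : ℕ} (hN : W + Q ^ 4 ≤ N) (hW : off + m ≤ W)
    (hQ : 9 < Q) (hm : m + 2 < Q) (bt : α → ℕ → Bool) (J : List (α × Bool × ℕ))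
    (hpos : ∀ x ∈ J, 0 < x.2.2) (hJ : J.Pairwise fun x y => ∃ s < m, bt x.1 s ≠ bt y.1 s) :
    ∃ T, Impl N (blockCode W off m bt J) T ∧ ∀ u : ℕ → Bool, (∀ z, W ≤ z → u z = false) →
      (∀ s < m, u (off + s) = false) →
      (√(sumSq J : ℝ) : ℂ) • T (kt N u) =
        (J.map fun x => (wt x : ℂ) • kt N (setBlock off m u (bt x.1))).sum := by
  obtain ⟨T1, i1, e1⟩ := impl_itemsCode hN hW hQ hm bt J hpos hJ
  have hnot : (notI W (wk W 8 0 0 0)).WF N := notI_wf hN (by omega)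
    ((wk_lt (by omega) (by omega) (by omega) (by omega)).trans_le hN) (by simp)
  have hwf : ∀ g ∈ [notI W (wk W 8 0 0 0)], g.WF N := by simpa using hnot
  have i2 := impl_crun hwf
  rw [List.flatMap_singleton] at i2
  refine ⟨_, i1.append i2, fun u hu hu' => ?_⟩
  have h0 : prepVal W off m u (fun _ => false) false false = u := by
    funext z
    rw [prepVal]
    by_cases h9 : z = wk W 8 1 0 0
    · rw [h9, Function.update_self, hu _ (le_wk ..)]
    · rw [Function.update_of_ne h9]
      by_cases h8 : z = wk W 8 0 0 0
      · rw [h8, Function.update_self, hu _ (le_wk ..)]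
      · rw [Function.update_of_ne h8, setBlock]
        split_ifs with h
        · obtain ⟨s, rfl⟩ := Nat.exists_eq_add_of_le h.1
          exact (hu' s (by omega)).symm
        · rfl
  have h1 : ∀ c : ℕ → Bool, crun [notI W (wk W 8 0 0 0)] (prepVal W off m u c true false) =
      setBlock off m u c := by
    intro c
    have hz : ∀ {t i j b : ℕ}, setBlock off m u c (wk W t i j b) = false := fun {t i j b} => by
      have h := le_wk W t i j b
      rw [setBlock, if_neg (by omega), hu _ h]
    have hp : ∀ {i : ℕ}, prepVal W off m u c true false (wk W 0 0 0 i) = false :=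
      prepVal_wk hW hu (by simp) _ _ _
    rw [crun_cons, crun_nil]
    funext z
    by_cases h8 : z = wk W 8 0 0 0
    · subst h8
      simp [Instr.step, notI, prepVal_flag, hp, hz]
    · simp only [Instr.step, notI]
      rw [Function.update_of_ne h8, prepVal]
      by_cases h9 : z = wk W 8 1 0 0
      · rw [h9, Function.update_self, hz]
      · rw [Function.update_of_ne h9, Function.update_of_ne h8]
  have h2 := (e1 u hu).1
  rw [h0] at h2
  rw [LinearMap.comp_apply, ← map_smul, h2, map_list_sum, List.map_map]
  congr 1
  refine List.map_congr_left fun x _ => ?_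
  rw [Function.comp_apply, map_smul, funLeft_crun_kt hwf, h1]

/-! ### All blocks -/

/-- The concatenation of the strings of a tuple. -/
def tupVal {ι : Type} (m : ℕ) (bt : ι → ℕ → Bool) {c : ℕ} (τ : Fin c → ι) : ℕ → Bool :=
  fun z => if h : z / m < c then bt (τ ⟨z / m, h⟩) (z % m) else false

/-- Preparation of all blocks. -/
def blocksCode {α : Type} (W m : ℕ) (bt : α → ℕ → Bool) (J : List (α × Bool × ℕ)) (c : ℕ) :
    List GateCode :=
  (List.range c).flatMap fun j => blockCode W (j * m) m bt J

/-- Expansion of a product state: each block multiplies the number of branches by the number of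
items, and the coefficients multiply. The hypothesis `hB` trades the list of items for a sum over a
fixed finite type, in which items with weight zero may occur. -/
theorem impl_blocksCode {α ι : Type} [Fintype ι] {W Q N m : ℕ} (hN : W + Q ^ 4 ≤ N) (h0 : 0 < m)
    (hQ : 9 < Q) (hm : m + 2 < Q) (bt : α → ℕ → Bool) (J : List (α × Bool × ℕ))
    (hpos : ∀ x ∈ J, 0 < x.2.2) (hJ : J.Pairwise fun x y => ∃ s < m, bt x.1 s ≠ bt y.1 s)
    (bt' : ι → ℕ → Bool) (B : ι → ℝ)
    (hB : ∀ F : (ℕ → Bool) → State N,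
      (J.map fun x => (wt x : ℂ) • F (bt x.1)).sum = ∑ S, (B S : ℂ) • F (bt' S))
    {c : ℕ} (hW : c * m ≤ W) :
    ∃ T, Impl N (blocksCode W m bt J c) T ∧
      ((√(sumSq J : ℝ) : ℂ) ^ c) • T (kt N fun _ => false) =
        ∑ τ : Fin c → ι, ((∏ j, B (τ j) : ℝ) : ℂ) • kt N (tupVal m bt' τ) := by
  induction c with
  | zero =>
    refine ⟨_, Impl.nil N, ?_⟩
    have h : ∀ τ : Fin 0 → ι, tupVal m bt' τ = fun _ => false := fun τ => by
      funext z; simp [tupVal]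
    simp [h]
  | succ c ih =>
    rw [add_mul, one_mul] at hW
    obtain ⟨T1, i1, e1⟩ := ih (by omega)
    obtain ⟨T2, i2, e2⟩ := impl_blockCode hN hW hQ hm bt J hpos hJ
    have hcode : blocksCode W m bt J (c + 1) =
        blocksCode W m bt J c ++ blockCode W (c * m) m bt J := by
      rw [blocksCode, List.range_succ, List.flatMap_append, List.flatMap_singleton]; rfl
    rw [hcode]
    refine ⟨_, i1.append i2, ?_⟩
    rw [LinearMap.comp_apply, pow_succ', mul_smul, ← map_smul, e1, map_sum, Finset.smul_sum,
      ← (Fin.snocEquiv fun _ => ι).sum_comp, Fintype.sum_prod_type_right]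
    refine Finset.sum_congr rfl fun τ _ => ?_
    have hv : ∀ z, c * m ≤ z → tupVal m bt' τ z = false := fun z hz => by
      rw [tupVal, dif_neg]
      have := (Nat.le_div_iff_mul_le h0).2 hz
      omega
    have hB' := hB fun b => kt N (setBlock (c * m) m (tupVal m bt' τ) b)
    beta_reduce at hB'
    rw [map_smul, smul_comm, e2 _ (fun z hz => hv z (by omega)) fun s _ => hv _ (by omega), hB',
      Finset.smul_sum]
    refine Finset.sum_congr rfl fun S _ => ?_
    rw [smul_smul, Fin.prod_univ_castSucc]
    simp only [Fin.snocEquiv, Equiv.coe_fn_mk, Fin.snoc_castSucc, Fin.snoc_last]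
    rw [Complex.ofReal_mul]
    congr 2
    funext z
    rw [setBlock]
    split_ifs with h
    · have hd : z / m = c := by
        refine Nat.div_eq_of_lt_le h.1 ?_
        rw [Nat.succ_mul]
        exact h.2
      rw [tupVal, dif_pos (by omega)]
      have hl : (⟨z / m, by omega⟩ : Fin (c + 1)) = Fin.last c := Fin.ext hd
      rw [hl, Fin.snoc_last]
      congr 1
      have := Nat.div_add_mod z m
      rw [hd, mul_comm] at this
      omega
    · rw [tupVal, tupVal]
      by_cases hd : z / m < c
      · rw [dif_pos hd, dif_pos (by omega)]
        have hl : (⟨z / m, by omega⟩ : Fin (c + 1)) = Fin.castSucc ⟨z / m, hd⟩ := rfl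
        rw [hl, Fin.snoc_castSucc (α := fun _ => ι)]
      · rw [dif_neg hd, dif_neg]
        intro h'
        have hd' : z / m = c := by omega
        have h1 := Nat.div_add_mod z m
        have h2 := Nat.mod_lt z h0
        rw [hd', mul_comm] at h1
        omega

/-! ### Hadamard gates -/

/-- The description of the Hadamard matrix. -/
def hCode (a b : Bool) : EntryCode := .real (a && b) 1 2

/-- Hadamard gates on consecutive wires. -/
def hadsCode (base r : ℕ) : List GateCode := (List.range r).map fun s => .one (base + s) hCode

theorem hCode_unitary : codeMat hCode ∈ Matrix.unitaryGroup Bool ℂ := by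
  rw [Matrix.mem_unitaryGroup_iff]
  have h1 : √((1 : ℝ) / 2) * √((1 : ℝ) / 2) = 1 / 2 := Real.mul_self_sqrt (by norm_num)
  have h2 : (√((1 : ℝ) / 2) : ℂ) * √((1 : ℝ) / 2) = 1 / 2 := by rw [← Complex.ofReal_mul, h1]; norm_num
  ext a b
  simp only [Matrix.mul_apply, Fintype.sum_bool, codeMat, Matrix.star_apply, Matrix.of_apply,
    hCode, Matrix.one_apply, EntryCode.val_real, Nat.cast_one, Nat.cast_ofNat]
  generalize √((1 : ℝ) / 2) = P at *
  cases a <;> cases b <;>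
    simp only [RCLike.star_def, Complex.conj_ofReal, reduceCtorEq, if_true, if_false,
      Bool.and_true, Bool.and_false, Complex.ofReal_mul, Complex.ofReal_neg, Complex.ofReal_one,
      map_mul, map_neg, map_one] <;>
    first | linear_combination 2 * h2 | ring

/-- Only one row of the Hadamard transform is needed: the amplitude of the zero string is `2^(-r/2)`
for every initial content of the `r` wires. The other wires keep their values, so the amplitude
vanishes on strings that disagree there. -/
theorem impl_hadsCode {N base r : ℕ} (h : base + r ≤ N) :
    ∃ T, Impl N (hadsCode base r) T ∧ ∀ (v : ℕ → Bool) (x : Fin N → Bool),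
      ((∀ z : Fin N, (z < base ∨ base + r ≤ z) → x z = v z) →
        (∀ z : Fin N, base ≤ z → z < base + r → x z = false) →
        T (kt N v) x = (√((1 : ℝ) / 2) : ℂ) ^ r) ∧
      (∀ z : Fin N, (z < base ∨ base + r ≤ z) → x z ≠ v z → T (kt N v) x = 0) := by
  induction r with
  | zero =>
    refine ⟨_, Impl.nil N, fun v x => ⟨fun h1 h2 => ?_, fun z hz h1 => ?_⟩⟩
    · rw [LinearMap.id_apply, kt, ket, if_pos, pow_zero]
      funext z
      exact h1 z (by omega)
    · rw [LinearMap.id_apply, kt, ket, if_neg]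
      exact fun e => h1 (congrFun e z)
  | succ r ih =>
    obtain ⟨T1, i1, e1⟩ := ih (by omega)
    obtain ⟨T2, i2, e2⟩ := impl_one (show base + r < N by omega) hCode_unitary
    have hcode : hadsCode base (r + 1) = hadsCode base r ++ [.one (base + r) hCode] := by
      rw [hadsCode, List.range_succ, List.map_append]; rfl
    rw [hcode]
    refine ⟨_, i1.append i2, fun v x => ?_⟩
    rw [LinearMap.comp_apply, e2, Fintype.sum_bool]
    set i : Fin N := ⟨base + r, by omega⟩ with hi
    constructor
    · intro h1 h2
      have hxi : x i = false := h2 i (by simp [hi]) (by simp [hi])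
      have good : T1 (kt N v) (Function.update x i (v i)) = (√((1 : ℝ) / 2) : ℂ) ^ r := by
        refine (e1 _ _).1 (fun z hz => ?_) fun z hz hz' => ?_
        · by_cases hzi : z = i
          · rw [hzi, Function.update_self]
          · have : (z : ℕ) ≠ base + r := fun e => hzi (Fin.ext e)
            rw [Function.update_of_ne hzi]
            exact h1 z (by omega)
        · have : z ≠ i := fun e => by rw [e] at hz'; simp [hi] at hz'
          rw [Function.update_of_ne this]
          exact h2 z hz (by omega)
      have bad : T1 (kt N v) (Function.update x i (!v i)) = 0 := by
        refine (e1 _ _).2 i (by simp [hi]) ?_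
        rw [Function.update_self]
        cases v i <;> simp
      rw [hxi]
      simp only [hCode, EntryCode.val_real, Nat.cast_one, Nat.cast_ofNat, Bool.false_and]
      rw [pow_succ']
      cases hvi : v i <;> rw [hvi] at good bad
      · rw [good, show T1 (kt N v) (Function.update x i true) = 0 from bad]
        simp
      · rw [good, show T1 (kt N v) (Function.update x i false) = 0 from bad]
        simp
    · intro z hz hne
      have hzi : z ≠ i := fun e => by rw [e] at hz; simp [hi] at hz
      have bad : ∀ a, T1 (kt N v) (Function.update x i a) = 0 := fun a =>
        (e1 _ _).2 z (by omega) (by rwa [Function.update_of_ne hzi])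
      rw [bad, bad]
      simp

/-! ### The final flag -/

/-- The conjunction of the negations of the rank register and the collision flag. -/
def finChain (W l L M : ℕ) : List Instr :=
  chain W (wk W 10 0 0) (fun s => (l * L + s, true)) (l * M + 1)

/-- The flag is flipped unless the rank register and the collision flag are zero. -/
def finCirc (W l L M : ℕ) : List Instr :=
  finChain W l L M ++ [addI W (l * L + (l * M + 2)) (wk W 10 0 0 (l * M + 1)) true] ++
    (finChain W l L M).reverse

theorem finChain_wf {W Q N l L M : ℕ} (hN : W + Q ^ 4 ≤ N) (hW : l * L + (l * M + 3) ≤ W)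
    (hQ : 10 < Q) (hM : l * M + 2 < Q) : ∀ g ∈ finChain W l L M, g.WF N := by
  have hw : ∀ {t i j b : ℕ}, t < Q → i < Q → j < Q → b < Q → wk W t i j b < N :=
    fun h1 h2 h3 h4 => (wk_lt h1 h2 h3 h4).trans_le hN
  exact chain_wf hN (by omega) (fun a b e => (wk_inj.1 e).2.2.2)
    (fun s hs => hw (by omega) (by omega) (by omega) (by omega)) (by simp)
    (fun s hs => by dsimp only; omega)
    (fun s hs s' => (wk_ne (by dsimp only; omega)).symm)

theorem finCirc_wf {W Q N l L M : ℕ} (hN : W + Q ^ 4 ≤ N) (hW : l * L + (l * M + 3) ≤ W)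
    (hQ : 10 < Q) (hM : l * M + 2 < Q) : ∀ g ∈ finCirc W l L M, g.WF N := by
  have hA := finChain_wf hN hW hQ hM
  intro g hg
  simp only [finCirc, List.mem_append, List.mem_reverse, List.mem_singleton] at hg
  rcases hg with (hg | rfl) | hg
  · exact hA g hg
  · exact addI_wf hN (by omega) (by omega)
      ((wk_lt (by omega) (by omega) (by omega) (by omega)).trans_le hN)
      (wk_ne (by omega)).symm (wk_ne (by omega)).symm (by simp)
  · exact hA g hg

theorem crun_finCirc {W Q l L M : ℕ} (hW : l * L + (l * M + 3) ≤ W) (hQ : 10 < Q)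
    (hM : l * M + 2 < Q) {v : ℕ → Bool} (hv : ∀ z, W ≤ z → v z = false) :
    crun (finCirc W l L M) v = Function.update v (l * L + (l * M + 2))
      (v (l * L + (l * M + 2)) ^^ !decide (∀ s ≤ l * M, v (l * L + s) = false)) := by
  have hA : Avoids (fun z => z = l * L + (l * M + 2)) (finChain W l L M) := by
    intro g hg
    simp only [finChain, chain, List.mem_cons, List.mem_map, List.mem_range] at hg
    rcases hg with rfl | ⟨s, hs, rfl⟩
    · exact ⟨wk_ne (by omega), wk_ne (by omega), wk_ne (by omega)⟩
    · exact ⟨wk_ne (by omega), wk_ne (by omega), by dsimp only; omega⟩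
  have hC : Layer (fun z => z = l * L + (l * M + 2))
      [addI W (l * L + (l * M + 2)) (wk W 10 0 0 (l * M + 1)) true] := by
    intro g hg
    rw [List.mem_singleton] at hg
    subst hg
    exact ⟨rfl, wk_ne (by omega), wk_ne (by omega)⟩
  have hch := crun_chain (W := W) (base := wk W 10 0 0) (f := fun s => (l * L + s, true))
    (m := l * M + 1) (v := v) (fun a b e => (wk_inj.1 e).2.2.2)
    (fun b => hv _ (le_wk ..)) (fun s hs s' => (wk_ne (by dsimp only; omega)).symm)
    (hv _ (le_wk ..)) (hv _ (le_wk ..))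
  have h1 : crun (finChain W l L M) v (wk W 10 0 0 (l * M + 1)) =
      decide (∀ s ≤ l * M, v (l * L + s) = false) := by
    rw [finChain, (hch _).2 _ le_rfl rfl, Bool.eq_iff_iff, List.all_eq_true, decide_eq_true_iff]
    simp
  have h2 : crun (finChain W l L M) v (wk W 0 0 0 0) = false := by
    rw [finChain, (hch _).1 (by simp)]
    exact hv _ (le_wk ..)
  funext z
  rw [finCirc, crun_conj (N := W + Q ^ 4) (finChain_wf le_rfl hW hQ hM) hA hC]
  by_cases hz : z = l * L + (l * M + 2)
  · subst hz
    rw [Function.update_self]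
    simp [xs_cons, xs_nil, addI, Instr.term, h1, h2]
  · rw [Function.update_of_ne hz, xs_eq_false (by simpa [addI] using Ne.symm hz), Bool.xor_false]

/-- On strings with clean work wires the circuit flips the last flag according to bits it leaves
unchanged. It is thus an involution there, and its inverse has the same description. -/
theorem crun_finCirc_reverse {W Q l L M : ℕ} (hW : l * L + (l * M + 3) ≤ W) (hQ : 10 < Q)
    (hM : l * M + 2 < Q) {v : ℕ → Bool} (hv : ∀ z, W ≤ z → v z = false) :
    crun (finCirc W l L M).reverse v = Function.update v (l * L + (l * M + 2))
      (v (l * L + (l * M + 2)) ^^ !decide (∀ s ≤ l * M, v (l * L + s) = false)) := by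
  rw [← crun_finCirc hW hQ hM hv]
  have h : crun (finCirc W l L M) (crun (finCirc W l L M) v) = v := by
    have hv' : ∀ z, W ≤ z → crun (finCirc W l L M) v z = false := fun z hz => by
      rw [crun_finCirc hW hQ hM hv, Function.update_of_ne (by omega), hv z hz]
    rw [crun_finCirc hW hQ hM hv', crun_finCirc hW hQ hM hv]
    have h' : ∀ s ≤ l * M, ∀ a, Function.update v (l * L + (l * M + 2)) a (l * L + s) =
        v (l * L + s) := fun s hs a => Function.update_of_ne (by omega) _ _
    rw [Function.update_idem, Function.update_self]
    have h'' : decide (∀ s ≤ l * M, Function.update v (l * L + (l * M + 2))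
        (v (l * L + (l * M + 2)) ^^ !decide (∀ s ≤ l * M, v (l * L + s) = false)) (l * L + s) = false) =
        decide (∀ s ≤ l * M, v (l * L + s) = false) := by
      congr 1
      exact propext (forall₂_congr fun s hs => by rw [h' s hs])
    rw [h'']
    simp
  conv_lhs => rw [← h]
  exact crun_reverse (N := W + Q ^ 4) (finCirc_wf le_rfl hW hQ hM) _

/-! ### Tuples of scopes -/

/-- The `i`-th smallest element of a set. -/
def elt {n : ℕ} (S : Finset (Fin n)) (i : ℕ) : ℕ := ((S.sort (· ≤ ·)).map Fin.val).getD i 0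

theorem elt_eq {n : ℕ} {S : Finset (Fin n)} {i : ℕ} (hi : i < S.card) :
    elt S i = S.orderEmbOfFin rfl ⟨i, hi⟩ := by
  rw [elt, List.getD_eq_getElem _ _ (by simpa using hi), List.getElem_map, Finset.orderEmbOfFin_apply]
  rfl

theorem elt_lt_elt {n : ℕ} {S : Finset (Fin n)} {i j : ℕ} (hij : i < j) (hj : j < S.card) :
    elt S i < elt S j := by
  rw [elt_eq hj, elt_eq (hij.trans hj)]
  exact (S.orderEmbOfFin rfl).strictMono hij

theorem elt_injOn {n : ℕ} (S : Finset (Fin n)) {i j : ℕ} (hi : i < S.card) (hj : j < S.card)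
    (h : elt S i = elt S j) : i = j := by
  rcases lt_trichotomy i j with h' | h' | h'
  · have := elt_lt_elt h' hj; omega
  · exact h'
  · have := elt_lt_elt h' hi; omega

theorem exists_elt {n : ℕ} {S : Finset (Fin n)} {i : ℕ} (hi : i < S.card) :
    ∃ x ∈ S, elt S i = x.val := ⟨_, S.orderEmbOfFin_mem rfl ⟨i, hi⟩, elt_eq hi⟩

theorem exists_eq_elt {n : ℕ} {S : Finset (Fin n)} {x : Fin n} (hx : x ∈ S) :
    ∃ i < S.card, elt S i = x.val := by
  have : x ∈ Set.range (S.orderEmbOfFin rfl) := by rw [Finset.range_orderEmbOfFin]; exact hx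
  obtain ⟨i, rfl⟩ := this
  exact ⟨i, i.2, elt_eq i.2⟩

theorem elt_lt {n : ℕ} {S : Finset (Fin n)} {i : ℕ} (hi : i < S.card) : elt S i < n := by
  obtain ⟨x, -, h⟩ := exists_elt hi
  rw [h]; exact x.2

variable {n k c : ℕ}

/-- The elements of the sets of a tuple, in order. -/
def seqOf (τ : Fin c → Scope n k) (i : ℕ) : ℕ :=
  if h : i / k < c then elt (τ ⟨i / k, h⟩).1 (i % k) else 0

/-- The sets of a tuple are pairwise disjoint. -/
def DisjTuple (τ : Fin c → Scope n k) : Prop := Pairwise fun i j => Disjoint (τ i).1 (τ j).1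

/-- The union of a tuple of sets. -/
def unionOf (τ : Fin c → Scope n k) : Finset (Fin n) := Finset.univ.biUnion fun j => (τ j).1

theorem DisjTuple.card_unionOf {τ : Fin c → Scope n k} (h : DisjTuple τ) :
    (unionOf τ).card = c * k := by
  rw [unionOf, Finset.card_biUnion fun i _ j _ hij => h hij, Finset.sum_congr rfl fun i _ => (τ i).2]
  simp

theorem seqOf_add (hk : 0 < k) (τ : Fin c → Scope n k) (j : Fin c) {p : ℕ} (hp : p < k) :
    seqOf τ (j * k + p) = elt (τ j).1 p := by
  have h1 : (j * k + p) / k = j := by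
    rw [add_comm, Nat.add_mul_div_right _ _ hk, Nat.div_eq_of_lt hp, zero_add]
  have h2 : (j * k + p) % k = p := by
    rw [add_comm, Nat.add_mul_mod_self_right, Nat.mod_eq_of_lt hp]
  simp only [seqOf, h1, h2, j.2, dif_pos]

theorem exists_seqOf (hk : 0 < k) {i : ℕ} (hi : i < c * k) :
    ∃ (j : Fin c) (p : ℕ), p < k ∧ i = j * k + p :=
  ⟨⟨i / k, by rw [Nat.div_lt_iff_lt_mul hk]; exact hi⟩, i % k, Nat.mod_lt _ hk,
    (Nat.div_add_mod' i k).symm⟩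

theorem seqOf_lt (hk : 0 < k) (τ : Fin c → Scope n k) {i : ℕ} (hi : i < c * k) : seqOf τ i < n := by
  obtain ⟨j, p, hp, rfl⟩ := exists_seqOf hk hi
  rw [seqOf_add hk τ j hp]
  exact elt_lt (by rw [(τ j).2]; exact hp)

theorem seqOf_injOn (hk : 0 < k) (τ : Fin c → Scope n k) :
    Set.InjOn (seqOf τ) (Finset.range (c * k)) ↔ DisjTuple τ := by
  constructor
  · intro h i j hij
    rw [Finset.disjoint_left]
    intro x hx hx'
    obtain ⟨p, hp, e⟩ := exists_eq_elt hx
    obtain ⟨q, hq, e'⟩ := exists_eq_elt hx'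
    rw [(τ _).2] at hp hq
    have := h (Finset.mem_coe.2 (Finset.mem_range.2 (idx_lt i.2 hp)))
      (Finset.mem_coe.2 (Finset.mem_range.2 (idx_lt j.2 hq)))
      (by rw [seqOf_add hk τ i hp, seqOf_add hk τ j hq, e, e'])
    have h2 := congrArg (· / k) this
    simp only [mul_comm _ k, Nat.mul_add_div hk, Nat.div_eq_of_lt hp, Nat.div_eq_of_lt hq,
      add_zero] at h2
    exact hij (Fin.ext h2)
  · intro h a ha b hb hab
    rw [Finset.mem_coe, Finset.mem_range] at ha hb
    obtain ⟨i, p, hp, rfl⟩ := exists_seqOf hk ha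
    obtain ⟨j, q, hq, rfl⟩ := exists_seqOf hk hb
    rw [seqOf_add hk τ i hp, seqOf_add hk τ j hq] at hab
    by_cases hij : i = j
    · subst hij
      rw [elt_injOn _ (by rw [(τ i).2]; exact hp) (by rw [(τ i).2]; exact hq) hab]
    · obtain ⟨x, hx, e⟩ := exists_elt (S := (τ i).1) (i := p) (by rw [(τ i).2]; exact hp)
      obtain ⟨y, hy, e'⟩ := exists_elt (S := (τ j).1) (i := q) (by rw [(τ j).2]; exact hq)
      rw [e, e'] at hab
      rw [Fin.ext hab] at hx
      exact absurd hy (Finset.disjoint_left.1 (h hij) hx)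

theorem image_seqOf (hk : 0 < k) (τ : Fin c → Scope n k) :
    (Finset.range (c * k)).image (seqOf τ) = (unionOf τ).image Fin.val := by
  ext a
  simp only [Finset.mem_image, Finset.mem_range, unionOf, Finset.mem_biUnion, Finset.mem_univ,
    true_and]
  constructor
  · rintro ⟨i, hi, rfl⟩
    obtain ⟨j, p, hp, rfl⟩ := exists_seqOf hk hi
    obtain ⟨x, hx, e⟩ := exists_elt (S := (τ j).1) (i := p) (by rw [(τ j).2]; exact hp)
    exact ⟨x, ⟨j, hx⟩, by rw [seqOf_add hk τ j hp, e]⟩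
  · rintro ⟨x, ⟨j, hx⟩, rfl⟩
    obtain ⟨p, hp, e⟩ := exists_eq_elt hx
    rw [(τ j).2] at hp
    exact ⟨j * k + p, idx_lt j.2 hp, by rw [seqOf_add hk τ j hp, e]⟩

theorem card_filter_lt_image {s : ℕ → ℕ} {A : Finset ℕ} (hs : Set.InjOn s A) (a : ℕ) :
    (A.filter fun j => s j < a).card = ((A.image s).filter fun b => b < a).card := by
  rw [Finset.filter_image, Finset.card_image_of_injOn]
  exact hs.mono fun x hx => (Finset.mem_filter.1 hx).1

/-- For a disjoint tuple the listed numbers are exactly the elements of the union, each once. Hence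
the number of list entries below a given one equals its position in the sorted union. -/
theorem elt_rankOf (hk : 0 < k) {τ : Fin c → Scope n k} (h : DisjTuple τ) {i : ℕ}
    (hi : i < c * k) : elt (unionOf τ) (rankOf (seqOf τ) (c * k) i) = seqOf τ i := by
  have hm : seqOf τ i ∈ (unionOf τ).image Fin.val := by
    rw [← image_seqOf hk]
    exact Finset.mem_image_of_mem _ (Finset.mem_range.2 hi)
  obtain ⟨x, hx, e⟩ := Finset.mem_image.1 hm
  obtain ⟨r, hr, e'⟩ := exists_eq_elt hx
  rw [h.card_unionOf] at hr
  rw [← e, ← e']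
  congr 1
  have hinj : Set.InjOn (elt (unionOf τ)) (Finset.range (c * k)) := by
    intro a ha b hb hab
    rw [Finset.mem_coe, Finset.mem_range] at ha hb
    exact elt_injOn _ (by rwa [h.card_unionOf]) (by rwa [h.card_unionOf]) hab
  have him : (Finset.range (c * k)).image (elt (unionOf τ)) = (unionOf τ).image Fin.val := by
    ext a
    simp only [Finset.mem_image, Finset.mem_range]
    constructor
    · rintro ⟨i, hi, rfl⟩
      obtain ⟨x, hx, e⟩ := exists_elt (S := unionOf τ) (i := i) (by rwa [h.card_unionOf])
      exact ⟨x, hx, e.symm⟩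
    · rintro ⟨x, hx, rfl⟩
      obtain ⟨p, hp, e⟩ := exists_eq_elt hx
      exact ⟨p, by rwa [h.card_unionOf] at hp, e⟩
  rw [rankOf, card_filter_lt_image ((seqOf_injOn hk τ).2 h), image_seqOf hk, ← him,
    ← card_filter_lt_image hinj, ← e, ← e']
  have : ((Finset.range (c * k)).filter fun j => elt (unionOf τ) j < elt (unionOf τ) r) =
      Finset.range r := by
    ext j
    rw [Finset.mem_filter, Finset.mem_range, Finset.mem_range]
    constructor
    · rintro ⟨hj, hlt⟩
      by_contra! hle
      rcases hle.eq_or_lt with rfl | hlt'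
      · omega
      · have := elt_lt_elt (S := unionOf τ) hlt' (by rwa [h.card_unionOf])
        omega
    · intro hj
      exact ⟨by omega, elt_lt_elt hj (by rwa [h.card_unionOf])⟩
  rw [this, Finset.card_range]

theorem tupVal_seqOf {L : ℕ} (hk : 0 < k) (hL : 0 < L) (τ : Fin c → Scope n k) {i b : ℕ}
    (hi : i < c * k) (hb : b < L) :
    tupVal (k * L) (fun S : Scope n k => fun s => (elt S.1 (s / L)).testBit (s % L)) τ (i * L + b) =
      (seqOf τ i).testBit b := by
  obtain ⟨j, p, hp, rfl⟩ := exists_seqOf hk hi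
  have h0 : p * L + b < k * L := idx_lt hp hb
  have h : (j * k + p) * L + b = k * L * j + (p * L + b) := by ring
  have h1 : ((j * k + p) * L + b) / (k * L) = j := by
    rw [h, Nat.mul_add_div (by positivity), Nat.div_eq_of_lt h0, add_zero]
  have h2 : ((j * k + p) * L + b) % (k * L) = p * L + b := by
    rw [h, Nat.mul_add_mod, Nat.mod_eq_of_lt h0]
  have h3 : (p * L + b) / L = p := by
    rw [mul_comm, Nat.mul_add_div hL, Nat.div_eq_of_lt hb, add_zero]
  have h4 : (p * L + b) % L = b := by
    rw [mul_comm, Nat.mul_add_mod, Nat.mod_eq_of_lt hb]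
  rw [tupVal, dif_pos (by rw [h1]; exact j.2), seqOf_add hk τ j hp]
  simp only [h1, h2, h3, h4]

theorem tupVal_eq_false {L : ℕ} (hk : 0 < k) (hL : 0 < L) (f : Scope n k → ℕ → Bool)
    (τ : Fin c → Scope n k) {z : ℕ} (hz : c * k * L ≤ z) : tupVal (k * L) f τ z = false := by
  rw [tupVal, dif_neg]
  rw [not_lt, Nat.le_div_iff_mul_le (by positivity), ← mul_assoc]
  exact hz

/-! ### Ordered and unordered partitions -/

theorem mem_partitions {T : Finset (Fin n)} {P : Finset (Finset (Fin n))} :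
    P ∈ partitions k T ↔ (∀ S ∈ P, S ⊆ T ∧ S.card = k) ∧
      (P : Set (Finset (Fin n))).PairwiseDisjoint id ∧ P.sup id = T := by
  classical
  simp only [partitions, Finset.mem_filter, Finset.mem_powerset, Finset.subset_iff (s₁ := P),
    Finset.mem_powersetCard]

theorem card_of_mem_partitions (hk : 0 < k) {T : Finset (Fin n)} {P : Finset (Finset (Fin n))}
    (hT : T.card = c * k) (hP : P ∈ partitions k T) : P.card = c := by
  classical
  obtain ⟨h1, h2, h3⟩ := mem_partitions.1 hP
  have : T.card = P.card * k := by
    rw [← h3, Finset.sup_eq_biUnion, Finset.card_biUnion fun a ha b hb hab => h2 ha hb hab]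
    exact Finset.sum_const_nat fun S hS => (h1 S hS).2
  rw [hT] at this
  exact (Nat.eq_of_mul_eq_mul_right hk this).symm

/-- Sending a tuple to its set of members, the fibre over each partition of `T` consists of its `c!`
orderings. The members of a disjoint tuple are distinct because `k > 0` makes them nonempty. -/
theorem sum_disjTuple (hk : 0 < k) (T : Finset (Fin n)) (hT : T.card = c * k)
    (B : Finset (Fin n) → ℝ) [DecidablePred fun τ : Fin c → Scope n k => DisjTuple τ ∧ unionOf τ = T] :
    ∑ τ : Fin c → Scope n k with DisjTuple τ ∧ unionOf τ = T, ∏ j, B (τ j).1 =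
      c.factorial * ∑ P ∈ partitions k T, ∏ S ∈ P, B S := by
  classical
  set im : (Fin c → Scope n k) → Finset (Finset (Fin n)) := fun τ =>
    Finset.univ.image fun j => (τ j).1 with him
  have hinj : ∀ τ : Fin c → Scope n k, DisjTuple τ → Function.Injective fun j => (τ j).1 := by
    intro τ h i j hij
    by_contra hne
    have hd : Disjoint (τ i).1 (τ j).1 := h hne
    dsimp only at hij
    rw [hij, disjoint_self] at hd
    have := (τ j).2
    rw [show (τ j).1 = ∅ from hd, Finset.card_empty] at this
    omega
  have hmaps : ∀ τ ∈ Finset.univ.filter (fun τ : Fin c → Scope n k => DisjTuple τ ∧ unionOf τ = T),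
      im τ ∈ partitions k T := by
    intro τ hτ
    obtain ⟨h, hu⟩ := (Finset.mem_filter.1 hτ).2
    rw [mem_partitions]
    refine ⟨?_, ?_, ?_⟩
    · intro S hS
      obtain ⟨j, -, rfl⟩ := Finset.mem_image.1 hS
      exact ⟨hu ▸ Finset.subset_biUnion_of_mem (fun j => (τ j).1) (Finset.mem_univ j), (τ j).2⟩
    · intro S hS S' hS' hne
      obtain ⟨j, -, rfl⟩ := Finset.mem_image.1 (Finset.mem_coe.1 hS)
      obtain ⟨j', -, rfl⟩ := Finset.mem_image.1 (Finset.mem_coe.1 hS')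
      exact h fun e => hne (by rw [e])
    · rw [Finset.sup_image, Finset.sup_eq_biUnion, ← hu]; rfl
  rw [← Finset.sum_fiberwise_of_maps_to hmaps, Finset.mul_sum]
  refine Finset.sum_congr rfl fun P hP => ?_
  have hcard := card_of_mem_partitions hk hT hP
  obtain ⟨h1, h2, h3⟩ := mem_partitions.1 hP
  have e0 : Fin c ≃ {S // S ∈ P} := (finCongr hcard.symm).trans P.equivFin.symm
  have hprod : ∀ τ : Fin c → Scope n k, DisjTuple τ → im τ = P →
      ∏ j, B (τ j).1 = ∏ S ∈ P, B S := by
    intro τ h hP'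
    rw [← hP', him, Finset.prod_image fun i _ j _ hij => hinj τ h hij]
  rw [Finset.sum_congr rfl (g := fun _ => ∏ S ∈ P, B S), Finset.sum_const, nsmul_eq_mul]
  swap
  · intro τ hτ
    rw [Finset.mem_filter, Finset.mem_filter] at hτ
    exact hprod τ hτ.1.2.1 hτ.2
  congr 2
  have hc : c.factorial = (Finset.univ : Finset (Equiv.Perm (Fin c))).card := by
    rw [Finset.card_univ, Fintype.card_perm, Fintype.card_fin]
  rw [hc]
  symm
  refine Finset.card_bij (fun (σ : Equiv.Perm (Fin c)) _ => fun j =>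
    (⟨(e0 (σ j)).1, (h1 _ (e0 (σ j)).2).2⟩ : Scope n k)) ?_ ?_ ?_
  · intro σ _
    have himg : im (fun j => (⟨(e0 (σ j)).1, (h1 _ (e0 (σ j)).2).2⟩ : Scope n k)) = P := by
      ext S
      rw [him, Finset.mem_image]
      constructor
      · rintro ⟨j, -, rfl⟩
        exact (e0 (σ j)).2
      · intro hS
        exact ⟨σ.symm (e0.symm ⟨S, hS⟩), Finset.mem_univ _, by simp⟩
    rw [Finset.mem_filter, Finset.mem_filter]
    refine ⟨⟨Finset.mem_univ _, ?_, ?_⟩, himg⟩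
    · intro i j hij
      refine h2 (e0 (σ i)).2 (e0 (σ j)).2 fun e => hij ?_
      exact σ.injective (e0.injective (Subtype.ext e))
    · refine (Finset.sup_eq_biUnion _ _).symm.trans (Eq.trans ?_ h3)
      conv_rhs => rw [← himg, him, Finset.sup_image]
      rfl
  · intro σ _ σ' _ h
    ext j
    have := congrArg Subtype.val (congrFun h j)
    exact congrArg Fin.val (e0.injective (Subtype.ext this))
  · intro τ hτ
    rw [Finset.mem_filter, Finset.mem_filter] at hτ
    obtain ⟨⟨-, h, -⟩, hP'⟩ := hτ
    have hmem : ∀ j, (τ j).1 ∈ P := fun j => hP' ▸ Finset.mem_image_of_mem _ (Finset.mem_univ j)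
    have hi : Function.Injective fun j => e0.symm ⟨(τ j).1, hmem j⟩ := by
      intro i j hij
      have h' := congrArg Subtype.val (e0.symm.injective hij)
      exact hinj τ h h'
    refine ⟨Equiv.ofBijective _ (Finite.injective_iff_bijective.1 hi), Finset.mem_univ _, ?_⟩
    funext j
    apply Subtype.ext
    simp

/-! ### The preparation circuit -/

theorem sum_disjTuple_mul {n k c : ℕ} (hk : 0 < k) (I : KXor n k)
    [DecidablePred fun τ : Fin c → Scope n k => DisjTuple τ] (f : Finset (Fin n) → ℂ) :
    ∑ τ : Fin c → Scope n k with DisjTuple τ,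
        ((∏ j, (coeff I (τ j).1 : ℝ) : ℝ) : ℂ) * f (unionOf τ) =
      ∑ T ∈ (Finset.univ : Finset (Fin n)).powersetCard (c * k),
        ((c.factorial * guideCoeff I T : ℝ) : ℂ) * f T := by
  classical
  rw [← Finset.sum_fiberwise_of_maps_to (g := unionOf)
    (t := (Finset.univ : Finset (Fin n)).powersetCard (c * k))]
  · refine Finset.sum_congr rfl fun T hT => ?_
    rw [guideCoeff, ← sum_disjTuple hk T (Finset.mem_powersetCard.1 hT).2, Finset.filter_filter,
      Complex.ofReal_sum, Finset.sum_mul]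
    refine Finset.sum_congr rfl fun τ hτ => ?_
    rw [(Finset.mem_filter.1 hτ).2.2]
  · intro τ hτ
    exact Finset.mem_powersetCard.2 ⟨Finset.subset_univ _, (Finset.mem_filter.1 hτ).2.card_unionOf⟩

/-- The preparation circuit for the items `J`. -/
def mainCode {α : Type} (W k l L M : ℕ) (bt : α → ℕ → Bool) (J : List (α × Bool × ℕ)) (c : ℕ) :
    List GateCode :=
  blocksCode W (k * L) bt J c ++ ((sortCirc W l L M).flatMap Instr.code ++
    (hadsCode (l * L) (l * M) ++ (finCirc W l L M).flatMap Instr.code))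

/-- The bits of a scope. -/
def scopeBits {n k : ℕ} (L : ℕ) (S : Scope n k) (s : ℕ) : Bool := (elt S.1 (s / L)).testBit (s % L)

/-- These are the only facts about a sorted branch that matter. The content of the rank register is
left open on purpose, because the Hadamard gates treat all contents alike. -/
theorem crun_sortCirc_tupVal {n k c W Q : ℕ} {L M : ℕ} (hk : 0 < k) (hL : 0 < L)
    (hW : c * k * L + (c * k * M + 3) ≤ W) (hQ : 8 < Q) (hl : c * k + 2 < Q) (hLQ : L + 2 < Q)
    (hM : M + 2 < Q) (hnL : n ≤ 2 ^ L) (hlM : c * k ≤ 2 ^ M) (τ : Fin c → Scope n k) :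
    (DisjTuple τ → (∀ z < c * k * L, crun (sortCirc W (c * k) L M) (tupVal (k * L) (scopeBits L) τ) z =
        (elt (unionOf τ) (z / L)).testBit (z % L)) ∧
      ∀ z, c * k * L + c * k * M ≤ z →
        crun (sortCirc W (c * k) L M) (tupVal (k * L) (scopeBits L) τ) z = false) ∧
    (¬ DisjTuple τ → crun (sortCirc W (c * k) L M) (tupVal (k * L) (scopeBits L) τ)
        (c * k * L + c * k * M) = true) ∧
    ∀ z, c * k * L + c * k * M < z →
        crun (sortCirc W (c * k) L M) (tupVal (k * L) (scopeBits L) τ) z = false := by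
  have h0 : ∀ z, c * k * L ≤ z → tupVal (k * L) (scopeBits L) τ z = false := fun z hz =>
    tupVal_eq_false hk hL _ τ hz
  have h := crun_sortCirc (s := seqOf τ) (y := elt (unionOf τ)) hW hQ hl hLQ hM hlM h0
    (fun i hi => (seqOf_lt hk τ hi).trans_le hnL)
    (fun i hi b hb => tupVal_seqOf hk hL τ hi hb)
    (fun hi i hi' => elt_rankOf hk ((seqOf_injOn hk τ).1 hi) hi')
  by_cases hd : DisjTuple τ
  · rw [if_pos ((seqOf_injOn hk τ).2 hd)] at h
    rw [h]
    refine ⟨fun _ => ⟨fun z hz => if_pos hz, fun z hz => ?_⟩, fun h => absurd hd h, fun z hz => ?_⟩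
    all_goals
      dsimp only
      rw [if_neg (by omega), if_neg (by omega)]
  · rw [if_neg fun h' => hd ((seqOf_injOn hk τ).1 h')] at h
    rw [h]
    refine ⟨fun h => absurd h hd, fun _ => Function.update_self .., fun z hz => ?_⟩
    rw [Function.update_of_ne (by omega), h0 z (by omega)]

/-- The amplitude at `|T⟩|0…0⟩` collects the coefficients of all disjoint tuples with union `T`,
each with the same factor. This is `c!` times the coordinate of the guiding vector, times
`2^(-lM/2)` from the Hadamard gates and the normalization of the `c` blocks; `β` is the resulting
multiple of the unit vector. The bounds involving `Q` ensure that all work wires exist. -/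
theorem prepares_mainCode {α : Type} {n k c w Q : ℕ} (I : KXor n k) (hk : 0 < k)
    (hL : 0 < bitLen n) (hw : Q ^ 4 ≤ w) (hQ : 10 < Q) (hl : c * k + 2 < Q) (hLQ : bitLen n + 2 < Q)
    (hM : bitLen (c * k) + 2 < Q) (hlL : c * k * bitLen n < Q) (hlM : c * k * bitLen (c * k) + 2 < Q)
    (hkL : k * bitLen n + 2 < Q) (bt : α → ℕ → Bool) (J : List (α × Bool × ℕ))
    (hpos : ∀ x ∈ J, 0 < x.2.2)
    (hJ : J.Pairwise fun x y => ∃ s < k * bitLen n, bt x.1 s ≠ bt y.1 s)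
    (hB : ∀ F : (ℕ → Bool) → State (width n (c * k) w),
      (J.map fun x => (wt x : ℂ) • F (bt x.1)).sum =
        ∑ S : Scope n k, (((coeff I S.1 : ℤ) : ℝ) : ℂ) • F (scopeBits (bitLen n) S))
    (hR : 0 < sumSq J) (hg : guideNorm (c * k) I ≠ 0) :
    ∃ G : List (Gate (width n (c * k) w)),
      List.Forall₂ GateCode.Denotes
        (mainCode (c * k * bitLen n + (c * k * bitLen (c * k) + 3)) k (c * k) (bitLen n)
          (bitLen (c * k)) bt J c) G ∧
      Prepares (c * k) I w G (c.factorial * guideNorm (c * k) I *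
        √((1 : ℝ) / 2) ^ (c * k * bitLen (c * k)) / √(sumSq J : ℝ) ^ c) := by
  classical
  set L := bitLen n with hLdef
  set l := c * k with hldef
  set M := bitLen l with hMdef
  set W := l * L + (l * M + 3) with hWdef
  have hN : W + Q ^ 4 ≤ width n l w := by
    change l * L + (l * M + 3) + Q ^ 4 ≤ l * L + (l * M + 2 + 1) + w
    omega
  have hWN : W ≤ width n l w := le_trans (by omega) hN
  have hnL : n ≤ 2 ^ L := Nat.le_pow_clog (by norm_num) n
  have hlM' : l ≤ 2 ^ M := Nat.le_pow_clog (by norm_num) l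
  set N := width n l w with hNdef
  obtain ⟨T1, i1, e1⟩ := impl_blocksCode hN (Nat.mul_pos hk hL) (by omega) hkL bt J hpos hJ
    (scopeBits L) (fun S => ((coeff I S.1 : ℤ) : ℝ)) hB (c := c)
    (by rw [← mul_assoc]; change l * L ≤ W; omega)
  have wf2 : ∀ g ∈ sortCirc W l L M, g.WF N :=
    sortCirc_wf hN le_rfl (by omega) hl hLQ hM hlL
  have i2 := impl_crun wf2
  obtain ⟨T3, i3, e3⟩ := impl_hadsCode (N := N) (base := l * L) (r := l * M) (by omega)
  have wf4 : ∀ g ∈ finCirc W l L M, g.WF N := finCirc_wf hN le_rfl (by omega) hlM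
  have i4 := impl_crun wf4
  obtain ⟨G, hG, hG'⟩ := i1.append (i2.append (i3.append i4))
  refine ⟨G, hG, hg, ?_⟩
  set v : (Fin c → Scope n k) → ℕ → Bool := fun τ =>
    crun (sortCirc W l L M) (tupVal (k * L) (scopeBits L) τ) with hv
  have hvs := fun τ : Fin c → Scope n k => crun_sortCirc_tupVal (W := W) (Q := Q) (L := L) (M := M)
    hk hL le_rfl (by omega) hl hLQ hM hnL hlM' τ
  -- `Φ` is the state before the last flag is computed, without its normalization. The last circuit
  -- permutes basis strings, so the output is read off from `Φ` at the preimage.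
  set Φ : State N := ∑ τ : Fin c → Scope n k,
    ((∏ j, ((coeff I (τ j).1 : ℤ) : ℝ) : ℝ) : ℂ) • T3 (kt N (v τ)) with hΦ
  set γ : ℂ := (√(sumSq J : ℝ) : ℂ) ^ c with hγ
  have hγ0 : γ ≠ 0 := by
    refine pow_ne_zero _ ?_
    rw [Ne, Complex.ofReal_eq_zero]
    exact (Real.sqrt_pos.2 (by exact_mod_cast hR)).ne'
  have hout : ∀ x, circuitOutput G x = γ⁻¹ * Φ (restr N (crun (finCirc W l L M).reverse (ext x))) := by
    intro x
    have h1 : γ • circuitOutput G =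
        LinearMap.funLeft ℂ ℂ (fun x => restr N (crun (finCirc W l L M).reverse (ext x))) Φ := by
      rw [circuitOutput, hG', show zeros N = kt N fun _ => false from rfl]
      simp only [LinearMap.comp_apply]
      rw [← map_smul, ← map_smul, ← map_smul, e1, map_sum, map_sum]
      congr 1
      refine Finset.sum_congr rfl fun τ _ => ?_
      rw [map_smul, map_smul, funLeft_crun_kt wf2]
    have h2 := congrFun h1 x
    rw [LinearMap.funLeft_apply, Pi.smul_apply, smul_eq_mul] at h2
    rw [← h2, inv_mul_cancel_left₀ hγ0]
  have hΦx : ∀ y, Φ y = ∑ τ : Fin c → Scope n k,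
      ((∏ j, ((coeff I (τ j).1 : ℤ) : ℝ) : ℝ) : ℂ) * T3 (kt N (v τ)) y := by
    intro y
    rw [hΦ, Finset.sum_apply]
    rfl
  -- Before the last flag is computed, the spare ancilla qubit, the flag qubit and all work qubits
  -- are zero in every branch.
  have hΦ1 : ∀ y : Fin N → Bool, (∃ z : Fin N, l * L + l * M < z ∧ y z = true) → Φ y = 0 := by
    rintro y ⟨z, hz, hyz⟩
    rw [hΦx]
    refine Finset.sum_eq_zero fun τ _ => ?_
    rw [(e3 (v τ) y).2 z (by omega), mul_zero]
    rw [hyz, hv]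
    dsimp only
    rw [(hvs τ).2.2 z hz]
    simp
  -- On strings with zero ancillas the intersecting tuples drop out, because their collision flag is
  -- 1 and the Hadamard gates do not touch it.
  have hΦ2 : ∀ y : Fin N → Bool, (∀ z : Fin N, l * L ≤ z → y z = false) → Φ y =
      ∑ T ∈ (Finset.univ : Finset (Fin n)).powersetCard l,
        ((c.factorial * guideCoeff I T : ℝ) : ℂ) * ((√((1 : ℝ) / 2) : ℂ) ^ (l * M) *
          if (fun i : Fin (l * L) => y ⟨i, by omega⟩) = setBits l T then 1 else 0) := by
    intro y hy
    rw [hΦx, ← sum_disjTuple_mul hk, Finset.sum_filter]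
    refine Finset.sum_congr rfl fun τ _ => ?_
    by_cases hd : DisjTuple τ
    · rw [if_pos hd]
      congr 1
      obtain ⟨h1, h2⟩ := (hvs τ).1 hd
      split_ifs with hs
      · rw [mul_one]
        refine (e3 (v τ) y).1 ?_ fun z hz _ => hy z hz
        rintro z (hz | hz)
        · rw [hv]
          dsimp only
          rw [h1 z hz]
          exact congrFun hs ⟨z, hz⟩
        · rw [hv]
          dsimp only
          rw [h2 z hz, hy z (by omega)]
      · rw [mul_zero]
        obtain ⟨i, hi⟩ := Function.ne_iff.1 hs
        refine (e3 (v τ) y).2 ⟨i, by omega⟩ (Or.inl i.2) ?_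
        rw [hv]
        dsimp only
        rw [h1 i i.2]
        exact hi
    · rw [if_neg hd, (e3 (v τ) y).2 ⟨l * L + l * M, by omega⟩ (Or.inr le_rfl), mul_zero]
      rw [hy _ (by dsimp only; omega), hv]
      dsimp only
      rw [(hvs τ).2.1 hd]
      simp
  set FL := l * L + (l * M + 2) with hFL
  -- The vector `|⊥⟩` is defined by the output itself on strings with flag 1 and zero work qubits.
  -- It remains to treat the strings with flag 0 or with a set work qubit.
  refine ⟨fun y => circuitOutput G (restr N fun z => if h : z < l * L + (l * M + 2) then y ⟨z, h⟩
    else decide (z = FL)), ?_⟩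
  funext x
  by_cases hx : ∀ z : Fin N, W ≤ z → x z = false
  swap
  · push Not at hx
    obtain ⟨z, hz, hxz⟩ := hx
    have hxz' : x z = true := by simpa using hxz
    have hr : tensor (((c.factorial * guideNorm l I * √((1 : ℝ) / 2) ^ (l * M) /
        √(sumSq J : ℝ) ^ c : ℝ) : ℂ) • tensor (guideState l I) (zeros (l * bitLen l + 2 + 1))
        + tensor (fun y => circuitOutput G (restr N fun z => if h : z < l * L + (l * M + 2) then
          y ⟨z, h⟩ else decide (z = FL))) (ket fun _ : Fin 1 => true)) (zeros w) x = 0 := by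
      refine mul_eq_zero_of_right _ ?_
      rw [zeros, ket, if_neg]
      intro h
      have h' := congrFun h ⟨z - W, by
        have := z.2
        change (z : ℕ) < W + w at this
        omega⟩
      have hz' : Fin.natAdd (l * L + (l * M + 2 + 1)) (⟨z - W, by
        have := z.2
        change (z : ℕ) < W + w at this
        omega⟩ : Fin w) = z := by
        apply Fin.ext
        change W + (z - W) = (z : ℕ)
        omega
      rw [show x (Fin.natAdd (l * L + (l * M + 2 + 1)) (⟨z - W, _⟩ : Fin w)) = x z from
        congrArg x hz', hxz'] at h'
      exact absurd h' (by simp)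
    refine Eq.trans ?_ hr.symm
    rw [hout]
    by_cases hy : ∀ z : ℕ, W ≤ z → crun (finCirc W l L M).reverse (ext x) z = false
    -- The last circuit restores its work wires, so a string with a set work wire has no preimage
    -- with clean ones.
    · exfalso
      have h1 := crun_reverse' wf4 (ext x)
      rw [crun_finCirc (Q := Q) le_rfl (by omega) hlM hy] at h1
      have h2 := congrFun h1 z
      rw [Function.update_of_ne (by omega), hy _ hz] at h2
      rw [ext, dif_pos z.2] at h2
      exact absurd (h2.trans hxz') (by simp)
    · push Not at hy
      obtain ⟨z', hz1, hz2⟩ := hy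
      have hz3 : z' < N := by
        by_contra hge
        apply hz2
        rw [crun_of_not_target, ext, dif_neg hge]
        intro g hg
        have := (wf4 g (List.mem_reverse.1 hg)).ht
        omega
      rw [hΦ1, mul_zero]
      exact ⟨⟨z', hz3⟩, by dsimp only; omega, Bool.eq_true_of_not_eq_false hz2⟩
  · have hext : ∀ z, W ≤ z → ext x z = false := by
      intro z hz
      rw [ext]
      split_ifs with h
      · exact hx ⟨z, h⟩ hz
      · rfl
    have hzw : zeros w (fun j => x (Fin.natAdd (l * L + (l * M + 2 + 1)) j)) = 1 := by
      rw [zeros, ket, if_pos]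
      funext j
      exact hx _ (by simp only [Fin.val_natAdd]; omega)
    have hFLN : FL < N := by omega
    cases hf : x ⟨FL, hFLN⟩
    · have hk1 : ket (fun _ : Fin 1 => true)
          (fun j => x (Fin.castAdd w (Fin.natAdd (l * L + (l * M + 2)) j))) = 0 := by
        rw [ket, if_neg]
        intro h
        have h' := congrFun h 0
        have : x ⟨FL, hFLN⟩ = true := h'
        rw [hf] at this
        exact absurd this (by simp)
      have hr : tensor (((c.factorial * guideNorm l I * √((1 : ℝ) / 2) ^ (l * M) /
          √(sumSq J : ℝ) ^ c : ℝ) : ℂ) • tensor (guideState l I) (zeros (l * bitLen l + 2 + 1))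
          + tensor (fun y => circuitOutput G (restr N fun z => if h : z < l * L + (l * M + 2) then
            y ⟨z, h⟩ else decide (z = FL))) (ket fun _ : Fin 1 => true)) (zeros w) x =
          ((c.factorial * guideNorm l I * √((1 : ℝ) / 2) ^ (l * M) / √(sumSq J : ℝ) ^ c : ℝ) : ℂ) *
          (guideState l I (fun i => x ⟨i, i.2.trans_le (show l * L ≤ N by omega)⟩) *
            zeros (l * M + 2 + 1) fun j => x (Fin.castAdd w (Fin.natAdd (l * L) j))) := by
        rw [tensor]
        erw [hzw, mul_one]
        rw [Pi.add_apply]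
        have : ∀ φ : State (l * L + (l * M + 2)), tensor φ (ket fun _ : Fin 1 => true)
            (fun i => x (Fin.castAdd w i)) = 0 := fun φ => by
          rw [tensor]
          erw [hk1, mul_zero]
        erw [this, add_zero]
        rfl
      refine Eq.trans ?_ hr.symm
      rw [hout, crun_finCirc_reverse (Q := Q) le_rfl (by omega) hlM hext]
      have hf' : ext x FL = false := by rw [ext, dif_pos hFLN, hf]
      by_cases ho : ∀ z : Fin N, l * L ≤ z → x z = false
      · have h1 : decide (∀ s ≤ l * M, ext x (l * L + s) = false) = true := by
          rw [decide_eq_true_iff]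
          intro s hs
          rw [ext, dif_pos (by omega)]
          exact ho _ (by dsimp only; omega)
        have h2 : zeros (l * M + 2 + 1) (fun j => x (Fin.castAdd w (Fin.natAdd (l * L) j))) = 1 := by
          rw [zeros, ket, if_pos]
          funext j
          exact ho _ (by simp)
        rw [h1, h2, hf', Bool.not_true, Bool.xor_false, ← hf', Function.update_eq_self, restr_ext,
          hΦ2 x ho, mul_one, guideState, Finset.sum_apply, Finset.mul_sum, Finset.mul_sum]
        refine Finset.sum_congr rfl fun T _ => ?_
        rw [Pi.smul_apply, smul_eq_mul, ket]
        split_ifs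
        · rw [hγ]
          push_cast
          have hg' : (guideNorm l I : ℂ) ≠ 0 := by exact_mod_cast hg
          field_simp
        · simp
      · have h2 : zeros (l * M + 2 + 1) (fun j => x (Fin.castAdd w (Fin.natAdd (l * L) j))) = 0 := by
          push Not at ho
          obtain ⟨z, hz, hxz⟩ := ho
          rw [zeros, ket, if_neg]
          intro h
          have hzW : (z : ℕ) < W := by
            by_contra hge
            exact hxz (hx z (by omega))
          exact hxz ((congrArg x (Fin.ext (by
            simp only [Fin.val_castAdd, Fin.val_natAdd]; omega))).trans
              (congrFun h ⟨z - l * L, by omega⟩))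
        rw [h2, mul_zero, mul_zero]
        -- If the rank register and the collision flag vanish, the string is its own preimage and
        -- the set wire is one of those excluded by `hΦ1`. Otherwise the preimage has the last flag
        -- set, and `hΦ1` applies to that wire.
        by_cases h1 : ∀ s ≤ l * M, ext x (l * L + s) = false
        · rw [hΦ1, mul_zero]
          push Not at ho
          obtain ⟨z, hz, hxz⟩ := ho
          have hz1 : l * L + l * M < z := by
            by_contra hle
            have := h1 (z - l * L) (by omega)
            rw [Nat.add_sub_cancel' hz, ext, dif_pos z.2] at this
            exact hxz this
          have hz2 : (z : ℕ) ≠ FL := by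
            intro e
            apply hxz
            rw [show z = ⟨FL, hFLN⟩ from Fin.ext e, hf]
          refine ⟨z, hz1, ?_⟩
          rw [restr, Function.update_of_ne hz2, ext, dif_pos z.2]
          simpa using hxz
        · rw [hΦ1, mul_zero]
          refine ⟨⟨FL, hFLN⟩, by dsimp only; omega, ?_⟩
          rw [restr, Function.update_self, hf', decide_eq_false h1]
          rfl
    · have hz0 : zeros (l * M + 2 + 1) (fun j => x (Fin.castAdd w (Fin.natAdd (l * L) j))) = 0 := by
        rw [zeros, ket, if_neg]
        intro h
        have h' := congrFun h ⟨l * M + 2, by omega⟩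
        have : x ⟨FL, hFLN⟩ = false := h'
        rw [hf] at this
        exact absurd this (by simp)
      have hk1 : ket (fun _ : Fin 1 => true)
          (fun j => x (Fin.castAdd w (Fin.natAdd (l * L + (l * M + 2)) j))) = 1 := by
        rw [ket, if_pos]
        funext j
        rw [Subsingleton.elim j 0]
        exact hf
      have hr : tensor (((c.factorial * guideNorm l I * √((1 : ℝ) / 2) ^ (l * M) /
          √(sumSq J : ℝ) ^ c : ℝ) : ℂ) • tensor (guideState l I) (zeros (l * bitLen l + 2 + 1))
          + tensor (fun y => circuitOutput G (restr N fun z => if h : z < l * L + (l * M + 2) then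
            y ⟨z, h⟩ else decide (z = FL))) (ket fun _ : Fin 1 => true)) (zeros w) x =
          circuitOutput G (restr N fun z => if h : z < l * L + (l * M + 2) then
            x ⟨z, by omega⟩ else decide (z = FL)) := by
        rw [tensor]
        erw [hzw, mul_one]
        rw [Pi.add_apply]
        have h1 : (((c.factorial * guideNorm l I * √((1 : ℝ) / 2) ^ (l * M) /
            √(sumSq J : ℝ) ^ c : ℝ) : ℂ) • tensor (guideState l I) (zeros (l * M + 2 + 1)))
            (fun i => x (Fin.castAdd w i)) = 0 := by
          rw [Pi.smul_apply, tensor]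
          erw [hz0]
          rw [mul_zero, smul_zero]
        have h2 : ∀ φ : State (l * L + (l * M + 2)), tensor φ (ket fun _ : Fin 1 => true)
            (fun i => x (Fin.castAdd w i)) = φ fun i => x ⟨i, by omega⟩ := fun φ => by
          rw [tensor]
          erw [hk1, mul_one]
          rfl
        erw [h1, h2, zero_add]
      refine Eq.trans ?_ hr.symm
      congr 1
      funext z
      rw [restr]
      split_ifs with hz
      · rfl
      · by_cases hz2 : (z : ℕ) = FL
        · rw [decide_eq_true hz2, show z = ⟨FL, hFLN⟩ from Fin.ext hz2, hf]
        · rw [decide_eq_false hz2, hx z (by omega)]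

/-! ### Circuits are computable in polynomial time -/

instance : Enc Instr := ⟨fun g => Enc.enc (g.t, g.a, g.pa, g.b, g.pb)⟩

section
variable {α β γ : Type} [Enc α] [Enc β] [Enc γ]

@[fun_prop]
theorem PT.instr {t a b : α → ℕ} {pa pb : α → Bool} (ht : PT t) (ha : PT a) (hpa : PT pa) (hb : PT b)
    (hpb : PT pb) : PT (fun x => Instr.mk (t x) (a x) (pa x) (b x) (pb x)) :=
  (ht.prodMk (ha.prodMk (hpa.prodMk (hb.prodMk hpb)))).of_enc fun _ => rfl

theorem PT.instr_fields : PT (fun g : Instr => (g.t, g.a, g.pa, g.b, g.pb)) :=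
  (PT.id (α := Instr)).of_enc fun _ => rfl

@[fun_prop]
theorem PT.div {m d : α → ℕ} (hm : PT m) (hd : PT d) : PT (fun a => m a / d a) := by
  have h : PT fun a => bif d a == 0 then 0 else
      ((List.range (m a)).filter fun i => decide ((i + 1) * d a ≤ m a)).length := by fun_prop
  refine h.of_eq fun a => ?_
  rcases Nat.eq_zero_or_pos (d a) with h0 | h0
  · simp [h0]
  · rw [show (d a == 0) = false by simp; omega, Bool.cond_false,
      length_filter_range _ (m := m a / d a) (Nat.div_le_self _ _)]
    intro i _
    rw [Bool.eq_iff_iff, decide_eq_true_iff, decide_eq_true_iff, ← Nat.succ_le_iff (m := i),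
      Nat.le_div_iff_mul_le h0]

@[fun_prop]
theorem PT.mod {m d : α → ℕ} (hm : PT m) (hd : PT d) : PT (fun a => m a % d a) := by
  have h : PT fun a => m a - d a * (m a / d a) := by fun_prop
  refine h.of_eq fun a => ?_
  have := Nat.div_add_mod (m a) (d a)
  omega

@[fun_prop]
theorem PT.decideEqList {f g : α → List ℕ} (hf : PT f) (hg : PT g) :
    PT (fun a => decide (f a = g a)) := by
  have h : PT fun a => ((f a).length == (g a).length) &&
      (List.range (f a).length).all fun i => (f a).getD i 0 == (g a).getD i 0 := by fun_prop
  refine h.of_eq fun a => ?_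
  rw [Bool.eq_iff_iff, decide_eq_true_iff]
  simp only [Bool.and_eq_true, beq_iff_eq, List.all_eq_true, List.mem_range]
  constructor
  · rintro h; simp [h]
  · rintro ⟨h1, h2⟩
    refine List.ext_getElem h1 fun i hi hi' => ?_
    have := h2 i hi
    rwa [List.getD_eq_getElem _ _ hi, List.getD_eq_getElem _ _ hi'] at this

/-- The head of a list, if it does not occur in the tail. -/
def newHead : List (List ℕ) → List (List ℕ)
  | [] => []
  | x :: r => bif r.any fun y => decide (x = y) then [] else [x]

/-- The function `List.dedup` keeps the last occurrence of each entry, so an entry survives exactly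
if it is absent from the tail behind it. This turns the recursion into one loop over the tails. -/
theorem dedup_eq_flatMap (l : List (List ℕ)) : l.dedup = l.tails.flatMap newHead := by
  induction l with
  | nil => rfl
  | cons x l ih =>
    rw [List.tails_cons, List.flatMap_cons, ← ih, newHead]
    by_cases hx : x ∈ l
    · rw [List.dedup_cons_of_mem hx, show (l.any fun y => decide (x = y)) = true by simpa using hx]
      rfl
    · rw [List.dedup_cons_of_notMem hx,
        show (l.any fun y => decide (x = y)) = false by
          rw [List.any_eq_false]
          rintro y hy h
          rw [decide_eq_true_iff] at h
          exact hx (h ▸ hy)]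
      rfl

@[fun_prop]
theorem PT.dedup {l : α → List (List ℕ)} (hl : PT l) : PT (fun a => (l a).dedup) := by
  have hF : PT newHead :=
    (PT.listCases (f := fun _ => []) (g := fun p : List (List ℕ) × List ℕ × List (List ℕ) =>
      bif p.2.2.any fun y => decide (p.2.1 = y) then [] else [p.2.1]) PT.id (PT.const [])
      (by fun_prop)).of_eq fun t => by cases t <;> rfl
  exact (PT.flatMap (F := fun _ => newHead) hl.tails (hF.comp (PT.snd PT.id))).of_eq
    fun a => dedup_eq_flatMap _

/-! ### Instructions -/

@[fun_prop]
theorem PT.wk {W t i j b : α → ℕ} (hW : PT W) (ht : PT t) (hi : PT i) (hj : PT j) (hb : PT b) :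
    PT (fun a => wk (W a) (t a) (i a) (j a) (b a)) := by
  unfold Guiding.wk
  fun_prop

@[fun_prop]
theorem PT.notI {W t : α → ℕ} (hW : PT W) (ht : PT t) : PT (fun a => notI (W a) (t a)) := by
  unfold Guiding.notI
  fun_prop

@[fun_prop]
theorem PT.addI {W t a : α → ℕ} {pa : α → Bool} (hW : PT W) (ht : PT t) (ha : PT a) (hpa : PT pa) :
    PT (fun x => addI (W x) (t x) (a x) (pa x)) := by
  unfold Guiding.addI
  fun_prop

theorem PT.chain {W m : α → ℕ} {base : α → ℕ → ℕ} {f : α → ℕ → ℕ × Bool} (hW : PT W)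
    (hb : PT fun p : α × ℕ => base p.1 p.2) (hf : PT fun p : α × ℕ => f p.1 p.2) (hm : PT m) :
    PT (fun a => chain (W a) (base a) (f a) (m a)) := by
  unfold Guiding.chain
  have h0 : PT fun a => base a 0 := hb.comp (PT.id.prodMk (PT.const 0))
  have hb' : PT fun p : α × ℕ => base p.1 (p.2 + 1) := hb.comp (g := fun p : α × ℕ => (p.1, p.2 + 1)) (by fun_prop)
  have h : PT fun a => (List.range (m a)).map fun s =>
      Instr.mk (base a (s + 1)) (base a s) false (f a s).1 (f a s).2 :=
    PT.map (by fun_prop) (PT.instr hb' hb (PT.const false) (PT.fst hf) (PT.snd hf))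
  exact (PT.notI hW h0).cons h

@[fun_prop]
theorem PT.ctrlCode {p : α → Bool} {M : α → Bool → Bool → EntryCode} (hp : PT p)
    (hM : ∀ r s, PT fun a => M a r s) (r s : Bool × Bool) :
    PT (fun a => ctrlCode (p a) (M a) r s) := by
  have h : PT fun a => if decide (r.1 = s.1) = true then
      if (r.1 ^^ p a) = true then M a r.2 s.2 else
        if decide (r.2 = s.2) = true then EntryCode.real false 1 1 else .zero
      else EntryCode.zero :=
    PT.ite (PT.const _) (PT.ite (by fun_prop) (hM _ _) (PT.ite (PT.const _) (PT.const _)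
      (PT.const _))) (PT.const _)
  exact h.of_eq fun a => by simp [Guiding.ctrlCode]

@[fun_prop]
theorem PT.instrCode {g : α → Instr} (hg : PT g) : PT (fun a => (g a).code) := by
  have h : PT fun q : ℕ × ℕ × Bool × ℕ × Bool =>
      (⟨q.1, q.2.1, q.2.2.1, q.2.2.2.1, q.2.2.2.2⟩ : Instr).code := by
    unfold Instr.code
    have h1 : ∀ s : Bool, ∀ r t, PT fun q : ℕ × ℕ × Bool × ℕ × Bool =>
        Guiding.ctrlCode q.2.2.2.2 (vCode s) r t :=
      fun s => PT.ctrlCode (by fun_prop) fun _ _ => PT.const _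
    have h2 : ∀ s : Bool, ∀ r t, PT fun q : ℕ × ℕ × Bool × ℕ × Bool =>
        Guiding.ctrlCode q.2.2.1 (vCode s) r t :=
      fun s => PT.ctrlCode (by fun_prop) fun _ _ => PT.const _
    have h3 : ∀ r t, PT fun q : ℕ × ℕ × Bool × ℕ × Bool => Guiding.ctrlCode q.2.2.1 xCode r t :=
      PT.ctrlCode (by fun_prop) fun _ _ => PT.const _
    have g1 := PT.gateTwo (α := ℕ × ℕ × Bool × ℕ × Bool) (i := fun q => q.2.2.2.1)
      (j := fun q => q.1) (by fun_prop) (by fun_prop) (h1 false)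
    have g2 := PT.gateTwo (α := ℕ × ℕ × Bool × ℕ × Bool) (i := fun q => q.2.1)
      (j := fun q => q.2.2.2.1) (by fun_prop) (by fun_prop) h3
    have g3 := PT.gateTwo (α := ℕ × ℕ × Bool × ℕ × Bool) (i := fun q => q.2.2.2.1)
      (j := fun q => q.1) (by fun_prop) (by fun_prop) (h1 true)
    have g4 := PT.gateTwo (α := ℕ × ℕ × Bool × ℕ × Bool) (i := fun q => q.2.1)
      (j := fun q => q.1) (by fun_prop) (by fun_prop) (h2 false)
    exact g1.cons (g2.cons (g3.cons (g2.cons (g4.cons (PT.const [])))))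
  exact (h.comp PT.instr_fields).comp hg

@[fun_prop]
theorem PT.flatMapCode {l : α → List Instr} (hl : PT l) : PT (fun a => (l a).flatMap Instr.code) :=
  PT.flatMap (F := fun _ g => g.code) hl (by fun_prop)

/-! ### The sorting circuit -/

@[fun_prop]
theorem PT.sortA {W l L : α → ℕ} (hW : PT W) (hl : PT l) (hL : PT L) :
    PT (fun a => sortA (W a) (l a) (L a)) := by
  have h1 : PT fun a => cmps (W a) (l a) (L a) (L a) := by
    unfold cmps cmpLayer
    fun_prop
  have h2 : PT fun a => ranks (W a) (l a) (L a) (l a) := by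
    unfold ranks rankLayer
    fun_prop
  have h3 : PT fun a => parity (W a) (l a) := by
    unfold parity
    fun_prop
  have h4 : PT fun a => sel (W a) (l a) := by
    unfold sel
    fun_prop
  have h5 : PT fun a => Guiding.chain (W a) (Guiding.wk (W a) 4 0 0)
      (fun r => (Guiding.wk (W a) 3 r 0 0, false)) (l a) :=
    PT.chain (base := fun a => Guiding.wk (W a) 4 0 0)
      (f := fun a r => (Guiding.wk (W a) 3 r 0 0, false)) hW (by fun_prop) (by fun_prop) hl
  exact (((h1.append h2).append h3).append h5).append h4

@[fun_prop]
theorem PT.sortCirc {W l L M : α → ℕ} (hW : PT W) (hl : PT l) (hL : PT L) (hM : PT M) :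
    PT (fun a => sortCirc (W a) (l a) (L a) (M a)) := by
  have h1 : PT fun a => sortC (W a) (l a) (L a) (M a) := by
    unfold sortC outC rankC
    fun_prop
  have h2 : PT fun a => dec (W a) (l a) (L a) (M a) := by
    unfold dec
    have h : PT fun p : (α × ℕ) × ℕ => Guiding.chain (W p.1.1) (Guiding.wk (W p.1.1) 7 p.1.2 p.2)
        (fun b => (l p.1.1 * L p.1.1 + (p.1.2 * M p.1.1 + b), !p.2.testBit b)) (M p.1.1) :=
      PT.chain (base := fun p : (α × ℕ) × ℕ => Guiding.wk (W p.1.1) 7 p.1.2 p.2)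
        (f := fun p b => (l p.1.1 * L p.1.1 + (p.1.2 * M p.1.1 + b), !p.2.testBit b))
        (by fun_prop) (by fun_prop) (by fun_prop) (by fun_prop)
    exact PT.flatMap (by fun_prop) (PT.flatMap (F := fun (p : α × ℕ) r => _) (by fun_prop) h)
  have h3 : PT fun a => decC (W a) (l a) (L a) (M a) := by
    unfold decC
    fun_prop
  have h4 : PT fun a => mvA (W a) (l a) (L a) := by
    unfold mvA
    fun_prop
  have h5 : PT fun a => mvB (W a) (l a) (L a) (M a) := by
    unfold mvB
    fun_prop
  have h6 := PT.sortA hW hl hL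
  unfold Guiding.sortCirc
  fun_prop

@[fun_prop]
theorem PT.finCirc {W l L M : α → ℕ} (hW : PT W) (hl : PT l) (hL : PT L) (hM : PT M) :
    PT (fun a => finCirc (W a) (l a) (L a) (M a)) := by
  have h : PT fun a => finChain (W a) (l a) (L a) (M a) :=
    PT.chain (base := fun a => Guiding.wk (W a) 10 0 0) (f := fun a s => (l a * L a + s, true)) hW
      (by fun_prop) (by fun_prop) (by fun_prop)
  unfold Guiding.finCirc
  fun_prop

@[fun_prop]
theorem PT.hadsCode {b r : α → ℕ} (hb : PT b) (hr : PT r) : PT (fun a => hadsCode (b a) (r a)) := by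
  have h : PT fun p : α × ℕ => GateCode.one (b p.1 + p.2) hCode :=
    PT.gateOne (by fun_prop) fun _ _ => PT.const _
  exact PT.map (F := fun a s => GateCode.one (b a + s) hCode) (by fun_prop) h

/-! ### The loading circuit -/

theorem PT.stepCode {W off m p q : α → ℕ} {b : α → ℕ → Bool} {neg : α → Bool} (hW : PT W)
    (ho : PT off) (hm : PT m) (hb : PT fun x : α × ℕ => b x.1 x.2) (hn : PT neg) (hp : PT p)
    (hq : PT q) : PT (fun a => stepCode (W a) (off a) (m a) (b a) (neg a) (p a) (q a)) := by
  have h1 : ∀ r s, PT fun a => rotCode (neg a) (p a) (q a) r s := by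
    intro r s
    have : PT fun a => if decide (r = s) = true then EntryCode.real false (p a) (p a + q a) else
        .real (neg a ^^ s) (q a) (p a + q a) := by
      unfold EntryCode.real
      fun_prop
    exact this.of_eq fun a => by simp [rotCode]
  have h2 : PT fun a => GateCode.two (Guiding.wk (W a) 8 0 0 0) (Guiding.wk (W a) 8 1 0 0)
      (Guiding.ctrlCode true (rotCode (neg a) (p a) (q a))) :=
    PT.gateTwo (by fun_prop) (by fun_prop) (PT.ctrlCode (PT.const true) h1)
  have h3 : PT fun a => loadCirc (W a) (off a) (m a) (b a) := by
    unfold loadCirc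
    have : PT fun a => (List.range (m a)).flatMap fun s => bif b a s then
        [Guiding.addI (W a) (off a + s) (Guiding.wk (W a) 8 1 0 0) false] else [] :=
      PT.flatMap (by fun_prop) (PT.cond hb (by fun_prop) (by fun_prop))
    fun_prop
  have h4 : PT fun a => eqChain (W a) (off a) (m a) (b a) := by
    unfold eqChain
    refine PT.chain (base := fun a => Guiding.wk (W a) 9 0 0)
      (f := fun a s => bif decide (s < m a) then (off a + s, !b a s) else
        (Guiding.wk (W a) 8 0 0 0, false)) hW (by fun_prop) (PT.cond (by fun_prop) ?_ (by fun_prop))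
      (by fun_prop)
    exact PT.prodMk (by fun_prop) hb.not
  have h5 : PT fun a => testCirc (W a) (off a) (m a) (b a) := by
    unfold testCirc
    fun_prop
  exact h2.cons (h3.append h5).flatMapCode

/-- The bits of the numbers in a list. -/
def listBits (L : ℕ) (S : List ℕ) (s : ℕ) : Bool := (S.getD (s / L) 0).testBit (s % L)

@[fun_prop]
theorem PT.sumSq {J : α → List (List ℕ × Bool × ℕ)} (hJ : PT J) : PT (fun a => sumSq (J a)) := by
  unfold Guiding.sumSq
  fun_prop

/-- The code for the head of a list of items. -/
def headCode {β : Type} (W off m : ℕ) (bt : β → ℕ → Bool) : List (β × Bool × ℕ) → List GateCode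
  | [] => []
  | x :: r => stepCode W off m (bt x.1) x.2.1 (sumSq r) (x.2.2 * x.2.2)

/-- The rotation for an item depends on the weights of all later items, so the recursion becomes a
loop over the tails of the list. -/
theorem itemsCode_eq_flatMap {β : Type} (W off m : ℕ) (bt : β → ℕ → Bool) (J : List (β × Bool × ℕ)) :
    itemsCode W off m bt J = J.tails.flatMap (headCode W off m bt) := by
  induction J with
  | nil => rfl
  | cons x J ih => rw [List.tails_cons, List.flatMap_cons, ← ih]; rfl

theorem PT.itemsCode {W off m L : α → ℕ} {J : α → List (List ℕ × Bool × ℕ)} (hW : PT W)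
    (ho : PT off) (hm : PT m) (hL : PT L) (hJ : PT J) :
    PT (fun a => itemsCode (W a) (off a) (m a) (listBits (L a)) (J a)) := by
  have hF : PT fun t : α × List (List ℕ × Bool × ℕ) =>
      headCode (W t.1) (off t.1) (m t.1) (listBits (L t.1)) t.2 := by
    refine (PT.listCases (l := fun t => t.2) (f := fun _ => [])
      (g := fun p : (α × List (List ℕ × Bool × ℕ)) × (List ℕ × Bool × ℕ) ×
      List (List ℕ × Bool × ℕ) => Guiding.stepCode (W p.1.1) (off p.1.1) (m p.1.1)
        (listBits (L p.1.1) p.2.1.1) p.2.1.2.1 (Guiding.sumSq p.2.2) (p.2.1.2.2 * p.2.1.2.2))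
      (by fun_prop) (PT.const []) (PT.stepCode (by fun_prop) (by fun_prop) (by fun_prop) ?_
        (by fun_prop) (by fun_prop) (by fun_prop))).of_eq fun t => by
          obtain ⟨a, _ | ⟨x, r⟩⟩ := t <;> rfl
    unfold listBits
    fun_prop
  exact (PT.flatMap (F := fun a => headCode (W a) (off a) (m a) (listBits (L a))) hJ.tails hF).of_eq
    fun a => itemsCode_eq_flatMap ..

theorem PT.mainCode {W k l L M c : α → ℕ} {J : α → List (List ℕ × Bool × ℕ)} (hW : PT W)
    (hk : PT k) (hl : PT l) (hL : PT L) (hM : PT M) (hJ : PT J) (hc : PT c) :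
    PT (fun a => mainCode (W a) (k a) (l a) (L a) (M a) (listBits (L a)) (J a) (c a)) := by
  have h1 : PT fun a => blocksCode (W a) (k a * L a) (listBits (L a)) (J a) (c a) := by
    unfold blocksCode
    refine PT.flatMap (by fun_prop) ?_
    unfold blockCode
    exact (PT.itemsCode (by fun_prop) (by fun_prop) (by fun_prop) (by fun_prop)
      (by fun_prop)).append (by fun_prop)
  unfold Guiding.mainCode
  fun_prop

/-! ### The items of an instance -/

/-- The number of occurrences of a constraint. -/
def cnt (J : List (List ℕ × Bool)) (S : List ℕ) (b : Bool) : ℕ :=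
  (J.filter fun y => decide (y.1 = S) && !(y.2 ^^ b)).length

/-- A scope with the sign and the absolute value of its coefficient. -/
def item (J : List (List ℕ × Bool)) (S : List ℕ) : List ℕ × Bool × ℕ :=
  (S, decide (cnt J S false < cnt J S true),
    (cnt J S false - cnt J S true) + (cnt J S true - cnt J S false))

/-- The scopes with nonzero coefficients. -/
def items (J : List (List ℕ × Bool)) : List (List ℕ × Bool × ℕ) :=
  (((J.map fun y => y.1).dedup).map (item J)).filter fun x => decide (0 < x.2.2)

@[fun_prop]
theorem PT.items {J : α → List (List ℕ × Bool)} (hJ : PT J) : PT (fun a => items (J a)) := by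
  have h : ∀ b, PT fun p : α × List ℕ => cnt (J p.1) p.2 b := by
    intro b
    unfold cnt
    fun_prop
  have h' : PT fun p : α × List ℕ => item (J p.1) p.2 := by
    have := h false
    have := h true
    unfold item
    fun_prop
  have h2 : PT fun a => ((J a).map fun y => y.1).dedup.map (item (J a)) :=
    PT.map (F := fun a S => item (J a) S) (by fun_prop) h'
  unfold Guiding.items
  fun_prop

end

/-! ### The algorithm -/

/-- A bound on the indices of the work wires. -/
def idxBound (n k l : ℕ) : ℕ := (n + k + l + 11) ^ 2

/-- The output of the algorithm. -/
def output (x : ℕ × ℕ × ℕ × List (List ℕ × Bool)) : ℕ × List GateCode :=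
  (idxBound x.1 x.2.1 x.2.2.1 ^ 4,
    mainCode (x.2.2.1 * bitLen x.1 + (x.2.2.1 * bitLen x.2.2.1 + 3)) x.2.1 x.2.2.1 (bitLen x.1)
      (bitLen x.2.2.1) (listBits (bitLen x.1)) (items x.2.2.2) (x.2.2.1 / x.2.1))

theorem PT.output : PT output := by
  unfold Guiding.output
  refine PT.prodMk ?_ ?_
  · simp only [idxBound, pow_succ, pow_zero, one_mul]
    fun_prop
  · exact PT.mainCode (by fun_prop) (by fun_prop) (by fun_prop) (by fun_prop) (by fun_prop)
      (by fun_prop) (by fun_prop)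

/-- The list of constraints as a list of numbers and signs. -/
def rawInput {n k : ℕ} (I : KXor n k) : List (List ℕ × Bool) :=
  I.map fun c => ((c.1.1.sort (· ≤ ·)).map Fin.val, decide (c.2 = -1))

theorem enc_rawInput {n k l : ℕ} (I : KXor n k) : Enc.enc (n, k, l, rawInput I) = encodeInput n k l I := by
  have h1 : ∀ S : List (Fin n), Enc.enc (S.map Fin.val) = Tree.ofList (fun i : Fin n => .ofNat i.val) S := by
    intro S
    induction S with
    | nil => rfl
    | cons x S ih => exact congrArg (Tree.node _) ih
  have h2 : Enc.enc (rawInput I) = Tree.ofList (fun c : Constraint n k =>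
      .node (.ofList (fun i : Fin n => .ofNat i.val) (c.1.1.sort (· ≤ ·)))
        (.ofBool (decide (c.2 = -1)))) I := by
    induction I with
    | nil => rfl
    | cons c I ih =>
      change Tree.node (.node (Enc.enc _) _) (Enc.enc (rawInput I)) = _
      rw [ih, h1]
      rfl
  change Tree.node _ (.node _ (.node _ (Enc.enc (rawInput I)))) = _
  rw [h2]
  rfl

theorem exists_alg : ∃ alg : Prog, PolyTime alg ∧ ∀ (n k l : ℕ) (I : KXor n k), ∃ t,
    Eval alg (encodeInput n k l I)
      (circuitTree (output (n, k, l, rawInput I)).1 (output (n, k, l, rawInput I)).2) t := by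
  obtain ⟨p, P, h⟩ := PT.output
  refine ⟨p, ⟨P, fun n k l I => ?_⟩, fun n k l I => ?_⟩ <;>
  obtain ⟨t, h1, h2⟩ := h (n, k, l, rawInput I) <;> rw [enc_rawInput] at h1
  · rw [sz, enc_rawInput] at h2
    exact ⟨_, t, h1, h2⟩
  · exact ⟨t, h1⟩

/-! ### The items of an instance -/

/-- The elements of a scope in increasing order. -/
def scopeList {n k : ℕ} (S : Scope n k) : List ℕ := (S.1.sort (· ≤ ·)).map Fin.val

theorem scopeList_injective {n k : ℕ} : Function.Injective (scopeList (n := n) (k := k)) := by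
  intro S S' h
  have h1 : S.1.sort (· ≤ ·) = S'.1.sort (· ≤ ·) := List.map_injective_iff.2 Fin.val_injective h
  apply Subtype.ext
  rw [← Finset.sort_toFinset S.1 (· ≤ ·), h1, Finset.sort_toFinset]

theorem length_scopeList {n k : ℕ} (S : Scope n k) : (scopeList S).length = k := by
  rw [scopeList, List.length_map, Finset.length_sort, S.2]

/-- In the raw input the Boolean `true` stands for the right-hand side `-1`, whence the order of the
difference. -/
theorem cnt_sub_cnt {n k : ℕ} (I : KXor n k) (S : Scope n k) :
    (cnt (rawInput I) (scopeList S) false : ℤ) - cnt (rawInput I) (scopeList S) true =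
      coeff I S.1 := by
  induction I with
  | nil => rfl
  | cons c I ih =>
    have h : ∀ b, cnt (rawInput (c :: I)) (scopeList S) b =
        (if c.1 = S ∧ decide (c.2 = -1) = b then 1 else 0) + cnt (rawInput I) (scopeList S) b := by
      intro b
      rw [cnt, cnt, rawInput, List.map_cons, List.filter_cons]
      have h1 : (scopeList c.1 = scopeList S) = (c.1 = S) := propext scopeList_injective.eq_iff
      have h2 : (!(decide (c.2 = -1) ^^ b)) = decide (decide (c.2 = -1) = b) := by
        cases b <;> cases decide (c.2 = -1) <;> rfl
      dsimp only
      rw [show (c.1.1.sort (· ≤ ·)).map Fin.val = scopeList c.1 from rfl, h2]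
      simp only [h1, Bool.and_eq_true, decide_eq_true_eq]
      split_ifs
      · rw [List.length_cons, add_comm]; rfl
      · rw [zero_add]; rfl
    have h3 : coeff (c :: I) S.1 = (if c.1 = S then (c.2 : ℤ) else 0) + coeff I S.1 := by
      rw [coeff, coeff, List.map_cons, List.sum_cons]
      simp only [Subtype.ext_iff]
    rw [h, h, h3, ← ih]
    by_cases hS : c.1 = S
    · rcases Int.units_eq_one_or c.2 with hc | hc
      · simp [hS, hc]; ring
      · simp [hS, hc]; ring
    · simp [hS]

theorem wt_item {n k : ℕ} (I : KXor n k) (S : Scope n k) :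
    wt (item (rawInput I) (scopeList S)) = (coeff I S.1 : ℝ) := by
  rw [← cnt_sub_cnt, wt, item]
  generalize cnt (rawInput I) (scopeList S) false = p
  generalize cnt (rawInput I) (scopeList S) true = q
  by_cases h : p < q
  · simp only [h, decide_true, if_true]
    rw [show p - q = 0 by omega, zero_add, Nat.cast_sub h.le]
    push_cast; ring
  · simp only [h, decide_false]
    rw [show q - p = 0 by omega, add_zero, Nat.cast_sub (not_lt.1 h)]
    push_cast; simp

theorem sum_map_filter {α A : Type} [AddCommMonoid A] (p : α → Bool) (G : α → A)
    (h : ∀ x, p x = false → G x = 0) (l : List α) :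
    ((l.filter p).map G).sum = (l.map G).sum := by
  induction l with
  | nil => rfl
  | cons x l ih =>
    rw [List.filter_cons, List.map_cons, List.sum_cons, ← ih]
    split_ifs with hx
    · rw [List.map_cons, List.sum_cons]
    · rw [h x (by simpa using hx), zero_add]

theorem dedup_rawInput {n k : ℕ} (I : KXor n k) : ((rawInput I).map fun y => y.1).dedup =
    ((I.map fun c => c.1).dedup).map scopeList := by
  rw [← List.dedup_map_of_injective scopeList_injective, rawInput, List.map_map, List.map_map]
  rfl

/-- The list contains each scope with nonzero coefficient exactly once. All other scopes, present in
the instance or not, have weight zero and contribute nothing to either side. -/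
theorem sum_items {A : Type} [AddCommMonoid A] {n k : ℕ} (I : KXor n k)
    (G : List ℕ × Bool × ℕ → A) (h : ∀ x, x.2.2 = 0 → G x = 0) :
    ((items (rawInput I)).map G).sum =
      ∑ S : Scope n k, G (item (rawInput I) (scopeList S)) := by
  rw [items, sum_map_filter _ _ fun x hx => h x (by simpa using hx), dedup_rawInput, List.map_map,
    List.map_map, ← List.sum_toFinset _ (List.nodup_dedup _)]
  refine Finset.sum_subset (Finset.subset_univ _) fun S _ hS => h _ ?_
  rw [List.mem_toFinset, List.mem_dedup] at hS
  have h0 : ∀ b, cnt (rawInput I) (scopeList S) b = 0 := by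
    intro b
    rw [cnt, List.length_eq_zero_iff, List.filter_eq_nil_iff]
    intro y hy
    obtain ⟨c, hc, rfl⟩ := List.mem_map.1 hy
    simp only [Bool.and_eq_true, decide_eq_true_eq, not_and]
    intro h'
    exact absurd (List.mem_map.2 ⟨c, hc, scopeList_injective h'⟩) hS
  simp [item, h0]

theorem sumSq_items {n k : ℕ} (I : KXor n k) :
    (sumSq (items (rawInput I)) : ℝ) = ∑ S : Scope n k, (coeff I S.1 : ℝ) ^ 2 := by
  rw [sumSq, sum_items I _ fun x hx => by rw [hx, mul_zero], Nat.cast_sum]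
  refine Finset.sum_congr rfl fun S _ => ?_
  rw [← wt_item, wt, mul_pow, Nat.cast_mul, ← sq]
  split_ifs <;> norm_num

theorem length_items_le {n k : ℕ} (I : KXor n k) : (items (rawInput I)).length ≤ I.length := by
  rw [items]
  refine (List.length_filter_le _ _).trans ?_
  rw [List.length_map, dedup_rawInput, List.length_map]
  refine (List.dedup_sublist _).length_le.trans ?_
  rw [List.length_map]

theorem scopeBits_ne {n k L : ℕ} (hL : 0 < L) (hn : n ≤ 2 ^ L) {S S' : Scope n k} (h : S ≠ S') :
    ∃ s < k * L, scopeBits L S s ≠ scopeBits L S' s := by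
  by_contra! hcon
  apply h
  apply scopeList_injective
  refine List.ext_getElem (by rw [length_scopeList, length_scopeList]) fun i hi hi' => ?_
  rw [length_scopeList] at hi hi'
  have e : ∀ S : Scope n k, elt S.1 i = (scopeList S)[i]'(by rwa [length_scopeList]) := fun S => by
    rw [elt, ← List.getD_eq_getElem _ 0]; rfl
  rw [← e, ← e]
  refine Nat.eq_of_testBit_eq fun b => ?_
  by_cases hb : b < L
  · have h1 := hcon (i * L + b) (idx_lt hi hb)
    have h3 : (i * L + b) / L = i := by
      rw [mul_comm, Nat.mul_add_div hL, Nat.div_eq_of_lt hb, add_zero]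
    have h4 : (i * L + b) % L = b := by
      rw [mul_comm, Nat.mul_add_mod, Nat.mod_eq_of_lt hb]
    rwa [scopeBits, scopeBits, h3, h4] at h1
  · have h2 : 2 ^ L ≤ 2 ^ b := Nat.pow_le_pow_right (by norm_num) (not_lt.1 hb)
    rw [Nat.testBit_lt_two_pow, Nat.testBit_lt_two_pow]
    · exact (elt_lt (by rw [S'.2]; exact hi)).trans_le (hn.trans h2)
    · exact (elt_lt (by rw [S.2]; exact hi)).trans_le (hn.trans h2)

theorem pairwise_items {n k L : ℕ} (hL : 0 < L) (hn : n ≤ 2 ^ L) (I : KXor n k) :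
    (items (rawInput I)).Pairwise fun x y => ∃ s < k * L, listBits L x.1 s ≠ listBits L y.1 s := by
  rw [items]
  refine List.Pairwise.filter _ ?_
  rw [List.pairwise_map, dedup_rawInput, List.pairwise_map]
  exact (List.nodup_dedup (I.map fun c => c.1)).imp fun h => scopeBits_ne hL hn h

theorem exists_coeff_ne_zero {n k c : ℕ} (hk : 0 < k) (hc : 0 < c) {I : KXor n k}
    (h : guideNorm (c * k) I ≠ 0) : ∃ S : Scope n k, coeff I S.1 ≠ 0 := by
  by_contra! hcon
  apply h
  rw [guideNorm, Finset.sum_eq_zero, Real.sqrt_zero]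
  intro T hT
  have hT' := (Finset.mem_powersetCard.1 hT).2
  rw [guideCoeff, Finset.sum_eq_zero, zero_pow two_ne_zero]
  intro P hP
  have hcard := card_of_mem_partitions hk hT' hP
  obtain ⟨S, hS⟩ := Finset.card_pos.1 (hcard ▸ hc)
  refine Finset.prod_eq_zero hS ?_
  rw [Int.cast_eq_zero]
  exact hcon ⟨S, ((mem_partitions.1 hP).1 S hS).2⟩

/-! ### The number of gates -/

theorem length_flatMap_le {α β : Type} {l : List α} {F : α → List β} {B : ℕ}
    (h : ∀ x ∈ l, (F x).length ≤ B) : (l.flatMap F).length ≤ l.length * B := by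
  induction l with
  | nil => simp
  | cons x l ih =>
    rw [List.flatMap_cons, List.length_append, List.length_cons, add_mul, one_mul, add_comm]
    exact add_le_add (ih fun y hy => h y (by simp [hy])) (h x (by simp))

theorem length_flatMap_range_le {β : Type} {l B : ℕ} {F : ℕ → List β}
    (h : ∀ x, (F x).length ≤ B) : ((List.range l).flatMap F).length ≤ l * B := by
  have := length_flatMap_le (l := List.range l) (F := F) (B := B) fun x _ => h x
  rwa [List.length_range] at this

theorem length_flatMap_code (L : List Instr) : (L.flatMap Instr.code).length = L.length * 5 := by
  induction L with
  | nil => rfl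
  | cons g L ih => rw [List.flatMap_cons, List.length_append, ih, List.length_cons]; simp [Instr.code]; ring

theorem length_chain (W : ℕ) (base : ℕ → ℕ) (f : ℕ → ℕ × Bool) (m : ℕ) :
    (chain W base f m).length = m + 1 := by
  simp [chain]

theorem length_stepCode_le (W off m : ℕ) (b : ℕ → Bool) (neg : Bool) (p q : ℕ) :
    (stepCode W off m b neg p q).length ≤ 15 * m + 31 := by
  have h1 : (loadCirc W off m b).length ≤ m + 1 := by
    rw [loadCirc, List.length_append]
    have := length_flatMap_range_le (l := m) (B := 1)
      (F := fun s => bif b s then [addI W (off + s) (wk W 8 1 0 0) false] else [])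
      fun s => by cases b s <;> simp
    simp only [List.length_singleton]
    omega
  have h2 : (testCirc W off m b).length = 2 * m + 5 := by
    simp only [testCirc, eqChain, List.length_append, List.length_reverse, length_chain,
      List.length_singleton]
    ring
  rw [stepCode, List.length_cons, length_flatMap_code, List.length_append, h2]
  omega

theorem length_itemsCode_le {α : Type} (W off m : ℕ) (bt : α → ℕ → Bool)
    (J : List (α × Bool × ℕ)) : (itemsCode W off m bt J).length ≤ J.length * (15 * m + 31) := by
  induction J with
  | nil => simp [itemsCode]
  | cons x J ih =>
    rw [itemsCode, List.length_append, List.length_cons, add_mul, one_mul, add_comm]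
    exact add_le_add ih (length_stepCode_le ..)

theorem length_sortA_le (W l L : ℕ) :
    (sortA W l L).length ≤ L * (l * (l * 3)) + (l + l * (l * (l * 2))) + l * l + (l + 1) + l * l := by
  have h1 : (cmps W l L L).length ≤ L * (l * (l * 3)) := by
    unfold cmps cmpLayer
    refine length_flatMap_range_le fun b => length_flatMap_range_le fun i =>
      length_flatMap_range_le fun j => ?_
    cases i == j <;> simp
  have h2 : (ranks W l L l).length ≤ l + l * (l * (l * 2)) := by
    unfold ranks rankLayer
    rw [List.length_append, List.length_map, List.length_range]
    refine Nat.add_le_add_left ?_ _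
    exact length_flatMap_range_le fun b => length_flatMap_range_le fun i =>
      length_flatMap_range_le fun j => le_rfl
  have h3 : (parity W l).length ≤ l * (l * 1) :=
    length_flatMap_range_le fun b => length_flatMap_range_le fun i => le_rfl
  have h4 : (sel W l).length ≤ l * (l * 1) :=
    length_flatMap_range_le fun b => length_flatMap_range_le fun i => le_rfl
  rw [mul_one] at h3 h4
  simp only [sortA, List.length_append, length_chain]
  omega

theorem length_sortCirc_le {W l L M : ℕ} (hl : 0 < l) (hML : M ≤ L) :
    (sortCirc W l L M).length ≤ 13 * (l * (l * L)) + 17 * (l * (l * l)) := by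
  have h0 := length_sortA_le W l L
  have h1 : (outC W l L).length ≤ l * (L * (l * 1)) :=
    length_flatMap_range_le fun _ => length_flatMap_range_le fun _ =>
      length_flatMap_range_le fun _ => le_rfl
  have h2 : (rankC W l L M).length ≤ l * (M * (l * 1)) := by
    refine length_flatMap_range_le fun _ => length_flatMap_range_le fun b =>
      length_flatMap_range_le fun r => ?_
    cases r.testBit b <;> simp
  have h3 : (dec W l L M).length ≤ l * (l * (M + 1)) :=
    length_flatMap_range_le fun _ => length_flatMap_range_le fun _ => (length_chain ..).le
  have h4 : (decC W l L M).length ≤ l * (L * (l * 1)) :=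
    length_flatMap_range_le fun _ => length_flatMap_range_le fun _ =>
      length_flatMap_range_le fun _ => le_rfl
  have h5 : (mvA W l L).length ≤ l * L * 1 := length_flatMap_range_le fun _ => le_rfl
  have h6 : (mvB W l L M).length ≤ l * L * 1 := length_flatMap_range_le fun _ => le_rfl
  have e1 : l * (M * (l * 1)) ≤ l * (l * L) := by
    rw [mul_one, mul_comm M]; gcongr
  have e2 : l * (l * (M + 1)) ≤ l * (l * L) + l * l := by
    rw [← Nat.mul_add]
    refine Nat.mul_le_mul_left _ ?_
    rw [Nat.mul_add, mul_one]
    gcongr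
  have e3 : l * L ≤ l * (l * L) := Nat.le_mul_of_pos_left _ hl
  have e4 : l * l ≤ l * (l * l) := Nat.le_mul_of_pos_left _ hl
  have e5 : l ≤ l * l := Nat.le_mul_of_pos_left _ hl
  have e6 : L * (l * (l * 3)) = 3 * (l * (l * L)) := by ring
  have e7 : l * (l * (l * 2)) = 2 * (l * (l * l)) := by ring
  have e8 : l * (L * (l * 1)) = l * (l * L) := by ring
  simp only [sortCirc, sortC, List.length_append, List.length_reverse, List.length_singleton]
  omega

/-- Loading costs `c` blocks times the number of items times `O(kL)`, sorting costs `O(l²L + l³)`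
from the comparison and the partial ranks of all pairs, and the Hadamard gates and the last flag
cost `O(lM)` with `M ≤ L`. The constant 120 absorbs all lower-order terms. -/
theorem length_mainCode_le {α : Type} {W k c L M : ℕ} (bt : α → ℕ → Bool) (J : List (α × Bool × ℕ))
    (hk : 0 < k) (hc : 0 < c) (hL : 0 < L) (hML : M ≤ L) :
    (mainCode W k (c * k) L M bt J c).length ≤
      120 * (c * k * (J.length * L + c * k * (c * k) + c * k * L)) := by
  have hl : 0 < c * k := Nat.mul_pos hc hk
  have h1 : (blocksCode W (k * L) bt J c).length ≤ c * (J.length * (15 * (k * L) + 31) + 5) := by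
    refine length_flatMap_range_le fun j => ?_
    rw [blockCode, List.length_append]
    exact add_le_add (length_itemsCode_le ..) le_rfl
  have h2 := length_sortCirc_le (W := W) hl hML
  have h3 : (hadsCode (c * k * L) (c * k * M)).length = c * k * M := by simp [hadsCode]
  have h4 : (finCirc W (c * k) L M).length = 2 * (c * k * M) + 5 := by
    simp only [finCirc, finChain, List.length_append, List.length_reverse, length_chain,
      List.length_singleton]
    ring
  have e1 : c * (J.length * (15 * (k * L) + 31) + 5) ≤ 46 * (c * k * (J.length * L)) + 5 * (c * k) := by
    have : 31 ≤ 31 * (k * L) := Nat.le_mul_of_pos_right _ (Nat.mul_pos hk hL)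
    calc c * (J.length * (15 * (k * L) + 31) + 5)
        ≤ c * (J.length * (15 * (k * L) + 31 * (k * L)) + 5) := by gcongr
      _ = 46 * (c * k * (J.length * L)) + 5 * c := by ring
      _ ≤ _ := by gcongr; exact Nat.le_mul_of_pos_right _ hk
  rw [mainCode, List.length_append, List.length_append, List.length_append, length_flatMap_code,
    length_flatMap_code, h3, h4]
  set l := c * k
  have e2 : l * M ≤ l * (l * L) :=
    Nat.mul_le_mul_left _ (hML.trans (Nat.le_mul_of_pos_left _ hl))
  have e4 : l * l ≤ l * (l * l) := Nat.le_mul_of_pos_left _ hl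
  have e5 : l ≤ l * l := Nat.le_mul_of_pos_left _ hl
  have e6 : l * (J.length * L + l * l + l * L) =
      l * (J.length * L) + l * (l * l) + l * (l * L) := by ring
  rw [e6]
  omega

/-! ### Correctness of the algorithm -/

theorem outputsPreparation {alg : Prog} (halg : ∀ (n k l : ℕ) (I : KXor n k), ∃ t,
      Eval alg (encodeInput n k l I)
        (circuitTree (output (n, k, l, rawInput I)).1 (output (n, k, l, rawInput I)).2) t)
    {n k c : ℕ} (hk : 2 ≤ k) (hkn : k ≤ n) (hc : 0 < c) (hln : c * k ≤ n) (I : KXor n k)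
    (hg : guideNorm (c * k) I ≠ 0) {g b : ℝ}
    (hgates : ((120 * (c * k * (I.length * bitLen n + c * k * (c * k) + c * k * bitLen n)) : ℕ) : ℝ)
      ≤ g)
    (hb : b ≤ c.factorial * guideNorm (c * k) I * √((1 : ℝ) / 2) ^ (c * k * bitLen (c * k)) /
      √(∑ S : Scope n k, (coeff I S.1 : ℝ) ^ 2) ^ c) :
    OutputsPreparation alg (c * k) I g b := by
  have hk0 : 0 < k := by omega
  have hL : 0 < bitLen n := Nat.clog_pos (by norm_num) (by omega)
  have hLn : bitLen n ≤ n := Nat.clog_le_of_le_pow Nat.lt_two_pow_self.le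
  have hMl : bitLen (c * k) ≤ c * k := Nat.clog_le_of_le_pow Nat.lt_two_pow_self.le
  have hML : bitLen (c * k) ≤ bitLen n := Nat.clog_mono_right _ hln
  have hR : 0 < sumSq (items (rawInput I)) := by
    obtain ⟨S, hS⟩ := exists_coeff_ne_zero hk0 hc hg
    rw [← Nat.cast_pos (α := ℝ), sumSq_items]
    refine Finset.sum_pos' (fun S _ => sq_nonneg _) ⟨S, Finset.mem_univ _, ?_⟩
    exact sq_pos_of_ne_zero (Int.cast_ne_zero.2 hS)
  -- The bound is a square, so it dominates not only the parameters but also products such as `l *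
  -- bitLen n`, which occur as indices of work wires.
  set Q := idxBound n k (c * k) with hQdef
  have hQ : (n + k + c * k + 11) ^ 2 = Q := rfl
  have q1 : n + k + c * k + 11 ≤ Q := by
    rw [← hQ, sq]; exact Nat.le_mul_of_pos_left _ (by omega)
  have q2 : c * k * bitLen n < Q := by
    rw [← hQ]
    calc c * k * bitLen n ≤ (c * k) * n := Nat.mul_le_mul_left _ hLn
      _ < _ := by nlinarith
  have q3 : c * k * bitLen (c * k) + 2 < Q := by
    rw [← hQ]
    calc c * k * bitLen (c * k) + 2 ≤ c * k * (c * k) + 2 :=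
          Nat.add_le_add_right (Nat.mul_le_mul_left _ hMl) _
      _ < _ := by nlinarith
  have q4 : k * bitLen n + 2 < Q := by
    rw [← hQ]
    calc k * bitLen n + 2 ≤ k * n + 2 := Nat.add_le_add_right (Nat.mul_le_mul_left _ hLn) _
      _ < _ := by nlinarith
  obtain ⟨G, hG1, hG2⟩ := prepares_mainCode (w := Q ^ 4) (Q := Q) I hk0 hL le_rfl (by omega)
    (by omega) (by omega) (by omega) q2 q3 q4 (listBits (bitLen n)) (items (rawInput I))
    (fun x hx => by simpa using (List.mem_filter.1 hx).2)
    (pairwise_items hL (Nat.le_pow_clog (by norm_num) n) I)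
    (fun F => by
      rw [sum_items I (fun x => (wt x : ℂ) • F (listBits (bitLen n) x.1)) fun x hx => by
        simp [wt, hx]]
      refine Finset.sum_congr rfl fun S _ => ?_
      rw [wt_item]
      rfl) hR hg
  obtain ⟨t, ht⟩ := halg n k (c * k) I
  refine ⟨_, _, G, t, _, ht, ?_, ?_, ?_, hG2⟩
  · rw [output]
    dsimp only
    rw [Nat.mul_div_cancel _ hk0]
    exact hG1
  · refine le_trans ?_ hgates
    rw [Nat.cast_le, ← hG1.length_eq]
    refine (length_mainCode_le _ _ hk0 hc hL hML).trans ?_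
    gcongr
    exact length_items_le I
  · rw [sumSq_items]
    exact hb

/-! ### Averages over functions -/

section
variable {ι κ α : Type} [Fintype ι] [DecidableEq ι] [Fintype κ] [DecidableEq κ] [Fintype α]

/-- Replacement of some coordinates. -/
def extendEquiv (e : κ → ι) (he : Function.Injective e) :
    ((ι → α) × (κ → α)) ≃ ((ι → α) × (κ → α)) :=
  Function.Involutive.toPerm (fun p => (Function.extend e p.2 p.1, p.1 ∘ e)) (by
    rintro ⟨σ, u⟩
    refine Prod.ext ?_ ?_
    · funext i
      by_cases hi : ∃ a, e a = i
      · obtain ⟨a, rfl⟩ := hi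
        simp [he.extend_apply]
      · simp [Function.extend_apply' _ _ _ hi]
    · funext a
      simp [he.extend_apply])

/-- Exchanging the coordinates in the range of `e` with a fresh family is an involution of the set
of pairs. So resampling these coordinates uniformly does not change an average. -/
theorem sum_extend (e : κ → ι) (he : Function.Injective e) (F : (ι → α) → ℝ) :
    ∑ σ : ι → α, ∑ u : κ → α, F (Function.extend e u σ) =
      (Fintype.card α : ℝ) ^ Fintype.card κ * ∑ σ, F σ := by
  rw [← Fintype.sum_prod_type' (f := fun (σ : ι → α) (u : κ → α) => F (Function.extend e u σ))]
  have h := (extendEquiv (α := α) e he).sum_comp fun p : (ι → α) × (κ → α) => F p.1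
  rw [Fintype.sum_prod_type] at h
  simp only [Fintype.sum_prod_type (f := fun p : (ι → α) × (κ → α) => F p.1), Finset.sum_const,
    Finset.card_univ, nsmul_eq_mul, Fintype.card_fun, Nat.cast_pow, ← Finset.mul_sum] at h
  rw [← h, Fintype.sum_prod_type]
  rfl

theorem sum_update (q : ι) (F : (ι → α) → ℝ) :
    ∑ σ : ι → α, ∑ x : α, F (Function.update σ q x) = Fintype.card α * ∑ σ, F σ := by
  have he : Function.Injective fun _ : Unit => q := fun _ _ _ => rfl
  have h := sum_extend (α := α) _ he F
  rw [Fintype.card_unit, pow_one] at h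
  rw [← h]
  refine Finset.sum_congr rfl fun σ _ => ?_
  rw [← (Equiv.funUnique Unit α).symm.sum_comp]
  refine Finset.sum_congr rfl fun x _ => ?_
  congr 1
  funext i
  by_cases hi : i = q
  · subst hi
    rw [Function.update_self]
    exact (he.extend_apply (fun _ => x) σ ()).symm
  · rw [Function.update_of_ne hi, Function.extend_apply']
    rintro ⟨a, ha⟩
    exact hi ha.symm

theorem sum_apply_mul (i : ι) (g : α → ℝ) :
    (∑ τ : ι → α, g (τ i)) * Fintype.card α = (Fintype.card α : ℝ) ^ Fintype.card ι * ∑ a, g a := by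
  rw [mul_comm, ← sum_update i]
  simp only [Function.update_self, Finset.sum_const, Finset.card_univ, nsmul_eq_mul,
    Fintype.card_fun, Nat.cast_pow]

theorem sum_apply_apply_mul {i j : ι} (hij : i ≠ j) (g : α → α → ℝ) :
    (∑ τ : ι → α, g (τ i) (τ j)) * (Fintype.card α : ℝ) ^ 2 =
      (Fintype.card α : ℝ) ^ Fintype.card ι * ∑ a, ∑ b, g a b := by
  rw [sq, ← mul_assoc, mul_comm (∑ τ : ι → α, _), ← sum_update j]
  simp only [Function.update_self, Function.update_of_ne hij]
  exact sum_apply_mul i fun a => ∑ b, g a b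

theorem markov_card (f : (ι → α) → ℝ) (hf : ∀ σ, 0 ≤ f σ) (t : ℝ)
    [DecidablePred fun σ => t < f σ] :
    ((Finset.univ.filter fun σ => t < f σ).card : ℝ) * t ≤ ∑ σ, f σ := by
  calc ((Finset.univ.filter fun σ => t < f σ).card : ℝ) * t
      = ∑ σ ∈ Finset.univ.filter (fun σ => t < f σ), t := by rw [Finset.sum_const, nsmul_eq_mul]
    _ ≤ ∑ σ ∈ Finset.univ.filter (fun σ => t < f σ), f σ :=
        Finset.sum_le_sum fun σ hσ => (Finset.mem_filter.1 hσ).2.le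
    _ ≤ ∑ σ, f σ := Finset.sum_le_sum_of_subset_of_nonneg (Finset.subset_univ _) fun σ _ _ => hf σ

/-- The second moment of a sum over pairs of functions whose averages over either argument vanish. -/
theorem sum_sq_pairs_le (Y : α → α → ℝ) (hs : ∀ a b, Y a b = Y b a) (h0 : ∀ a, ∑ b, Y a b = 0) :
    (∑ σ : ι → α, (∑ p, ∑ q, if p = q then 0 else Y (σ p) (σ q)) ^ 2) * (Fintype.card α : ℝ) ^ 2 ≤
      (Fintype.card α : ℝ) ^ Fintype.card ι *
        (2 * (Fintype.card ι : ℝ) ^ 2 * ∑ a, ∑ b, Y a b ^ 2) := by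
  -- The coordinate `q` enters only through `Y (σ p) (σ q)`, and the average of `Y` over this
  -- argument is zero.
  have hzero : ∀ (q p : ι) (G : (ι → α) → ℝ), p ≠ q →
      (∀ σ x, G (Function.update σ q x) = G σ) → ∑ σ : ι → α, Y (σ p) (σ q) * G σ = 0 := by
    intro q p G hpq hG
    have h := sum_update q fun σ : ι → α => Y (σ p) (σ q) * G σ
    simp only [Function.update_self, Function.update_of_ne hpq, hG, ← Finset.sum_mul, h0, zero_mul,
      Finset.sum_const_zero] at h
    rcases mul_eq_zero.1 h.symm with h | h
    · have hα : IsEmpty α := Fintype.card_eq_zero_iff.1 (by exact_mod_cast h)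
      have : IsEmpty (ι → α) := ⟨fun f => hα.elim (f q)⟩
      exact Fintype.sum_empty _
    · exact h
  -- Two different unordered pairs have a coordinate that belongs to the first only; by symmetry of
  -- `Y` it may be either argument.
  have hzero' : ∀ p q p' q' : ι, p ≠ q → p' ≠ q' → ¬ ((p = p' ∧ q = q') ∨ (p = q' ∧ q = p')) →
      ∑ σ : ι → α, Y (σ p) (σ q) * Y (σ p') (σ q') = 0 := by
    intro p q p' q' hpq hpq' hne
    by_cases hq : q = p' ∨ q = q'
    · have hp : p ≠ p' ∧ p ≠ q' := by
        rcases hq with rfl | rfl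
        · exact ⟨hpq, fun h => hne (Or.inr ⟨h, rfl⟩)⟩
        · exact ⟨fun h => hne (Or.inl ⟨h, rfl⟩), hpq⟩
      have := hzero p q (fun σ => Y (σ p') (σ q')) hpq.symm fun σ x => by
        rw [Function.update_of_ne hp.1.symm, Function.update_of_ne hp.2.symm]
      rw [← this]
      exact Finset.sum_congr rfl fun σ _ => by rw [hs (σ p)]
    · push Not at hq
      exact hzero q p (fun σ => Y (σ p') (σ q')) hpq fun σ x => by
        rw [Function.update_of_ne hq.1.symm, Function.update_of_ne hq.2.symm]
  set V := (Fintype.card α : ℝ)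
  set S2 := ∑ a, ∑ b, Y a b ^ 2
  have hS2 : 0 ≤ S2 := Finset.sum_nonneg fun a _ => Finset.sum_nonneg fun b _ => sq_nonneg _
  -- Of all products only those of a pair with itself and with its transpose survive. These two
  -- cases give the factor 2 of the final bound.
  have hterm : ∀ p q p' q' : ι,
      (∑ σ : ι → α, (if p = q then 0 else Y (σ p) (σ q)) * (if p' = q' then 0 else Y (σ p') (σ q'))) *
        V ^ 2 ≤ V ^ Fintype.card ι * ((if p = p' ∧ q = q' then S2 else 0) +
          (if p = q' ∧ q = p' then S2 else 0)) := by
    intro p q p' q'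
    have hR : 0 ≤ V ^ Fintype.card ι * ((if p = p' ∧ q = q' then S2 else 0) +
          (if p = q' ∧ q = p' then S2 else 0)) := by
      refine mul_nonneg (by positivity) (add_nonneg ?_ ?_) <;> split_ifs <;> first | exact hS2 | rfl
    by_cases hpq : p = q
    · simpa [hpq] using hR
    by_cases hpq' : p' = q'
    · simpa [hpq'] using hR
    simp only [if_neg hpq, if_neg hpq']
    have hsq := sum_apply_apply_mul (α := α) hpq fun a b => Y a b ^ 2
    by_cases h : (p = p' ∧ q = q') ∨ (p = q' ∧ q = p')
    · have e : ∑ σ : ι → α, Y (σ p) (σ q) * Y (σ p') (σ q') = ∑ σ : ι → α, Y (σ p) (σ q) ^ 2 := by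
        refine Finset.sum_congr rfl fun σ _ => ?_
        rcases h with ⟨rfl, rfl⟩ | ⟨rfl, rfl⟩
        · rw [sq]
        · rw [sq, hs (σ q)]
      rw [e, hsq]
      refine mul_le_mul_of_nonneg_left ?_ (by positivity)
      rcases h with h | h
      · rw [if_pos h]
        refine le_add_of_nonneg_right ?_
        split_ifs <;> first | exact hS2 | rfl
      · rw [if_pos h]
        refine le_add_of_nonneg_left ?_
        split_ifs <;> first | exact hS2 | rfl
    · rw [hzero' p q p' q' hpq hpq' h, zero_mul]
      exact hR
  calc (∑ σ : ι → α, (∑ p, ∑ q, if p = q then 0 else Y (σ p) (σ q)) ^ 2) * V ^ 2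
      = ∑ p : ι, ∑ q : ι, ∑ p' : ι, ∑ q' : ι, (∑ σ : ι → α,
          (if p = q then 0 else Y (σ p) (σ q)) * (if p' = q' then 0 else Y (σ p') (σ q'))) * V ^ 2 := by
        simp only [← Finset.sum_mul]
        congr 1
        rw [Finset.sum_congr rfl fun σ _ => by
          rw [sq, Finset.sum_mul, Finset.sum_congr rfl fun p _ => by
            rw [Finset.sum_mul, Finset.sum_congr rfl fun q _ => by
              rw [Finset.mul_sum, Finset.sum_congr rfl fun p' _ => Finset.mul_sum ..]]]]
        rw [Finset.sum_comm]
        refine Finset.sum_congr rfl fun p _ => ?_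
        rw [Finset.sum_comm]
        refine Finset.sum_congr rfl fun q _ => ?_
        rw [Finset.sum_comm]
        refine Finset.sum_congr rfl fun p' _ => ?_
        rw [Finset.sum_comm]
    _ ≤ ∑ p : ι, ∑ q : ι, ∑ p' : ι, ∑ q' : ι, V ^ Fintype.card ι *
          ((if p = p' ∧ q = q' then S2 else 0) + (if p = q' ∧ q = p' then S2 else 0)) :=
        Finset.sum_le_sum fun p _ => Finset.sum_le_sum fun q _ => Finset.sum_le_sum fun p' _ =>
          Finset.sum_le_sum fun q' _ => hterm p q p' q'
    _ = _ := by
        simp only [← Finset.mul_sum, Finset.sum_add_distrib]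
        congr 1
        have h1 : ∀ p q : ι, ∑ p' : ι, ∑ q' : ι, (if p = p' ∧ q = q' then S2 else 0) = S2 := by
          intro p q
          simp only [ite_and, Finset.sum_ite_irrel, Finset.sum_const_zero, Finset.sum_ite_eq,
            Finset.mem_univ, if_true]
        have h2 : ∀ p q : ι, ∑ p' : ι, ∑ q' : ι, (if p = q' ∧ q = p' then S2 else 0) = S2 := by
          intro p q
          rw [Finset.sum_comm]
          exact h1 p q
        simp only [h1, h2, Finset.sum_const, Finset.card_univ, nsmul_eq_mul]
        ring

end

/-! ### Counting scopes -/

theorem card_scope (n k : ℕ) : Fintype.card (Scope n k) = n.choose k := by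
  rw [Fintype.card_finset_len, Fintype.card_fin]

/-- By linearity: a fixed point lies in `(n-1).choose (k-1)` scopes, which is the fraction `k / n`
of all of them, and `S` has `k` points. -/
theorem sum_inter_card {n k : ℕ} (hk : 0 < k) (hn : 0 < n) (S : Scope n k) :
    (∑ T : Scope n k, ((S.1 ∩ T.1).card : ℝ)) * n = k ^ 2 * Fintype.card (Scope n k) := by
  classical
  have h1 : ∀ i : Fin n, (∑ T : Scope n k, if i ∈ T.1 then (1 : ℝ) else 0) = (n - 1).choose (k - 1) := by
    intro i
    have h := Finset.card_filter_powersetCard_subset {i} (Finset.univ : Finset (Fin n)) k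
      (Finset.subset_univ _) (by rw [Finset.card_singleton]; exact hk)
    rw [Finset.card_univ, Fintype.card_fin, Finset.card_singleton] at h
    rw [← h, Finset.sum_boole, Nat.cast_inj]
    refine Finset.card_bij (fun T _ => T.1) ?_ ?_ ?_
    · intro T hT
      simpa using ⟨T.2, (Finset.mem_filter.1 hT).2⟩
    · intro T _ T' _ h
      exact Subtype.ext h
    · intro T hT
      simp only [Finset.mem_filter, Finset.mem_powersetCard, Finset.singleton_subset_iff] at hT
      exact ⟨⟨T, hT.1.2⟩, by simpa using hT.2, rfl⟩
  have h2 : ∀ T : Scope n k, ((S.1 ∩ T.1).card : ℝ) = ∑ i ∈ S.1, if i ∈ T.1 then (1 : ℝ) else 0 := by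
    intro T
    rw [Finset.sum_boole, Finset.filter_mem_eq_inter]
  simp only [h2]
  rw [Finset.sum_comm, Finset.sum_congr rfl fun i _ => h1 i, Finset.sum_const, S.2, nsmul_eq_mul,
    card_scope, sq, mul_assoc, mul_assoc]
  congr 1
  have h3 := Nat.add_one_mul_choose_eq (n - 1) (k - 1)
  rw [Nat.sub_add_cancel hn, Nat.sub_add_cancel hk] at h3
  rw [mul_comm, mul_comm (k : ℝ)]
  exact_mod_cast h3

/-- The number of families of disjoint scopes with a given union. -/
theorem card_disjoint_families_le {n k : ℕ} {κ : Type} [Fintype κ] [DecidableEq κ]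
    (U : Finset (Fin n))
    [DecidablePred fun u : κ → Scope n k => (Pairwise fun i j => Disjoint (u i).1 (u j).1) ∧
      (Finset.univ.biUnion fun i => (u i).1) = U] :
    (Finset.univ.filter fun u : κ → Scope n k => (Pairwise fun i j => Disjoint (u i).1 (u j).1) ∧
      (Finset.univ.biUnion fun i => (u i).1) = U).card ≤ Fintype.card κ ^ (Fintype.card κ * k) := by
  classical
  rcases (Finset.univ.filter fun u : κ → Scope n k =>
    (Pairwise fun i j => Disjoint (u i).1 (u j).1) ∧
      (Finset.univ.biUnion fun i => (u i).1) = U).eq_empty_or_nonempty with h | ⟨u0, h0⟩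
  · rw [h, Finset.card_empty]; exact Nat.zero_le _
  have hU : U.card = Fintype.card κ * k := by
    obtain ⟨h1, h2⟩ := (Finset.mem_filter.1 h0).2
    rw [← h2, Finset.card_biUnion fun i _ j _ hij => h1 hij, Finset.sum_congr rfl fun i _ => (u0 i).2]
    simp
  rw [← hU, ← Fintype.card_coe U, ← Fintype.card_fun, ← Finset.card_univ]
  have hex : ∀ u ∈ Finset.univ.filter (fun u : κ → Scope n k =>
      (Pairwise fun i j => Disjoint (u i).1 (u j).1) ∧ (Finset.univ.biUnion fun i => (u i).1) = U),
      ∀ x : U, ∃ i, x.1 ∈ (u i).1 := by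
    intro u hu x
    have hx : x.1 ∈ Finset.univ.biUnion fun i => (u i).1 := (Finset.mem_filter.1 hu).2.2 ▸ x.2
    obtain ⟨i, -, hi⟩ := Finset.mem_biUnion.1 hx
    exact ⟨i, hi⟩
  -- A family is determined by the map that sends each point of `U` to the index of the member
  -- containing it. The `else` branch is a default that is not reached for families that cover `U`.
  refine Finset.card_le_card_of_injOn (fun u => if hu : ∀ x : U, ∃ i, x.1 ∈ (u i).1 then
    fun x => (hu x).choose else fun x => ((hex u0 h0) x).choose) (fun _ _ => Finset.mem_coe.2 (Finset.mem_univ _)) ?_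
  intro u hu v hv huv
  have hu1 := hex u hu
  have hv1 := hex v hv
  simp only [dif_pos hu1, dif_pos hv1] at huv
  have key : ∀ w ∈ Finset.univ.filter (fun u : κ → Scope n k =>
      (Pairwise fun i j => Disjoint (u i).1 (u j).1) ∧ (Finset.univ.biUnion fun i => (u i).1) = U),
      ∀ hw : (∀ x : U, ∃ i, x.1 ∈ (w i).1), ∀ i x, x ∈ (w i).1 ↔ ∃ hx : x ∈ U, (hw ⟨x, hx⟩).choose = i := by
    intro w hw hw' i x
    obtain ⟨h1, h2⟩ := (Finset.mem_filter.1 hw).2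
    constructor
    · intro hx
      have hxU : x ∈ U := h2 ▸ Finset.mem_biUnion.2 ⟨i, Finset.mem_univ _, hx⟩
      refine ⟨hxU, ?_⟩
      by_contra hne
      exact Finset.disjoint_left.1 (h1 hne) (hw' ⟨x, hxU⟩).choose_spec hx
    · rintro ⟨hx, rfl⟩
      exact (hw' ⟨x, hx⟩).choose_spec
  funext i
  apply Subtype.ext
  ext x
  rw [key u hu hu1, key v hv hv1]
  exact exists_congr fun hx => by rw [congrFun huv ⟨x, hx⟩]

/-! ### Lists of scopes with few coincidences -/

section
variable {n k c N : ℕ}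

open Classical in
/-- The pairs of constraints with equal scopes. -/
def repPairs (σ : Fin N → Scope n k) : Finset (Fin N × Fin N) :=
  Finset.univ.filter fun p => p.1 ≠ p.2 ∧ σ p.1 = σ p.2

open Classical in
/-- The pairs of constraints with intersecting scopes. -/
def meetPairs (σ : Fin N → Scope n k) : Finset (Fin N × Fin N) :=
  Finset.univ.filter fun p => ¬ Disjoint (σ p.1).1 (σ p.2).1

/-- The scopes of the constraints in `B` are disjoint and can replace those of the constraints
`τ j`, `j ∈ A`. -/
def Exchange (σ : Fin N → Scope n k) (τ : Fin c → Fin N) (A : Finset (Fin c)) (B : Finset (Fin N)) :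
    Prop :=
  2 ≤ A.card ∧ B.card = A.card ∧ (∀ j ∈ A, τ j ∉ B) ∧
    (∀ p ∈ B, ∀ q ∈ B, p ≠ q → Disjoint (σ p).1 (σ q).1) ∧
    (B.biUnion fun p => (σ p).1) = A.biUnion fun j => (σ (τ j)).1

open Classical in
/-- All possible replacements. -/
def exchanges (c : ℕ) (σ : Fin N → Scope n k) :
    Finset ((Fin c → Fin N) × Finset (Fin c) × Finset (Fin N)) :=
  Finset.univ.filter fun x => Exchange σ x.1 x.2.1 x.2.2

/-- There are few coincidences between the scopes. -/
structure GoodScopes (c : ℕ) (σ : Fin N → Scope n k) : Prop where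
  rep : 8 * c * (repPairs σ).card ≤ N
  meet : 4 * c ^ 2 * (meetPairs σ).card ≤ N ^ 2
  exch : 8 * (exchanges c σ).card ≤ N ^ c

/-- The coefficients of the signed scopes. -/
def signSum (σ : Fin N → Scope n k) (b : Fin N → ℤˣ) (S : Finset (Fin n)) : ℤ :=
  ∑ i, if (σ i).1 = S then (b i : ℤ) else 0

/-- In the expanded squares the diagonal contributes `N`, and every ordered pair of different
constraints with equal scopes contributes at most 1, whatever the signs are. -/
theorem sum_sq_signSum_le (σ : Fin N → Scope n k) (b : Fin N → ℤˣ) :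
    ∑ S : Scope n k, (signSum σ b S.1 : ℝ) ^ 2 ≤ N + (repPairs σ).card := by
  classical
  have h1 : ∀ S : Scope n k, (signSum σ b S.1 : ℝ) ^ 2 ≤
      ∑ p : Fin N, ∑ q : Fin N, if σ p = S ∧ σ q = S then (1 : ℝ) else 0 := by
    intro S
    rw [sq, signSum, Int.cast_sum, Finset.sum_mul_sum]
    refine Finset.sum_le_sum fun p _ => Finset.sum_le_sum fun q _ => ?_
    by_cases hp : σ p = S
    · by_cases hq : σ q = S
      · rcases Int.units_eq_one_or (b p) with h | h <;> rcases Int.units_eq_one_or (b q) with h' | h' <;>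
          simp [hp, hq, h, h']
      · have : (σ q).1 ≠ S.1 := fun h => hq (Subtype.ext h)
        simp [hq, this]
    · have : (σ p).1 ≠ S.1 := fun h => hp (Subtype.ext h)
      simp [hp, this]
  calc ∑ S : Scope n k, (signSum σ b S.1 : ℝ) ^ 2
      ≤ ∑ S : Scope n k, ∑ p : Fin N, ∑ q : Fin N, if σ p = S ∧ σ q = S then (1 : ℝ) else 0 :=
        Finset.sum_le_sum fun S _ => h1 S
    _ = ∑ p : Fin N, ∑ q : Fin N, if σ p = σ q then (1 : ℝ) else 0 := by
        rw [Finset.sum_comm]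
        refine Finset.sum_congr rfl fun p _ => ?_
        rw [Finset.sum_comm]
        refine Finset.sum_congr rfl fun q _ => ?_
        simp only [ite_and, Finset.sum_ite_eq, Finset.mem_univ, if_true, eq_comm (a := σ q)]
    _ = ∑ p : Fin N, ∑ q : Fin N, ((if p = q then (1 : ℝ) else 0) +
          if p ≠ q ∧ σ p = σ q then (1 : ℝ) else 0) := by
        refine Finset.sum_congr rfl fun p _ => Finset.sum_congr rfl fun q _ => ?_
        by_cases h : p = q
        · simp [h]
        · simp [h]
    _ = N + (repPairs σ).card := by
        simp only [Finset.sum_add_distrib, Finset.sum_ite_eq, Finset.mem_univ, if_true,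
          Finset.sum_const, Finset.card_univ, Fintype.card_fin, nsmul_eq_mul, mul_one]
        congr 1
        rw [repPairs, ← Fintype.sum_prod_type' (f := fun p q : Fin N =>
          if p ≠ q ∧ σ p = σ q then (1 : ℝ) else 0), Finset.sum_boole]

/-- The tuples of constraints that are determined by the union of their scopes. -/
structure Clean (σ : Fin N → Scope n k) (b : Fin N → ℤˣ) (τ : Fin c → Fin N) : Prop where
  disj : DisjTuple (σ ∘ τ)
  single : ∀ j q, σ q = σ (τ j) → q = τ j
  uniq : ∀ P ∈ partitions k (unionOf (σ ∘ τ)), (∀ S ∈ P, signSum σ b S ≠ 0) →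
    P = Finset.univ.image fun j => (σ (τ j)).1

theorem Clean.signSum_eq {σ : Fin N → Scope n k} {b : Fin N → ℤˣ} {τ : Fin c → Fin N}
    (h : Clean σ b τ) (j : Fin c) : signSum σ b (σ (τ j)).1 = b (τ j) := by
  rw [signSum, Finset.sum_eq_single (τ j), if_pos rfl]
  · intro q _ hq
    rw [if_neg fun e => hq (h.single j q (Subtype.ext e))]
  · simp

theorem DisjTuple.image_mem_partitions {τ : Fin c → Scope n k} (h : DisjTuple τ) :
    (Finset.univ.image fun j => (τ j).1) ∈ partitions k (unionOf τ) := by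
  classical
  rw [mem_partitions]
  refine ⟨?_, ?_, ?_⟩
  · intro S hS
    obtain ⟨j, -, rfl⟩ := Finset.mem_image.1 hS
    exact ⟨Finset.subset_biUnion_of_mem (fun j => (τ j).1) (Finset.mem_univ j), (τ j).2⟩
  · intro S hS S' hS' hne
    obtain ⟨j, -, rfl⟩ := Finset.mem_image.1 (Finset.mem_coe.1 hS)
    obtain ⟨j', -, rfl⟩ := Finset.mem_image.1 (Finset.mem_coe.1 hS')
    exact h fun e => hne (by rw [e])
  · rw [Finset.sup_image, Finset.sup_eq_biUnion]; rfl

theorem Clean.sum_partitions {σ : Fin N → Scope n k} {b : Fin N → ℤˣ} {τ : Fin c → Fin N}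
    (h : Clean σ b τ) (B : Finset (Fin n) → ℝ) (hB : ∀ S, signSum σ b S = 0 → B S = 0) :
    ∑ P ∈ partitions k (unionOf (σ ∘ τ)), ∏ S ∈ P, B S =
      ∏ S ∈ Finset.univ.image fun j => (σ (τ j)).1, B S := by
  refine Finset.sum_eq_single_of_mem _ h.disj.image_mem_partitions fun P hP hne => ?_
  by_contra h0
  refine hne (h.uniq P hP fun S hS h' => h0 ?_)
  exact Finset.prod_eq_zero hS (hB S h')

/-- Only one partition of the union has all coefficients nonzero, and each of its scopes carries a
single constraint, so the coordinate is a product of signs. -/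
theorem Clean.guideCoeff_sq {σ : Fin N → Scope n k} {b : Fin N → ℤˣ} {τ : Fin c → Fin N}
    (h : Clean σ b τ) {I : KXor n k} (hI : ∀ S, coeff I S = signSum σ b S) :
    guideCoeff I (unionOf (σ ∘ τ)) ^ 2 = 1 := by
  simp only [guideCoeff, hI]
  rw [h.sum_partitions (fun S => (signSum σ b S : ℝ)) fun S hS => by rw [hS, Int.cast_zero],
    ← Finset.prod_pow]
  refine Finset.prod_eq_one fun S hS => ?_
  obtain ⟨j, -, rfl⟩ := Finset.mem_image.1 hS
  rw [h.signSum_eq]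
  rcases Int.units_eq_one_or (b (τ j)) with h | h <;> simp [h]

open Classical in
-- Clean tuples are counted by their union `T`. At `T` the squared coordinate is 1, so it suffices
-- that at most `c!` clean tuples have union `T`; this follows because `T` has only one partition
-- into scopes with nonzero coefficients, and a clean tuple is determined by the ordered list of its
-- scopes.
theorem card_clean_le (hk : 0 < k) (σ : Fin N → Scope n k) (b : Fin N → ℤˣ) {I : KXor n k}
    (hI : ∀ S, coeff I S = signSum σ b S) :
    ((Finset.univ.filter fun τ : Fin c → Fin N => Clean σ b τ).card : ℝ) ≤
      c.factorial * guideNorm (c * k) I ^ 2 := by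
  rw [guideNorm, Real.sq_sqrt (Finset.sum_nonneg fun T _ => sq_nonneg _), Finset.mul_sum,
    Finset.card_eq_sum_card_fiberwise (f := fun τ => unionOf (σ ∘ τ))
      (t := (Finset.univ : Finset (Fin n)).powersetCard (c * k)), Nat.cast_sum]
  swap
  · intro τ hτ
    exact Finset.mem_coe.2 (Finset.mem_powersetCard.2 ⟨Finset.subset_univ _,
      (Finset.mem_filter.1 (Finset.mem_coe.1 hτ)).2.disj.card_unionOf⟩)
  refine Finset.sum_le_sum fun T hT => ?_
  rcases ((Finset.univ.filter fun τ : Fin c → Fin N => Clean σ b τ).filter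
    fun τ => unionOf (σ ∘ τ) = T).eq_empty_or_nonempty with h | ⟨τ0, h0⟩
  · rw [h, Finset.card_empty, Nat.cast_zero]
    positivity
  rw [Finset.mem_filter, Finset.mem_filter] at h0
  obtain ⟨⟨-, hc⟩, hu⟩ := h0
  rw [← hu, hc.guideCoeff_sq hI, mul_one, hu]
  -- Applied to the indicator of the nonzero coefficients, `sum_disjTuple` counts ordered partitions
  -- of `T` into scopes that are present: there are `c!` of them.
  set B : Finset (Fin n) → ℝ := fun S => if signSum σ b S = 0 then 0 else 1 with hB
  have hB1 : ∀ τ : Fin c → Fin N, Clean σ b τ → ∀ j, B (σ (τ j)).1 = 1 := by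
    intro τ hτ j
    rw [hB]
    dsimp only
    rw [hτ.signSum_eq, if_neg (Units.ne_zero _)]
  have hsum := sum_disjTuple hk T (Finset.mem_powersetCard.1 hT).2 B
  have hs1 : ∑ P ∈ partitions k T, ∏ S ∈ P, B S = 1 := by
    rw [← hu, hc.sum_partitions B fun S hS => by simp [hB, hS]]
    refine Finset.prod_eq_one fun S hS => ?_
    obtain ⟨j, -, rfl⟩ := Finset.mem_image.1 hS
    exact hB1 τ0 hc j
  rw [hs1, mul_one] at hsum
  rw [← hsum]
  calc _ = ∑ τ ∈ (Finset.univ.filter fun τ : Fin c → Fin N => Clean σ b τ).filter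
          fun τ => unionOf (σ ∘ τ) = T, ∏ j, B ((σ ∘ τ) j).1 := by
        rw [Finset.sum_congr rfl (g := fun _ => (1 : ℝ)), Finset.sum_const, nsmul_eq_mul, mul_one]
        intro τ hτ
        exact Finset.prod_eq_one fun j _ => hB1 τ (Finset.mem_filter.1 (Finset.mem_filter.1 hτ).1).2 j
    _ = ∑ u ∈ ((Finset.univ.filter fun τ : Fin c → Fin N => Clean σ b τ).filter
          fun τ => unionOf (σ ∘ τ) = T).image fun τ => σ ∘ τ, ∏ j, B (u j).1 := by
        rw [Finset.sum_image]
        intro τ hτ τ' hτ' h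
        have h1 := (Finset.mem_filter.1 (Finset.mem_filter.1 hτ).1).2
        funext j
        exact (h1.single j (τ' j) (congrFun h j).symm).symm
    _ ≤ _ := by
        refine Finset.sum_le_sum_of_subset_of_nonneg ?_ fun u _ _ => Finset.prod_nonneg fun j _ => ?_
        · intro u hu
          obtain ⟨τ, hτ, rfl⟩ := Finset.mem_image.1 hu
          rw [Finset.mem_filter, Finset.mem_filter] at hτ
          exact Finset.mem_filter.2 ⟨Finset.mem_univ _, hτ.1.2.disj, hτ.2⟩
        · rw [hB]
          dsimp only
          split_ifs <;> norm_num

open Classical in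
-- Let `R` be the partition given by `τ` and `P` another one. Then `R \ P` and `P \ R` have the same
-- size and the same union. `A` consists of the indices of the scopes in `R \ P`, and `B` contains
-- one constraint for each scope in `P \ R`, which exists because its coefficient is nonzero.
theorem exists_exchange (hk : 0 < k) {σ : Fin N → Scope n k} {b : Fin N → ℤˣ} {τ : Fin c → Fin N}
    (hd : DisjTuple (σ ∘ τ)) {P : Finset (Finset (Fin n))}
    (hP : P ∈ partitions k (unionOf (σ ∘ τ))) (h0 : ∀ S ∈ P, signSum σ b S ≠ 0)
    (hne : P ≠ Finset.univ.image fun j => (σ (τ j)).1) : ∃ A B, Exchange σ τ A B := by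
  set R := Finset.univ.image fun j => (σ (τ j)).1 with hR
  have hRp : R ∈ partitions k (unionOf (σ ∘ τ)) := hd.image_mem_partitions
  have hPc := card_of_mem_partitions hk hd.card_unionOf hP
  have hRc := card_of_mem_partitions hk hd.card_unionOf hRp
  obtain ⟨p1, p2, p3⟩ := mem_partitions.1 hP
  obtain ⟨r1, r2, r3⟩ := mem_partitions.1 hRp
  have hf : ∀ S : Finset (Fin n), ∃ i : Fin N, S ∈ P → (σ i).1 = S := by
    intro S
    by_cases hS : S ∈ P
    · by_contra! hcon
      refine h0 S hS (Finset.sum_eq_zero fun i _ => if_neg (hcon i).2)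
    · have hc : 0 < c := by
        by_contra hc
        have hc' : c = 0 := by omega
        rw [hc', Finset.card_eq_zero] at hPc hRc
        exact hne (by rw [hPc, hRc])
      exact ⟨τ ⟨0, hc⟩, fun h => absurd h hS⟩
  choose f hf using hf
  have hcard : (P \ R).card = (R \ P).card := Finset.card_sdiff_comm (by rw [hPc, hRc])
  have hsub : ∀ {P R : Finset (Finset (Fin n))} {T : Finset (Fin n)}, P.sup id = T → R.sup id = T →
      (R : Set (Finset (Fin n))).PairwiseDisjoint id →
      ∀ x, x ∈ (R \ P).sup id → x ∈ (P \ R).sup id := by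
    intro P R T hP hR hRd x hx
    rw [Finset.mem_sup] at hx ⊢
    obtain ⟨S, hS, hxS⟩ := hx
    rw [Finset.mem_sdiff] at hS
    have hxT : x ∈ P.sup id := by
      rw [hP, ← hR, Finset.mem_sup]
      exact ⟨S, hS.1, hxS⟩
    obtain ⟨S', hS', hxS'⟩ := Finset.mem_sup.1 hxT
    refine ⟨S', Finset.mem_sdiff.2 ⟨hS', fun hR' => hS.2 ?_⟩, hxS'⟩
    by_cases e : S = S'
    · rwa [e]
    · exact absurd hxS' (Finset.disjoint_left.1 (hRd hS.1 hR' e) hxS)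
  have hsup : (P \ R).sup id = (R \ P).sup id :=
    Finset.Subset.antisymm (fun x hx => hsub r3 p3 p2 x hx) fun x hx => hsub p3 r3 r2 x hx
  -- If only one set were exchanged, equality of the unions would force the two sets to be equal.
  -- The exponent `a ≥ 2` gained here is what makes exchanges rare enough.
  have htwo : 2 ≤ (R \ P).card := by
    by_contra hlt
    have hcases : (R \ P).card = 0 ∨ (R \ P).card = 1 := by omega
    rcases hcases with h | h
    · rw [Finset.card_eq_zero, Finset.sdiff_eq_empty_iff_subset] at h
      exact hne (Finset.eq_of_subset_of_card_le h (by rw [hPc, hRc])).symm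
    · obtain ⟨S, hS⟩ := Finset.card_eq_one.1 h
      rw [h] at hcard
      obtain ⟨S', hS'⟩ := Finset.card_eq_one.1 hcard
      rw [hS, hS', Finset.sup_singleton, Finset.sup_singleton] at hsup
      have h1 : S ∈ R \ P := by rw [hS]; exact Finset.mem_singleton_self _
      have h2 : S' ∈ P \ R := by rw [hS']; exact Finset.mem_singleton_self _
      have e : S' = S := hsup
      rw [e] at h2
      exact (Finset.mem_sdiff.1 h1).2 (Finset.mem_sdiff.1 h2).1
  have hinj : Function.Injective fun j => (σ (τ j)).1 := by
    intro i j hij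
    by_contra hne
    have hdis : Disjoint (σ (τ i)).1 (σ (τ j)).1 := hd hne
    dsimp only at hij
    rw [hij, disjoint_self] at hdis
    have := (σ (τ j)).2
    rw [show (σ (τ j)).1 = ∅ from hdis, Finset.card_empty] at this
    omega
  have hA : (Finset.univ.filter fun j => (σ (τ j)).1 ∉ P).image (fun j => (σ (τ j)).1) = R \ P := by
    ext S
    simp only [Finset.mem_image, Finset.mem_filter, Finset.mem_univ, true_and, Finset.mem_sdiff, hR]
    constructor
    · rintro ⟨j, hj, rfl⟩; exact ⟨⟨j, rfl⟩, hj⟩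
    · rintro ⟨⟨j, rfl⟩, hj⟩; exact ⟨j, hj, rfl⟩
  have hAc : (Finset.univ.filter fun j => (σ (τ j)).1 ∉ P).card = (R \ P).card := by
    rw [← hA, Finset.card_image_of_injective _ hinj]
  have hfS : ∀ S ∈ P \ R, (σ (f S)).1 = S := fun S hS => hf S (Finset.mem_sdiff.1 hS).1
  refine ⟨Finset.univ.filter fun j => (σ (τ j)).1 ∉ P, (P \ R).image f, by rw [hAc]; exact htwo, ?_, ?_, ?_, ?_⟩
  · rw [hAc, Finset.card_image_of_injOn, hcard]
    intro S hS S' hS' h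
    rw [← hfS S hS, ← hfS S' hS', h]
  · intro j hj hjB
    obtain ⟨S, hS, e⟩ := Finset.mem_image.1 hjB
    have := hfS S hS
    rw [e] at this
    rw [Finset.mem_filter, this] at hj
    exact hj.2 (Finset.mem_sdiff.1 hS).1
  · intro p hp q hq hpq
    obtain ⟨S, hS, rfl⟩ := Finset.mem_image.1 hp
    obtain ⟨S', hS', rfl⟩ := Finset.mem_image.1 hq
    rw [hfS S hS, hfS S' hS']
    exact p2 (Finset.mem_sdiff.1 hS).1 (Finset.mem_sdiff.1 hS').1 fun e => hpq (by rw [e])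
  · rw [Finset.image_biUnion]
    have e1 : ((P \ R).biUnion fun S => (σ (f S)).1) = (P \ R).sup id := by
      rw [Finset.sup_eq_biUnion]
      exact Finset.biUnion_congr rfl fun S hS => hfS S hS
    rw [e1, hsup, ← hA, Finset.sup_image, Finset.sup_eq_biUnion]
    rfl

/-- A tuple that is not clean has two intersecting scopes, or a scope that occurs again in the
instance, or an exchange. Averaging over the entries of the tuple, the hypotheses bound the three
fractions by 1/4, 1/8 and 1/8, so at least half of all tuples are clean. -/
theorem pow_le_guideNorm_sq (hk : 0 < k) (hN : 0 < N) {σ : Fin N → Scope n k} (hσ : GoodScopes c σ)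
    (b : Fin N → ℤˣ) {I : KXor n k} (hI : ∀ S, coeff I S = signSum σ b S) :
    (N : ℝ) ^ c ≤ 2 * (c.factorial * guideNorm (c * k) I ^ 2) := by
  classical
  have hN' : (0 : ℝ) < N := by exact_mod_cast hN
  refine le_trans ?_ (mul_le_mul_of_nonneg_left (card_clean_le hk σ b hI) two_pos.le)
  set G := Finset.univ.filter fun τ : Fin c → Fin N => Clean σ b τ
  set D : Fin c → Fin c → Finset (Fin c → Fin N) := fun i j =>
    Finset.univ.filter fun τ => ¬ Disjoint (σ (τ i)).1 (σ (τ j)).1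
  set E : Fin c → Finset (Fin c → Fin N) := fun j =>
    Finset.univ.filter fun τ => ∃ q, q ≠ τ j ∧ σ q = σ (τ j)
  set X := (exchanges c σ).image Prod.fst
  have hcover : (Finset.univ : Finset (Fin c → Fin N)) ⊆ ((G ∪
      (Finset.univ : Finset (Fin c × Fin c)).biUnion fun p => if p.1 = p.2 then ∅ else D p.1 p.2) ∪
      Finset.univ.biUnion E) ∪ X := by
    intro τ _
    by_contra hτ
    simp only [Finset.mem_union, not_or, Finset.mem_biUnion, Finset.mem_univ, true_and,
      not_exists] at hτ
    obtain ⟨⟨⟨h1, h2⟩, h3⟩, h4⟩ := hτ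
    apply h1
    have hd : DisjTuple (σ ∘ τ) := by
      intro i j hij
      by_contra hcon
      refine h2 (i, j) ?_
      dsimp only
      rw [if_neg hij]
      exact Finset.mem_filter.2 ⟨Finset.mem_univ _, hcon⟩
    refine Finset.mem_filter.2 ⟨Finset.mem_univ _, hd, ?_, ?_⟩
    · intro j q hq
      by_contra hne
      exact h3 j (Finset.mem_filter.2 ⟨Finset.mem_univ _, q, hne, hq⟩)
    · intro P hP h0
      by_contra hne
      obtain ⟨A, B, hAB⟩ := exists_exchange hk hd hP h0 hne
      exact h4 (Finset.mem_image.2 ⟨(τ, A, B), Finset.mem_filter.2 ⟨Finset.mem_univ _, hAB⟩, rfl⟩)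
  have hcard : (N : ℝ) ^ c ≤ G.card + (∑ p : Fin c × Fin c,
      ((if p.1 = p.2 then ∅ else D p.1 p.2 : Finset (Fin c → Fin N)).card : ℝ)) +
      (∑ j, ((E j).card : ℝ)) + X.card := by
    have h := Finset.card_le_card hcover
    rw [Finset.card_univ, Fintype.card_fun, Fintype.card_fin, Fintype.card_fin] at h
    have h' := h.trans ((Finset.card_union_le _ _).trans (Nat.add_le_add_right
      ((Finset.card_union_le _ _).trans (add_le_add ((Finset.card_union_le _ _).trans
        (Nat.add_le_add_left Finset.card_biUnion_le _)) Finset.card_biUnion_le)) _))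
    exact_mod_cast h'
  have hX : (X.card : ℝ) * 8 ≤ (N : ℝ) ^ c := by
    have h1 : X.card ≤ (exchanges c σ).card := Finset.card_image_le
    have := hσ.exch
    have h2 : X.card * 8 ≤ N ^ c := by omega
    exact_mod_cast h2
  have hE : (∑ j, ((E j).card : ℝ)) * 8 ≤ (N : ℝ) ^ c := by
    have h1 : ∀ j, ((E j).card : ℝ) * N ≤ (N : ℝ) ^ c * (repPairs σ).card := by
      intro j
      have h2 := sum_apply_mul (α := Fin N) j fun p => if ∃ q, q ≠ p ∧ σ q = σ p then (1 : ℝ) else 0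
      rw [Finset.sum_boole, Finset.sum_boole, Fintype.card_fin, Fintype.card_fin] at h2
      refine h2.le.trans (mul_le_mul_of_nonneg_left ?_ (by positivity))
      rw [Nat.cast_le]
      calc _ ≤ ((repPairs σ).image Prod.snd).card := by
            refine Finset.card_le_card fun p hp => ?_
            obtain ⟨q, hq, e⟩ := (Finset.mem_filter.1 hp).2
            exact Finset.mem_image.2 ⟨(q, p), Finset.mem_filter.2 ⟨Finset.mem_univ _, hq, e⟩, rfl⟩
        _ ≤ _ := Finset.card_image_le
    have h3 : (∑ j, ((E j).card : ℝ)) * N ≤ c * ((N : ℝ) ^ c * (repPairs σ).card) := by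
      rw [Finset.sum_mul]
      refine (Finset.sum_le_sum fun j _ => h1 j).trans ?_
      rw [Finset.sum_const, Finset.card_univ, Fintype.card_fin, nsmul_eq_mul]
    have h4 : (8 : ℝ) * c * (repPairs σ).card ≤ N := by exact_mod_cast hσ.rep
    refine le_of_mul_le_mul_right ?_ hN'
    calc (∑ j, ((E j).card : ℝ)) * 8 * N = 8 * ((∑ j, ((E j).card : ℝ)) * N) := by ring
      _ ≤ 8 * (c * ((N : ℝ) ^ c * (repPairs σ).card)) := by gcongr
      _ = (N : ℝ) ^ c * (8 * c * (repPairs σ).card) := by ring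
      _ ≤ (N : ℝ) ^ c * N := by gcongr
  have hD : (∑ p : Fin c × Fin c,
      ((if p.1 = p.2 then ∅ else D p.1 p.2 : Finset (Fin c → Fin N)).card : ℝ)) * 4 ≤ (N : ℝ) ^ c := by
    have h1 : ∀ p : Fin c × Fin c,
        ((if p.1 = p.2 then ∅ else D p.1 p.2 : Finset (Fin c → Fin N)).card : ℝ) * N ^ 2 ≤
          (N : ℝ) ^ c * (meetPairs σ).card := by
      intro p
      by_cases hp : p.1 = p.2
      · rw [if_pos hp, Finset.card_empty, Nat.cast_zero, zero_mul]
        positivity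
      rw [if_neg hp]
      have h2 := sum_apply_apply_mul (α := Fin N) hp fun p q =>
        if ¬ Disjoint (σ p).1 (σ q).1 then (1 : ℝ) else 0
      rw [Finset.sum_boole, Fintype.card_fin, Fintype.card_fin,
        ← Fintype.sum_prod_type' (f := fun p q : Fin N => if ¬ Disjoint (σ p).1 (σ q).1 then (1 : ℝ) else 0),
        Finset.sum_boole] at h2
      exact h2.le
    have h3 : (∑ p : Fin c × Fin c,
        ((if p.1 = p.2 then ∅ else D p.1 p.2 : Finset (Fin c → Fin N)).card : ℝ)) * N ^ 2 ≤
        (c : ℝ) ^ 2 * ((N : ℝ) ^ c * (meetPairs σ).card) := by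
      rw [Finset.sum_mul]
      refine (Finset.sum_le_sum fun j _ => h1 j).trans ?_
      rw [Finset.sum_const, Finset.card_univ, Fintype.card_prod, Fintype.card_fin, nsmul_eq_mul,
        Nat.cast_mul, sq]
    have h4 : (4 : ℝ) * c ^ 2 * (meetPairs σ).card ≤ N ^ 2 := by exact_mod_cast hσ.meet
    refine le_of_mul_le_mul_right ?_ (pow_pos hN' 2)
    generalize (∑ p : Fin c × Fin c,
      ((if p.1 = p.2 then ∅ else D p.1 p.2 : Finset (Fin c → Fin N)).card : ℝ)) = s at *
    calc s * 4 * (N : ℝ) ^ 2 = 4 * (s * N ^ 2) := by ring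
      _ ≤ 4 * ((c : ℝ) ^ 2 * ((N : ℝ) ^ c * (meetPairs σ).card)) := by gcongr
      _ = (N : ℝ) ^ c * (4 * c ^ 2 * (meetPairs σ).card) := by ring
      _ ≤ (N : ℝ) ^ c * N ^ 2 := by gcongr
  linarith

end

/-! ### Random lists of scopes have few coincidences -/

section
variable {n k c N : ℕ}

/-- For `n ≥ 2k` each of the `k` factors of the falling factorial is at least `n / 2`, so the
binomial coefficient is at least `(n / 2) ^ k / k!`. -/
theorem one_div_card_scope_le (hk : 0 < k) (hn : 2 * k ≤ n) :
    0 < (Fintype.card (Scope n k) : ℝ) ∧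
      (1 : ℝ) / Fintype.card (Scope n k) ≤ 2 ^ k * k.factorial / n ^ k := by
  have hV : 0 < Fintype.card (Scope n k) := by rw [card_scope]; exact Nat.choose_pos (by omega)
  have hV' : (0 : ℝ) < Fintype.card (Scope n k) := by exact_mod_cast hV
  have hn' : (0 : ℝ) < n := by exact_mod_cast (by omega : 0 < n)
  refine ⟨hV', ?_⟩
  rw [div_le_div_iff₀ hV' (by positivity), one_mul, card_scope]
  have h := Nat.pow_le_choose (α := ℝ) k n
  rw [div_le_iff₀ (by positivity)] at h
  have h2 : (n : ℝ) ≤ 2 * ((n + 1 - k : ℕ) : ℝ) := by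
    exact_mod_cast (by omega : n ≤ 2 * (n + 1 - k))
  calc (n : ℝ) ^ k ≤ (2 * ((n + 1 - k : ℕ) : ℝ)) ^ k := by gcongr
    _ = 2 ^ k * ((n + 1 - k : ℕ) : ℝ) ^ k := mul_pow ..
    _ ≤ 2 ^ k * ((n.choose k : ℝ) * k.factorial) := by gcongr
    _ = _ := by ring

/-! ### Repeated scopes: first moment -/

theorem sum_repPairs_mul :
    (∑ σ : Fin N → Scope n k, ((repPairs σ).card : ℝ)) * Fintype.card (Scope n k) ≤
      (N : ℝ) ^ 2 * (Fintype.card (Scope n k) : ℝ) ^ N := by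
  classical
  set V := (Fintype.card (Scope n k) : ℝ)
  have hV : 0 ≤ V := Nat.cast_nonneg _
  have h : ∀ p q : Fin N, (∑ σ : Fin N → Scope n k,
      if p ≠ q ∧ σ p = σ q then (1 : ℝ) else 0) * V ≤ V ^ N := by
    intro p q
    by_cases hpq : p = q
    · simp only [hpq, ne_eq, not_true_eq_false, false_and, if_false, Finset.sum_const_zero, zero_mul]
      positivity
    · simp only [ne_eq, hpq, not_false_eq_true, true_and]
      -- Resampling the scope of `q` makes it coincide with that of `p` for exactly one of all
      -- possible values.
      rw [mul_comm, ← sum_update q]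
      simp only [Function.update_self, Function.update_of_ne hpq, Finset.sum_ite_eq,
        Finset.mem_univ, if_true, Finset.sum_const, Finset.card_univ, Fintype.card_fun,
        Fintype.card_fin, nsmul_eq_mul, mul_one, Nat.cast_pow]
      exact le_rfl
  calc _ = ∑ p : Fin N, ∑ q : Fin N, (∑ σ : Fin N → Scope n k,
          if p ≠ q ∧ σ p = σ q then (1 : ℝ) else 0) * V := by
        have e : ∀ σ : Fin N → Scope n k, ((repPairs σ).card : ℝ) = ∑ p : Fin N, ∑ q : Fin N,
            if p ≠ q ∧ σ p = σ q then (1 : ℝ) else 0 := by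
          intro σ
          rw [repPairs, ← Fintype.sum_prod_type' (f := fun p q : Fin N =>
            if p ≠ q ∧ σ p = σ q then (1 : ℝ) else 0), Finset.sum_boole]
        simp only [e, ← Finset.sum_mul]
        congr 1
        rw [Finset.sum_comm]
        refine Finset.sum_congr rfl fun p _ => ?_
        rw [Finset.sum_comm]
    _ ≤ ∑ p : Fin N, ∑ q : Fin N, V ^ N :=
        Finset.sum_le_sum fun p _ => Finset.sum_le_sum fun q _ => h p q
    _ = _ := by
        simp only [Finset.sum_const, Finset.card_univ, Fintype.card_fin, nsmul_eq_mul]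
        ring

open Classical in
theorem card_rep_le (hc : 0 < c) (hN : 0 < N) (hV : 0 < (Fintype.card (Scope n k) : ℝ)) :
    ((Finset.univ.filter fun σ : Fin N → Scope n k => ¬ 8 * c * (repPairs σ).card ≤ N).card : ℝ) ≤
      8 * c * N * (1 / Fintype.card (Scope n k)) * (Fintype.card (Scope n k) : ℝ) ^ N := by
  set V := (Fintype.card (Scope n k) : ℝ)
  have hN' : (0 : ℝ) < N := by exact_mod_cast hN
  have hc' : (0 : ℝ) < c := by exact_mod_cast hc
  have h1 := markov_card (fun σ : Fin N → Scope n k => ((repPairs σ).card : ℝ))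
    (fun _ => Nat.cast_nonneg _) (N / (8 * c) : ℝ)
  have h2 : (Finset.univ.filter fun σ : Fin N → Scope n k => ¬ 8 * c * (repPairs σ).card ≤ N) =
      Finset.univ.filter fun σ : Fin N → Scope n k => (N / (8 * c) : ℝ) < (repPairs σ).card := by
    refine Finset.filter_congr fun σ _ => ?_
    rw [div_lt_iff₀ (by positivity), not_le, mul_comm, ← Nat.cast_lt (α := ℝ)]
    push_cast
    rfl
  rw [← h2] at h1
  set F := ((Finset.univ.filter fun σ : Fin N → Scope n k =>
    ¬ 8 * c * (repPairs σ).card ≤ N).card : ℝ)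
  have h3 : F * (N / (8 * c)) * V ≤ (N : ℝ) ^ 2 * V ^ N :=
    (mul_le_mul_of_nonneg_right h1 hV.le).trans sum_repPairs_mul
  calc F = F * (N / (8 * c)) * V * (8 * c / (N * V)) := by field_simp
    _ ≤ (N : ℝ) ^ 2 * V ^ N * (8 * c / (N * V)) := by gcongr
    _ = _ := by field_simp

/-! ### Intersecting scopes: second moment -/

theorem sum_centred_inter (hk : 0 < k) (hn : 0 < n) (S : Scope n k) :
    ∑ T : Scope n k, (((S.1 ∩ T.1).card : ℝ) - k ^ 2 / n) = 0 := by
  have hn' : (n : ℝ) ≠ 0 := by exact_mod_cast hn.ne'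
  have h := sum_inter_card hk hn S
  rw [← eq_div_iff hn'] at h
  rw [Finset.sum_sub_distrib, Finset.sum_const, Finset.card_univ, nsmul_eq_mul, h]
  ring

/-- The intersection size `X` lies between 0 and `k`, so its variance is at most the mean of `X² ≤
kX`. The subtracted multiple of `X - θ` in the pointwise bound has mean zero. -/
theorem sum_centred_inter_sq_le (hk : 0 < k) (hn : 0 < n) (S : Scope n k) :
    ∑ T : Scope n k, (((S.1 ∩ T.1).card : ℝ) - k ^ 2 / n) ^ 2 ≤
      k * (k ^ 2 / n * Fintype.card (Scope n k)) := by
  have hn' : (n : ℝ) ≠ 0 := by exact_mod_cast hn.ne'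
  have h := sum_inter_card hk hn S
  have h0 := sum_centred_inter hk hn S
  rw [← eq_div_iff hn'] at h
  have hθ : 0 ≤ (k : ℝ) ^ 2 / n := by positivity
  have e : k * (k ^ 2 / n * (Fintype.card (Scope n k) : ℝ)) =
      ∑ T : Scope n k, (k : ℝ) * ((S.1 ∩ T.1).card : ℝ) := by
    rw [← Finset.mul_sum, h]
    ring
  generalize (k : ℝ) ^ 2 / n = θ at h0 hθ e ⊢
  rw [e]
  calc ∑ T : Scope n k, (((S.1 ∩ T.1).card : ℝ) - θ) ^ 2
      ≤ ∑ T : Scope n k, ((k : ℝ) * ((S.1 ∩ T.1).card : ℝ) - θ * (((S.1 ∩ T.1).card : ℝ) - θ)) := by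
        refine Finset.sum_le_sum fun T _ => ?_
        have h1 : ((S.1 ∩ T.1).card : ℝ) ≤ k := by
          exact_mod_cast (Finset.card_le_card Finset.inter_subset_left).trans_eq S.2
        have h2 : (0 : ℝ) ≤ ((S.1 ∩ T.1).card : ℝ) := Nat.cast_nonneg _
        nlinarith [mul_nonneg h2 (sub_nonneg.2 h1), mul_nonneg h2 hθ]
    _ = _ := by rw [Finset.sum_sub_distrib, ← Finset.mul_sum Finset.univ _ θ, h0, mul_zero, sub_zero]

/-- The indicator of an intersection is at most the intersection size. Its centred part has small
second moment; the diagonal contributes `N` and the mean `N² θ`. -/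
theorem card_meetPairs_le {θ : ℝ} (hθ : 0 ≤ θ) (σ : Fin N → Scope n k) :
    ((meetPairs σ).card : ℝ) ≤ (N : ℝ) + (∑ p : Fin N, ∑ q : Fin N,
      if p = q then 0 else (((σ p).1 ∩ (σ q).1).card : ℝ) - θ) + (N : ℝ) ^ 2 * θ := by
  classical
  have e : ((meetPairs σ).card : ℝ) = ∑ p : Fin N, ∑ q : Fin N,
      if ¬ Disjoint (σ p).1 (σ q).1 then (1 : ℝ) else 0 := by
    rw [meetPairs, ← Fintype.sum_prod_type' (f := fun p q : Fin N =>
      if ¬ Disjoint (σ p).1 (σ q).1 then (1 : ℝ) else 0), Finset.sum_boole]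
  rw [e]
  calc _ ≤ ∑ p : Fin N, ∑ q : Fin N, ((if p = q then (1 : ℝ) else 0) +
        (if p = q then 0 else (((σ p).1 ∩ (σ q).1).card : ℝ) - θ) + θ) := by
        refine Finset.sum_le_sum fun p _ => Finset.sum_le_sum fun q _ => ?_
        by_cases hpq : p = q
        · rw [if_pos hpq, if_pos hpq]
          split_ifs <;> linarith
        · rw [if_neg hpq, if_neg hpq]
          by_cases hd : Disjoint (σ p).1 (σ q).1
          · rw [if_neg (not_not.2 hd)]
            have : (0 : ℝ) ≤ ((σ p).1 ∩ (σ q).1).card := Nat.cast_nonneg _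
            linarith
          · rw [if_pos hd]
            have h1 : 0 < ((σ p).1 ∩ (σ q).1).card :=
              Finset.card_pos.2 (Finset.not_disjoint_iff_nonempty_inter.1 hd)
            have : (1 : ℝ) ≤ ((σ p).1 ∩ (σ q).1).card := by exact_mod_cast h1
            linarith
    _ = _ := by
        simp only [Finset.sum_add_distrib, Finset.sum_ite_eq, Finset.mem_univ, if_true,
          Finset.sum_const, Finset.card_univ, Fintype.card_fin, nsmul_eq_mul, mul_one]
        ring

/-- After multiplication by `4c²` each of the three contributions, from the diagonal, the
fluctuation and the mean, is at most `N² / 4`. -/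
theorem meet_threshold {k c n N : ℝ} (hk : 1 ≤ k) (hc : 1 ≤ c) (hcn : 32 * k ^ 2 * c ^ 2 ≤ n)
    (hnN : n ≤ 2 * N) {x z : ℝ} (hx : x ≤ N + z + N ^ 2 * (k ^ 2 / n))
    (hz : z ≤ N ^ 2 / (16 * c ^ 2)) : 4 * c ^ 2 * x ≤ N ^ 2 := by
  have hc2 : 1 ≤ c ^ 2 := one_le_pow₀ hc
  have hk2 : 1 ≤ k ^ 2 := one_le_pow₀ hk
  have hkc : c ^ 2 ≤ k ^ 2 * c ^ 2 := le_mul_of_one_le_left (by positivity) hk2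
  have hn : 0 < n := by linarith
  have hN : 0 < N := by linarith
  have h1 : 4 * c ^ 2 * N ≤ N ^ 2 / 4 := by
    have : 16 * c ^ 2 ≤ N := by linarith
    have := mul_le_mul_of_nonneg_right this hN.le
    linarith [sq N]
  have h2 : 4 * c ^ 2 * z ≤ N ^ 2 / 4 := by
    rw [le_div_iff₀ (by positivity)] at hz
    linarith
  have h3 : 4 * c ^ 2 * (N ^ 2 * (k ^ 2 / n)) ≤ N ^ 2 / 4 := by
    have h4 : 16 * (k ^ 2 * c ^ 2) / n ≤ 1 := by
      rw [div_le_one hn]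
      linarith
    calc 4 * c ^ 2 * (N ^ 2 * (k ^ 2 / n)) = N ^ 2 / 4 * (16 * (k ^ 2 * c ^ 2) / n) := by ring
      _ ≤ N ^ 2 / 4 * 1 := by gcongr
      _ = _ := mul_one _
  have h5 := mul_le_mul_of_nonneg_left hx (by positivity : 0 ≤ 4 * c ^ 2)
  rw [mul_add, mul_add] at h5
  linarith [sq_nonneg N]

theorem meet_bound {k c n N V W F : ℝ} (hk : 1 ≤ k) (hc : 1 ≤ c) (hcn : c ^ 2 ≤ n)
    (hnN : n ≤ 2 * N) (hV : 0 < V) (hW : 0 ≤ W)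
    (h : F * (N ^ 2 / (16 * c ^ 2)) ^ 2 * V ^ 2 ≤
      W * (2 * N ^ 2 * (V * (k * (k ^ 2 / n * V))))) : F ≤ 1024 * k ^ 3 / N * W := by
  have hn : 0 < n := by nlinarith
  have hN : 0 < N := by linarith
  have hc0 : 0 < c := by linarith
  have e1 : F * (N ^ 2 / (16 * c ^ 2)) ^ 2 * V ^ 2 = F * (N ^ 4 * V ^ 2 / (256 * c ^ 4)) := by
    field_simp
    norm_num
  have e2 : W * (2 * N ^ 2 * (V * (k * (k ^ 2 / n * V)))) =
      (W * (512 * k ^ 3 * c ^ 4 / (n * N ^ 2))) * (N ^ 4 * V ^ 2 / (256 * c ^ 4)) := by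
    field_simp
    ring
  rw [e1, e2] at h
  have h1 := le_of_mul_le_mul_right h (by positivity)
  refine h1.trans ?_
  rw [mul_comm]
  refine mul_le_mul_of_nonneg_right ?_ hW
  rw [div_le_div_iff₀ (by positivity) hN]
  have h2 : c ^ 4 ≤ n * (2 * N) := by
    calc c ^ 4 = c ^ 2 * c ^ 2 := by ring
      _ ≤ n * (2 * N) := mul_le_mul hcn (hcn.trans hnN) (by positivity) hn.le
  calc 512 * k ^ 3 * c ^ 4 * N ≤ 512 * k ^ 3 * (n * (2 * N)) * N := by gcongr
    _ = _ := by ring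

open Classical in
-- Chebyshev's inequality for the centred sum `Z` at the deviation `N² / (16c²)`. The second moment
-- is of order `N² k³ / n`, so the failure probability is of order `c⁴ / (n N²)`, which is `O(1/N)`
-- because `c² ≤ n ≤ 2N`.
theorem card_meet_le (hk : 0 < k) (hc : 0 < c) (hV : 0 < (Fintype.card (Scope n k) : ℝ)) (hn : 0 < n)
    (hcn : 32 * k ^ 2 * c ^ 2 ≤ n) (hnN : n ≤ 2 * N) :
    ((Finset.univ.filter fun σ : Fin N → Scope n k =>
      ¬ 4 * c ^ 2 * (meetPairs σ).card ≤ N ^ 2).card : ℝ) ≤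
      1024 * k ^ 3 / N * (Fintype.card (Scope n k) : ℝ) ^ N := by
  have hc' : (1 : ℝ) ≤ c := by exact_mod_cast hc
  have hk' : (1 : ℝ) ≤ k := by exact_mod_cast hk
  have hcn' : (32 : ℝ) * k ^ 2 * c ^ 2 ≤ n := by exact_mod_cast hcn
  have hnN' : (n : ℝ) ≤ 2 * N := by exact_mod_cast hnN
  have hcn2 : (c : ℝ) ^ 2 ≤ n := by
    have : (c : ℝ) ^ 2 ≤ k ^ 2 * c ^ 2 := le_mul_of_one_le_left (by positivity) (one_le_pow₀ hk')
    nlinarith [sq_nonneg (c : ℝ)]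
  set Y : Scope n k → Scope n k → ℝ := fun S T => ((S.1 ∩ T.1).card : ℝ) - k ^ 2 / n with hY
  set Z : (Fin N → Scope n k) → ℝ := fun σ =>
    ∑ p, ∑ q, if p = q then 0 else Y (σ p) (σ q) with hZ
  have hmk := markov_card (fun σ => Z σ ^ 2) (fun σ => sq_nonneg _) (((N : ℝ) ^ 2 / (16 * c ^ 2)) ^ 2)
  have hmom := sum_sq_pairs_le (ι := Fin N) Y (fun S T => by simp only [hY, Finset.inter_comm])
    (sum_centred_inter hk hn)
  rw [Fintype.card_fin] at hmom
  refine meet_bound hk' hc' hcn2 hnN' hV (by positivity) ?_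
  refine (mul_le_mul_of_nonneg_right (le_trans ?_ hmk) (by positivity)).trans (hmom.trans ?_)
  · gcongr with σ _
    intro hσ
    by_contra hle
    refine hσ ?_
    have hZt := (abs_le_of_sq_le_sq' (not_lt.1 hle) (by positivity)).2
    exact_mod_cast meet_threshold hk' hc' hcn' hnN' (card_meetPairs_le (by positivity) σ) hZt
  · gcongr
    refine (Finset.sum_le_sum fun S _ => sum_centred_inter_sq_le hk hn S).trans_eq ?_
    rw [Finset.sum_const, Finset.card_univ, nsmul_eq_mul]

/-! ### Exchanges: first moment -/

open Classical in
-- The scopes of the constraints in `B` are resampled with all others fixed. No `τ j` with `j ∈ A`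
-- lies in `B`, so the prescribed union stays fixed, and among the `V ^ a` choices on `B` at most `a
-- ^ (a * k)` are disjoint families with that union.
theorem card_exchange_mul_le (τ : Fin c → Fin N) (A : Finset (Fin c)) (B : Finset (Fin N)) :
    ((Finset.univ.filter fun σ : Fin N → Scope n k => Exchange σ τ A B).card : ℝ) *
      (Fintype.card (Scope n k) : ℝ) ^ A.card ≤ if 2 ≤ A.card ∧ B.card = A.card then
        (Fintype.card (Scope n k) : ℝ) ^ N * (A.card : ℝ) ^ (A.card * k) else 0 := by
  set V := (Fintype.card (Scope n k) : ℝ) with hV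
  split_ifs with h
  swap
  · rw [Finset.filter_eq_empty_iff.2 fun σ _ hσ => h ⟨hσ.1, hσ.2.1⟩, Finset.card_empty, Nat.cast_zero,
      zero_mul]
  by_cases hAB : ∀ j ∈ A, τ j ∉ B
  swap
  · rw [Finset.filter_eq_empty_iff.2 fun σ _ hσ => hAB hσ.2.2.1, Finset.card_empty, Nat.cast_zero,
      zero_mul]
    positivity
  have hs := sum_extend (α := Scope n k) (Subtype.val : {x // x ∈ B} → Fin N) Subtype.val_injective
    fun σ => if Exchange σ τ A B then (1 : ℝ) else 0
  rw [Fintype.card_coe, h.2, Finset.sum_boole, mul_comm] at hs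
  rw [← hs]
  have hin : ∀ σ : Fin N → Scope n k, ∑ u : {x // x ∈ B} → Scope n k,
      (if Exchange (Function.extend Subtype.val u σ) τ A B then (1 : ℝ) else 0) ≤
        (A.card : ℝ) ^ (A.card * k) := by
    intro σ
    rw [Finset.sum_boole]
    have hcard := card_disjoint_families_le (κ := {x // x ∈ B}) (k := k)
      (A.biUnion fun j => (σ (τ j)).1)
    rw [Fintype.card_coe, h.2] at hcard
    rw [← Nat.cast_pow, Nat.cast_le]
    refine (Finset.card_le_card fun u hu => ?_).trans hcard
    rw [Finset.mem_filter] at hu ⊢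
    refine ⟨Finset.mem_univ _, ?_⟩
    obtain ⟨-, -, -, -, h4, h5⟩ := hu
    have hu1 : ∀ x : {x // x ∈ B}, Function.extend Subtype.val u σ x.1 = u x := fun x =>
      Subtype.val_injective.extend_apply u σ x
    have hu2 : ∀ j ∈ A, Function.extend (Subtype.val : {x // x ∈ B} → Fin N) u σ (τ j) = σ (τ j) := by
      intro j hj
      rw [Function.extend_apply']
      rintro ⟨x, hx⟩
      exact hAB j hj (hx ▸ x.2)
    constructor
    · intro x y hxy
      have := h4 x.1 x.2 y.1 y.2 fun e => hxy (Subtype.ext e)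
      rwa [hu1, hu1] at this
    · have h6 : (A.biUnion fun j => (σ (τ j)).1) =
          A.biUnion fun j => (Function.extend (Subtype.val : {x // x ∈ B} → Fin N) u σ (τ j)).1 :=
        Finset.biUnion_congr rfl fun j hj => by rw [hu2 j hj]
      rw [h6, ← h5]
      ext i
      simp only [Finset.mem_biUnion, Finset.mem_univ, true_and, Subtype.exists]
      exact exists_congr fun x => ⟨fun ⟨hx, hi⟩ => ⟨hx, by rwa [hu1 ⟨x, hx⟩]⟩,
        fun ⟨hx, hi⟩ => ⟨hx, by rwa [hu1 ⟨x, hx⟩] at hi⟩⟩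
  refine (Finset.sum_le_sum fun σ _ => hin σ).trans_eq ?_
  rw [Finset.sum_const, Finset.card_univ, Fintype.card_fun, Fintype.card_fin, nsmul_eq_mul,
    Nat.cast_pow]

theorem sum_exchanges_le (hV : 0 < (Fintype.card (Scope n k) : ℝ)) :
    ∑ σ : Fin N → Scope n k, ((exchanges c σ).card : ℝ) ≤
      (N : ℝ) ^ c * (Fintype.card (Scope n k) : ℝ) ^ N *
        ∑ a ∈ Finset.range (c + 1), if 2 ≤ a then
          (c.choose a : ℝ) * N.choose a * ((a : ℝ) ^ (a * k) / (Fintype.card (Scope n k) : ℝ) ^ a)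
          else 0 := by
  classical
  set V := (Fintype.card (Scope n k) : ℝ) with hVdef
  have e : ∀ σ : Fin N → Scope n k, ((exchanges c σ).card : ℝ) = ∑ τ : Fin c → Fin N,
      ∑ A : Finset (Fin c), ∑ B : Finset (Fin N), if Exchange σ τ A B then (1 : ℝ) else 0 := by
    intro σ
    rw [exchanges, ← Finset.sum_boole, Fintype.sum_prod_type]
    refine Finset.sum_congr rfl fun τ _ => ?_
    rw [Fintype.sum_prod_type]
  simp only [e]
  calc _ = ∑ τ : Fin c → Fin N, ∑ A : Finset (Fin c), ∑ B : Finset (Fin N),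
        ((Finset.univ.filter fun σ : Fin N → Scope n k => Exchange σ τ A B).card : ℝ) := by
        rw [Finset.sum_comm]
        refine Finset.sum_congr rfl fun τ _ => ?_
        rw [Finset.sum_comm]
        refine Finset.sum_congr rfl fun A _ => ?_
        rw [Finset.sum_comm]
        exact Finset.sum_congr rfl fun B _ => Finset.sum_boole ..
    _ ≤ ∑ τ : Fin c → Fin N, ∑ A : Finset (Fin c), ∑ B : Finset (Fin N),
        (if B.card = A.card then (if 2 ≤ A.card then V ^ N * ((A.card : ℝ) ^ (A.card * k) / V ^ A.card)
          else 0) else 0) := by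
        refine Finset.sum_le_sum fun τ _ => Finset.sum_le_sum fun A _ => Finset.sum_le_sum fun B _ => ?_
        have h := card_exchange_mul_le (n := n) (k := k) τ A B
        rw [← le_div_iff₀ (by positivity)] at h
        refine h.trans_eq ?_
        by_cases h1 : 2 ≤ A.card
        · by_cases h2 : B.card = A.card
          · rw [if_pos ⟨h1, h2⟩, if_pos h2, if_pos h1, mul_div_assoc]
          · rw [if_neg fun h => h2 h.2, if_neg h2, zero_div]
        · rw [if_neg fun h => h1 h.1, if_neg h1, zero_div, ite_self]
    _ = ∑ τ : Fin c → Fin N, ∑ A : Finset (Fin c), (N.choose A.card : ℝ) *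
        (if 2 ≤ A.card then V ^ N * ((A.card : ℝ) ^ (A.card * k) / V ^ A.card) else 0) := by
        refine Finset.sum_congr rfl fun τ _ => Finset.sum_congr rfl fun A _ => ?_
        have h := Finset.sum_powerset_apply_card (fun m => if m = A.card then
          (if 2 ≤ A.card then V ^ N * ((A.card : ℝ) ^ (A.card * k) / V ^ A.card) else 0) else 0)
          (x := (Finset.univ : Finset (Fin N)))
        rw [Finset.powerset_univ, Finset.card_univ, Fintype.card_fin] at h
        rw [h, Finset.sum_eq_single A.card, if_pos rfl, nsmul_eq_mul]
        · intro m _ hm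
          rw [if_neg hm, smul_zero]
        · intro hm
          rw [Finset.mem_range, not_lt] at hm
          rw [Nat.choose_eq_zero_of_lt (by omega), zero_smul]
    _ = _ := by
        have h := Finset.sum_powerset_apply_card (fun m => (N.choose m : ℝ) *
          (if 2 ≤ m then V ^ N * ((m : ℝ) ^ (m * k) / V ^ m) else 0))
          (x := (Finset.univ : Finset (Fin c)))
        rw [Finset.powerset_univ, Finset.card_univ, Fintype.card_fin] at h
        rw [Finset.sum_const, h, Finset.card_univ, Fintype.card_fun, Fintype.card_fin,
          Fintype.card_fin, nsmul_eq_mul, Nat.cast_pow, mul_assoc, Finset.mul_sum (a := V ^ N)]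
        congr 1
        refine Finset.sum_congr rfl fun a _ => ?_
        rw [nsmul_eq_mul]
        split_ifs <;> ring

/-- Since `e < 3`, the inverse factorial is at most `(3 / a) ^ a`. The two binomial coefficients
then contribute `(9cN / a²) ^ a`, which explains both the factor 9 and the exponent `k - 2`. -/
theorem exchange_term_le (hk : 2 ≤ k) (hV : 0 < (Fintype.card (Scope n k) : ℝ)) {D : ℝ}
    (hD : 9 * (1 / (Fintype.card (Scope n k) : ℝ)) ≤ D / n ^ k) {a : ℕ} (ha : 0 < a) :
    (c.choose a : ℝ) * N.choose a * ((a : ℝ) ^ (a * k) / (Fintype.card (Scope n k) : ℝ) ^ a) ≤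
      (D * (c * N / n ^ k) * (a : ℝ) ^ (k - 2)) ^ a := by
  set V := (Fintype.card (Scope n k) : ℝ)
  have ha' : (0 : ℝ) < a := by exact_mod_cast ha
  have hf : (a : ℝ) ^ a ≤ a.factorial * 3 ^ a := by
    have h1 := Real.pow_div_factorial_le_exp (x := (a : ℝ)) ha'.le a
    rw [div_le_iff₀ (by positivity)] at h1
    have h2 : Real.exp a ≤ 3 ^ a := by
      rw [← mul_one (a : ℝ), Real.exp_nat_mul]
      gcongr
      exact (Real.exp_one_lt_d9.trans (by norm_num)).le
    calc (a : ℝ) ^ a ≤ Real.exp a * a.factorial := h1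
      _ ≤ 3 ^ a * a.factorial := by gcongr
      _ = _ := mul_comm ..
  have hi : 1 / (a.factorial : ℝ) ≤ (3 / a) ^ a := by
    rw [div_pow, div_le_div_iff₀ (by positivity) (by positivity), one_mul, mul_comm]
    exact hf
  have hc : (c.choose a : ℝ) ≤ (c * (3 / a)) ^ a := by
    rw [mul_pow]
    refine (Nat.choose_le_pow_div a c).trans ?_
    rw [div_eq_mul_one_div]
    gcongr
  have hN : (N.choose a : ℝ) ≤ (N * (3 / a)) ^ a := by
    rw [mul_pow]
    refine (Nat.choose_le_pow_div a N).trans ?_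
    rw [div_eq_mul_one_div]
    gcongr
  have hak : (a : ℝ) ^ k = (a : ℝ) ^ (k - 2) * a ^ 2 := by rw [← pow_add, Nat.sub_add_cancel hk]
  calc (c.choose a : ℝ) * N.choose a * ((a : ℝ) ^ (a * k) / V ^ a)
      ≤ (c * (3 / a)) ^ a * (N * (3 / a)) ^ a * ((a : ℝ) ^ (a * k) / V ^ a) := by gcongr
    _ = (c * N * (a : ℝ) ^ (k - 2) * (9 * (1 / V))) ^ a := by
        rw [mul_comm a k, pow_mul, ← div_pow, ← mul_pow, ← mul_pow, hak]
        congr 1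
        field_simp
        ring
    _ ≤ (c * N * (a : ℝ) ^ (k - 2) * (D / n ^ k)) ^ a := by gcongr
    _ = _ := by ring

end

section
variable {n k c N : ℕ}

open Classical in
-- Two of the `a ≥ 2` factors are kept as `(D y)² a^(2(k-2))` and the other `a - 2` are at most 1/2
-- each, so the sum converges and is of order `y²`. The constant 32 is 8 from Markov's inequality
-- times 4 from `(1/2)^(-2)`.
theorem card_bad_exchanges_le (hk : 2 ≤ k) (hN : 0 < N) (hV : 0 < (Fintype.card (Scope n k) : ℝ))
    {D y : ℝ} (hD : 9 * (1 / (Fintype.card (Scope n k) : ℝ)) ≤ D / n ^ k) (hD0 : 0 ≤ D)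
    (hy : y = c * N / n ^ k)
    (hx : ∀ a : ℕ, a ≤ c → D * y * (a : ℝ) ^ (k - 2) ≤ 1 / 2) :
    ((Finset.univ.filter fun σ : Fin N → Scope n k => ¬ 8 * (exchanges c σ).card ≤ N ^ c).card : ℝ) ≤
      32 * D ^ 2 * y ^ 2 * (∑' a : ℕ, ((a : ℝ) ^ (2 * (k - 2)) * (1 / 2 : ℝ) ^ a)) *
        (Fintype.card (Scope n k) : ℝ) ^ N := by
  set V := (Fintype.card (Scope n k) : ℝ) with hVdef
  have hy0 : 0 ≤ y := hy ▸ by positivity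
  have hNc : (0 : ℝ) < (N : ℝ) ^ c := by positivity
  have h1 := markov_card (fun σ : Fin N → Scope n k => ((exchanges c σ).card : ℝ))
    (fun _ => Nat.cast_nonneg _) ((N : ℝ) ^ c / 8)
  have h2 : (Finset.univ.filter fun σ : Fin N → Scope n k => ¬ 8 * (exchanges c σ).card ≤ N ^ c) =
      Finset.univ.filter fun σ : Fin N → Scope n k => ((N : ℝ) ^ c / 8) < (exchanges c σ).card := by
    refine Finset.filter_congr fun σ _ => ?_
    rw [div_lt_iff₀ (by norm_num), not_le, mul_comm, ← Nat.cast_lt (α := ℝ)]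
    push_cast
    rfl
  rw [← h2] at h1
  have hs : Summable fun a : ℕ => (a : ℝ) ^ (2 * (k - 2)) * (1 / 2 : ℝ) ^ a :=
    summable_pow_mul_geometric_of_norm_lt_one _ (by norm_num)
  have hterm : ∑ a ∈ Finset.range (c + 1), (if 2 ≤ a then
      (c.choose a : ℝ) * N.choose a * ((a : ℝ) ^ (a * k) / V ^ a) else 0) ≤
      4 * D ^ 2 * y ^ 2 * ∑' a : ℕ, ((a : ℝ) ^ (2 * (k - 2)) * (1 / 2 : ℝ) ^ a) := by
    refine le_trans ?_ (mul_le_mul_of_nonneg_left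
      (hs.sum_le_tsum (Finset.range (c + 1)) fun a _ => by positivity) (by positivity))
    rw [Finset.mul_sum]
    refine Finset.sum_le_sum fun a ha => ?_
    split_ifs with h
    swap
    · positivity
    refine (exchange_term_le (c := c) (N := N) hk hV hD (by omega : 0 < a)).trans ?_
    rw [← hy]
    have hxa := hx a (by rw [Finset.mem_range] at ha; omega)
    obtain ⟨d, rfl⟩ := Nat.exists_eq_add_of_le h
    have hr : (0 : ℝ) ≤ ((2 + d : ℕ) : ℝ) := Nat.cast_nonneg _
    generalize ((2 + d : ℕ) : ℝ) = r at hxa hr ⊢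
    calc (D * y * r ^ (k - 2)) ^ (2 + d)
        = (D * y * r ^ (k - 2)) ^ 2 * (D * y * r ^ (k - 2)) ^ d := pow_add ..
      _ ≤ (D * y * r ^ (k - 2)) ^ 2 * (1 / 2) ^ d := by gcongr
      _ = _ := by
        rw [mul_comm 2 (k - 2), pow_mul, pow_add]
        ring
  have h3 := (h1.trans (sum_exchanges_le hV)).trans (mul_le_mul_of_nonneg_left hterm (by positivity))
  rw [← hVdef] at h3
  refine le_of_mul_le_mul_right (h3.trans_eq ?_) (by positivity : (0 : ℝ) < (N : ℝ) ^ c / 8)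
  ring

/-- For `k ≥ 2` one has `n^(k/2) ≤ n^(k-1)`. Thus one factor `N` absorbs `b n^(k-1)`, the factor
`c²` supplies the missing `n`, and `N²` accounts for the remaining `n^k`. -/
theorem scale_sq_mul_le {n k : ℕ} {c N b : ℝ} (hk : 2 ≤ k) (hn : 1 ≤ (n : ℝ)) (hN : 0 ≤ N) (hb : 0 ≤ b)
    (hc : c ^ 2 ≤ n) (hNb : N ^ 2 ≤ b ^ 2 * (n : ℝ) ^ k) : (c * N / (n : ℝ) ^ k) ^ 2 * N ≤ b ^ 3 := by
  have hn0 : (0 : ℝ) < n := by linarith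
  have hN1 : N ≤ b * (n : ℝ) ^ (k - 1) := by
    refine le_of_sq_le_sq ?_ (by positivity)
    calc N ^ 2 ≤ b ^ 2 * (n : ℝ) ^ k := hNb
      _ ≤ b ^ 2 * (n : ℝ) ^ ((k - 1) * 2) := by
          gcongr
          omega
      _ = _ := by rw [pow_mul, mul_pow]
  rw [div_pow, div_mul_eq_mul_div, div_le_iff₀ (by positivity)]
  have hp : (n : ℝ) * (n : ℝ) ^ (k - 1) = (n : ℝ) ^ k := by
    rw [← pow_succ', Nat.sub_add_cancel (by omega)]
  calc (c * N) ^ 2 * N = c ^ 2 * N ^ 2 * N := by ring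
    _ ≤ n * (b ^ 2 * (n : ℝ) ^ k) * (b * (n : ℝ) ^ (k - 1)) := by gcongr
    _ = b ^ 3 * (n * (n : ℝ) ^ (k - 1)) * (n : ℝ) ^ k := by ring
    _ = _ := by rw [hp]; ring

/-- The worst case is `a = c`. The square of the left-hand side is then at most `D² N² (c²)^(k-1) /
n^(2k)`; here `N² ≤ b² n^k`, one factor `c²` gives `ε n`, and the others give `n` each. -/
theorem ratio_le_half {n k a : ℕ} {c N b D ε : ℝ} (hk : 2 ≤ k) (hn : 1 ≤ (n : ℝ))
    (hc : c ^ 2 ≤ ε * n) (hε : ε ≤ 1) (hε' : 4 * D ^ 2 * b ^ 2 * ε ≤ 1) (hac : a ≤ c)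
    (hNb : N ^ 2 ≤ b ^ 2 * (n : ℝ) ^ k) : D * (c * N / (n : ℝ) ^ k) * (a : ℝ) ^ (k - 2) ≤ 1 / 2 := by
  have hn0 : (0 : ℝ) < n := by linarith
  have hc0 : 0 ≤ c := le_trans (Nat.cast_nonneg a) hac
  have hcn : c ^ 2 ≤ n := hc.trans (mul_le_of_le_one_left hn0.le hε)
  refine le_of_sq_le_sq ?_ (by norm_num)
  have hp : (n : ℝ) * (n : ℝ) ^ (k - 2) ≤ (n : ℝ) ^ k := by
    rw [← pow_succ']
    exact pow_le_pow_right₀ hn (by omega)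
  have h1 : (c * N) ^ 2 * ((a : ℝ) ^ (k - 2)) ^ 2 ≤ b ^ 2 * ε * ((n : ℝ) ^ k) ^ 2 := by
    have hε0 : 0 ≤ ε := by
      by_contra h
      have := mul_neg_of_neg_of_pos (not_le.1 h) hn0
      linarith [sq_nonneg c]
    calc (c * N) ^ 2 * ((a : ℝ) ^ (k - 2)) ^ 2 ≤ (c * N) ^ 2 * (c ^ (k - 2)) ^ 2 := by gcongr
      _ = N ^ 2 * (c ^ 2 * (c ^ 2) ^ (k - 2)) := by rw [← pow_mul, ← pow_mul, mul_comm (k - 2)]; ring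
      _ ≤ b ^ 2 * (n : ℝ) ^ k * (ε * n * (n : ℝ) ^ (k - 2)) := by gcongr
      _ = b ^ 2 * (n : ℝ) ^ k * ε * (n * (n : ℝ) ^ (k - 2)) := by ring
      _ ≤ b ^ 2 * (n : ℝ) ^ k * ε * (n : ℝ) ^ k := by gcongr
      _ = _ := by ring
  calc (D * (c * N / (n : ℝ) ^ k) * (a : ℝ) ^ (k - 2)) ^ 2
      = D ^ 2 * (((c * N) ^ 2 * ((a : ℝ) ^ (k - 2)) ^ 2) / ((n : ℝ) ^ k) ^ 2) := by ring
    _ ≤ D ^ 2 * (b ^ 2 * ε * ((n : ℝ) ^ k) ^ 2 / ((n : ℝ) ^ k) ^ 2) := by gcongr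
    _ = D ^ 2 * (b ^ 2 * ε) := by field_simp
    _ ≤ (1 / 2) ^ 2 := by linarith

open Classical in
-- With `y = cN / n^k`, repeated scopes fail with probability `O(y)`, intersections with `O(1/N)`
-- and exchanges with `O(y²)`. By `scale_sq_mul_le`, `y` is `O(N^(-1/2))`, so repeated scopes
-- determine the final rate.
theorem exists_card_bad_le {k : ℕ} (hk : 2 ≤ k) {b : ℝ} (hb : 1 ≤ b) :
    ∃ ε K : ℝ, 0 < ε ∧ 0 < K ∧ ∀ n c N : ℕ, 2 * k ≤ n → 0 < c → (c : ℝ) ^ 2 ≤ ε * n → n ≤ 2 * N →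
      (N : ℝ) ^ 2 ≤ b ^ 2 * (n : ℝ) ^ k →
      ((Finset.univ.filter fun σ : Fin N → Scope n k => ¬ GoodScopes c σ).card : ℝ) ≤
        K / √N * (Fintype.card (Scope n k) : ℝ) ^ N := by
  set E : ℝ := 2 ^ k * k.factorial with hE
  have hE0 : 0 < E := by positivity
  set S : ℝ := ∑' a : ℕ, ((a : ℝ) ^ (2 * (k - 2)) * (1 / 2 : ℝ) ^ a) with hS
  have hS0 : 0 ≤ S := tsum_nonneg fun a => by positivity
  have hk0 : (0 : ℝ) < k := by exact_mod_cast (by omega : 0 < k)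
  have hk1 : (1 : ℝ) ≤ k ^ 2 := one_le_pow₀ (by exact_mod_cast (by omega : 1 ≤ k))
  set Q : ℝ := 4 * (9 * E) ^ 2 * b ^ 2 + 32 * k ^ 2 with hQ
  have hQ0 : 32 * (k : ℝ) ^ 2 ≤ Q := le_add_of_nonneg_left (by positivity)
  have hQ1 : 4 * (9 * E) ^ 2 * b ^ 2 ≤ Q := le_add_of_nonneg_right (by positivity)
  have hQp : 0 < Q := by linarith
  -- The two summands of `Q` are the requirements of the exchange bound (ratio at most 1/2) and of
  -- the intersection bound (`32k²c² ≤ n`). The three summands of the second constant belong to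
  -- repetitions, intersections and exchanges.
  refine ⟨1 / Q, 8 * E * b ^ 2 + 1024 * k ^ 3 + 32 * (9 * E) ^ 2 * b ^ 3 * S, by positivity,
    by positivity, fun n c N hn hc hcn hnN hNb => ?_⟩
  obtain ⟨hV, hVE⟩ := one_div_card_scope_le (n := n) (k := k) (by omega) hn
  have hN : 0 < N := by omega
  have hN1 : (1 : ℝ) ≤ N := by exact_mod_cast hN
  have hn1 : (1 : ℝ) ≤ n := by exact_mod_cast (by omega : 1 ≤ n)
  have hε1 : 1 / Q ≤ 1 := by rw [div_le_one hQp]; linarith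
  have hcn1 : (c : ℝ) ^ 2 ≤ n := hcn.trans (mul_le_of_le_one_left (by linarith) hε1)
  have hcn2 : 32 * k ^ 2 * c ^ 2 ≤ n := by
    rw [one_div_mul_eq_div, le_div_iff₀ hQp] at hcn
    have : (32 : ℝ) * k ^ 2 * c ^ 2 ≤ n :=
      le_trans (by rw [mul_comm]; gcongr) hcn
    exact_mod_cast this
  have hy2 := scale_sq_mul_le hk hn1 (Nat.cast_nonneg N) (by linarith) hcn1 hNb
  have hrep := card_rep_le (c := c) hc hN hV
  have hmeet := card_meet_le (c := c) (by omega) hc hV (by omega) hcn2 hnN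
  have hexch := card_bad_exchanges_le (c := c) hk hN hV (D := 9 * E)
    (by rw [mul_div_assoc]; gcongr) (by positivity) rfl
    fun a ha => ratio_le_half hk hn1 hcn hε1
      (by rw [mul_one_div, div_le_one hQp]; exact hQ1) (by exact_mod_cast ha) hNb
  rw [← hS] at hexch
  have hsq : 0 < √(N : ℝ) := Real.sqrt_pos.2 (by linarith)
  have hsN : √(N : ℝ) ≤ N := Real.sqrt_le_iff.2 ⟨by linarith, by nlinarith⟩
  have hW : 0 ≤ (Fintype.card (Scope n k) : ℝ) ^ N := by positivity
  set W := (Fintype.card (Scope n k) : ℝ) ^ N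
  set y : ℝ := c * N / (n : ℝ) ^ k with hy
  have hy0 : 0 ≤ y := by positivity
  have hyb : y ≤ b ^ 2 / √N := by
    rw [le_div_iff₀ hsq]
    refine le_of_sq_le_sq ?_ (by positivity)
    rw [mul_pow, Real.sq_sqrt (by linarith)]
    exact hy2.trans (by rw [← pow_mul]; exact pow_le_pow_right₀ hb (by norm_num))
  have hyb2 : y ^ 2 ≤ b ^ 3 / √N := by
    rw [le_div_iff₀ hsq]
    exact (by gcongr : y ^ 2 * √N ≤ y ^ 2 * N).trans hy2
  have hunion : (Finset.univ.filter fun σ : Fin N → Scope n k => ¬ GoodScopes c σ) ⊆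
      (Finset.univ.filter fun σ : Fin N → Scope n k => ¬ 8 * c * (repPairs σ).card ≤ N) ∪
      ((Finset.univ.filter fun σ : Fin N → Scope n k => ¬ 4 * c ^ 2 * (meetPairs σ).card ≤ N ^ 2) ∪
      (Finset.univ.filter fun σ : Fin N → Scope n k => ¬ 8 * (exchanges c σ).card ≤ N ^ c)) := by
    intro σ hσ
    simp only [Finset.mem_union, Finset.mem_filter, Finset.mem_univ, true_and] at hσ ⊢
    by_contra h
    push Not at h
    exact hσ ⟨h.1, h.2.1, h.2.2⟩
  have hcard : ((Finset.univ.filter fun σ : Fin N → Scope n k => ¬ GoodScopes c σ).card : ℝ) ≤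
      (Finset.univ.filter fun σ : Fin N → Scope n k => ¬ 8 * c * (repPairs σ).card ≤ N).card +
      ((Finset.univ.filter fun σ : Fin N → Scope n k => ¬ 4 * c ^ 2 * (meetPairs σ).card ≤ N ^ 2).card +
      (Finset.univ.filter fun σ : Fin N → Scope n k => ¬ 8 * (exchanges c σ).card ≤ N ^ c).card) := by
    exact_mod_cast (Finset.card_le_card hunion).trans
      ((Finset.card_union_le _ _).trans (Nat.add_le_add_left (Finset.card_union_le _ _) _))
  have b1 : 8 * (c : ℝ) * N * (1 / Fintype.card (Scope n k)) ≤ 8 * E * b ^ 2 / √N := by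
    calc 8 * (c : ℝ) * N * (1 / Fintype.card (Scope n k)) ≤ 8 * (c : ℝ) * N * (E / n ^ k) := by gcongr
      _ = 8 * E * y := by rw [hy]; ring
      _ ≤ 8 * E * (b ^ 2 / √N) := by gcongr
      _ = _ := by ring
  have b2 : 1024 * (k : ℝ) ^ 3 / N ≤ 1024 * k ^ 3 / √N := by gcongr
  have b3 : 32 * (9 * E) ^ 2 * y ^ 2 * S ≤ 32 * (9 * E) ^ 2 * b ^ 3 * S / √N := by
    calc 32 * (9 * E) ^ 2 * y ^ 2 * S ≤ 32 * (9 * E) ^ 2 * (b ^ 3 / √N) * S := by gcongr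
      _ = _ := by ring
  calc _ ≤ 8 * (c : ℝ) * N * (1 / Fintype.card (Scope n k)) * W + (1024 * (k : ℝ) ^ 3 / N * W +
        32 * (9 * E) ^ 2 * y ^ 2 * S * W) :=
        hcard.trans (add_le_add hrep (add_le_add hmeet hexch))
    _ ≤ 8 * E * b ^ 2 / √N * W + (1024 * k ^ 3 / √N * W +
        32 * (9 * E) ^ 2 * b ^ 3 * S / √N * W) := by gcongr
    _ = _ := by ring

end

/-! ### The law of the list of scopes -/

theorem map_iidList {α β : Type} (p : PMF α) (f : α → β) :
    ∀ N, (iidList p N).map (List.map f) = iidList (p.map f) N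
  | 0 => by rw [iidList, iidList, PMF.pure_map, List.map_nil]
  | N + 1 => by
    rw [iidList, iidList, PMF.map_bind, PMF.bind_map]
    congr 1
    funext a
    rw [Function.comp_apply, ← map_iidList p f N, PMF.map_comp, PMF.map_comp]
    rfl

theorem uniform_bind_uniform {α β γ : Type} [Fintype α] [Fintype β] [Fintype γ] [Nonempty α]
    [Nonempty β] [Nonempty γ] (e : α × β ≃ γ) :
    ((PMF.uniformOfFintype α).bind fun a => (PMF.uniformOfFintype β).map fun b => e (a, b)) =
      PMF.uniformOfFintype γ := by
  classical
  ext x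
  obtain ⟨⟨a₀, b₀⟩, rfl⟩ := e.surjective x
  rw [PMF.bind_apply, tsum_eq_single a₀, PMF.map_apply, tsum_eq_single b₀, if_pos rfl,
    PMF.uniformOfFintype_apply, PMF.uniformOfFintype_apply, PMF.uniformOfFintype_apply,
    ← Fintype.card_congr e, Fintype.card_prod, Nat.cast_mul, ENNReal.mul_inv]
  · exact Or.inr (ENNReal.natCast_ne_top _)
  · exact Or.inl (ENNReal.natCast_ne_top _)
  · intro b hb
    rw [if_neg]
    exact fun h => hb (Prod.ext_iff.1 (e.injective h)).2.symm
  · intro a ha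
    rw [PMF.map_apply, ENNReal.tsum_eq_zero.2, mul_zero]
    intro b
    rw [if_neg]
    exact fun h => ha (Prod.ext_iff.1 (e.injective h)).1.symm

theorem iidList_uniform (α : Type) [Fintype α] [Nonempty α] :
    ∀ N, iidList (PMF.uniformOfFintype α) N = (PMF.uniformOfFintype (Fin N → α)).map List.ofFn
  | 0 => by
    have h : PMF.uniformOfFintype (Fin 0 → α) = PMF.pure default := by
      ext σ
      rw [Subsingleton.elim σ default, PMF.uniformOfFintype_apply, PMF.pure_apply_self,
        Fintype.card_unique, Nat.cast_one, inv_one]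
    rw [h, PMF.pure_map, List.ofFn_zero, iidList]
  | N + 1 => by
    rw [← uniform_bind_uniform (Fin.consEquiv fun _ : Fin (N + 1) => α), PMF.map_bind, iidList,
      iidList_uniform α N]
    congr 1
    funext a
    rw [PMF.map_comp, PMF.map_comp]
    congr 1
    funext σ
    simp only [Function.comp_apply, Fin.consEquiv, Equiv.coe_fn_mk, List.ofFn_succ, Fin.cons_zero,
      Fin.cons_succ]

theorem map_fst_constraintLaw {n k : ℕ} [Nonempty (Scope n k)] (hk : k ≤ n) (z : Fin n → ℤˣ)
    (ρ : ℝ≥0) (hρ : ρ ≤ 1) :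
    (constraintLaw hk z ρ hρ).map Prod.fst = PMF.uniformOfFintype (Scope n k) := by
  rw [constraintLaw, PMF.map_bind]
  refine Eq.trans ?_ (PMF.bind_pure _)
  congr 1
  funext S
  rw [PMF.map_comp]
  exact PMF.map_const _ _

open Classical in
-- The event depends on the scopes only. Projecting away the signs turns the planted law into the
-- uniform law on lists of scopes, so `z` and `ρ` disappear and probabilities become counts.
theorem iidList_constraintLaw_le {n k N : ℕ} (hk : k ≤ n) (z : Fin n → ℤˣ) (ρ : ℝ≥0) (hρ : ρ ≤ 1)
    (P : (Fin N → Scope n k) → Prop) {δ : ℝ}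
    (hP : ((Finset.univ.filter fun σ => ¬ P σ).card : ℝ) ≤ δ * (Fintype.card (Scope n k) : ℝ) ^ N) :
    (iidList (constraintLaw hk z ρ hρ) N).toOuterMeasure
      {I | ¬ ∃ σ, I.map Prod.fst = List.ofFn σ ∧ P σ} ≤ ENNReal.ofReal δ := by
  have hne : Nonempty (Scope n k) := by
    obtain ⟨S, -, hS⟩ := Finset.exists_subset_card_eq
      (s := (Finset.univ : Finset (Fin n))) (n := k) (by simpa using hk)
    exact ⟨⟨S, hS⟩⟩
  have e : {I : KXor n k | ¬ ∃ σ, I.map Prod.fst = List.ofFn σ ∧ P σ} =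
      List.map Prod.fst ⁻¹' {Ls : List (Scope n k) | ¬ ∃ σ, Ls = List.ofFn σ ∧ P σ} := rfl
  rw [e, ← PMF.toOuterMeasure_map_apply, map_iidList, map_fst_constraintLaw, iidList_uniform,
    PMF.toOuterMeasure_map_apply]
  have hsub : List.ofFn ⁻¹' {Ls : List (Scope n k) | ¬ ∃ σ : Fin N → Scope n k, Ls = List.ofFn σ ∧ P σ} ⊆
      {σ | ¬ P σ} := fun σ hσ hPσ => hσ ⟨σ, rfl, hPσ⟩
  refine (MeasureTheory.measure_mono hsub).trans ?_
  rw [PMF.toOuterMeasure_uniformOfFintype_apply]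
  have hV : 0 < (Fintype.card (Scope n k) : ℝ) := by exact_mod_cast Fintype.card_pos
  refine ENNReal.div_le_of_le_mul ?_
  have h1 : ((Fintype.card {σ : Fin N → Scope n k | ¬ P σ} : ℕ) : ℝ≥0∞) =
      ENNReal.ofReal ((Finset.univ.filter fun σ => ¬ P σ).card : ℝ) := by
    rw [ENNReal.ofReal_natCast, ← Fintype.card_subtype]
    rfl
  have h2 : ((Fintype.card (Fin N → Scope n k) : ℕ) : ℝ≥0∞) =
      ENNReal.ofReal ((Fintype.card (Scope n k) : ℝ) ^ N) := by
    rw [Fintype.card_fun, Fintype.card_fin, ← Nat.cast_pow, ENNReal.ofReal_natCast]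
  rw [h1, h2, ← ENNReal.ofReal_mul' (by positivity)]
  exact ENNReal.ofReal_le_ofReal hP

/-! ### Concentration of the Poisson law -/

/-- The first two factorial moments follow from the recursion `p(N+1) (N+1) = m p(N)` by shifting
the index; the variance is a combination of them. -/
theorem hasSum_poisson_sq (m : ℝ≥0) :
    HasSum (fun N : ℕ => Real.exp (-m) * (m : ℝ) ^ N / N.factorial * ((N : ℝ) - m) ^ 2) m := by
  have h0 := ProbabilityTheory.hasSum_one_poissonMeasure m
  set p : ℕ → ℝ := fun N => Real.exp (-m) * (m : ℝ) ^ N / N.factorial with hp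
  have hstep : ∀ N : ℕ, p (N + 1) * ((N : ℝ) + 1) = m * p N := by
    intro N
    simp only [hp]
    rw [Nat.factorial_succ]
    push_cast
    field_simp
    ring
  have h1 : HasSum (fun N : ℕ => p N * N) m := by
    rw [← hasSum_nat_add_iff' 1]
    simp only [Finset.range_one, Finset.sum_singleton, Nat.cast_zero, mul_zero, sub_zero]
    have e : (fun N : ℕ => p (N + 1) * ((N + 1 : ℕ) : ℝ)) = fun N => (m : ℝ) * p N := by
      funext N
      push_cast
      exact hstep N
    rw [e]
    have h := h0.mul_left (m : ℝ)
    rwa [mul_one] at h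
  have h2 : HasSum (fun N : ℕ => p N * (N * (N - 1))) ((m : ℝ) * m) := by
    rw [← hasSum_nat_add_iff' 1]
    simp only [Finset.range_one, Finset.sum_singleton, Nat.cast_zero, zero_mul, mul_zero, sub_zero]
    have e : (fun N : ℕ => p (N + 1) * (((N + 1 : ℕ) : ℝ) * (((N + 1 : ℕ) : ℝ) - 1))) =
        fun N => (m : ℝ) * (p N * N) := by
      funext N
      push_cast
      rw [← mul_assoc, hstep N]
      ring
    rw [e]
    exact h1.mul_left _
  convert (h2.add (h1.mul_left (1 - 2 * (m : ℝ)))).add (h0.mul_left ((m : ℝ) ^ 2)) using 1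
  · funext N
    ring
  · ring

/-- Chebyshev's inequality: outside `m ≤ 2N`, `N ≤ 2m` the quantity `4 (N - m)² / m²` is at least 1,
and its mean is `4 / m`. -/
theorem tsum_poisson_le {m : ℝ≥0} (hm : 0 < m) {f : ℕ → ℝ≥0∞} {δ : ℝ≥0∞} (h1 : ∀ N, f N ≤ 1)
    (hδ : ∀ N : ℕ, (m : ℝ) ≤ 2 * N → (N : ℝ) ≤ 2 * m → f N ≤ δ) :
    ∑' N, (ProbabilityTheory.poissonMeasure m).toPMF N * f N ≤ δ + ENNReal.ofReal (4 / m) := by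
  have hm' : (0 : ℝ) < m := hm
  have hs := (hasSum_poisson_sq m).mul_right (4 / (m : ℝ) ^ 2)
  have hsum : ∑' N : ℕ, ENNReal.ofReal (Real.exp (-m) * (m : ℝ) ^ N / N.factorial *
      ((N : ℝ) - m) ^ 2 * (4 / (m : ℝ) ^ 2)) = ENNReal.ofReal (4 / m) := by
    rw [← ENNReal.ofReal_tsum_of_nonneg (fun N => by positivity) hs.summable, hs.tsum_eq]
    congr 1
    field_simp
  calc ∑' N, (ProbabilityTheory.poissonMeasure m).toPMF N * f N
      ≤ ∑' N, ((ProbabilityTheory.poissonMeasure m).toPMF N * δ + ENNReal.ofReal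
        (Real.exp (-m) * (m : ℝ) ^ N / N.factorial * ((N : ℝ) - m) ^ 2 * (4 / (m : ℝ) ^ 2))) := by
        refine ENNReal.tsum_le_tsum fun N => ?_
        by_cases hN : (m : ℝ) ≤ 2 * N ∧ (N : ℝ) ≤ 2 * m
        · exact (mul_le_mul_right (hδ N hN.1 hN.2) _).trans le_self_add
        · refine le_trans ?_ le_add_self
          refine (mul_le_mul_right (h1 N) _).trans ?_
          rw [mul_one, MeasureTheory.Measure.toPMF_apply, ProbabilityTheory.poissonMeasure_singleton,
            mul_assoc]
          refine ENNReal.ofReal_le_ofReal (le_mul_of_one_le_right (by positivity) ?_)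
          rw [mul_div_assoc', one_le_div (by positivity)]
          rw [not_and_or, not_le, not_le] at hN
          rcases hN with hN | hN
          · nlinarith
          · nlinarith
    _ = δ + ENNReal.ofReal (4 / m) := by
        rw [ENNReal.tsum_add, ENNReal.tsum_mul_right, PMF.tsum_coe, one_mul, hsum]

theorem outerMeasure_le_one {α : Type} (p : PMF α) (s : Set α) : p.toOuterMeasure s ≤ 1 := by
  rw [← PMF.tsum_coe p, PMF.toOuterMeasure_apply]
  exact ENNReal.tsum_le_tsum fun I => Set.indicator_le_self _ _ _

open Classical in
theorem plantedLaw_le {n k : ℕ} (hk : k ≤ n) (z : Fin n → ℤˣ) {m : ℝ≥0} (hm : 0 < m) (ρ : ℝ≥0)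
    (hρ : ρ ≤ 1) (P : ∀ N, (Fin N → Scope n k) → Prop) {δ : ℝ}
    (hP : ∀ N : ℕ, (m : ℝ) ≤ 2 * N → (N : ℝ) ≤ 2 * m →
      ((Finset.univ.filter fun σ => ¬ P N σ).card : ℝ) ≤ δ * (Fintype.card (Scope n k) : ℝ) ^ N) :
    (plantedLaw hk z m ρ hρ).toOuterMeasure {I | ¬ ∃ N : ℕ, (m : ℝ) ≤ 2 * N ∧ (N : ℝ) ≤ 2 * m ∧
      ∃ σ : Fin N → Scope n k, I.map Prod.fst = List.ofFn σ ∧ P N σ} ≤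
      ENNReal.ofReal δ + ENNReal.ofReal (4 / m) := by
  rw [plantedLaw, PMF.toOuterMeasure_bind_apply]
  refine tsum_poisson_le hm (fun N => outerMeasure_le_one _ _) fun N h1 h2 => ?_
  refine (MeasureTheory.measure_mono ?_).trans
    (iidList_constraintLaw_le hk z ρ hρ (P N) (hP N h1 h2))
  exact fun I hI h => hI ⟨N, h1, h2, h⟩

theorem exists_coeff_eq_signSum {n k N : ℕ} {I : KXor n k} {σ : Fin N → Scope n k}
    (h : I.map Prod.fst = List.ofFn σ) :
    I.length = N ∧ ∃ b : Fin N → ℤˣ, ∀ S, coeff I S = signSum σ b S := by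
  have hl : I.length = N := by simpa using congrArg List.length h
  subst hl
  refine ⟨rfl, fun i => I[i].2, fun S => ?_⟩
  have hσ : ∀ i : Fin I.length, σ i = I[i].1 := by
    intro i
    have := congrArg (fun L : List (Scope n k) => L[i.1]?) h
    simpa using this.symm
  rw [coeff, signSum, ← Fin.sum_univ_fun_getElem]
  simp only [hσ]
  rfl

/-! ### Parameters -/

theorem half_le_log_two : (1 : ℝ) / 2 ≤ Real.log 2 :=
  le_trans (by norm_num) Real.log_two_gt_d9.le

/-- From `2^(L-1) < n` one gets `(L - 1) log 2 ≤ log n`. Adding `log 2 ≤ log n` and using `log 2 ≥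
1/2` produces the factor 4. -/
theorem bitLen_le_log {n : ℕ} (hn : 2 ≤ n) : (bitLen n : ℝ) ≤ 4 * Real.log n := by
  have hL : 0 < bitLen n := Nat.clog_pos (by norm_num) hn
  have h1 : 2 ^ (bitLen n - 1) < n := Nat.pow_pred_clog_lt_self (by norm_num) hn
  have h2 : (2 : ℝ) ^ (bitLen n - 1) ≤ n := by exact_mod_cast h1.le
  have h3 := Real.log_le_log (by positivity) h2
  have h4 : Real.log 2 ≤ Real.log n :=
    Real.log_le_log (by norm_num) (by exact_mod_cast hn)
  rw [Real.log_pow, Nat.cast_pred hL] at h3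
  have hL1 : (1 : ℝ) ≤ bitLen n := by exact_mod_cast hL
  nlinarith [half_le_log_two]

theorem two_pow_bitLen_le {l : ℕ} (hl : 0 < l) : 2 ^ bitLen l ≤ 2 * l := by
  rcases Nat.lt_or_ge 1 l with h | h
  · have hL : 0 < bitLen l := Nat.clog_pos (by norm_num) h
    have h1 : 2 ^ (bitLen l - 1) < l := Nat.pow_pred_clog_lt_self (by norm_num) h
    obtain ⟨d, hd⟩ := Nat.exists_eq_add_of_lt hL
    rw [hd, zero_add] at h1 ⊢
    rw [Nat.add_sub_cancel] at h1
    rw [pow_succ]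
    omega
  · obtain rfl : l = 1 := by omega
    simp [bitLen]

/-- With `N ≤ 2m` and `l² ≤ m` the three summands are at most 8, 2 and 4 times `m log n`, and `120 ·
14 = 1680`. -/
theorem gates_le {n l N : ℕ} {m : ℝ} (hn : 2 ≤ n) (hN : (N : ℝ) ≤ 2 * m) (hl : (l : ℝ) ^ 2 ≤ m) :
    ((120 * (l * (N * bitLen n + l * l + l * bitLen n)) : ℕ) : ℝ) ≤ 1680 * (l * m * Real.log n) := by
  have hL := bitLen_le_log hn
  have h4 : 1 / 2 ≤ Real.log n :=
    half_le_log_two.trans (Real.log_le_log (by norm_num) (by exact_mod_cast hn))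
  have hm : 0 ≤ m := (sq_nonneg _).trans hl
  have hl2 : (l : ℝ) ≤ m := by
    refine le_trans ?_ hl
    exact_mod_cast Nat.le_self_pow two_ne_zero l
  push_cast
  have h1 : (N : ℝ) * bitLen n ≤ 2 * m * (4 * Real.log n) := by gcongr
  have h2 : (l : ℝ) * l ≤ 2 * (m * Real.log n) := by nlinarith
  have h3 : (l : ℝ) * bitLen n ≤ m * (4 * Real.log n) := by gcongr
  calc (120 : ℝ) * (l * (N * bitLen n + l * l + l * bitLen n))
      ≤ 120 * (l * (2 * m * (4 * Real.log n) + 2 * (m * Real.log n) + m * (4 * Real.log n))) := by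
        gcongr
    _ = _ := by ring

/-- The constant in the lower bound for the amplitude. -/
def amplitudeConst (k : ℕ) : ℝ := √(Real.exp (-2 ^ (k + 1)) / 2)

/-- Squaring and inserting `R ≤ 2N` and `2^M ≤ 2l` leaves `c! / (2 · 2^c · 2^l) · l^(-l)`. Since `l
= ck`, the denominator is `2 (2^(k+1))^c`. -/
theorem amplitude_le {k c N l : ℕ} (hl : l = c * k) (hl0 : 0 < l) {g R : ℝ} (hg : 0 ≤ g)
    (hgN : (N : ℝ) ^ c ≤ 2 * (c.factorial * g ^ 2)) (hR : R ≤ 2 * N) (hR0 : 0 < R) :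
    amplitudeConst k * (l : ℝ) ^ (-(l : ℝ) / 2) ≤
      c.factorial * g * √((1 : ℝ) / 2) ^ (l * bitLen l) / √R ^ c := by
  have hl' : (0 : ℝ) < l := by exact_mod_cast hl0
  rw [le_div_iff₀ (by positivity)]
  refine le_of_sq_le_sq ?_ (by positivity)
  have e1 : ((l : ℝ) ^ (-(l : ℝ) / 2)) ^ 2 = 1 / (l : ℝ) ^ l := by
    rw [← Real.rpow_natCast, ← Real.rpow_mul hl'.le, Nat.cast_ofNat, div_mul_cancel₀ _ two_ne_zero,
      Real.rpow_neg hl'.le, Real.rpow_natCast, one_div]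
  have e2 : (√((1 : ℝ) / 2) ^ (l * bitLen l)) ^ 2 = 1 / ((2 : ℝ) ^ bitLen l) ^ l := by
    rw [← pow_mul, mul_comm, pow_mul, Real.sq_sqrt (by norm_num), mul_comm l, pow_mul, div_pow,
      div_pow, one_pow, one_pow]
  have e3 : (√R ^ c) ^ 2 = R ^ c := by rw [← pow_mul, mul_comm, pow_mul, Real.sq_sqrt hR0.le]
  have h2 : ((2 : ℝ) ^ bitLen l) ^ l ≤ (2 : ℝ) ^ l * (l : ℝ) ^ l := by
    rw [← mul_pow]
    exact pow_le_pow_left₀ (by positivity) (by exact_mod_cast two_pow_bitLen_le hl0) _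
  have h3 : R ^ c ≤ 2 ^ c * (N : ℝ) ^ c := by
    rw [← mul_pow]
    exact pow_le_pow_left₀ hR0.le hR _
  -- This is `x^c / c! ≤ e^x` at `x = 2^(k+1)`, the source of `amplitudeConst`.
  have hE : ((2 : ℝ) ^ (k + 1)) ^ c * Real.exp (-2 ^ (k + 1)) ≤ c.factorial := by
    have := Real.pow_div_factorial_le_exp (x := (2 : ℝ) ^ (k + 1)) (by positivity) c
    rw [div_le_iff₀ (by positivity)] at this
    rw [Real.exp_neg, ← div_eq_mul_inv, div_le_iff₀ (Real.exp_pos _), mul_comm]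
    exact this
  have hpow : (2 : ℝ) ^ c * 2 ^ l = ((2 : ℝ) ^ (k + 1)) ^ c := by
    rw [hl, ← pow_mul, ← pow_add]
    ring_nf
  rw [mul_pow, mul_pow, mul_pow, mul_pow, e1, e2, e3, amplitudeConst, Real.sq_sqrt (by positivity)]
  calc Real.exp (-2 ^ (k + 1)) / 2 * (1 / (l : ℝ) ^ l) * R ^ c
      ≤ Real.exp (-2 ^ (k + 1)) / 2 * (1 / (l : ℝ) ^ l) *
          (2 ^ c * (2 * (c.factorial * g ^ 2))) := by gcongr; exact h3.trans (by gcongr)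
    _ = ((2 : ℝ) ^ c * 2 ^ l * Real.exp (-2 ^ (k + 1))) * (c.factorial * g ^ 2) *
          (1 / (2 ^ l * (l : ℝ) ^ l)) := by field_simp
    _ ≤ c.factorial * (c.factorial * g ^ 2) * (1 / (2 ^ l * (l : ℝ) ^ l)) := by
        rw [hpow]
        gcongr
    _ ≤ c.factorial * (c.factorial * g ^ 2) * (1 / ((2 : ℝ) ^ bitLen l) ^ l) := by gcongr
    _ = _ := by ring

theorem outputsPreparation_of_goodScopes {alg : Prog}
    (halg : ∀ (n k l : ℕ) (I : KXor n k), ∃ t, Eval alg (encodeInput n k l I)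
      (circuitTree (output (n, k, l, rawInput I)).1 (output (n, k, l, rawInput I)).2) t)
    {n k c N l : ℕ} (hk : 2 ≤ k) (hkn : k ≤ n) (hc : 0 < c) (hl : l = c * k) (hln : l ≤ n) {m : ℝ}
    (hN0 : 0 < N) (hN : (N : ℝ) ≤ 2 * m) (hlm : (l : ℝ) ^ 2 ≤ m) {I : KXor n k}
    {σ : Fin N → Scope n k} (hI : I.map Prod.fst = List.ofFn σ) (hσ : GoodScopes c σ) :
    OutputsPreparation alg l I (1680 * (l * m * Real.log n))
      (amplitudeConst k * (l : ℝ) ^ (-(l : ℝ) / 2)) := by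
  obtain ⟨hlen, b, hb⟩ := exists_coeff_eq_signSum hI
  have hg := pow_le_guideNorm_sq (by omega) hN0 hσ b hb
  have hl0 : 0 < l := hl ▸ Nat.mul_pos hc (by omega)
  have hgne : guideNorm (c * k) I ≠ 0 := by
    intro h
    rw [h] at hg
    have : (0 : ℝ) < (N : ℝ) ^ c := by positivity
    norm_num at hg
    linarith
  have hsum : ∑ S : Scope n k, (coeff I S.1 : ℝ) ^ 2 ≤ 2 * N := by
    have h1 := sum_sq_signSum_le σ b
    have h2 : ((repPairs σ).card : ℝ) ≤ N := by
      have h3 := hσ.rep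
      have : (repPairs σ).card ≤ 8 * c * (repPairs σ).card := Nat.le_mul_of_pos_left _ (by omega)
      exact_mod_cast this.trans h3
    simp only [hb]
    linarith
  have hsum0 : 0 < ∑ S : Scope n k, (coeff I S.1 : ℝ) ^ 2 := by
    obtain ⟨S, hS⟩ := exists_coeff_ne_zero (by omega) hc hgne
    exact Finset.sum_pos' (fun S _ => sq_nonneg _)
      ⟨S, Finset.mem_univ _, sq_pos_of_ne_zero (Int.cast_ne_zero.2 hS)⟩
  have hamp := amplitude_le (k := k) hl hl0 (Real.sqrt_nonneg _) hg hsum hsum0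
  have hgates := gates_le (by omega : 2 ≤ n) hN hlm
  subst hl
  exact outputsPreparation halg hk hkn hc hln I hgne (by rw [hlen]; exact hgates) hamp

end Guiding

end

/-! ### The main theorem -/

theorem mainTheorem6 :
    ∃ alg : Guiding.Prog, Guiding.PolyTime alg ∧
      ∀ (k : ℕ), 2 ≤ k → ∀ (C : ℝ), 0 < C →
        ∃ (ε K₁ K₂ κ : ℝ), 0 < ε ∧ 0 < K₁ ∧ 0 < K₂ ∧ 0 < κ ∧
          ∀ (n l : ℕ) (hk : k ≤ n), 0 < l → k ∣ l →
            ∀ (z : Fin n → ℤˣ) (m ρ : ℝ≥0) (hρ : ρ ≤ 1),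
              (l : ℝ) ^ 2 * Real.log n ≤ ε * n →
              (n : ℝ) ≤ m →
              (m : ℝ) ≤ C * (n : ℝ) ^ ((k : ℝ) / 2) →
              (Guiding.plantedLaw hk z m ρ hρ).toOuterMeasure
                  {I | ¬ Guiding.OutputsPreparation alg l I
                    (K₂ * (l * m * Real.log n)) (κ * (l : ℝ) ^ (-(l : ℝ) / 2))}
                ≤ ENNReal.ofReal (K₁ * (m : ℝ) ^ (-(1 / 2) : ℝ)) := by
  obtain ⟨alg, hpoly, halg⟩ := Guiding.exists_alg
  refine ⟨alg, hpoly, fun k hk C hC => ?_⟩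
  have hC1 : 1 ≤ max C 1 := le_max_right _ _
  -- The factor 2 accounts for `N ≤ 2m`, and the maximum for the requirement `1 ≤ b`.
  obtain ⟨ε, K, hε, hK, hbad⟩ := Guiding.exists_card_bad_le hk (b := 2 * max C 1) (by linarith)
  -- As `log n ≥ 1/2`, the hypothesis on `l` bounds `l²` only by twice the constant times `n`, hence
  -- the halves. In `K₁` the summand `2K` pays for bad scopes, `4` for deviations of the Poisson
  -- number, and the last one for the case `n < 2k`.
  refine ⟨min (ε / 2) (1 / 2), 2 * K + 4 + max C 1 * (2 * k) ^ k, 1680, Guiding.amplitudeConst k,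
    by positivity, by positivity, by norm_num,
    Real.sqrt_pos.2 (div_pos (Real.exp_pos _) two_pos), ?_⟩
  intro n l hkn hl hkl z m ρ hρ hln hnm hmC
  have hn2 : (2 : ℝ) ≤ n := by exact_mod_cast hk.trans hkn
  have hm2 : (2 : ℝ) ≤ m := hn2.trans hnm
  have hm0 : (0 : ℝ) < m := by linarith
  have hsm : 0 < √(m : ℝ) := Real.sqrt_pos.2 hm0
  have hpow : (m : ℝ) ^ (-(1 / 2) : ℝ) = 1 / √m := by
    rw [Real.rpow_neg hm0.le, ← Real.sqrt_eq_rpow, one_div]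
  have hsqm : √(m : ℝ) ≤ m := Real.sqrt_le_iff.2 ⟨hm0.le, by nlinarith⟩
  rw [hpow, mul_one_div]
  have hmC' : (m : ℝ) ≤ max C 1 * (n : ℝ) ^ ((k : ℝ) / 2) := hmC.trans (by gcongr; exact le_max_left _ _)
  -- For `n < 2k` the mean `m` is at most a constant, and `K₁` is chosen so large that the claimed
  -- bound on the probability is at least 1.
  rcases Nat.lt_or_ge n (2 * k) with hn | hn
  · refine (Guiding.outerMeasure_le_one _ _).trans ?_
    rw [← ENNReal.ofReal_one]
    refine ENNReal.ofReal_le_ofReal ?_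
    rw [one_le_div hsm]
    have h1 : (n : ℝ) ^ ((k : ℝ) / 2) ≤ (2 * k) ^ k := by
      calc (n : ℝ) ^ ((k : ℝ) / 2) ≤ (n : ℝ) ^ (k : ℝ) :=
            Real.rpow_le_rpow_of_exponent_le (by linarith) (half_le_self (Nat.cast_nonneg k))
        _ = (n : ℝ) ^ k := Real.rpow_natCast _ _
        _ ≤ (2 * k) ^ k := by
            gcongr
            exact_mod_cast hn.le
    have h2 : max C 1 * (n : ℝ) ^ ((k : ℝ) / 2) ≤ max C 1 * (2 * k) ^ k := by gcongr
    linarith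
  obtain ⟨c, rfl⟩ := hkl
  have hc : 0 < c := Nat.pos_of_mul_pos_left hl
  have hlog : 1 / 2 ≤ Real.log n :=
    Guiding.half_le_log_two.trans (Real.log_le_log (by norm_num) hn2)
  have hl2 : ((k * c : ℕ) : ℝ) ^ 2 ≤ 2 * (min (ε / 2) (1 / 2) * n) := by
    nlinarith [sq_nonneg ((k * c : ℕ) : ℝ)]
  have hlε : ((k * c : ℕ) : ℝ) ^ 2 ≤ ε * n := by
    have := mul_le_mul_of_nonneg_right (min_le_left (ε / 2) (1 / 2)) (by linarith : (0 : ℝ) ≤ n)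
    linarith
  have hln' : ((k * c : ℕ) : ℝ) ^ 2 ≤ n := by
    have := mul_le_mul_of_nonneg_right (min_le_right (ε / 2) (1 / 2)) (by linarith : (0 : ℝ) ≤ n)
    linarith
  have hlen : k * c ≤ n := (Nat.le_self_pow two_ne_zero _).trans (by exact_mod_cast hln')
  have hcε : (c : ℝ) ^ 2 ≤ ε * n := by
    refine le_trans ?_ hlε
    gcongr
    exact_mod_cast Nat.le_mul_of_pos_left c (by omega)
  have hsqn : ((n : ℝ) ^ ((k : ℝ) / 2)) ^ 2 = (n : ℝ) ^ k := by
    rw [← Real.rpow_natCast, ← Real.rpow_mul (by linarith), Nat.cast_ofNat,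
      div_mul_cancel₀ _ two_ne_zero, Real.rpow_natCast]
  have key := Guiding.plantedLaw_le hkn z (NNReal.coe_pos.1 hm0) ρ hρ
    (fun N σ => Guiding.GoodScopes c σ) (δ := 2 * K / √m) fun N h1 h2 => by
      have hnN : n ≤ 2 * N := by exact_mod_cast hnm.trans h1
      have hN0 : (0 : ℝ) < N := by linarith
      refine (hbad n c N hn hc hcε hnN ?_).trans ?_
      · calc (N : ℝ) ^ 2 ≤ (2 * (max C 1 * (n : ℝ) ^ ((k : ℝ) / 2))) ^ 2 := by
              gcongr
              linarith
          _ = _ := by rw [← hsqn]; ring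
      · refine mul_le_mul_of_nonneg_right ?_ (by positivity)
        rw [div_le_div_iff₀ (Real.sqrt_pos.2 hN0) hsm]
        -- This converts the rate in `N` into one in `m`, by `m ≤ 2N` and at the cost of the factor
        -- 2 in `δ`.
        have : √(m : ℝ) ≤ 2 * √N := by
          refine Real.sqrt_le_iff.2 ⟨by positivity, ?_⟩
          rw [mul_pow, Real.sq_sqrt hN0.le]
          linarith
        calc K * √m ≤ K * (2 * √N) := by gcongr
          _ = _ := by ring
  refine (MeasureTheory.measure_mono ?_).trans (key.trans ?_)
  · intro I hI hgood
    obtain ⟨N, h1, h2, σ, hσ, hg⟩ := hgood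
    have hN0 : 0 < N := by
      have : (0 : ℝ) < N := by linarith
      exact_mod_cast this
    exact hI (Guiding.outputsPreparation_of_goodScopes halg hk hkn hc (mul_comm k c) hlen hN0 h2
      (hln'.trans hnm) hσ hg)
  · rw [← ENNReal.ofReal_add (by positivity) (by positivity)]
    refine ENNReal.ofReal_le_ofReal ?_
    have h4 : 4 / (m : ℝ) ≤ 4 / √m := by gcongr
    calc 2 * K / √m + 4 / m ≤ 2 * K / √m + 4 / √m := by gcongr
      _ = (2 * K + 4) / √m := by ring
      _ ≤ _ := by
        refine div_le_div_of_nonneg_right ?_ hsm.le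
        exact le_add_of_nonneg_right (by positivity)
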